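/- A $d$-polytope is a $d$-dimensional convex lattice polytope $P\subset\mathbb R^d$ (lattice $\mathbb Z^d$). It is smooth if through every vertex there are exactly $d$ edges and their primitive directions form a basis of $\mathbb Z^d$. Two polytopes are isomorphic ($\cong$) if a lattice preserving affine isomorphism takes one to the other, and strictly isomorphic if they have the same inner-normal fan. For a smooth $3$-polytope $P$ with inner-normal fan $\Sigma$, the complex $\Sigma\cap S^2$ is a triangulation of the sphere; $P$ has label $\prod_{m>0}m^{v_m}$ if this triangulation has exactly $v_m$ vertices of degree $m$ for every $m>0$ (equivalently, $P$ has $v_m$ facets with $m$ edges). Blow-ups: let $P$ be a smooth polytope with inner-normal fan $\Sigma$, let $F$ be a face of $P$ whose cone $\sigma=\operatorname{cone}(x_1,\dots,x_r)\in\Sigma$ has dimension $r\ge 2$, where $x_1,\dots,x_r$ are linearly independent lattice vectors generating $\sigma\cap\mathbb Z^d$; let $p=x_1+\dots+x_r$ and let $k\ge 1$ be an integer. If $P'=\{y\in P:\ \langle p,y\rangle\ge k+\min_P\langle p,\cdot\rangle\}$ has as inner-normal fan the stellar subdivision of $\Sigma$ in direction $p$, then $P'$ is called a blow-up of $P$ along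 $F$ (at level $k$). For $d=3$, $F$ is a vertex or an edge. For $s\ge 1$ and strictly isomorphic polytopes $P_0,\dots,P_k\subset\mathbb R^n$ let $\operatorname{Cay}^s(P_0,\dots,P_k)=\operatorname{conv}\big(\bigcup_{i=0}^k P_i\times\{s e_i\}\big)\subset\mathbb R^{n+k}$, where $e_0=0$ and $e_1,\dots,e_k$ is the standard basis of $\mathbb Z^k$. Let $\Delta_n=\operatorname{conv}(0,e_1,\dots,e_n)$. **Lemma.** There is no smooth $3$-polytope $P$ such that 1. $|P\cap\mathbb Z^3|\le 16$; 2. $P$ can be obtained by finitely many (possibly no) consecutive blow-ups starting from a smooth $3$-polytope with one of the labels $3^14^35^3$, $4^6$, $3^24^36^2$ or $4^55^2$; 3. $P$ is none of the following: (a) a polytope with label $3^24^36^2$ that is isomorphic to the blow-up of $\operatorname{Cay}^2(3\Delta_1,\Delta_1,\Delta_1)$ at two of its vertices; (b) isomorphic to $\Delta_3$ or $2\Delta_3$; (c) isomorphic to $\operatorname{Cay}^s([0,i],[0,j],[0,k])$ for some integers $s,i,j,k\ge1$; (d) isomorphic to $\operatorname{Cay}^s(P_0,P_1)$ for some integer $s\ge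 1$ and strictly isomorphic $2$-polytopes $P_0,P_1$. -/

import Mathlib

namespace LatticePolytope

/-- The lattice point of `ℝⁿ` with the given integer coordinates. -/
def latticePt {n : ℕ} (z : Fin n → ℤ) : Fin n → ℝ := fun i => (z i : ℝ)

/-- `n`-polytopes: convex hulls of finitely many lattice points of `ℝⁿ`, of full dimension `n`. -/
def IsPolytope {n : ℕ} (P : Set (Fin n → ℝ)) : Prop :=
  (∃ S : Finset (Fin n → ℤ), P = convexHull ℝ (latticePt '' (S : Set (Fin n → ℤ)))) ∧
    affineSpan ℝ P = ⊤

/-- `F` is a nonempty face of `P`: the locus where some linear functional attains its minimum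
on `P`. -/
def IsFace {n : ℕ} (P F : Set (Fin n → ℝ)) : Prop :=
  F.Nonempty ∧ ∃ u : Fin n → ℝ, F = {x ∈ P | ∀ y ∈ P, dotProduct u x ≤ dotProduct u y}

/-- Edges are the one-dimensional faces. -/
def IsEdge {n : ℕ} (P F : Set (Fin n → ℝ)) : Prop :=
  IsFace P F ∧ Module.finrank ℝ (vectorSpan ℝ F) = 1

/-- A smooth `n`-polytope: at every vertex `v` the edges through `v` are exactly `n` segments
that start at `v` and run in the directions of a basis of the lattice `ℤⁿ`. -/
def IsSmooth {n : ℕ} (P : Set (Fin n → ℝ)) : Prop :=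
  IsPolytope P ∧ ∀ v ∈ P.extremePoints ℝ,
    ∃ (b : Module.Basis (Fin n) ℤ (Fin n → ℤ)) (t : Fin n → ℝ), (∀ i, 0 < t i) ∧
      {F | IsEdge P F ∧ v ∈ F} = Set.range fun i => segment ℝ v (v + t i • latticePt (b i))

/-- Two polytopes are isomorphic if they differ by a lattice preserving affine isomorphism. -/
def Isomorphic {n : ℕ} (P Q : Set (Fin n → ℝ)) : Prop :=
  ∃ φ : (Fin n → ℝ) ≃ᵃ[ℝ] (Fin n → ℝ),
    φ '' Set.range (latticePt (n := n)) = Set.range (latticePt (n := n)) ∧ φ '' P = Q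

/-- The cone of the inner-normal fan that belongs to the face `F` of `P`: all functionals that
attain their minimum over `P` at every point of `F`. -/
def normalCone {n : ℕ} (P F : Set (Fin n → ℝ)) : Set (Fin n → ℝ) :=
  {u | ∀ x ∈ F, ∀ y ∈ P, dotProduct u x ≤ dotProduct u y}

/-- The inner-normal fan, as the set of its cones. -/
def normalFan {n : ℕ} (P : Set (Fin n → ℝ)) : Set (Set (Fin n → ℝ)) :=
  {σ | ∃ F, IsFace P F ∧ σ = normalCone P F}

/-- The dimension of a cone. -/
noncomputable def coneDim {n : ℕ} (σ : Set (Fin n → ℝ)) : ℕ :=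
  Module.finrank ℝ (Submodule.span ℝ σ)

/-- The rays of a fan `Φ`. For a fan in `ℝ³` they are the vertices of the spherical complex
`Φ ∩ S²`. -/
def rays {n : ℕ} (Φ : Set (Set (Fin n → ℝ))) : Set (Set (Fin n → ℝ)) :=
  {ρ ∈ Φ | coneDim ρ = 1}

/-- The degree of the ray `ρ` as a vertex of the spherical complex `Φ ∩ S²`, whose edges are
cut out by the two-dimensional cones. -/
noncomputable def rayDegree {n : ℕ} (Φ : Set (Set (Fin n → ℝ))) (ρ : Set (Fin n → ℝ)) : ℕ :=
  {τ ∈ Φ | coneDim τ = 2 ∧ ρ ⊆ τ}.ncard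

/-- The triangulation `Σ ∩ S²` given by the inner-normal fan `Σ` of `P` has the label
`∏ m ^ (v_m)`, where the word is given as the multiset `L` that contains `m` exactly `v_m` times:
for all `m > 0` there are `v_m` vertices of degree `m`. -/
def HasLabel (P : Set (Fin 3 → ℝ)) (L : Multiset ℕ) : Prop :=
  ∀ m : ℕ, 0 < m →
    {ρ ∈ rays (normalFan P) | rayDegree (normalFan P) ρ = m}.ncard = L.count m

/-- The cones of the fan `Φ` having `σ ∈ Φ` as a face. (For two cones of a fan, being a face is
the same as being a subset.) -/
def fanStar {n : ℕ} (Φ : Set (Set (Fin n → ℝ))) (σ : Set (Fin n → ℝ)) :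
    Set (Set (Fin n → ℝ)) :=
  {τ ∈ Φ | σ ⊆ τ}

/-- The cones of the fan `Φ` that are faces of a cone in the star of `σ`. -/
def closedStar {n : ℕ} (Φ : Set (Set (Fin n → ℝ))) (σ : Set (Fin n → ℝ)) :
    Set (Set (Fin n → ℝ)) :=
  {τ ∈ Φ | ∃ τ' ∈ fanStar Φ σ, τ ⊆ τ'}

/-- The cone spanned by the ray `ℝ≥0 p` and the cone `τ`. -/
def joinRay {n : ℕ} (p : Fin n → ℝ) (τ : Set (Fin n → ℝ)) : Set (Fin n → ℝ) :=
  {u | ∃ c : ℝ, 0 ≤ c ∧ ∃ v ∈ τ, u = c • p + v}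

/-- The stellar subdivision of the fan `Φ` in direction `p`, where `p` is a point of the relative
interior of `σ ∈ Φ`. -/
def stellarSubdivision {n : ℕ} (Φ : Set (Set (Fin n → ℝ))) (σ : Set (Fin n → ℝ))
    (p : Fin n → ℝ) : Set (Set (Fin n → ℝ)) :=
  (Φ \ fanStar Φ σ) ∪ joinRay p '' (closedStar Φ σ \ fanStar Φ σ)

/-- The linearly independent lattice vectors `x₁, …, x_r` span the cone `σ`, and generate the
semigroup of lattice points of `σ`. -/
def IsUnimodularBasis {n r : ℕ} (σ : Set (Fin n → ℝ)) (x : Fin r → Fin n → ℤ) : Prop :=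
  LinearIndependent ℝ (fun i => latticePt (x i)) ∧
  σ = {u | ∃ c : Fin r → ℝ, (∀ i, 0 ≤ c i) ∧ u = ∑ i, c i • latticePt (x i)} ∧
  ∀ z : Fin n → ℤ, latticePt z ∈ σ → ∃ c : Fin r → ℕ, z = ∑ i, c i • x i

/-- `P'` is the blow-up `Bl_F^k(P)` of `P` along its face `F` (of codimension `r ≥ 2`) at level
`k ≥ 1`. With `σ` the cone of `F`, spanned by the primitive vectors `x₁, …, x_r`, and
`p = x₁ + ⋯ + x_r`, the polytope `P'` is got from `P` by cutting off `F` at level `k` in direction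
`p`; it is the polytope of the divisor `π^* L_P - k E` on the toric variety of the unimodular
stellar subdivision `s(σ)`. That this divisor is ample means that the inner-normal fan of `P'` is
`s(σ)`. -/
def IsBlowUpAt {n : ℕ} (P F : Set (Fin n → ℝ)) (k : ℕ) (P' : Set (Fin n → ℝ)) : Prop :=
  IsFace P F ∧ 1 ≤ k ∧
  ∃ (r : ℕ) (x : Fin r → Fin n → ℤ), 2 ≤ r ∧ IsUnimodularBasis (normalCone P F) x ∧
    P' = {y ∈ P | ∀ f ∈ F, dotProduct (latticePt (∑ i, x i)) f + k ≤
      dotProduct (latticePt (∑ i, x i)) y} ∧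
    normalFan P' = stellarSubdivision (normalFan P) (normalCone P F) (latticePt (∑ i, x i))

/-- `P'` is a blow-up of `P` along some face, at some level. -/
def IsBlowUp {n : ℕ} (P P' : Set (Fin n → ℝ)) : Prop :=
  ∃ (F : Set (Fin n → ℝ)) (k : ℕ), IsBlowUpAt P F k P'

/-- `P` can be obtained from `Q` by finitely many (possibly no) consecutive blow-ups. -/
def ObtainedByBlowUps {n : ℕ} (Q P : Set (Fin n → ℝ)) : Prop :=
  Relation.ReflTransGen IsBlowUp Q P

/-- The dilated standard simplex `k Δ_n`. In particular `k Δ_1` is the line segment `[0, k]`. -/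
def dilatedSimplex (n k : ℕ) : Set (Fin n → ℝ) :=
  convexHull ℝ (insert 0 (Set.range fun i : Fin n => (Pi.single i (k : ℝ) : Fin n → ℝ)))

/-- `e₀ = 0` and the standard basis `e₁, …, e_k` of `ℤᵏ`. -/
def cayleyVertex {k : ℕ} : Fin (k + 1) → Fin k → ℝ :=
  Fin.cons 0 fun j => Pi.single j 1

/-- `Cay^s(P₀, …, P_k) = conv((P₀, s e₀), …, (P_k, s e_k))` in `ℝⁿ⁺ᵏ`. -/
def cayley {n k : ℕ} (s : ℕ) (P : Fin (k + 1) → Set (Fin n → ℝ)) : Set (Fin (n + k) → ℝ) :=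
  convexHull ℝ (⋃ i, (fun p => Fin.append p ((s : ℝ) • cayleyVertex i)) '' P i)

/-- `P` is isomorphic to the blow-up of `Cay²(3Δ₁, Δ₁, Δ₁)` at two of its vertices, and it is
associated to a triangulation with label `3² 4³ 6²`. -/
def IsTwoVertexBlowUp (P : Set (Fin 3 → ℝ)) : Prop :=
  HasLabel P {3, 3, 4, 4, 4, 6, 6} ∧
  ∃ C : Set (Fin 3 → ℝ), C = cayley (n := 1) (k := 2) 2 ![dilatedSimplex 1 3, dilatedSimplex 1 1, dilatedSimplex 1 1] ∧
    ∃ v ∈ C.extremePoints ℝ, ∃ w ∈ C.extremePoints ℝ, v ≠ w ∧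
    ∃ (k l : ℕ) (B B' : Set (Fin 3 → ℝ)), IsBlowUpAt C {v} k B ∧ IsBlowUpAt B {w} l B' ∧
      Isomorphic P B'

/-- `P` is isomorphic to `Δ₃` or to `2Δ₃`. -/
def IsSmallSimplex (P : Set (Fin 3 → ℝ)) : Prop :=
  Isomorphic P (dilatedSimplex 3 1) ∨ Isomorphic P (dilatedSimplex 3 2)

/-- `P ≅ Cay^s([0,i], [0,j], [0,k])` for line segments of positive integral length. -/
def IsCayleyOfSegments (P : Set (Fin 3 → ℝ)) : Prop :=
  ∃ s i j k : ℕ, 1 ≤ s ∧ 1 ≤ i ∧ 1 ≤ j ∧ 1 ≤ k ∧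
    Isomorphic P (cayley (n := 1) (k := 2) s ![dilatedSimplex 1 i, dilatedSimplex 1 j, dilatedSimplex 1 k])

/-- `P ≅ Cay^s(P₀, P₁)` for strictly isomorphic `2`-polytopes, that is, `2`-polytopes having the
same inner-normal fan. -/
def IsCayleyOfPolygons (P : Set (Fin 3 → ℝ)) : Prop :=
  ∃ (s : ℕ) (P₀ P₁ : Set (Fin 2 → ℝ)), 1 ≤ s ∧ IsPolytope P₀ ∧ IsPolytope P₁ ∧
    normalFan P₀ = normalFan P₁ ∧ Isomorphic P (cayley (n := 2) (k := 1) s ![P₀, P₁])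

end LatticePolytope

open LatticePolytope

/-! ### Dual bases of the lattice -/

section Dual

/-! The inner-normal fan of a smooth `3`-polytope `P` is unimodular, so it gives a triangulation `T`
of the sphere whose vertices are the facets of `P` and whose triangles are the vertices of `P`. A
blow-up acts on `T` as a stellar subdivision at an edge or a triangle and adds one facet. Euler's
relation, which says that `f` facets come with `2f - 4` vertices, is not imported from topology: for
the four starting labels it follows from the degree sum, and subdivisions preserve it. The invariant
`IsGood` records it together with what is known about the labels. With six facets the label is
`4^6`, with seven it is one of the three other starting labels, and with eight it is not `3^4 6^4`.
This last point is where the blow-up hypothesis matters, since that label would survive the count of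
lattice points.

Every facet is a smooth polygon. A smooth polygon with at least five edges has an interior lattice
point (`SmoothPolygon.exists_interior`), one with at least seven edges has three
(`SmoothPolygon.exists_three_interior`), and a pentagon has two edges of length at least two
(`SmoothPolygon.pentagon_two_long`). Adding these points to the `2f - 4` vertices, the bound `16`
forces `f ≤ 8` and leaves seven labels (`SmoothModel.classification`), which are settled one by one.

`4^6`: the triangulation is an octahedron. The relations between the normals around its edges force
two opposite normals to be antiparallel, so all vertices lie in two parallel facets and `P` is a
Cayley polytope of two polygons (`SmoothModel.isCayleyOfPolygons`).

`4^5 5^2` and `4^6 6^2`: the two big facets are disjoint and `P` is a combinatorial prism. The count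
leaves at least three connecting edges of length one, so the sum of the two big normals is minimal
at three vertices of one facet that do not lie on an edge. Hence this sum vanishes, and `P` is again
a Cayley polytope.

`3 4^3 5^3`: the count is sharp, so the pentagons meet pairwise in edges of length two and have a
common vertex. The midpoint of two known vertices is then a seventeenth lattice point.

`3^2 4^3 6^2`: two adjacent hexagons meet all other facets. In coordinates at a common vertex the
count determines all facet equations, and `P` is the double blow-up of `Cay²(3Δ₁, Δ₁, Δ₁)`.

`3^2 4^3 6^3` and `3 4^5 6 7`: no such triangulation exists. -/

theorem latticePt_apply {n : ℕ} (z : Fin n → ℤ) (i : Fin n) : latticePt z i = (z i : ℝ) := rfl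

theorem latticePt_injective {n : ℕ} : Function.Injective (latticePt (n := n)) := by
  intro a b h
  funext i
  have := congrFun h i
  simpa [latticePt_apply] using this

theorem latticePt_add {n : ℕ} (a b : Fin n → ℤ) :
    latticePt (a + b) = latticePt a + latticePt b := by
  funext i; simp [latticePt_apply]

theorem latticePt_sub {n : ℕ} (a b : Fin n → ℤ) :
    latticePt (a - b) = latticePt a - latticePt b := by
  funext i; simp [latticePt_apply]

theorem latticePt_smul {n : ℕ} (k : ℤ) (a : Fin n → ℤ) :
    latticePt (k • a) = (k : ℝ) • latticePt a := by
  funext i; simp [latticePt_apply]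

theorem latticePt_sum {n : ℕ} {ι : Type*} (s : Finset ι) (f : ι → Fin n → ℤ) :
    latticePt (∑ i ∈ s, f i) = ∑ i ∈ s, latticePt (f i) := by
  funext j; simp [latticePt_apply, Finset.sum_apply]

theorem latticePt_dot {n : ℕ} (a b : Fin n → ℤ) :
    latticePt a ⬝ᵥ latticePt b = ((a ⬝ᵥ b : ℤ) : ℝ) := by
  simp [dotProduct, latticePt_apply]

/-- `E` assigns to the members of the `n`-element set `t` the dual basis. -/
structure IsDual {n : ℕ} (t : Finset (Fin n → ℤ)) (E : (Fin n → ℤ) → Fin n → ℤ) : Prop where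
  card : t.card = n
  dot : ∀ a ∈ t, ∀ b ∈ t, b ⬝ᵥ E a = if b = a then 1 else 0

namespace IsDual

variable {n : ℕ} {t : Finset (Fin n → ℤ)} {E : (Fin n → ℤ) → Fin n → ℤ}

theorem dot_self (h : IsDual t E) {a : Fin n → ℤ} (ha : a ∈ t) : a ⬝ᵥ E a = 1 := by
  simpa using h.dot a ha a ha

theorem dot_ne (h : IsDual t E) {a b : Fin n → ℤ} (ha : a ∈ t) (hb : b ∈ t) (hab : b ≠ a) :
    b ⬝ᵥ E a = 0 := by
  simpa [hab] using h.dot a ha b hb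

/-- With the members of `t` as the rows of a square integer matrix and their dual vectors as the
columns of another, duality says that the product is the identity. A one-sided inverse of a square
matrix is two-sided, and the other product gives this relation, from which all the expansions
follow. -/
theorem sum_mul (h : IsDual t E) (k l : Fin n) :
    ∑ a ∈ t, E a k * a l = if k = l then 1 else 0 := by
  classical
  let e : Fin n ≃ t := (Finset.equivFinOfCardEq h.card).symm
  let M : Matrix (Fin n) (Fin n) ℤ := fun i j => (e i : Fin n → ℤ) j
  let N : Matrix (Fin n) (Fin n) ℤ := fun i j => E (e j) i
  have hMN : M * N = 1 := by
    ext i j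
    have := h.dot (e j) (e j).2 (e i) (e i).2
    rw [Matrix.mul_apply, Matrix.one_apply]
    simp only [dotProduct] at this
    rw [show ∑ x, M i x * N x j = ∑ x, (e i : Fin n → ℤ) x * E (e j) x from rfl, this]
    by_cases hij : i = j
    · simp [hij]
    · rw [if_neg hij, if_neg]
      intro hh
      exact hij (e.injective (Subtype.ext hh))
  have hNM : N * M = 1 := mul_eq_one_comm.mp hMN
  have := congrFun (congrFun hNM k) l
  rw [Matrix.mul_apply, Matrix.one_apply] at this
  rw [← this, ← Finset.sum_coe_sort t (fun a => E a k * a l)]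
  exact (Equiv.sum_comp e (fun a : t => E (a : Fin n → ℤ) k * (a : Fin n → ℤ) l)).symm

theorem sum_mul_real (h : IsDual t E) (k l : Fin n) :
    ∑ a ∈ t, (E a k : ℝ) * (a l : ℝ) = if k = l then 1 else 0 := by
  have := h.sum_mul k l
  have h2 : ((∑ a ∈ t, E a k * a l : ℤ) : ℝ) = ((if k = l then 1 else 0 : ℤ) : ℝ) := by rw [this]
  push_cast at h2
  exact h2

theorem expand (h : IsDual t E) (x : Fin n → ℤ) : x = ∑ a ∈ t, (a ⬝ᵥ x) • E a := by
  funext k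
  simp only [Finset.sum_apply, Pi.smul_apply, smul_eq_mul, dotProduct, Finset.sum_mul]
  rw [Finset.sum_comm]
  have : ∀ l, ∑ a ∈ t, a l * x l * E a k = (if k = l then 1 else 0) * x l := by
    intro l
    rw [← h.sum_mul k l, Finset.sum_mul]
    exact Finset.sum_congr rfl fun a _ => by ring
  simp [this]

theorem expand_dual (h : IsDual t E) (u : Fin n → ℤ) : u = ∑ a ∈ t, (u ⬝ᵥ E a) • a := by
  funext l
  simp only [Finset.sum_apply, Pi.smul_apply, smul_eq_mul, dotProduct, Finset.sum_mul]
  rw [Finset.sum_comm]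
  have : ∀ k, ∑ a ∈ t, u k * E a k * a l = u k * (if k = l then 1 else 0) := by
    intro k
    rw [← h.sum_mul k l, Finset.mul_sum]
    exact Finset.sum_congr rfl fun a _ => by ring
  simp [this]

theorem expand_dual_real (h : IsDual t E) (u : Fin n → ℝ) :
    u = ∑ a ∈ t, (u ⬝ᵥ latticePt (E a)) • latticePt a := by
  funext l
  simp only [Finset.sum_apply, Pi.smul_apply, smul_eq_mul, dotProduct, Finset.sum_mul,
    latticePt_apply]
  rw [Finset.sum_comm]
  have : ∀ k, ∑ a ∈ t, u k * (E a k : ℝ) * (a l : ℝ) = u k * (if k = l then 1 else 0) := by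
    intro k
    rw [← h.sum_mul_real k l, Finset.mul_sum]
    exact Finset.sum_congr rfl fun a _ => by ring
  simp [this]

theorem dot_expand (h : IsDual t E) (u x : Fin n → ℤ) :
    u ⬝ᵥ x = ∑ a ∈ t, (u ⬝ᵥ E a) * (a ⬝ᵥ x) := by
  conv_lhs => rw [h.expand_dual u]
  rw [sum_dotProduct]
  exact Finset.sum_congr rfl fun a _ => by rw [smul_dotProduct, smul_eq_mul]

theorem dot_expand_real (h : IsDual t E) (u x : Fin n → ℝ) :
    u ⬝ᵥ x = ∑ a ∈ t, (u ⬝ᵥ latticePt (E a)) * (latticePt a ⬝ᵥ x) := by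
  conv_lhs => rw [h.expand_dual_real u]
  rw [sum_dotProduct]
  exact Finset.sum_congr rfl fun a _ => by rw [smul_dotProduct, smul_eq_mul]

end IsDual

end Dual

/-- A smooth lattice polytope, given by its vertices `v`, for each of them the set `t v` of the
primitive inner normals of the facets through `v`, and the dual basis `E v`, consisting of the
primitive directions of the edges at `v`. -/
structure SmoothModel (n : ℕ) where
  V : Finset (Fin n → ℤ)
  t : (Fin n → ℤ) → Finset (Fin n → ℤ)
  E : (Fin n → ℤ) → (Fin n → ℤ) → (Fin n → ℤ)
  nonempty : V.Nonempty
  dual : ∀ v ∈ V, IsDual (t v) (E v)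
  le : ∀ v ∈ V, ∀ a ∈ t v, ∀ w ∈ V, a ⬝ᵥ v ≤ a ⬝ᵥ w
  nbr : ∀ v ∈ V, ∀ a ∈ t v, ∃ k : ℤ, 0 < k ∧ v + k • E v a ∈ V

/-- The polytope itself. -/
def SmoothModel.body {n : ℕ} (M : SmoothModel n) : Set (Fin n → ℝ) :=
  convexHull ℝ (latticePt '' (M.V : Set (Fin n → ℤ)))

/-! ### Minimality at a vertex is tested on the edges -/

section Separation

theorem exists_dotProduct_eq {n : ℕ} (f : (Fin n → ℝ) →L[ℝ] ℝ) :
    ∃ w : Fin n → ℝ, ∀ x, f x = w ⬝ᵥ x := by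
  refine ⟨fun i => f (Pi.single i 1), fun x => ?_⟩
  conv_lhs => rw [← Finset.univ_sum_single x]
  rw [map_sum, dotProduct]
  refine Finset.sum_congr rfl fun i _ => ?_
  have : (Pi.single i (x i) : Fin n → ℝ) = x i • Pi.single i 1 := by
    funext j; by_cases h : j = i
    · subst h; simp
    · simp [h]
  rw [this, map_smul, smul_eq_mul, mul_comm]

theorem exists_dot_lt_of_notMem {n : ℕ} {K : Set (Fin n → ℝ)} (hc : Convex ℝ K)
    (hK : IsClosed K) {x : Fin n → ℝ} (hx : x ∉ K) :
    ∃ w : Fin n → ℝ, ∀ y ∈ K, w ⬝ᵥ x < w ⬝ᵥ y := by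
  obtain ⟨f, u, h1, h2⟩ := geometric_hahn_banach_point_closed hc hK hx
  obtain ⟨w, hw⟩ := exists_dotProduct_eq f
  refine ⟨w, fun y hy => ?_⟩
  rw [← hw, ← hw]
  exact h1.trans (h2 y hy)

theorem convex_dot_le {n : ℕ} (u : Fin n → ℝ) (c : ℝ) : Convex ℝ {x | c ≤ u ⬝ᵥ x} := by
  intro x hx y hy a b ha hb hab
  simp only [Set.mem_ofPred_eq] at *
  rw [dotProduct_add, dotProduct_smul, dotProduct_smul, smul_eq_mul, smul_eq_mul]
  have h3 : c = a * c + b * c := by rw [← add_mul, hab, one_mul]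
  rw [h3]
  exact add_le_add (mul_le_mul_of_nonneg_left hx ha) (mul_le_mul_of_nonneg_left hy hb)

theorem continuous_dot {n : ℕ} (u : Fin n → ℝ) : Continuous fun x : Fin n → ℝ => u ⬝ᵥ x := by
  unfold dotProduct; fun_prop

theorem isClosed_dot_le {n : ℕ} (u : Fin n → ℝ) (c : ℝ) : IsClosed {x | c ≤ u ⬝ᵥ x} :=
  isClosed_le continuous_const (continuous_dot u)

theorem dot_le_of_mem_convexHull {n : ℕ} {S : Set (Fin n → ℝ)} {u : Fin n → ℝ} {c : ℝ}
    (h : ∀ s ∈ S, c ≤ u ⬝ᵥ s) {x : Fin n → ℝ} (hx : x ∈ convexHull ℝ S) : c ≤ u ⬝ᵥ x :=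
  convexHull_min (fun s hs => h s hs) (convex_dot_le u c) hx

theorem notMem_convexHull_diff_of_extreme {n : ℕ} {S : Set (Fin n → ℝ)} {v : Fin n → ℝ}
    (hv : v ∈ (convexHull ℝ S).extremePoints ℝ) : v ∉ convexHull ℝ (S \ {v}) := by
  have h := ((convex_convexHull ℝ S).mem_extremePoints_iff_mem_sdiff_convexHull_sdiff).1 hv
  exact fun h2 => h.2 (convexHull_mono
    (Set.sdiff_subset_sdiff_left (subset_convexHull ℝ S)) h2)

/-- A linear functional that does not decrease along the edges at a vertex `v` attains its
minimum at `v`. -/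
theorem dot_le_of_edges {n : ℕ} (S : Finset (Fin n → ℝ)) {v u : Fin n → ℝ}
    (hv : v ∈ (convexHull ℝ (S : Set (Fin n → ℝ))).extremePoints ℝ)
    (hu : ∀ F, IsEdge (convexHull ℝ (S : Set (Fin n → ℝ))) F → v ∈ F → ∀ x ∈ F,
      u ⬝ᵥ v ≤ u ⬝ᵥ x) :
    ∀ x ∈ convexHull ℝ (S : Set (Fin n → ℝ)), u ⬝ᵥ v ≤ u ⬝ᵥ x := by
  classical
  set P := convexHull ℝ (S : Set (Fin n → ℝ)) with hP
  have hvS : v ∈ (S : Set (Fin n → ℝ)) := extremePoints_convexHull_subset hv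
  -- `g` attains its minimum over `S` at the extreme point `v` only, so the hyperplane at height one
  -- above `v` cuts out a vertex figure.
  obtain ⟨g, hg⟩ := exists_dot_lt_of_notMem (convex_convexHull ℝ _)
    ((S.finite_toSet.subset Set.sdiff_subset).isClosed_convexHull ℝ)
    (notMem_convexHull_diff_of_extreme hv)
  replace hg : ∀ s ∈ S, s ≠ v → 0 < g ⬝ᵥ (s - v) := by
    intro s hs hsv
    have := hg s (subset_convexHull ℝ _ ⟨hs, hsv⟩)
    rw [dotProduct_sub]; linarith
  -- `k s` is the point at which the ray from `v` through `s`, translated to the origin, meets the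
  -- hyperplane `g = 1`.
  let k : (Fin n → ℝ) → (Fin n → ℝ) := fun s => (g ⬝ᵥ (s - v))⁻¹ • (s - v)
  let K' : Finset (Fin n → ℝ) := (S.erase v).image k
  have hk : ∀ s ∈ S, s ≠ v → s - v = (g ⬝ᵥ (s - v)) • k s := by
    intro s hs hsv
    simp only [k]
    rw [smul_smul, mul_inv_cancel₀ (hg s hs hsv).ne', one_smul]
  have hgk : ∀ s ∈ S, s ≠ v → g ⬝ᵥ k s = 1 := by
    intro s hs hsv
    simp only [k]
    rw [dotProduct_smul, smul_eq_mul, inv_mul_cancel₀ (hg s hs hsv).ne']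
  -- An extreme point of the vertex figure spans an edge of the polytope at `v`, where the
  -- hypothesis on `u` applies.
  have hext : ∀ κ ∈ (convexHull ℝ (K' : Set (Fin n → ℝ))).extremePoints ℝ, 0 ≤ u ⬝ᵥ κ := by
    intro κ hκ
    have hκK : κ ∈ (K' : Set (Fin n → ℝ)) := extremePoints_convexHull_subset hκ
    obtain ⟨s0, hs0, hs0κ⟩ := Finset.mem_image.1 (Finset.mem_coe.1 hκK)
    rw [Finset.mem_erase] at hs0
    obtain ⟨h, hh⟩ := exists_dot_lt_of_notMem (convex_convexHull ℝ _)
      ((K'.finite_toSet.subset Set.sdiff_subset).isClosed_convexHull ℝ)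
      (notMem_convexHull_diff_of_extreme hκ)
    replace hh : ∀ s ∈ S, s ≠ v → k s ≠ κ → h ⬝ᵥ κ < h ⬝ᵥ k s := by
      intro s hs hsv hne
      refine hh _ (subset_convexHull ℝ _ ⟨?_, hne⟩)
      exact Finset.mem_coe.2 (Finset.mem_image.2 ⟨s, Finset.mem_erase.2 ⟨hsv, hs⟩, rfl⟩)
    -- On the hyperplane `g = 1` this functional is `h` minus its value at `κ`: zero at `κ` and
    -- positive at the other `k s`. The face that it cuts out is therefore the edge in direction
    -- `κ`.
    let w : Fin n → ℝ := h - (h ⬝ᵥ κ) • g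
    have hw : ∀ s ∈ S, s ≠ v → w ⬝ᵥ (s - v) = (g ⬝ᵥ (s - v)) * (h ⬝ᵥ k s - h ⬝ᵥ κ) := by
      intro s hs hsv
      have e1 : h ⬝ᵥ (s - v) = (g ⬝ᵥ (s - v)) * (h ⬝ᵥ k s) := by
        conv_lhs => rw [hk s hs hsv]
        rw [dotProduct_smul, smul_eq_mul]
      simp only [w, sub_dotProduct, smul_dotProduct, smul_eq_mul]
      rw [e1]; ring
    have hw0 : ∀ s ∈ S, 0 ≤ w ⬝ᵥ (s - v) := by
      intro s hs
      by_cases hsv : s = v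
      · simp [hsv]
      · rw [hw s hs hsv]
        refine mul_nonneg (hg s hs hsv).le ?_
        by_cases hne : k s = κ
        · simp [hne]
        · exact (sub_pos.2 (hh s hs hsv hne)).le
    have hwP : ∀ x ∈ P, w ⬝ᵥ v ≤ w ⬝ᵥ x := by
      intro x hx
      refine dot_le_of_mem_convexHull (fun s hs => ?_) hx
      have := hw0 s hs
      rw [dotProduct_sub] at this; linarith
    set F : Set (Fin n → ℝ) := {x ∈ P | ∀ y ∈ P, w ⬝ᵥ x ≤ w ⬝ᵥ y} with hF
    have hvP : v ∈ P := hv.1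
    have hvF : v ∈ F := ⟨hvP, hwP⟩
    have hs0F : s0 ∈ F := by
      refine ⟨subset_convexHull ℝ _ hs0.2, fun y hy => ?_⟩
      have := hw s0 hs0.2 hs0.1
      rw [hs0κ, sub_self, mul_zero, dotProduct_sub] at this
      linarith [hwP y hy]
    have hFκ : ∀ x ∈ F, ∃ μ : ℝ, x - v = μ • κ := by
      intro x hx
      obtain ⟨c, hc0, hc1, hcx⟩ := (Finset.mem_convexHull').1 hx.1
      have e1 : x - v = ∑ s ∈ S, c s • (s - v) := by
        simp only [smul_sub, Finset.sum_sub_distrib, ← Finset.sum_smul, hc1, one_smul, hcx]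
      have e2 : w ⬝ᵥ (x - v) = 0 := by
        rw [dotProduct_sub]
        linarith [hx.2 v hvP, hwP x hx.1]
      rw [e1, dotProduct_sum] at e2
      have e3 := (Finset.sum_eq_zero_iff_of_nonneg (fun s hs => by
        rw [dotProduct_smul, smul_eq_mul]
        exact mul_nonneg (hc0 s hs) (hw0 s hs))).1 e2
      refine ⟨∑ s ∈ S, c s * (g ⬝ᵥ (s - v)), ?_⟩
      rw [e1, Finset.sum_smul]
      refine Finset.sum_congr rfl fun s hs => ?_
      by_cases hsv : s = v
      · simp [hsv]
      · have e4 := e3 s hs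
        rw [dotProduct_smul, smul_eq_mul, hw s hs hsv] at e4
        by_cases hne : k s = κ
        · conv_lhs => rw [hk s hs hsv, hne, smul_smul]
        · have : c s = 0 := by
            rcases mul_eq_zero.1 e4 with h0 | h0
            · exact h0
            · exact absurd h0 (mul_pos (hg s hs hsv) (sub_pos.2 (hh s hs hsv hne))).ne'
          simp [this]
    have hκ0 : κ ≠ 0 := by
      intro h0
      have := hgk s0 hs0.2 hs0.1
      rw [hs0κ, h0, dotProduct_zero] at this
      exact zero_ne_one this
    have hspan : vectorSpan ℝ F = Submodule.span ℝ {κ} := by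
      apply le_antisymm
      · rw [vectorSpan_def, Submodule.span_le]
        rintro _ ⟨x, hx, y, hy, rfl⟩
        obtain ⟨μ, hμ⟩ := hFκ x hx
        obtain ⟨ν, hν⟩ := hFκ y hy
        rw [SetLike.mem_coe, Submodule.mem_span_singleton]
        refine ⟨μ - ν, ?_⟩
        rw [sub_smul, ← hμ, ← hν]; exact sub_sub_sub_cancel_right x y v
      · rw [Submodule.span_singleton_le_iff_mem]
        have h1 := vsub_mem_vectorSpan ℝ hs0F hvF
        rw [vsub_eq_sub] at h1
        rw [← hs0κ]
        exact Submodule.smul_mem _ _ h1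
    have hedge : IsEdge P F := by
      refine ⟨⟨⟨v, hvF⟩, w, rfl⟩, ?_⟩
      rw [hspan, finrank_span_singleton hκ0]
    have h1 := hu F hedge hvF s0 hs0F
    rw [← hs0κ]
    simp only [k]
    rw [dotProduct_smul, smul_eq_mul]
    refine mul_nonneg (inv_nonneg.2 (hg s0 hs0.2 hs0.1).le) ?_
    rw [dotProduct_sub]; linarith
  -- By Krein–Milman the inequality passes from the extreme points to the whole vertex figure.
  have hKM : ∀ κ ∈ convexHull ℝ (K' : Set (Fin n → ℝ)), 0 ≤ u ⬝ᵥ κ := by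
    intro κ hκ
    rw [← closure_convexHull_extremePoints (K'.finite_toSet.isCompact_convexHull (𝕜 := ℝ))
      (convex_convexHull ℝ _)] at hκ
    exact closure_minimal (convexHull_min (fun y hy => hext y hy) (convex_dot_le u 0))
      (isClosed_dot_le u 0) hκ
  intro x hx
  refine dot_le_of_mem_convexHull (fun s hs => ?_) hx
  by_cases hsv : s = v
  · rw [hsv]
  · have h1 := hKM (k s) (subset_convexHull ℝ _ (Finset.mem_coe.2
      (Finset.mem_image.2 ⟨s, Finset.mem_erase.2 ⟨hsv, hs⟩, rfl⟩)))
    have h2 : 0 ≤ u ⬝ᵥ (s - v) := by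
      rw [hk s hs hsv, dotProduct_smul, smul_eq_mul]
      exact mul_nonneg (hg s hs hsv).le h1
    rw [dotProduct_sub] at h2; linarith

end Separation

/-! ### From smooth polytopes to `SmoothModel` -/

section OfSmooth

/-- If `w` lies between two points of `P`, both of them minimize the functional that cuts out the
face, so they lie in the segment; since `w` is an end of it, both equal `w`. -/
theorem extremePoint_of_face_segment {n : ℕ} {P F : Set (Fin n → ℝ)} {v w : Fin n → ℝ}
    (hF : IsFace P F) (h : F = segment ℝ v w) : w ∈ P.extremePoints ℝ := by
  obtain ⟨-, u, hu⟩ := hF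
  have hwF : w ∈ F := h ▸ right_mem_segment ℝ v w
  have hvF : v ∈ F := h ▸ left_mem_segment ℝ v w
  rw [mem_extremePoints]
  refine ⟨(hu ▸ hwF : w ∈ {x ∈ P | ∀ y ∈ P, u ⬝ᵥ x ≤ u ⬝ᵥ y}).1, ?_⟩
  intro x hx y hy hxy
  have hw : w ∈ {x ∈ P | ∀ y ∈ P, u ⬝ᵥ x ≤ u ⬝ᵥ y} := hu ▸ hwF
  obtain ⟨a, b, ha, hb, hab, hab2⟩ := hxy
  have e1 : u ⬝ᵥ w = a * (u ⬝ᵥ x) + b * (u ⬝ᵥ y) := by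
    rw [← hab2, dotProduct_add, dotProduct_smul, dotProduct_smul, smul_eq_mul, smul_eq_mul]
  have h1 := hw.2 x hx
  have h2 := hw.2 y hy
  have hb' : b = 1 - a := by linarith
  have ex : u ⬝ᵥ x = u ⬝ᵥ w := by
    subst hb'
    nlinarith
  have ey : u ⬝ᵥ y = u ⬝ᵥ w := by
    subst hb'
    nlinarith
  have hxF : x ∈ F := by rw [hu]; exact ⟨hx, fun z hz => ex ▸ hw.2 z hz⟩
  have hyF : y ∈ F := by rw [hu]; exact ⟨hy, fun z hz => ey ▸ hw.2 z hz⟩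
  rw [h, segment_eq_image'] at hxF hyF
  obtain ⟨p, ⟨hp0, hp1⟩, hp⟩ := hxF
  obtain ⟨q, ⟨hq0, hq1⟩, hq⟩ := hyF
  simp only at hp hq
  by_cases hvw : w - v = 0
  · rw [hvw] at hp hq
    have : v = w := (sub_eq_zero.1 hvw).symm
    simp only [smul_zero, add_zero] at hp hq
    exact ⟨hp ▸ this, hq ▸ this⟩
  · have e2 : (1 - (a * p + b * q)) • (w - v) = 0 := by
      have : w = v + (a * p + b * q) • (w - v) := by
        conv_lhs => rw [← hab2, ← hp, ← hq]
        have hv : v = a • v + b • v := by rw [← add_smul, hab, one_smul]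
        rw [add_smul, mul_smul, mul_smul, smul_add, smul_add]
        nth_rewrite 5 [hv]
        abel
      rw [sub_smul, one_smul, sub_eq_zero, sub_eq_iff_eq_add']
      exact this
    have e3 : a * p + b * q = 1 := by
      rcases smul_eq_zero.1 e2 with h0 | h0
      · linarith
      · exact absurd h0 hvw
    have hp' : p = 1 := by nlinarith
    have hq' : q = 1 := by nlinarith
    constructor
    · rw [← hp, hp']; simp
    · rw [← hq, hq']; simp

/-- Krein–Milman; the closure is superfluous because there are finitely many extreme points. -/
theorem convexHull_extremePoints_eq {n : ℕ} (S : Finset (Fin n → ℤ)) (P : Set (Fin n → ℝ))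
    (hP : P = convexHull ℝ (latticePt '' (S : Set (Fin n → ℤ)))) :
    P = convexHull ℝ (P.extremePoints ℝ) := by
  have hfin : (latticePt '' (S : Set (Fin n → ℤ))).Finite := S.finite_toSet.image _
  have hsub : P.extremePoints ℝ ⊆ latticePt '' (S : Set (Fin n → ℤ)) := by
    rw [hP]; exact extremePoints_convexHull_subset
  have hcl : IsClosed (convexHull ℝ (P.extremePoints ℝ)) :=
    (hfin.subset hsub).isClosed_convexHull ℝ
  have hcomp : IsCompact P := by rw [hP]; exact hfin.isCompact_convexHull ℝ
  have hconv : Convex ℝ P := by rw [hP]; exact convex_convexHull ℝ _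
  rw [← hcl.closure_eq, closure_convexHull_extremePoints hcomp hconv]

theorem isDual_of_basis {n : ℕ} (b : Module.Basis (Fin n) ℤ (Fin n → ℤ)) :
    ∃ D : Fin n → Fin n → ℤ, ∀ i x, D i ⬝ᵥ x = b.coord i x := by
  refine ⟨fun i j => b.coord i (Pi.single j 1), fun i x => ?_⟩
  conv_rhs => rw [← Finset.univ_sum_single x]
  rw [map_sum, dotProduct]
  refine Finset.sum_congr rfl fun j _ => ?_
  have : (Pi.single j (x j) : Fin n → ℤ) = x j • Pi.single j 1 := by
    funext k; by_cases h : k = j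
    · subst h; simp
    · simp [h]
  rw [this, map_smul, smul_eq_mul, mul_comm]

/-- The normals at a vertex are the coordinate functionals of the basis of edge directions. They do
not decrease along the edges at that vertex, so `dot_le_of_edges` makes them minimal there on all of
the polytope. -/
theorem IsSmooth.exists_model {n : ℕ} {P : Set (Fin n → ℝ)} (h : IsSmooth P) :
    ∃ M : SmoothModel n, M.body = P := by
  classical
  obtain ⟨⟨⟨S, hS⟩, hspan⟩, hsm⟩ := h
  have hne : P.Nonempty := by
    by_contra h0
    rw [Set.not_nonempty_iff_eq_empty] at h0
    rw [h0, AffineSubspace.span_empty] at hspan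
    exact AffineSubspace.bot_ne_top ℝ (Fin n → ℝ) (Fin n → ℝ) hspan
  have hfin : (latticePt '' (S : Set (Fin n → ℤ))).Finite := S.finite_toSet.image _
  have hsub : P.extremePoints ℝ ⊆ latticePt '' (S : Set (Fin n → ℤ)) := by
    nth_rewrite 1 [hS]; exact extremePoints_convexHull_subset
  let V := S.filter fun z => latticePt z ∈ P.extremePoints ℝ
  have hV : ∀ z, z ∈ V ↔ latticePt z ∈ P.extremePoints ℝ := by
    intro z
    simp only [V, Finset.mem_filter, and_iff_right_iff_imp]
    intro hz
    obtain ⟨z', hz', e⟩ := hsub hz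
    rwa [← latticePt_injective e]
  have hVext : latticePt '' (V : Set (Fin n → ℤ)) = P.extremePoints ℝ := by
    ext x
    constructor
    · rintro ⟨z, hz, rfl⟩
      exact (hV z).1 hz
    · intro hx
      obtain ⟨z, hz, rfl⟩ := hsub hx
      exact ⟨z, (hV z).2 hx, rfl⟩
  have hhull : P = convexHull ℝ (latticePt '' (V : Set (Fin n → ℤ))) := by
    rw [hVext]; exact convexHull_extremePoints_eq S P hS
  have key : ∀ z ∈ V, ∃ (tz : Finset (Fin n → ℤ)) (Ez : (Fin n → ℤ) → Fin n → ℤ),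
      IsDual tz Ez ∧ (∀ a ∈ tz, ∀ w ∈ V, a ⬝ᵥ z ≤ a ⬝ᵥ w) ∧
      (∀ a ∈ tz, ∃ k : ℤ, 0 < k ∧ z + k • Ez a ∈ V) := by
    intro z hz
    obtain ⟨b, τ, hτ, hedges⟩ := hsm _ ((hV z).1 hz)
    obtain ⟨D, hD⟩ := isDual_of_basis b
    have hDb : ∀ i j, D i ⬝ᵥ b j = if i = j then 1 else 0 := by
      intro i j
      rw [hD, Module.Basis.coord_apply, Module.Basis.repr_self, Finsupp.single_apply]
      by_cases hij : i = j
      · simp [hij]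
      · rw [if_neg (Ne.symm hij), if_neg hij]
    have hDinj : Function.Injective D := by
      intro i j hij
      by_contra hne
      have h1 := hDb i i
      have h2 := hDb j i
      rw [← hij, h1] at h2
      simp [Ne.symm hne] at h2
    let Ez : (Fin n → ℤ) → Fin n → ℤ := fun a => if h : ∃ i, D i = a then b h.choose else 0
    have hEz : ∀ i, Ez (D i) = b i := by
      intro i
      have hex : ∃ j, D j = D i := ⟨i, rfl⟩
      simp only [Ez, dif_pos hex]
      rw [hDinj hex.choose_spec]
    refine ⟨Finset.univ.image D, Ez, ⟨?_, ?_⟩, ?_, ?_⟩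
    · rw [Finset.card_image_of_injective _ hDinj, Finset.card_univ, Fintype.card_fin]
    · intro a ha c hc
      obtain ⟨i, -, rfl⟩ := Finset.mem_image.1 ha
      obtain ⟨j, -, rfl⟩ := Finset.mem_image.1 hc
      rw [hEz, hDb]
      simp only [hDinj.eq_iff]
    · intro a ha w hw
      obtain ⟨i, -, rfl⟩ := Finset.mem_image.1 ha
      have hP' : P = convexHull ℝ ((V.image latticePt : Finset (Fin n → ℝ)) :
          Set (Fin n → ℝ)) := by rw [Finset.coe_image]; exact hhull
      have := dot_le_of_edges (V.image latticePt) (v := latticePt z) (u := latticePt (D i))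
        (by rw [← hP']; exact (hV z).1 hz) (by
          rw [← hP']
          intro F hF hvF x hx
          have hm : F ∈ {F | IsEdge P F ∧ latticePt z ∈ F} := ⟨hF, hvF⟩
          rw [hedges] at hm
          obtain ⟨j, rfl⟩ := hm
          simp only [segment_eq_image'] at hx
          obtain ⟨θ, ⟨hθ, -⟩, rfl⟩ := hx
          simp only [dotProduct_add, add_sub_cancel_left, dotProduct_smul, smul_eq_mul,
            latticePt_dot, hDb]
          have : (0 : ℝ) ≤ θ * (τ j * ((if i = j then 1 else 0 : ℤ) : ℝ)) := by
            refine mul_nonneg hθ (mul_nonneg (hτ j).le ?_)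
            split_ifs <;> simp
          linarith) (latticePt w) (subset_convexHull ℝ _ (by
            rw [Finset.coe_image]; exact ⟨w, hw, rfl⟩))
      rw [latticePt_dot, latticePt_dot] at this
      exact_mod_cast this
    · intro a ha
      obtain ⟨i, -, rfl⟩ := Finset.mem_image.1 ha
      have hm : segment ℝ (latticePt z) (latticePt z + τ i • latticePt (b i)) ∈
          {F | IsEdge P F ∧ latticePt z ∈ F} := by rw [hedges]; exact ⟨i, rfl⟩
      have hx := extremePoint_of_face_segment hm.1.1 rfl
      rw [← hVext] at hx
      obtain ⟨w, hw, hwe⟩ := hx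
      -- The far end of the edge is an extreme point, hence a lattice point, so the real length `τ
      -- i` is the integer that the dual functional reads off.
      have hτi : τ i = ((D i ⬝ᵥ (w - z) : ℤ) : ℝ) := by
        rw [← latticePt_dot, latticePt_sub, hwe, add_sub_cancel_left, dotProduct_smul,
          latticePt_dot, hDb]
        simp
      refine ⟨D i ⬝ᵥ (w - z), ?_, ?_⟩
      · have := hτ i
        rw [hτi] at this
        exact_mod_cast this
      · rw [hEz]
        have : z + (D i ⬝ᵥ (w - z)) • b i = w := by
          apply latticePt_injective
          rw [latticePt_add, latticePt_smul, ← hτi, hwe]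
        rw [this]; exact hw
  choose! t E h1 h2 h3 using key
  refine ⟨⟨V, t, E, ?_, h1, h2, h3⟩, hhull.symm⟩
  have hcne : (convexHull ℝ (latticePt '' (V : Set (Fin n → ℤ)))).Nonempty := hhull ▸ hne
  rw [convexHull_nonempty_iff] at hcne
  obtain ⟨_, z, hz, -⟩ := hcne
  exact ⟨z, hz⟩

end OfSmooth


/-- The cone spanned by a finite set of lattice vectors. -/
def coneOver {n : ℕ} (A : Finset (Fin n → ℤ)) : Set (Fin n → ℝ) :=
  {u | ∃ c : (Fin n → ℤ) → ℝ, (∀ a ∈ A, 0 ≤ c a) ∧ u = ∑ a ∈ A, c a • latticePt a}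

theorem IsDual.mem_coneOver_iff {n : ℕ} {t A : Finset (Fin n → ℤ)}
    {E : (Fin n → ℤ) → Fin n → ℤ} (h : IsDual t E) (hA : A ⊆ t) (u : Fin n → ℝ) :
    u ∈ coneOver A ↔ (∀ a ∈ A, 0 ≤ u ⬝ᵥ latticePt (E a)) ∧
      ∀ a ∈ t, a ∉ A → u ⬝ᵥ latticePt (E a) = 0 := by
  classical
  constructor
  · rintro ⟨c, hc, rfl⟩
    have key : ∀ a ∈ t, (∑ b ∈ A, c b • latticePt b) ⬝ᵥ latticePt (E a) =
        if a ∈ A then c a else 0 := by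
      intro a ha
      rw [sum_dotProduct]
      have : ∀ b ∈ A, c b • latticePt b ⬝ᵥ latticePt (E a) = if b = a then c b else 0 := by
        intro b hb
        rw [smul_dotProduct, latticePt_dot, h.dot a ha b (hA hb), smul_eq_mul]
        split_ifs <;> simp
      rw [Finset.sum_congr rfl this, Finset.sum_ite_eq']
    constructor
    · intro a ha
      rw [key a (hA ha), if_pos ha]; exact hc a ha
    · intro a ha haA
      rw [key a ha, if_neg haA]
  · rintro ⟨h1, h2⟩
    refine ⟨fun a => u ⬝ᵥ latticePt (E a), h1, ?_⟩
    conv_lhs => rw [h.expand_dual_real u]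
    refine (Finset.sum_subset hA fun a ha haA => ?_).symm
    rw [h2 a ha haA, zero_smul]

/-- The fan `Φ` consists of the cones over the subsets of the members of `T`, which are bases of
the lattice. -/
structure IsFanModel {n : ℕ} (Φ : Set (Set (Fin n → ℝ))) (T : Finset (Finset (Fin n → ℤ))) :
    Prop where
  uni : ∀ t ∈ T, ∃ E, IsDual t E
  eq : Φ = {σ | ∃ t ∈ T, ∃ A, A ⊆ t ∧ σ = coneOver A}

/-! ### The normal fan of a smooth polytope -/

namespace SmoothModel

variable {n : ℕ} (M : SmoothModel n)

theorem mem_body {v : Fin n → ℤ} (hv : v ∈ M.V) : latticePt v ∈ M.body :=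
  subset_convexHull ℝ _ ⟨v, hv, rfl⟩

theorem dot_le_body {u : Fin n → ℝ} {c : ℝ} (h : ∀ w ∈ M.V, c ≤ u ⬝ᵥ latticePt w)
    {x : Fin n → ℝ} (hx : x ∈ M.body) : c ≤ u ⬝ᵥ x := by
  refine dot_le_of_mem_convexHull ?_ hx
  rintro _ ⟨w, hw, rfl⟩
  exact h w hw

theorem le_body {v a : Fin n → ℤ} (hv : v ∈ M.V) (ha : a ∈ M.t v) {x : Fin n → ℝ}
    (hx : x ∈ M.body) : latticePt a ⬝ᵥ latticePt v ≤ latticePt a ⬝ᵥ x := by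
  refine M.dot_le_body (fun w hw => ?_) hx
  rw [latticePt_dot, latticePt_dot]
  exact_mod_cast M.le v hv a ha w hw

theorem edge_nonneg {v : Fin n → ℤ} (hv : v ∈ M.V) {u : Fin n → ℝ}
    (hu : ∀ w ∈ M.V, u ⬝ᵥ latticePt v ≤ u ⬝ᵥ latticePt w) {a : Fin n → ℤ} (ha : a ∈ M.t v) :
    0 ≤ u ⬝ᵥ latticePt (M.E v a) := by
  obtain ⟨k, hk, hw⟩ := M.nbr v hv a ha
  have h1 := hu _ hw
  rw [latticePt_add, latticePt_smul, dotProduct_add, dotProduct_smul, smul_eq_mul] at h1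
  have hk' : (0 : ℝ) < k := by exact_mod_cast hk
  exact nonneg_of_mul_nonneg_right (by linarith) hk'

theorem dot_sub_eq {v : Fin n → ℤ} (hv : v ∈ M.V) (u x : Fin n → ℝ) :
    u ⬝ᵥ x - u ⬝ᵥ latticePt v = ∑ a ∈ M.t v, (u ⬝ᵥ latticePt (M.E v a)) *
      (latticePt a ⬝ᵥ x - latticePt a ⬝ᵥ latticePt v) := by
  rw [← dotProduct_sub, (M.dual v hv).dot_expand_real]
  simp only [dotProduct_sub]

/-- If `x` satisfied the inequalities but lay outside, some `u` would be smaller at `x` than on the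
whole polytope. At a vertex where `u` is minimal, `u` is a nonnegative combination of the normals,
so the inequalities give the opposite estimate. -/
theorem mem_body_iff (x : Fin n → ℝ) : x ∈ M.body ↔
    ∀ v ∈ M.V, ∀ a ∈ M.t v, latticePt a ⬝ᵥ latticePt v ≤ latticePt a ⬝ᵥ x := by
  refine ⟨fun hx v hv a ha => M.le_body hv ha hx, fun h => ?_⟩
  by_contra hx
  obtain ⟨u, hu⟩ := exists_dot_lt_of_notMem (convex_convexHull ℝ _)
    ((M.V.finite_toSet.image _).isClosed_convexHull ℝ) hx
  obtain ⟨v, hv, hmin⟩ := M.V.exists_min_image (fun w => u ⬝ᵥ latticePt w) M.nonempty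
  have h1 := hu _ (M.mem_body hv)
  have h2 := M.dot_sub_eq hv u x
  have h3 : 0 ≤ ∑ a ∈ M.t v, (u ⬝ᵥ latticePt (M.E v a)) *
      (latticePt a ⬝ᵥ x - latticePt a ⬝ᵥ latticePt v) :=
    Finset.sum_nonneg fun a ha => mul_nonneg (M.edge_nonneg hv hmin ha)
      (sub_nonneg.2 (h v hv a ha))
  linarith

/-- A functional with positive coordinates exactly on `A` is minimal at `v` and at the neighbours
across the facets outside `A`. A member of the normal cone must therefore be constant along these
edges, which leaves the cone over `A`. Conversely the normals in `A` are constant on the face. -/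
theorem normalCone_face {v : Fin n → ℤ} (hv : v ∈ M.V) {A : Finset (Fin n → ℤ)} (hA : A ⊆ M.t v)
    {u : Fin n → ℝ} (h1 : ∀ a ∈ A, 0 < u ⬝ᵥ latticePt (M.E v a))
    (h2 : ∀ a ∈ M.t v, a ∉ A → u ⬝ᵥ latticePt (M.E v a) = 0) :
    latticePt v ∈ {x ∈ M.body | ∀ y ∈ M.body, u ⬝ᵥ x ≤ u ⬝ᵥ y} ∧
    normalCone M.body {x ∈ M.body | ∀ y ∈ M.body, u ⬝ᵥ x ≤ u ⬝ᵥ y} = coneOver A := by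
  have hpos : ∀ a ∈ M.t v, 0 ≤ u ⬝ᵥ latticePt (M.E v a) := by
    intro a ha
    by_cases haA : a ∈ A
    · exact (h1 a haA).le
    · exact (h2 a ha haA).ge
  have hterm : ∀ x ∈ M.body, ∀ a ∈ M.t v, 0 ≤ (u ⬝ᵥ latticePt (M.E v a)) *
      (latticePt a ⬝ᵥ x - latticePt a ⬝ᵥ latticePt v) := fun x hx a ha =>
    mul_nonneg (hpos a ha) (sub_nonneg.2 (M.le_body hv ha hx))
  have hvmin : ∀ x ∈ M.body, u ⬝ᵥ latticePt v ≤ u ⬝ᵥ x := by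
    intro x hx
    have := M.dot_sub_eq hv u x
    have h3 := Finset.sum_nonneg (hterm x hx)
    linarith
  have hvF : latticePt v ∈ {x ∈ M.body | ∀ y ∈ M.body, u ⬝ᵥ x ≤ u ⬝ᵥ y} :=
    ⟨M.mem_body hv, hvmin⟩
  refine ⟨hvF, ?_⟩
  ext w
  constructor
  · intro hw
    rw [(M.dual v hv).mem_coneOver_iff hA]
    have hmin : ∀ z ∈ M.V, w ⬝ᵥ latticePt v ≤ w ⬝ᵥ latticePt z := fun z hz =>
      hw _ hvF _ (M.mem_body hz)
    refine ⟨fun a ha => M.edge_nonneg hv hmin (hA ha), fun a ha haA => ?_⟩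
    obtain ⟨k, hk, hz⟩ := M.nbr v hv a ha
    have hzF : latticePt (v + k • M.E v a) ∈ {x ∈ M.body | ∀ y ∈ M.body, u ⬝ᵥ x ≤ u ⬝ᵥ y} := by
      refine ⟨M.mem_body hz, fun y hy => ?_⟩
      rw [latticePt_add, latticePt_smul, dotProduct_add, dotProduct_smul, h2 a ha haA, smul_zero,
        add_zero]
      exact hvmin y hy
    have h3 := hw _ hzF _ (M.mem_body hv)
    rw [latticePt_add, latticePt_smul, dotProduct_add, dotProduct_smul, smul_eq_mul] at h3
    have hk' : (0 : ℝ) < k := by exact_mod_cast hk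
    have h4 := M.edge_nonneg hv hmin ha
    nlinarith
  · rintro ⟨c, hc, rfl⟩ x hx y hy
    simp only [sum_dotProduct, smul_dotProduct, smul_eq_mul]
    refine Finset.sum_le_sum fun a ha => mul_le_mul_of_nonneg_left ?_ (hc a ha)
    have h3 : ∑ a ∈ M.t v, (u ⬝ᵥ latticePt (M.E v a)) *
      (latticePt a ⬝ᵥ x - latticePt a ⬝ᵥ latticePt v) = 0 := by
      rw [← M.dot_sub_eq hv u x]
      linarith [hvmin x hx.1, hx.2 _ (M.mem_body hv)]
    have h4 := (Finset.sum_eq_zero_iff_of_nonneg (hterm x hx.1)).1 h3 a (hA ha)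
    have h5 : latticePt a ⬝ᵥ x = latticePt a ⬝ᵥ latticePt v := by
      rcases mul_eq_zero.1 h4 with h0 | h0
      · exact absurd h0 (h1 a ha).ne'
      · linarith
    rw [h5]
    exact M.le_body hv (hA ha) hy

/-- Every functional is minimal at some vertex, and its positive coordinates there name the cone;
conversely the sum of the normals in `A` cuts out a face whose cone is spanned by `A`. -/
theorem isFanModel :
    IsFanModel (normalFan M.body) (M.V.image M.t) := by
  refine ⟨?_, ?_⟩
  · intro t ht
    obtain ⟨v, hv, rfl⟩ := Finset.mem_image.1 ht
    exact ⟨_, M.dual v hv⟩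
  · ext σ
    constructor
    · rintro ⟨F, ⟨hne, u, rfl⟩, rfl⟩
      obtain ⟨v, hv, hmin⟩ := M.V.exists_min_image (fun w => u ⬝ᵥ latticePt w) M.nonempty
      refine ⟨M.t v, Finset.mem_image_of_mem _ hv,
        (M.t v).filter fun a => 0 < u ⬝ᵥ latticePt (M.E v a), Finset.filter_subset _ _, ?_⟩
      refine (M.normalCone_face hv (Finset.filter_subset _ _) ?_ ?_).2
      · intro a ha; exact (Finset.mem_filter.1 ha).2
      · intro a ha haA
        have h1 := M.edge_nonneg hv hmin ha
        have h2 : ¬ 0 < u ⬝ᵥ latticePt (M.E v a) := fun h => haA (Finset.mem_filter.2 ⟨ha, h⟩)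
        linarith
    · rintro ⟨t, ht, A, hA, rfl⟩
      obtain ⟨v, hv, rfl⟩ := Finset.mem_image.1 ht
      have key : ∀ a ∈ M.t v, latticePt (∑ b ∈ A, b) ⬝ᵥ latticePt (M.E v a) =
          if a ∈ A then 1 else 0 := by
        intro a ha
        rw [latticePt_dot, sum_dotProduct, Finset.sum_congr rfl fun b hb =>
          (M.dual v hv).dot a ha b (hA hb), Finset.sum_ite_eq']
        split_ifs <;> simp
      have h := M.normalCone_face hv hA (u := latticePt (∑ b ∈ A, b))
        (fun a ha => by rw [key a (hA ha), if_pos ha]; exact one_pos)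
        (fun a ha haA => by rw [key a ha, if_neg haA])
      exact ⟨_, ⟨⟨_, h.1⟩, _, rfl⟩, h.2.symm⟩

end SmoothModel

/-! ### Recovering generators and inclusions from the cones -/

section Order

variable {n : ℕ} {P : Set (Fin n → ℝ)} {T : Finset (Finset (Fin n → ℤ))}

/-- A family of vectors of a cone over part of a lattice basis, which generates the basis as a
semigroup, contains it. -/
theorem IsDual.subset_of_generate {t A : Finset (Fin n → ℤ)}
    {E : (Fin n → ℤ) → Fin n → ℤ} (h : IsDual t E) (hA : A ⊆ t) {ι : Type*} {s : Finset ι}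
    {x : ι → Fin n → ℤ} (hx : ∀ i ∈ s, latticePt (x i) ∈ coneOver A)
    {a : Fin n → ℤ} (ha : a ∈ A) {c : ι → ℤ} (hc : ∀ i ∈ s, 0 ≤ c i)
    (hac : a = ∑ i ∈ s, c i • x i) : ∃ i ∈ s, x i = a := by
  have hnn : ∀ i ∈ s, ∀ b ∈ A, 0 ≤ x i ⬝ᵥ E b := by
    intro i hi b hb
    have := ((h.mem_coneOver_iff hA _).1 (hx i hi)).1 b hb
    rw [latticePt_dot] at this
    exact_mod_cast this
  have hz : ∀ i ∈ s, ∀ b ∈ t, b ∉ A → x i ⬝ᵥ E b = 0 := by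
    intro i hi b hb hbA
    have := ((h.mem_coneOver_iff hA _).1 (hx i hi)).2 b hb hbA
    rw [latticePt_dot] at this
    exact_mod_cast this
  have e1 : ∀ b ∈ t, ∑ i ∈ s, c i * (x i ⬝ᵥ E b) = if a = b then 1 else 0 := by
    intro b hb
    rw [← h.dot b hb a (hA ha)]
    conv_rhs => rw [hac]
    rw [sum_dotProduct]
    exact Finset.sum_congr rfl fun i _ => by rw [smul_dotProduct, smul_eq_mul]
  have e2 := e1 a (hA ha)
  rw [if_pos rfl] at e2
  -- The coordinate of `a` at its own dual vector is one and is a sum of nonnegative integers, so a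
  -- single generator carries it. The other coordinates of this generator vanish, because they
  -- contribute to vanishing sums of nonnegative terms.
  have hex : ∃ i ∈ s, 0 < c i * (x i ⬝ᵥ E a) := by
    by_contra hcon
    push Not at hcon
    have := Finset.sum_nonpos hcon
    omega
  obtain ⟨i, hi, hpos⟩ := hex
  refine ⟨i, hi, ?_⟩
  have hci : 0 < c i := by
    rcases (hc i hi).lt_or_eq with h0 | h0
    · exact h0
    · rw [← h0] at hpos; simp at hpos
  have hle : c i * (x i ⬝ᵥ E a) ≤ 1 := by
    rw [← e2]
    exact Finset.single_le_sum (f := fun i => c i * (x i ⬝ᵥ E a))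
      (fun j hj => mul_nonneg (hc j hj) (hnn j hj a ha)) hi
  have hxa : x i ⬝ᵥ E a = 1 := by
    have := hnn i hi a ha
    nlinarith
  have hxb : ∀ b ∈ t, b ≠ a → x i ⬝ᵥ E b = 0 := by
    intro b hb hba
    by_cases hbA : b ∈ A
    · have e3 := e1 b hb
      rw [if_neg (Ne.symm hba)] at e3
      have := (Finset.sum_eq_zero_iff_of_nonneg (fun j hj =>
        mul_nonneg (hc j hj) (hnn j hj b hbA))).1 e3 i hi
      rcases mul_eq_zero.1 this with h0 | h0
      · omega
      · exact h0
    · exact hz i hi b hb hbA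
  rw [h.expand_dual (x i), Finset.sum_eq_single a]
  · rw [hxa, one_smul]
  · intro b hb hba
    rw [hxb b hb hba, zero_smul]
  · intro h0; exact absurd (hA ha) h0

theorem latticePt_mem_coneOver {A : Finset (Fin n → ℤ)} {a : Fin n → ℤ} (ha : a ∈ A) :
    latticePt a ∈ coneOver A := by
  classical
  refine ⟨fun b => if b = a then 1 else 0, fun b _ => by dsimp; split_ifs <;> norm_num, ?_⟩
  simp [ite_smul, ha]

/-- The generators are recovered from the cone as the indecomposable members of its semigroup of
lattice points. -/
theorem IsDual.subset_of_coneOver_eq {t A t' A' : Finset (Fin n → ℤ)}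
    {E E' : (Fin n → ℤ) → Fin n → ℤ} (h : IsDual t E) (hA : A ⊆ t) (h' : IsDual t' E')
    (hA' : A' ⊆ t') (heq : coneOver A = coneOver A') : A ⊆ A' := by
  intro a ha
  have hmem : latticePt a ∈ coneOver A' := heq ▸ latticePt_mem_coneOver ha
  obtain ⟨h1, h2⟩ := (h'.mem_coneOver_iff hA' _).1 hmem
  have hsum : a = ∑ b ∈ A', (a ⬝ᵥ E' b) • b := by
    conv_lhs => rw [h'.expand_dual a]
    refine (Finset.sum_subset hA' fun b hb hbA => ?_).symm
    have := h2 b hb hbA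
    rw [latticePt_dot] at this
    have h3 : a ⬝ᵥ E' b = 0 := by exact_mod_cast this
    rw [h3, zero_smul]
  obtain ⟨i, hi, hia⟩ := h.subset_of_generate hA (s := A') (x := fun b => b)
    (fun i hi => heq ▸ latticePt_mem_coneOver hi) ha (c := fun b => a ⬝ᵥ E' b)
    (fun b hb => by
      have := h1 b hb
      rw [latticePt_dot] at this
      exact_mod_cast this) hsum
  exact hia ▸ hi

theorem IsFanModel.subset_of_eq {Φ : Set (Set (Fin n → ℝ))} {T' : Finset (Finset (Fin n → ℤ))}
    (hT : IsFanModel Φ T) (hT' : IsFanModel Φ T') : T ⊆ T' := by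
  intro t ht
  obtain ⟨E, hE⟩ := hT.uni t ht
  have : coneOver t ∈ Φ := by rw [hT.eq]; exact ⟨t, ht, t, subset_rfl, rfl⟩
  rw [hT'.eq] at this
  obtain ⟨t', ht', A, hA, heq⟩ := this
  obtain ⟨E', hE'⟩ := hT'.uni t' ht'
  have h1 := hE.subset_of_coneOver_eq subset_rfl hE' hA heq
  have h2 : t = t' := Finset.eq_of_subset_of_card_le (h1.trans hA) (by rw [hE.card, hE'.card])
  rw [h2]; exact ht'

theorem IsFanModel.unique {Φ : Set (Set (Fin n → ℝ))} {T' : Finset (Finset (Fin n → ℤ))}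
    (hT : IsFanModel Φ T) (hT' : IsFanModel Φ T') : T = T' :=
  (hT.subset_of_eq hT').antisymm (hT'.subset_of_eq hT)

/-- A functional in the relative interior of a cone of the normal fan determines the cone. -/
theorem normalCone_eq_of_pos {A : Finset (Fin n → ℤ)} {F : Set (Fin n → ℝ)} (hF : IsFace P F)
    (hA : normalCone P F = coneOver A) {c : (Fin n → ℤ) → ℝ} (hc : ∀ a ∈ A, 0 < c a) :
    F = {x ∈ P | ∀ y ∈ P, (∑ a ∈ A, c a • latticePt a) ⬝ᵥ x ≤
      (∑ a ∈ A, c a • latticePt a) ⬝ᵥ y} := by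
  set u := ∑ a ∈ A, c a • latticePt a with hu
  obtain ⟨⟨f, hf⟩, u0, hu0⟩ := hF
  have hFP : F ⊆ P := by rw [hu0]; exact fun x hx => hx.1
  have hu0c : u0 ∈ normalCone P F := by
    intro x hx y hy
    rw [hu0] at hx
    exact hx.2 y hy
  have huc : u ∈ normalCone P F := by
    rw [hA]; exact ⟨c, fun a ha => (hc a ha).le, rfl⟩
  have hu0c' := hu0c
  rw [hA] at hu0c'
  obtain ⟨d, hd, hu0d⟩ := hu0c'
  -- As `u` has positive coefficients, a small multiple of the functional `u0` that defines the face
  -- can be subtracted from it within the cone. A minimizer of `u` then minimizes `u0` too.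
  obtain ⟨δ, hδ, hδc⟩ : ∃ δ : ℝ, 0 < δ ∧ ∀ a ∈ A, δ * d a ≤ c a := by
    have hall : ∀ a ∈ A, ∃ δ : ℝ, 0 < δ ∧ δ * d a ≤ c a := by
      intro a ha
      refine ⟨c a / (d a + 1), div_pos (hc a ha) (by linarith [hd a ha]), ?_⟩
      rw [div_mul_eq_mul_div, div_le_iff₀ (by linarith [hd a ha])]
      nlinarith [hc a ha, hd a ha]
    choose! g hg1 hg2 using hall
    by_cases hne : A.Nonempty
    · refine ⟨A.inf' hne g, ?_, ?_⟩
      · rw [Finset.lt_inf'_iff]; exact hg1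
      · intro a ha
        have := Finset.inf'_le g ha
        have h3 := hg2 a ha
        nlinarith [hd a ha]
    · refine ⟨1, one_pos, fun a ha => absurd ⟨a, ha⟩ hne⟩
  have hwc : u - δ • u0 ∈ normalCone P F := by
    rw [hA]
    refine ⟨fun a => c a - δ * d a, fun a ha => sub_nonneg.2 (hδc a ha), ?_⟩
    rw [hu, hu0d, Finset.smul_sum, ← Finset.sum_sub_distrib]
    exact Finset.sum_congr rfl fun a _ => by rw [sub_smul, mul_smul]
  ext x
  constructor
  · intro hx
    exact ⟨hFP hx, fun y hy => huc x hx y hy⟩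
  · rintro ⟨hxP, hx⟩
    rw [hu0]
    refine ⟨hxP, fun y hy => ?_⟩
    have h1 := hx f (hFP hf)
    have h2 := hwc f hf x hxP
    have h3 := hu0c f hf y hy
    simp only [sub_dotProduct, smul_dotProduct, smul_eq_mul] at h2
    nlinarith

/-- Here it matters that the fan is a normal fan. The sum of the members of `A` lies in the relative
interior of the cone over some `B ⊆ A'` as well; an interior functional determines its face, so the
cones over `A` and `B` agree, and then so do their generators. -/
theorem IsFanModel.subset_iff (hT : IsFanModel (normalFan P) T) {t A t' A' : Finset (Fin n → ℤ)}
    (ht : t ∈ T) (hA : A ⊆ t) (ht' : t' ∈ T) (hA' : A' ⊆ t') :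
    coneOver A ⊆ coneOver A' ↔ A ⊆ A' := by
  classical
  obtain ⟨E, hE⟩ := hT.uni t ht
  obtain ⟨E', hE'⟩ := hT.uni t' ht'
  constructor
  · intro hsub
    have huA : (∑ a ∈ A, (1 : ℝ) • latticePt a) ∈ coneOver A :=
      ⟨fun _ => 1, fun _ _ => zero_le_one, rfl⟩
    obtain ⟨c, hc, hcu⟩ := hsub huA
    let B := A'.filter fun a => 0 < c a
    have hBA' : B ⊆ A' := Finset.filter_subset _ _
    have hB : (∑ a ∈ A, (1 : ℝ) • latticePt a) = ∑ a ∈ B, c a • latticePt a := by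
      rw [hcu]
      refine (Finset.sum_subset hBA' fun a ha haB => ?_).symm
      have : ¬ 0 < c a := fun h => haB (Finset.mem_filter.2 ⟨ha, h⟩)
      have h0 : c a = 0 := le_antisymm (not_lt.1 this) (hc a ha)
      rw [h0, zero_smul]
    have hAΦ : coneOver A ∈ normalFan P := by rw [hT.eq]; exact ⟨t, ht, A, hA, rfl⟩
    have hBΦ : coneOver B ∈ normalFan P := by
      rw [hT.eq]; exact ⟨t', ht', B, hBA'.trans hA', rfl⟩
    obtain ⟨F, hF, hFA⟩ := hAΦ
    obtain ⟨G, hG, hGB⟩ := hBΦ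
    have e1 := normalCone_eq_of_pos hF hFA.symm (c := fun _ => 1) fun _ _ => one_pos
    have e2 := normalCone_eq_of_pos hG hGB.symm (c := c) fun a ha => (Finset.mem_filter.1 ha).2
    rw [hB] at e1
    have hFG : F = G := by rw [e1, e2]
    have heq : coneOver A = coneOver B := by rw [hFA, hGB, hFG]
    exact (hE.subset_of_coneOver_eq hA hE' (hBA'.trans hA') heq).trans hBA'
  · rintro hsub u ⟨c, hc, rfl⟩
    refine ⟨fun a => if a ∈ A then c a else 0, ?_, ?_⟩
    · intro a _
      dsimp; split_ifs with h
      · exact hc a h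
      · exact le_rfl
    · rw [← Finset.sum_subset hsub (fun a _ haA => by dsimp only; rw [if_neg haA, zero_smul])]
      exact Finset.sum_congr rfl fun a ha => by dsimp only; rw [if_pos ha]

theorem IsFanModel.coneOver_inj (hT : IsFanModel (normalFan P) T)
    {t A t' A' : Finset (Fin n → ℤ)}
    (ht : t ∈ T) (hA : A ⊆ t) (ht' : t' ∈ T) (hA' : A' ⊆ t') :
    coneOver A = coneOver A' ↔ A = A' := by
  constructor
  · intro h
    exact ((hT.subset_iff ht hA ht' hA').1 h.le).antisymm
      ((hT.subset_iff ht' hA' ht hA).1 h.ge)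
  · rintro rfl; rfl

theorem IsDual.coneDim_coneOver {t A : Finset (Fin n → ℤ)} {E : (Fin n → ℤ) → Fin n → ℤ}
    (h : IsDual t E) (hA : A ⊆ t) : coneDim (coneOver A) = A.card := by
  classical
  have hspan : Submodule.span ℝ (coneOver A) =
      Submodule.span ℝ (Set.range fun a : A => latticePt (a : Fin n → ℤ)) := by
    apply le_antisymm
    · rw [Submodule.span_le]
      rintro _ ⟨c, -, rfl⟩
      exact Submodule.sum_mem _ fun a ha => Submodule.smul_mem _ _
        (Submodule.subset_span ⟨⟨a, ha⟩, rfl⟩)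
    · rw [Submodule.span_le]
      rintro _ ⟨a, rfl⟩
      exact Submodule.subset_span (latticePt_mem_coneOver a.2)
  have hli : LinearIndependent ℝ fun a : A => latticePt (a : Fin n → ℤ) := by
    rw [Fintype.linearIndependent_iff]
    intro g hg a
    have h1 : (∑ i : A, g i • latticePt (i : Fin n → ℤ)) ⬝ᵥ latticePt (E a) = g a := by
      rw [sum_dotProduct, Finset.sum_eq_single a]
      · rw [smul_dotProduct, latticePt_dot, h.dot_self (hA a.2)]; simp
      · intro b _ hba
        rw [smul_dotProduct, latticePt_dot, h.dot_ne (hA a.2) (hA b.2)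
          (fun e => hba (Subtype.ext e))]; simp
      · intro h0; exact absurd (Finset.mem_univ a) h0
    rw [← h1, hg, zero_dotProduct]
  unfold coneDim
  rw [hspan, finrank_span_eq_card hli, Fintype.card_coe]

end Order


/-! ### Triangles, degrees and neighbours -/

section Triangulation

variable {α : Type*} [DecidableEq α]

/-- The vertices of a family of triangles. -/
def Tri.verts (T : Finset (Finset α)) : Finset α := T.biUnion id

/-- The number of triangles at a vertex. -/
def Tri.deg (T : Finset (Finset α)) (x : α) : ℕ := (T.filter fun t => x ∈ t).card

/-- A set of triangles such that each edge lies in exactly two of them. -/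
structure IsTri (T : Finset (Finset α)) : Prop where
  card : ∀ t ∈ T, t.card = 3
  pair : ∀ x y, x ≠ y → (∃ t ∈ T, x ∈ t ∧ y ∈ t) → (T.filter fun t => x ∈ t ∧ y ∈ t).card = 2

theorem Tri.mem_verts {T : Finset (Finset α)} {x : α} :
    x ∈ Tri.verts T ↔ ∃ t ∈ T, x ∈ t := by
  simp [Tri.verts]

theorem Tri.deg_pos {T : Finset (Finset α)} {x : α} (hx : x ∈ Tri.verts T) :
    0 < Tri.deg T x := by
  obtain ⟨t, ht, hxt⟩ := Tri.mem_verts.1 hx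
  exact Finset.card_pos.2 ⟨t, Finset.mem_filter.2 ⟨ht, hxt⟩⟩

theorem Tri.sum_deg {T : Finset (Finset α)} (h : ∀ t ∈ T, t.card = 3) :
    ∑ x ∈ Tri.verts T, Tri.deg T x = 3 * T.card := by
  have h1 := Finset.sum_card_bipartiteAbove_eq_sum_card_bipartiteBelow
    (s := Tri.verts T) (t := T) (fun x t => x ∈ t)
  simp only [Finset.bipartiteAbove, Finset.bipartiteBelow] at h1
  unfold Tri.deg
  rw [h1, Finset.sum_congr rfl (g := fun _ => 3), Finset.sum_const, smul_eq_mul, mul_comm]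
  intro t ht
  rw [← h t ht]
  congr 1
  ext x
  rw [Finset.mem_filter]
  exact ⟨fun h => h.2, fun h => ⟨Tri.mem_verts.2 ⟨t, ht, h⟩, h⟩⟩

/-- The neighbours of a vertex. -/
def Tri.nbrs (T : Finset (Finset α)) (x : α) : Finset α :=
  (Tri.verts T).filter fun y => y ≠ x ∧ ∃ t ∈ T, x ∈ t ∧ y ∈ t

theorem Tri.mem_nbrs {T : Finset (Finset α)} {x y : α} :
    y ∈ Tri.nbrs T x ↔ y ≠ x ∧ ∃ t ∈ T, x ∈ t ∧ y ∈ t := by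
  simp only [Tri.nbrs, Finset.mem_filter, and_iff_right_iff_imp]
  rintro ⟨-, t, ht, -, hy⟩
  exact Tri.mem_verts.2 ⟨t, ht, hy⟩

/-- Double counting: each edge at `x` lies in two triangles, and each triangle at `x` has two edges
at `x`. -/
theorem IsTri.card_nbrs {T : Finset (Finset α)} (h : IsTri T) (x : α) :
    (Tri.nbrs T x).card = Tri.deg T x := by
  have h1 := Finset.sum_card_bipartiteAbove_eq_sum_card_bipartiteBelow
    (s := Tri.nbrs T x) (t := T.filter fun t => x ∈ t) (fun y t => y ∈ t)
  simp only [Finset.bipartiteAbove, Finset.bipartiteBelow] at h1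
  rw [Finset.sum_congr rfl (g := fun _ => 2), Finset.sum_const,
    Finset.sum_congr rfl (g := fun _ => 2) (s₂ := T.filter fun t => x ∈ t), Finset.sum_const,
    smul_eq_mul, smul_eq_mul] at h1
  · unfold Tri.deg; omega
  · intro t ht
    rw [Finset.mem_filter] at ht
    have : (Tri.nbrs T x).filter (fun y => y ∈ t) = t.erase x := by
      ext y
      rw [Finset.mem_filter, Tri.mem_nbrs, Finset.mem_erase]
      exact ⟨fun h => ⟨h.1.1, h.2⟩, fun h => ⟨⟨h.1, t, ht.1, ht.2, h.2⟩, h.2⟩⟩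
    rw [this, Finset.card_erase_of_mem ht.2, h.card t ht.1]
  · intro y hy
    rw [Finset.filter_filter]
    rw [Tri.mem_nbrs] at hy
    exact h.pair x y (Ne.symm hy.1) hy.2

theorem exists_third {t : Finset α} (h : t.card = 3) {x y : α} (hx : x ∈ t) (hy : y ∈ t)
    (hxy : x ≠ y) : ∃ z, z ≠ x ∧ z ≠ y ∧ t = {x, y, z} := by
  have h1 : ((t.erase x).erase y).card = 1 := by
    rw [Finset.card_erase_of_mem (Finset.mem_erase.2 ⟨hxy.symm, hy⟩),
      Finset.card_erase_of_mem hx, h]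
  obtain ⟨z, hz⟩ := Finset.card_eq_one.1 h1
  have hz' : z ∈ (t.erase x).erase y := hz ▸ Finset.mem_singleton_self z
  rw [Finset.mem_erase, Finset.mem_erase] at hz'
  refine ⟨z, hz'.2.1, hz'.1, ?_⟩
  rw [← hz, Finset.insert_erase (Finset.mem_erase.2 ⟨hxy.symm, hy⟩), Finset.insert_erase hx]

theorem exists_others {t : Finset α} (h : t.card = 3) {x : α} (hx : x ∈ t) :
    ∃ y z, y ≠ x ∧ z ≠ x ∧ y ≠ z ∧ t = {x, y, z} := by
  have h1 : (t.erase x).card = 2 := by rw [Finset.card_erase_of_mem hx, h]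
  obtain ⟨y, z, hyz, he⟩ := Finset.card_eq_two.1 h1
  have hy : y ∈ t.erase x := by rw [he]; simp
  have hz : z ∈ t.erase x := by rw [he]; simp
  refine ⟨y, z, (Finset.mem_erase.1 hy).1, (Finset.mem_erase.1 hz).1, hyz, ?_⟩
  rw [← he, Finset.insert_erase hx]

end Triangulation

/-! ### Edges of the polytope and the triangulation by normals -/

namespace SmoothModel

variable {n : ℕ} (M : SmoothModel n)

theorem dot_sub_int {v : Fin n → ℤ} (hv : v ∈ M.V) (u x : Fin n → ℤ) :
    u ⬝ᵥ x - u ⬝ᵥ v = ∑ a ∈ M.t v, (u ⬝ᵥ M.E v a) * (a ⬝ᵥ x - a ⬝ᵥ v) := by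
  rw [← dotProduct_sub, (M.dual v hv).dot_expand]
  simp only [dotProduct_sub]

theorem eq_of_dot_eq {v : Fin n → ℤ} (hv : v ∈ M.V) {x y : Fin n → ℤ}
    (h : ∀ a ∈ M.t v, a ⬝ᵥ x = a ⬝ᵥ y) : x = y := by
  rw [(M.dual v hv).expand x, (M.dual v hv).expand y]
  exact Finset.sum_congr rfl fun a ha => by rw [h a ha]

theorem eq_of_dual_eq {v : Fin n → ℤ} (hv : v ∈ M.V) {x y : Fin n → ℤ}
    (h : ∀ a ∈ M.t v, x ⬝ᵥ M.E v a = y ⬝ᵥ M.E v a) : x = y := by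
  rw [(M.dual v hv).expand_dual x, (M.dual v hv).expand_dual y]
  exact Finset.sum_congr rfl fun a ha => by rw [h a ha]

theorem t_inj {v w : Fin n → ℤ} (hv : v ∈ M.V) (hw : w ∈ M.V) (h : M.t v = M.t w) : v = w :=
  M.eq_of_dot_eq hv fun a ha => le_antisymm (M.le v hv a ha w hw) (M.le w hw a (h ▸ ha) v hv)

theorem E_nonneg {v : Fin n → ℤ} (hv : v ∈ M.V) {u : Fin n → ℤ}
    (hu : ∀ w ∈ M.V, u ⬝ᵥ v ≤ u ⬝ᵥ w) {a : Fin n → ℤ} (ha : a ∈ M.t v) :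
    0 ≤ u ⬝ᵥ M.E v a := by
  obtain ⟨k, hk, hw⟩ := M.nbr v hv a ha
  have h1 := hu _ hw
  rw [dotProduct_add, dotProduct_smul, smul_eq_mul] at h1
  exact nonneg_of_mul_nonneg_right (by linarith) hk

/-- A facet normal belongs to every vertex at which it is minimal. -/
theorem mem_t_of_dot_eq {v w a : Fin n → ℤ} (hv : v ∈ M.V) (ha : a ∈ M.t v) (hw : w ∈ M.V)
    (h : a ⬝ᵥ w = a ⬝ᵥ v) : a ∈ M.t w := by
  have hmin : ∀ x ∈ M.V, a ⬝ᵥ w ≤ a ⬝ᵥ x := fun x hx => h ▸ M.le v hv a ha x hx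
  have hnn : ∀ b ∈ M.t w, 0 ≤ a ⬝ᵥ M.E w b := fun b hb => M.E_nonneg hw hmin hb
  have hzero : ∀ x ∈ M.V, a ⬝ᵥ x = a ⬝ᵥ w → ∀ b ∈ M.t w, 0 < a ⬝ᵥ M.E w b →
      b ⬝ᵥ x = b ⬝ᵥ w := by
    intro x hx hax b hb hpos
    have h1 := M.dot_sub_int hw a x
    rw [hax, sub_self] at h1
    have h2 := (Finset.sum_eq_zero_iff_of_nonneg (fun c hc => mul_nonneg (hnn c hc)
      (sub_nonneg.2 (M.le w hw c hc x hx)))).1 h1.symm b hb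
    rcases mul_eq_zero.1 h2 with h0 | h0
    · omega
    · omega
  have haa : a ≠ 0 := by
    rintro rfl
    have := (M.dual v hv).dot_self ha
    simp at this
  -- A normal `b` at `w` on which `a` has a positive coordinate is constant on the vertices where
  -- `a` is minimal. So it vanishes on all the edges at `v` inside the facet `a`, is a multiple of
  -- `a`, and by integrality equals `a`.
  obtain ⟨b, hb, hbne⟩ : ∃ b ∈ M.t w, a ⬝ᵥ M.E w b ≠ 0 := by
    by_contra hcon
    push Not at hcon
    exact haa (M.eq_of_dual_eq hw fun b hb => by rw [hcon b hb, zero_dotProduct])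
  have hbpos : 0 < a ⬝ᵥ M.E w b := lt_of_le_of_ne (hnn b hb) hbne.symm
  have hb0 : ∀ c ∈ M.t v, c ≠ a → b ⬝ᵥ M.E v c = 0 := by
    intro c hc hca
    obtain ⟨k, hk, hx⟩ := M.nbr v hv c hc
    have hac : a ⬝ᵥ M.E v c = 0 := (M.dual v hv).dot_ne hc ha hca.symm
    have e1 := hzero _ hx (by rw [dotProduct_add, dotProduct_smul, hac, smul_zero, add_zero, h])
      b hb hbpos
    have e2 := hzero v hv h.symm b hb hbpos
    rw [dotProduct_add, dotProduct_smul, e2, smul_eq_mul] at e1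
    have : k * b ⬝ᵥ M.E v c = 0 := by linarith
    rcases mul_eq_zero.1 this with h0 | h0
    · omega
    · exact h0
  have hbeq : b = (b ⬝ᵥ M.E v a) • a := by
    refine M.eq_of_dual_eq hv fun c hc => ?_
    rw [smul_dotProduct]
    by_cases hca : c = a
    · rw [hca, (M.dual v hv).dot_self ha, smul_eq_mul, mul_one]
    · rw [hb0 c hc hca, (M.dual v hv).dot_ne hc ha (Ne.symm hca), smul_zero]
  have h3 := (M.dual w hw).dot_self hb
  rw [hbeq, smul_dotProduct, smul_eq_mul, ← hbeq] at h3
  have h4 : b ⬝ᵥ M.E v a = 1 := by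
    rcases Int.mul_eq_one_iff_eq_one_or_neg_one.1 h3 with h5 | h5
    · exact h5.1
    · omega
  rw [h4, one_smul] at hbeq
  exact hbeq ▸ hb

open Classical in
/-- The lattice length of the edge at `v` that leaves the facet `a`. -/
noncomputable def len (v a : Fin n → ℤ) : ℤ :=
  if h : v ∈ M.V ∧ a ∈ M.t v then (M.nbr v h.1 a h.2).choose else 1

/-- The other end of the edge at `v` that leaves the facet `a`. -/
noncomputable def nb (v a : Fin n → ℤ) : Fin n → ℤ := v + M.len v a • M.E v a

theorem len_pos {v a : Fin n → ℤ} (hv : v ∈ M.V) (ha : a ∈ M.t v) : 0 < M.len v a := by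
  unfold len; rw [dif_pos ⟨hv, ha⟩]; exact (M.nbr v hv a ha).choose_spec.1

theorem nb_mem {v a : Fin n → ℤ} (hv : v ∈ M.V) (ha : a ∈ M.t v) : M.nb v a ∈ M.V := by
  unfold nb len; rw [dif_pos ⟨hv, ha⟩]; exact (M.nbr v hv a ha).choose_spec.2

theorem dot_nb {v a : Fin n → ℤ} (u : Fin n → ℤ) :
    u ⬝ᵥ M.nb v a = u ⬝ᵥ v + M.len v a * (u ⬝ᵥ M.E v a) := by
  unfold nb; rw [dotProduct_add, dotProduct_smul, smul_eq_mul]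

theorem mem_t_nb {v a b : Fin n → ℤ} (hv : v ∈ M.V) (ha : a ∈ M.t v) (hb : b ∈ M.t v)
    (hba : b ≠ a) : b ∈ M.t (M.nb v a) := by
  refine M.mem_t_of_dot_eq hv hb (M.nb_mem hv ha) ?_
  rw [dot_nb, (M.dual v hv).dot_ne ha hb hba, mul_zero, add_zero]

theorem dot_nb_self {v a : Fin n → ℤ} (hv : v ∈ M.V) (ha : a ∈ M.t v) :
    a ⬝ᵥ M.nb v a = a ⬝ᵥ v + M.len v a := by
  rw [dot_nb, (M.dual v hv).dot_self ha, mul_one]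

theorem notMem_t_nb {v a : Fin n → ℤ} (hv : v ∈ M.V) (ha : a ∈ M.t v) : a ∉ M.t (M.nb v a) := by
  intro h
  have h1 := M.le _ (M.nb_mem hv ha) a h v hv
  rw [M.dot_nb_self hv ha] at h1
  have := M.len_pos hv ha
  omega

/-- Crossing an edge exchanges exactly one facet. -/
theorem exists_opp {v a : Fin n → ℤ} (hv : v ∈ M.V) (ha : a ∈ M.t v) :
    ∃ a', a' ∉ M.t v ∧ M.t (M.nb v a) = insert a' ((M.t v).erase a) ∧ a' ⬝ᵥ M.E v a = -1 ∧
      M.E (M.nb v a) a' = - M.E v a := by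
  set w := M.nb v a with hw
  have hwV : w ∈ M.V := M.nb_mem hv ha
  have hsub : (M.t v).erase a ⊆ M.t w := fun b hb =>
    M.mem_t_nb hv ha (Finset.mem_of_mem_erase hb) (Finset.ne_of_mem_erase hb)
  have hcard : (M.t w \ (M.t v).erase a).card = 1 := by
    rw [Finset.card_sdiff_of_subset hsub, Finset.card_erase_of_mem ha, (M.dual v hv).card,
      (M.dual w hwV).card]
    have : 0 < (M.t v).card := Finset.card_pos.2 ⟨a, ha⟩
    rw [(M.dual v hv).card] at this
    omega
  obtain ⟨a', ha'⟩ := Finset.card_eq_one.1 hcard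
  have ha'm : a' ∈ M.t w \ (M.t v).erase a := ha' ▸ Finset.mem_singleton_self a'
  rw [Finset.mem_sdiff] at ha'm
  have hne : a' ≠ a := by
    rintro rfl
    exact M.notMem_t_nb hv ha ha'm.1
  have ht : M.t w = insert a' ((M.t v).erase a) := by
    rw [Finset.insert_eq, ← ha', Finset.sdiff_union_of_subset hsub]
  -- The common normals vanish on both edge directions, which are therefore proportional over the
  -- integers. As each direction pairs to one with its own normal, the factor is a unit; minimality
  -- of `a'` at `w` makes it `-1`.
  have hE : M.E w a' = (a ⬝ᵥ M.E w a') • M.E v a := by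
    refine M.eq_of_dot_eq hv fun b hb => ?_
    rw [dotProduct_smul, smul_eq_mul]
    by_cases hba : b = a
    · rw [hba, (M.dual v hv).dot_self ha, mul_one]
    · have hb' : b ∈ (M.t v).erase a := Finset.mem_erase.2 ⟨hba, hb⟩
      rw [(M.dual v hv).dot_ne ha hb hba, (M.dual w hwV).dot_ne ha'm.1 (hsub hb')
        (fun e => ha'm.2 (e ▸ hb')), mul_zero]
  have h1 := (M.dual w hwV).dot_self ha'm.1
  rw [hE, dotProduct_smul, smul_eq_mul] at h1
  have h2 := M.le w hwV a' ha'm.1 v hv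
  rw [hw, dot_nb] at h2
  have h3 := M.len_pos hv ha
  have h4 : a' ⬝ᵥ M.E v a ≤ 0 := by nlinarith
  rcases Int.mul_eq_one_iff_eq_one_or_neg_one.1 h1 with h5 | h5
  · omega
  · refine ⟨a', fun h => ha'm.2 (Finset.mem_erase.2 ⟨hne, h⟩), ht, h5.2, ?_⟩
    rw [hE, h5.1, neg_one_smul]

/-- The conditions put `w` on the line through the edge, between its ends. At a point strictly
between them every normal of `w` would be minimal at both ends as well, hence would vanish on the
edge direction, although these normals form a basis. -/
theorem eq_or_eq_nb {v a w : Fin n → ℤ} (hv : v ∈ M.V) (ha : a ∈ M.t v) (hw : w ∈ M.V)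
    (h : (M.t v).erase a ⊆ M.t w) : w = v ∨ w = M.nb v a := by
  obtain ⟨a', -, ht, ha'E, -⟩ := M.exists_opp hv ha
  have hc : w = v + (a ⬝ᵥ w - a ⬝ᵥ v) • M.E v a := by
    refine M.eq_of_dot_eq hv fun b hb => ?_
    rw [dotProduct_add, dotProduct_smul, smul_eq_mul]
    by_cases hba : b = a
    · rw [hba, (M.dual v hv).dot_self ha]; ring
    · rw [(M.dual v hv).dot_ne ha hb hba, mul_zero, add_zero]
      exact le_antisymm (M.le w hw b (h (Finset.mem_erase.2 ⟨hba, hb⟩)) v hv)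
        (M.le v hv b hb w hw)
  set c := a ⬝ᵥ w - a ⬝ᵥ v with hcdef
  have hc0 : 0 ≤ c := by have := M.le v hv a ha w hw; omega
  have hcl : c ≤ M.len v a := by
    have h1 := M.le _ (M.nb_mem hv ha) a' (ht ▸ Finset.mem_insert_self _ _) w hw
    rw [dot_nb, hc, dotProduct_add, dotProduct_smul, ha'E, smul_eq_mul] at h1
    omega
  rcases hc0.eq_or_lt with h0 | h0
  · left; rw [hc, ← h0, zero_smul, add_zero]
  rcases hcl.eq_or_lt with h1 | h1
  · right; rw [hc, h1]; rfl
  exfalso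
  have hall : ∀ b ∈ M.t w, b ⬝ᵥ M.E v a = 0 := by
    intro b hb
    have h2 := M.le w hw b hb v hv
    have h3 := M.le w hw b hb _ (M.nb_mem hv ha)
    rw [dot_nb] at h3
    rw [hc, dotProduct_add, dotProduct_smul, smul_eq_mul] at h2 h3
    nlinarith
  have h4 : M.E v a = 0 := M.eq_of_dot_eq hw fun b hb => by rw [hall b hb, dotProduct_zero]
  have h5 := (M.dual v hv).dot_self ha
  rw [h4, dotProduct_zero] at h5
  exact zero_ne_one h5

/-- The triangles of the normal fan. -/
def T (M : SmoothModel n) : Finset (Finset (Fin n → ℤ)) := M.V.image M.t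

theorem mem_T {s : Finset (Fin n → ℤ)} : s ∈ M.T ↔ ∃ v ∈ M.V, M.t v = s := Finset.mem_image

theorem t_mem_T {v : Fin n → ℤ} (hv : v ∈ M.V) : M.t v ∈ M.T := Finset.mem_image_of_mem _ hv

theorem card_T : M.T.card = M.V.card :=
  Finset.card_image_of_injOn fun _ hv _ hw h => M.t_inj hv hw h

end SmoothModel

namespace SmoothModel

variable (M : SmoothModel 3)

/-- The triangles that contain `x` and `y` correspond to the two ends of the edge in which the
facets `x` and `y` meet. -/
theorem isTri : IsTri M.T := by
  refine ⟨?_, ?_⟩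
  · intro t ht
    obtain ⟨v, hv, rfl⟩ := M.mem_T.1 ht
    exact (M.dual v hv).card
  · rintro x y hxy ⟨t, ht, hx, hy⟩
    obtain ⟨v, hv, rfl⟩ := M.mem_T.1 ht
    obtain ⟨z, hzx, hzy, hz⟩ := exists_third (M.dual v hv).card hx hy hxy
    have hzt : z ∈ M.t v := by rw [hz]; simp
    have hne : M.t v ≠ M.t (M.nb v z) := fun h => M.notMem_t_nb hv hzt (h ▸ hzt)
    have : M.T.filter (fun t => x ∈ t ∧ y ∈ t) = {M.t v, M.t (M.nb v z)} := by
      ext s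
      rw [Finset.mem_filter, Finset.mem_insert, Finset.mem_singleton]
      constructor
      · rintro ⟨hs, hxs, hys⟩
        obtain ⟨w, hw, rfl⟩ := M.mem_T.1 hs
        rcases M.eq_or_eq_nb hv hzt hw (by
          intro b hb
          rw [Finset.mem_erase, hz] at hb
          simp only [Finset.mem_insert, Finset.mem_singleton] at hb
          rcases hb with ⟨h0, rfl | rfl | rfl⟩
          · exact hxs
          · exact hys
          · exact absurd rfl h0) with rfl | rfl
        · left; rfl
        · right; rfl
      · rintro (rfl | rfl)
        · exact ⟨ht, hx, hy⟩
        · exact ⟨M.t_mem_T (M.nb_mem hv hzt), M.mem_t_nb hv hzt hx hzx.symm,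
            M.mem_t_nb hv hzt hy hzy.symm⟩
    rw [this, Finset.card_pair hne]

end SmoothModel

/-! ### The label read off from the triangulation -/

section Label

variable {P : Set (Fin 3 → ℝ)} {T : Finset (Finset (Fin 3 → ℤ))}

/-- The two-dimensional cones over the ray of `r` are spanned by `r` and one neighbour, and
neighbours are as numerous as triangles at `r`. -/
theorem IsFanModel.rayDegree_eq (hT : IsFanModel (normalFan P) T) (h3 : IsTri T)
    {r : Fin 3 → ℤ} (hr : r ∈ Tri.verts T) :
    rayDegree (normalFan P) (coneOver {r}) = Tri.deg T r := by
  obtain ⟨t0, ht0, hrt0⟩ := Tri.mem_verts.1 hr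
  have hr0 : ({r} : Finset (Fin 3 → ℤ)) ⊆ t0 := Finset.singleton_subset_iff.2 hrt0
  have hset : {τ ∈ normalFan P | coneDim τ = 2 ∧ coneOver {r} ⊆ τ} =
      (fun s => coneOver {r, s}) '' (Tri.nbrs T r : Set (Fin 3 → ℤ)) := by
    ext τ
    constructor
    · rintro ⟨hτ, hdim, hsub⟩
      rw [hT.eq] at hτ
      obtain ⟨t, ht, A, hA, rfl⟩ := hτ
      obtain ⟨E, hE⟩ := hT.uni t ht
      rw [hE.coneDim_coneOver hA] at hdim
      rw [hT.subset_iff ht0 hr0 ht hA, Finset.singleton_subset_iff] at hsub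
      have h1 : (A.erase r).card = 1 := by rw [Finset.card_erase_of_mem hsub, hdim]
      obtain ⟨s, hs⟩ := Finset.card_eq_one.1 h1
      have hsA : s ∈ A.erase r := hs ▸ Finset.mem_singleton_self s
      refine ⟨s, Finset.mem_coe.2 (Tri.mem_nbrs.2 ⟨Finset.ne_of_mem_erase hsA, t, ht, hA hsub,
        hA (Finset.mem_of_mem_erase hsA)⟩), ?_⟩
      dsimp only
      rw [← hs, Finset.insert_erase hsub]
    · rintro ⟨s, hs, rfl⟩
      obtain ⟨hsr, t, ht, hrt, hst⟩ := Tri.mem_nbrs.1 (Finset.mem_coe.1 hs)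
      have hA : ({r, s} : Finset (Fin 3 → ℤ)) ⊆ t := by
        intro x hx
        rw [Finset.mem_insert, Finset.mem_singleton] at hx
        rcases hx with rfl | rfl <;> assumption
      obtain ⟨E, hE⟩ := hT.uni t ht
      refine ⟨by rw [hT.eq]; exact ⟨t, ht, _, hA, rfl⟩, ?_, ?_⟩
      · rw [hE.coneDim_coneOver hA, Finset.card_pair hsr.symm]
      · rw [hT.subset_iff ht0 hr0 ht hA]; simp
  unfold rayDegree
  rw [hset, Set.InjOn.ncard_image, Set.ncard_coe_finset, h3.card_nbrs]
  intro s hs s' hs' heq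
  obtain ⟨hsr, t, ht, hrt, hst⟩ := Tri.mem_nbrs.1 (Finset.mem_coe.1 hs)
  obtain ⟨hsr', t', ht', hrt', hst'⟩ := Tri.mem_nbrs.1 (Finset.mem_coe.1 hs')
  have h1 := (hT.coneOver_inj (A := {r, s}) (A' := {r, s'}) ht (by
      intro x hx
      rw [Finset.mem_insert, Finset.mem_singleton] at hx
      rcases hx with rfl | rfl <;> assumption) ht' (by
      intro x hx
      rw [Finset.mem_insert, Finset.mem_singleton] at hx
      rcases hx with rfl | rfl <;> assumption)).1 heq
  have h2 : s ∈ ({r, s'} : Finset (Fin 3 → ℤ)) := h1 ▸ (by simp)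
  rw [Finset.mem_insert, Finset.mem_singleton] at h2
  exact h2.resolve_left hsr

theorem IsFanModel.ncard_rays (hT : IsFanModel (normalFan P) T) (h3 : IsTri T) (m : ℕ) :
    {ρ ∈ rays (normalFan P) | rayDegree (normalFan P) ρ = m}.ncard =
      ((Tri.verts T).filter fun r => Tri.deg T r = m).card := by
  have hset : {ρ ∈ rays (normalFan P) | rayDegree (normalFan P) ρ = m} =
      (fun r => coneOver {r}) '' ((Tri.verts T).filter fun r => Tri.deg T r = m :
        Set (Fin 3 → ℤ)) := by
    ext ρ
    constructor
    · rintro ⟨⟨hρ, hdim⟩, hdeg⟩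
      rw [hT.eq] at hρ
      obtain ⟨t, ht, A, hA, rfl⟩ := hρ
      obtain ⟨E, hE⟩ := hT.uni t ht
      rw [hE.coneDim_coneOver hA] at hdim
      obtain ⟨r, rfl⟩ := Finset.card_eq_one.1 hdim
      have hr : r ∈ Tri.verts T := Tri.mem_verts.2 ⟨t, ht, hA (Finset.mem_singleton_self r)⟩
      rw [hT.rayDegree_eq h3 hr] at hdeg
      exact ⟨r, Finset.mem_coe.2 (Finset.mem_filter.2 ⟨hr, hdeg⟩), rfl⟩
    · rintro ⟨r, hr, rfl⟩
      obtain ⟨hr, hdeg⟩ := Finset.mem_filter.1 (Finset.mem_coe.1 hr)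
      obtain ⟨t, ht, hrt⟩ := Tri.mem_verts.1 hr
      obtain ⟨E, hE⟩ := hT.uni t ht
      have hA : ({r} : Finset (Fin 3 → ℤ)) ⊆ t := Finset.singleton_subset_iff.2 hrt
      refine ⟨⟨by rw [hT.eq]; exact ⟨t, ht, _, hA, rfl⟩, ?_⟩, ?_⟩
      · rw [hE.coneDim_coneOver hA, Finset.card_singleton]
      · rw [hT.rayDegree_eq h3 hr, hdeg]
  rw [hset, Set.InjOn.ncard_image, Set.ncard_coe_finset]
  intro s hs s' hs' heq
  obtain ⟨t, ht, hst⟩ := Tri.mem_verts.1 (Finset.mem_filter.1 (Finset.mem_coe.1 hs)).1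
  obtain ⟨t', ht', hst'⟩ := Tri.mem_verts.1 (Finset.mem_filter.1 (Finset.mem_coe.1 hs')).1
  exact Finset.singleton_injective ((hT.coneOver_inj ht (Finset.singleton_subset_iff.2 hst) ht'
    (Finset.singleton_subset_iff.2 hst')).1 heq)

theorem IsFanModel.hasLabel_iff (hT : IsFanModel (normalFan P) T) (h3 : IsTri T)
    (L : Multiset ℕ) : HasLabel P L ↔ ∀ m, 0 < m →
      ((Tri.verts T).filter fun r => Tri.deg T r = m).card = L.count m := by
  unfold HasLabel
  simp only [hT.ncard_rays h3]

end Label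


/-! ### Stellar subdivision of triangulations -/

section StarSub

variable {α : Type*} [DecidableEq α]

/-- The combinatorial stellar subdivision at the face `S` with the new vertex `p`. -/
def Tri.starSub (T : Finset (Finset α)) (S : Finset α) (p : α) : Finset (Finset α) :=
  (T.filter fun t => ¬ S ⊆ t) ∪
    (T.filter fun t => S ⊆ t).biUnion fun t => S.image fun a => insert p (t.erase a)

theorem Tri.mem_starSub {T : Finset (Finset α)} {S : Finset α} {p : α} {s : Finset α} :
    s ∈ Tri.starSub T S p ↔ (s ∈ T ∧ ¬ S ⊆ s) ∨
      ∃ t ∈ T, S ⊆ t ∧ ∃ a ∈ S, s = insert p (t.erase a) := by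
  simp only [Tri.starSub, Finset.mem_union, Finset.mem_filter, Finset.mem_biUnion,
    Finset.mem_image, and_assoc, eq_comm]

variable {T : Finset (Finset α)} {S : Finset α} {p : α}

/-- The union is disjoint: new triangles contain `p`, old ones do not, and a new triangle determines
`t` and `a`. All later counts of degrees and edges are instances of this formula. -/
theorem Tri.card_filter_starSub (hp : p ∉ Tri.verts T) (q : Finset α → Prop) [DecidablePred q] :
    ((Tri.starSub T S p).filter q).card = (T.filter fun t => ¬ S ⊆ t ∧ q t).card +
      ∑ t ∈ T.filter (fun t => S ⊆ t), (S.filter fun a => q (insert p (t.erase a))).card := by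
  have hpt : ∀ t ∈ T, p ∉ t := fun t ht h => hp (Tri.mem_verts.2 ⟨t, ht, h⟩)
  have hera : ∀ t ∈ T, ∀ a, (insert p (t.erase a)).erase p = t.erase a := fun t ht a =>
    Finset.erase_insert fun h => hpt t ht (Finset.mem_of_mem_erase h)
  unfold Tri.starSub
  rw [Finset.filter_union, Finset.card_union_of_disjoint, Finset.filter_filter,
    Finset.filter_biUnion, Finset.card_biUnion]
  · congr 1
    refine Finset.sum_congr rfl fun t ht => ?_
    rw [Finset.mem_filter] at ht
    rw [Finset.filter_image, Finset.card_image_of_injOn]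
    intro a ha b hb hab
    have ha' := ht.2 (Finset.mem_filter.1 (Finset.mem_coe.1 ha)).1
    by_contra hne
    have h1 : t.erase a = t.erase b := by
      rw [← hera t ht.1 a, ← hera t ht.1 b]
      exact congrArg (fun s => Finset.erase s p) hab
    exact Finset.notMem_erase a t (h1 ▸ Finset.mem_erase.2 ⟨hne, ha'⟩)
  · intro t ht t' ht' hne
    rw [Finset.mem_coe, Finset.mem_filter] at ht ht'
    rw [Function.onFun, Finset.disjoint_left]
    intro s hs hs'
    obtain ⟨a, ha, rfl⟩ := Finset.mem_image.1 (Finset.mem_filter.1 hs).1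
    obtain ⟨b, hb, hab⟩ := Finset.mem_image.1 (Finset.mem_filter.1 hs').1
    have h1 : t'.erase b = t.erase a := by
      rw [← hera t ht.1 a, ← hera t' ht'.1 b, hab]
    have hba : a = b := by
      by_contra hne
      exact Finset.notMem_erase a t (h1 ▸ Finset.mem_erase.2 ⟨hne, ht'.2 ha⟩)
    subst hba
    exact hne (by rw [← Finset.insert_erase (ht.2 ha), ← h1, Finset.insert_erase (ht'.2 ha)])
  · rw [Finset.disjoint_left]
    intro s hs hs'
    obtain ⟨t, ht, hst⟩ := Finset.mem_biUnion.1 (Finset.mem_filter.1 hs').1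
    obtain ⟨a, ha, rfl⟩ := Finset.mem_image.1 hst
    exact hpt _ (Finset.mem_filter.1 (Finset.mem_filter.1 hs).1).1 (Finset.mem_insert_self _ _)

/-- The number of triangles containing `S`, which is an edge or a triangle. -/
theorem IsTri.card_star (h : IsTri T) {t0 : Finset α} (ht0 : t0 ∈ T) (hS : S ⊆ t0)
    (h2 : 2 ≤ S.card) : (S.card = 3 ∧ (T.filter fun t => S ⊆ t).card = 1) ∨
      (S.card = 2 ∧ (T.filter fun t => S ⊆ t).card = 2) := by
  have h3 : S.card ≤ 3 := h.card t0 ht0 ▸ Finset.card_le_card hS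
  rcases (by omega : S.card = 3 ∨ S.card = 2) with hc | hc
  · left
    refine ⟨hc, Finset.card_eq_one.2 ⟨t0, ?_⟩⟩
    have e0 : S = t0 := Finset.eq_of_subset_of_card_le hS (by rw [hc, h.card t0 ht0])
    ext t
    rw [Finset.mem_filter, Finset.mem_singleton]
    constructor
    · rintro ⟨ht, hst⟩
      rw [← e0]
      exact (Finset.eq_of_subset_of_card_le hst (by rw [hc, h.card t ht])).symm
    · rintro rfl; exact ⟨ht0, hS⟩
  · right
    refine ⟨hc, ?_⟩
    obtain ⟨x, y, hxy, rfl⟩ := Finset.card_eq_two.1 hc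
    rw [← h.pair x y hxy ⟨t0, ht0, hS (by simp), hS (by simp)⟩]
    congr 1
    ext t
    simp [Finset.insert_subset_iff]

theorem Tri.deg_starSub_new (hp : p ∉ Tri.verts T) :
    Tri.deg (Tri.starSub T S p) p = (T.filter fun t => S ⊆ t).card * S.card := by
  unfold Tri.deg
  rw [Tri.card_filter_starSub hp, Finset.sum_congr rfl (g := fun _ => S.card), Finset.sum_const,
    smul_eq_mul, Finset.card_eq_zero.2, zero_add]
  · rw [Finset.filter_eq_empty_iff]
    rintro t ht ⟨-, h⟩
    exact hp (Tri.mem_verts.2 ⟨t, ht, h⟩)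
  · intro t _
    rw [Finset.filter_true_of_mem]
    intro a _; exact Finset.mem_insert_self _ _

theorem Tri.deg_eq_add (x : α) : Tri.deg T x = (T.filter fun t => ¬ S ⊆ t ∧ x ∈ t).card +
    (T.filter fun t => S ⊆ t ∧ x ∈ t).card := by
  unfold Tri.deg
  rw [← Finset.card_filter_add_card_filter_not (s := T.filter fun t => x ∈ t)
    (fun t => ¬ S ⊆ t), Finset.filter_filter, Finset.filter_filter]
  congr 2
  · ext t; simp only [Finset.mem_filter]; tauto
  · ext t; simp only [Finset.mem_filter, not_not]; tauto

/-- Each triangle of the star is replaced by the `S.card - 1` new ones that keep `x`. The identity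
is stated with sums on both sides because natural subtraction truncates. -/
theorem Tri.deg_starSub_mem (hp : p ∉ Tri.verts T) {x : α} (hx : x ∈ S) (hxp : x ≠ p) :
    Tri.deg (Tri.starSub T S p) x + (T.filter fun t => S ⊆ t).card =
      Tri.deg T x + (T.filter fun t => S ⊆ t).card * (S.card - 1) := by
  rw [Tri.deg_eq_add (S := S) (T := T)]
  have h0 : (T.filter fun t => S ⊆ t ∧ x ∈ t) = T.filter fun t => S ⊆ t :=
    Finset.filter_congr fun t _ => ⟨fun h => h.1, fun h => ⟨h, h hx⟩⟩
  rw [h0]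
  conv_lhs => unfold Tri.deg
  rw [Tri.card_filter_starSub hp, Finset.sum_congr rfl (g := fun _ => S.card - 1),
    Finset.sum_const, smul_eq_mul]
  · ring
  · intro t ht
    have : (S.filter fun a => x ∈ insert p (t.erase a)) = S.erase x := by
      ext a
      simp only [Finset.mem_filter, Finset.mem_insert, hxp, false_or, Finset.mem_erase]
      constructor
      · rintro ⟨h1, h2, -⟩; exact ⟨Ne.symm h2, h1⟩
      · rintro ⟨h1, h2⟩; exact ⟨h2, Ne.symm h1, (Finset.mem_filter.1 ht).2 hx⟩
    rw [this, Finset.card_erase_of_mem hx]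

/-- All `S.card` new triangles that replace a triangle of the star keep a vertex `x` opposite to
`S`. -/
theorem Tri.deg_starSub_notMem (hp : p ∉ Tri.verts T) {x : α} (hx : x ∉ S) (hxp : x ≠ p) :
    Tri.deg (Tri.starSub T S p) x + (T.filter fun t => S ⊆ t ∧ x ∈ t).card =
      Tri.deg T x + (T.filter fun t => S ⊆ t ∧ x ∈ t).card * S.card := by
  rw [Tri.deg_eq_add (S := S) (T := T)]
  conv_lhs => unfold Tri.deg
  rw [Tri.card_filter_starSub hp, Finset.sum_congr rfl
    (g := fun t => if x ∈ t then S.card else 0), ← Finset.sum_filter, Finset.filter_filter,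
    Finset.sum_const, smul_eq_mul]
  · ring
  · intro t _
    split_ifs with h
    · rw [Finset.filter_true_of_mem]
      intro a ha
      refine Finset.mem_insert_of_mem (Finset.mem_erase.2 ⟨?_, h⟩)
      rintro rfl; exact hx ha
    · rw [Finset.card_eq_zero, Finset.filter_eq_empty_iff]
      intro a _ h'
      rcases Finset.mem_insert.1 h' with h1 | h1
      · exact hxp h1
      · exact h (Finset.mem_of_mem_erase h1)

theorem Tri.verts_starSub (h2 : 2 ≤ S.card) {t0 : Finset α} (ht0 : t0 ∈ T) (hS : S ⊆ t0) :
    Tri.verts (Tri.starSub T S p) = insert p (Tri.verts T) := by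
  ext x
  simp only [Tri.mem_verts, Finset.mem_insert, Tri.mem_starSub]
  constructor
  · rintro ⟨t, ⟨ht, -⟩ | ⟨t', ht', -, a, -, rfl⟩, hx⟩
    · exact Or.inr ⟨t, ht, hx⟩
    · rcases Finset.mem_insert.1 hx with rfl | hx
      · exact Or.inl rfl
      · exact Or.inr ⟨t', ht', Finset.mem_of_mem_erase hx⟩
  · intro hx
    have hne : ∀ y : α, ∃ a ∈ S, y ≠ a := by
      intro y
      by_contra hcon
      push Not at hcon
      have : S ⊆ {y} := fun a ha => Finset.mem_singleton.2 (hcon a ha).symm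
      have := Finset.card_le_card this
      rw [Finset.card_singleton] at this
      omega
    rcases hx with rfl | ⟨t, ht, hx⟩
    · obtain ⟨a, ha, -⟩ := hne x
      exact ⟨_, Or.inr ⟨t0, ht0, hS, a, ha, rfl⟩, Finset.mem_insert_self _ _⟩
    · by_cases hSt : S ⊆ t
      · obtain ⟨a, ha, hxa⟩ := hne x
        exact ⟨_, Or.inr ⟨t, ht, hSt, a, ha, rfl⟩,
          Finset.mem_insert_of_mem (Finset.mem_erase.2 ⟨hxa, hx⟩)⟩
      · exact ⟨t, Or.inl ⟨ht, hSt⟩, hx⟩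

theorem IsTri.starSub (h : IsTri T) (hp : p ∉ Tri.verts T) {t0 : Finset α} (ht0 : t0 ∈ T)
    (hS : S ⊆ t0) (h2 : 2 ≤ S.card) : IsTri (Tri.starSub T S p) := by
  have hpt : ∀ t ∈ T, p ∉ t := fun t ht h => hp (Tri.mem_verts.2 ⟨t, ht, h⟩)
  have hpS : p ∉ S := fun h => hpt t0 ht0 (hS h)
  have hstar := h.card_star ht0 hS h2
  refine ⟨?_, ?_⟩
  · intro s hs
    rcases Tri.mem_starSub.1 hs with ⟨hs, -⟩ | ⟨t, ht, hSt, a, ha, rfl⟩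
    · exact h.card s hs
    · rw [Finset.card_insert_of_notMem fun h' => hpt t ht (Finset.mem_of_mem_erase h'),
        Finset.card_erase_of_mem (hSt ha), h.card t ht]
  -- Edges at the new vertex. If `y` is in `S`, each triangle of the star contributes `S.card - 1`
  -- triangles, which makes `1 * 2` or `2 * 1`. Otherwise `S` is an edge, and `y` lies in only one
  -- triangle of its star, whose two halves contain `y`.
  · have newpair : ∀ y, y ≠ p → (∃ s ∈ Tri.starSub T S p, p ∈ s ∧ y ∈ s) →
        ((Tri.starSub T S p).filter fun s => p ∈ s ∧ y ∈ s).card = 2 := by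
      rintro y hyp ⟨s, hs, hps, hys⟩
      rw [Tri.card_filter_starSub hp, Finset.card_eq_zero.2, zero_add]
      swap
      · rw [Finset.filter_eq_empty_iff]
        rintro t ht ⟨-, h', -⟩
        exact hpt t ht h'
      by_cases hyS : y ∈ S
      · rw [Finset.sum_congr rfl (g := fun _ => S.card - 1), Finset.sum_const, smul_eq_mul]
        · rcases hstar with ⟨e1, e2⟩ | ⟨e1, e2⟩ <;> rw [e1, e2]
        · intro t ht
          have : (S.filter fun a => p ∈ insert p (t.erase a) ∧ y ∈ insert p (t.erase a)) =
              S.erase y := by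
            ext a
            simp only [Finset.mem_filter, Finset.mem_insert, hyp, false_or, Finset.mem_erase,
              true_or, true_and]
            constructor
            · rintro ⟨h1, h2, -⟩; exact ⟨Ne.symm h2, h1⟩
            · rintro ⟨h1, h2⟩; exact ⟨h2, Ne.symm h1, (Finset.mem_filter.1 ht).2 hyS⟩
          rw [this, Finset.card_erase_of_mem hyS]
      · rcases Tri.mem_starSub.1 hs with ⟨hs, -⟩ | ⟨t, ht, hSt, a, ha, rfl⟩
        · exact absurd hps (hpt s hs)
        have hyt : y ∈ t := by
          rcases Finset.mem_insert.1 hys with h' | h'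
          · exact absurd h' hyp
          · exact Finset.mem_of_mem_erase h'
        have hins : ∀ t' ∈ T, S ⊆ t' → y ∈ t' → t' = insert y S := by
          intro t' ht' hSt' hyt'
          refine (Finset.eq_of_subset_of_card_le (Finset.insert_subset hyt' hSt') ?_).symm
          rw [h.card t' ht', Finset.card_insert_of_notMem hyS]; omega
        have hc2 : S.card = 2 := by
          have := h.card t ht
          rw [hins t ht hSt hyt, Finset.card_insert_of_notMem hyS] at this
          omega
        rw [Finset.sum_eq_single t]
        · rw [Finset.filter_true_of_mem, hc2]
          intro b hb
          refine ⟨Finset.mem_insert_self _ _, Finset.mem_insert_of_mem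
            (Finset.mem_erase.2 ⟨?_, hyt⟩)⟩
          rintro rfl; exact hyS hb
        · intro t' ht' hne
          rw [Finset.mem_filter] at ht'
          rw [Finset.card_eq_zero, Finset.filter_eq_empty_iff]
          rintro b _ ⟨-, hy'⟩
          rcases Finset.mem_insert.1 hy' with h' | h'
          · exact hyp h'
          · exact hne (by rw [hins t ht hSt hyt,
              hins t' ht'.1 ht'.2 (Finset.mem_of_mem_erase h')])
        · intro h'; exact absurd (Finset.mem_filter.2 ⟨ht, hSt⟩) h'
    intro x y hxy hex
    by_cases hxp : x = p
    · subst hxp; exact newpair y (Ne.symm hxy) hex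
    by_cases hyp : y = p
    · subst hyp
      rw [← newpair x hxp (by obtain ⟨s, hs, h1, h2⟩ := hex; exact ⟨s, hs, h2, h1⟩)]
      congr 1
      exact Finset.filter_congr fun s _ => and_comm
    obtain ⟨s, hs, hxs, hys⟩ := hex
    -- No triangle of the subdivision contains all of `S`, so an edge that survives is not `S`.
    have hnot : ¬ S ⊆ {x, y} := by
      intro hsub
      rcases Tri.mem_starSub.1 hs with ⟨hs, hn⟩ | ⟨t, ht, hSt, a, ha, rfl⟩
      · exact hn fun b hb => by
          have := hsub hb
          rw [Finset.mem_insert, Finset.mem_singleton] at this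
          rcases this with rfl | rfl <;> assumption
      · have := hsub ha
        rw [Finset.mem_insert, Finset.mem_singleton] at this
        rcases this with rfl | rfl
        · rcases Finset.mem_insert.1 hxs with h' | h'
          · exact hxp h'
          · exact Finset.notMem_erase _ _ h'
        · rcases Finset.mem_insert.1 hys with h' | h'
          · exact hyp h'
          · exact Finset.notMem_erase _ _ h'
    have hexT : ∃ t ∈ T, x ∈ t ∧ y ∈ t := by
      rcases Tri.mem_starSub.1 hs with ⟨hs, hn⟩ | ⟨t, ht, hSt, a, ha, rfl⟩
      · exact ⟨s, hs, hxs, hys⟩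
      · refine ⟨t, ht, ?_, ?_⟩
        · exact Finset.mem_of_mem_erase ((Finset.mem_insert.1 hxs).resolve_left hxp)
        · exact Finset.mem_of_mem_erase ((Finset.mem_insert.1 hys).resolve_left hyp)
    rw [Tri.card_filter_starSub hp, ← h.pair x y hxy hexT,
      ← Finset.card_filter_add_card_filter_not (s := T.filter fun t => x ∈ t ∧ y ∈ t)
        (fun t => ¬ S ⊆ t), Finset.filter_filter, Finset.filter_filter]
    congr 1
    · congr 1; ext t; simp only [Finset.mem_filter]; tauto
    · rw [Finset.sum_congr rfl (g := fun t => if x ∈ t ∧ y ∈ t then 1 else 0), ← Finset.sum_filter,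
        Finset.filter_filter, Finset.sum_const, smul_eq_mul, mul_one]
      · congr 1; ext t; simp only [Finset.mem_filter, not_not]; tauto
      · intro t ht
        rw [Finset.mem_filter] at ht
        -- A triangle of the star that contains the old edge `x y` must be replaced by exactly one
        -- triangle containing it, namely the one that drops the single member of `S` off the edge.
        have : (S.filter fun a => x ∈ insert p (t.erase a) ∧ y ∈ insert p (t.erase a)) =
            if x ∈ t ∧ y ∈ t then S \ {x, y} else ∅ := by
          ext a
          simp only [Finset.mem_filter, Finset.mem_insert, hxp, hyp, false_or, Finset.mem_erase]
          split_ifs with h'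
          · simp only [Finset.mem_sdiff, Finset.mem_insert, Finset.mem_singleton, h', and_true,
              not_or, ne_eq]
            constructor
            · rintro ⟨h1, h2, h3⟩; exact ⟨h1, Ne.symm h2, Ne.symm h3⟩
            · rintro ⟨h1, h2, h3⟩; exact ⟨h1, Ne.symm h2, Ne.symm h3⟩
          · simp only [Finset.notMem_empty, iff_false]
            rintro ⟨-, ⟨-, h1⟩, -, h2⟩; exact h' ⟨h1, h2⟩
        rw [this]
        split_ifs with h'
        · apply le_antisymm
          · have h4 : S \ {x, y} ⊆ t \ {x, y} := Finset.sdiff_subset_sdiff ht.2 subset_rfl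
            have h5 : (t \ {x, y}).card = 1 := by
              rw [Finset.card_sdiff_of_subset (by
                intro b hb
                rw [Finset.mem_insert, Finset.mem_singleton] at hb
                rcases hb with rfl | rfl
                · exact h'.1
                · exact h'.2), h.card t ht.1, Finset.card_pair hxy]
            exact h5 ▸ Finset.card_le_card h4
          · rw [Nat.one_le_iff_ne_zero, Ne, Finset.card_eq_zero, Finset.sdiff_eq_empty_iff_subset]
            exact hnot
        · exact Finset.card_empty

theorem IsTri.card_starSub (h : IsTri T) (hp : p ∉ Tri.verts T) {t0 : Finset α} (ht0 : t0 ∈ T)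
    (hS : S ⊆ t0) (h2 : 2 ≤ S.card) : (Tri.starSub T S p).card = T.card + 2 := by
  have h1 := Tri.card_filter_starSub (S := S) hp (fun _ => True)
  simp only [Finset.filter_true, and_true, Finset.sum_const, smul_eq_mul] at h1
  have h3 := Finset.card_filter_add_card_filter_not (s := T) (fun t => S ⊆ t)
  rcases h.card_star ht0 hS h2 with ⟨e1, e2⟩ | ⟨e1, e2⟩ <;> rw [e1, e2] at h1 <;> omega

end StarSub


/-! ### Blow-ups act on the triangulation as stellar subdivisions -/

section Stellar

variable {n : ℕ} {P : Set (Fin n → ℝ)} {T : Finset (Finset (Fin n → ℤ))}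

theorem joinRay_coneOver {p : Fin n → ℤ} {A : Finset (Fin n → ℤ)} (hp : p ∉ A) :
    joinRay (latticePt p) (coneOver A) = coneOver (insert p A) := by
  ext u
  constructor
  · rintro ⟨c, hc, v, ⟨d, hd, rfl⟩, rfl⟩
    refine ⟨fun b => if b = p then c else d b, ?_, ?_⟩
    · intro a ha
      dsimp only
      split_ifs with h
      · exact hc
      · exact hd a ((Finset.mem_insert.1 ha).resolve_left h)
    · rw [Finset.sum_insert hp]
      dsimp only
      rw [if_pos rfl]
      congr 1
      refine Finset.sum_congr rfl fun a ha => ?_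
      rw [if_neg]
      rintro rfl; exact hp ha
  · rintro ⟨d, hd, rfl⟩
    refine ⟨d p, hd p (Finset.mem_insert_self _ _), _,
      ⟨d, fun a ha => hd a (Finset.mem_insert_of_mem ha), rfl⟩, Finset.sum_insert hp⟩

/-- Exchanging `a` for the sum `p` of `S` is unimodular. As `p` pairs to one with every `E b`, `b ∈
S`, the direction `E a` goes to `p`, and the other members of `S` are corrected by subtracting it.
-/
theorem IsDual.starSub {t S : Finset (Fin n → ℤ)} {E : (Fin n → ℤ) → Fin n → ℤ}
    (h : IsDual t E) (hS : S ⊆ t) {a : Fin n → ℤ} (ha : a ∈ S) (hp : ∑ b ∈ S, b ∉ t) :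
    IsDual (insert (∑ b ∈ S, b) (t.erase a))
      (fun b => if b = ∑ b ∈ S, b then E a else if b ∈ S then E b - E a else E b) := by
  set p := ∑ b ∈ S, b with hpdef
  have hpE : ∀ c ∈ t, p ⬝ᵥ E c = if c ∈ S then 1 else 0 := by
    intro c hc
    rw [hpdef, sum_dotProduct, Finset.sum_congr rfl fun b hb => h.dot c hc b (hS hb),
      Finset.sum_ite_eq']
  have hpa : p ∉ t.erase a := fun h' => hp (Finset.mem_of_mem_erase h')
  refine ⟨?_, ?_⟩
  · have hc := h.card
    have : 0 < t.card := Finset.card_pos.2 ⟨a, hS ha⟩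
    rw [Finset.card_insert_of_notMem hpa, Finset.card_erase_of_mem (hS ha)]
    omega
  · have hat := hS ha
    intro c hc b hb
    rcases Finset.mem_insert.1 hc with rfl | hc
    · rw [if_pos rfl]
      rcases Finset.mem_insert.1 hb with rfl | hb
      · rw [hpE a hat, if_pos ha, if_pos rfl]
      · rw [h.dot_ne hat (Finset.mem_of_mem_erase hb) (Finset.ne_of_mem_erase hb), if_neg]
        intro h'; exact hpa (h' ▸ hb)
    · have hcp : c ≠ p := fun h' => hpa (h' ▸ hc)
      have hct := Finset.mem_of_mem_erase hc
      have hca := Finset.ne_of_mem_erase hc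
      rw [if_neg hcp]
      rcases Finset.mem_insert.1 hb with rfl | hb
      · rw [if_neg (Ne.symm hcp)]
        split_ifs with hcS
        · rw [dotProduct_sub, hpE c hct, hpE a hat, if_pos hcS, if_pos ha, sub_self]
        · rw [hpE c hct, if_neg hcS]
      · have hbt := Finset.mem_of_mem_erase hb
        have hba := Finset.ne_of_mem_erase hb
        split_ifs with hcS hbc hbc
        · rw [dotProduct_sub, hbc, h.dot_self hct, h.dot_ne hat hct hca, sub_zero]
        · rw [dotProduct_sub, h.dot_ne hct hbt hbc, h.dot_ne hat hbt hba, sub_zero]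
        · rw [hbc, h.dot_self hct]
        · exact h.dot_ne hct hbt hbc

/-- If the sum were a generator, its ray would lie in the cone over `S`, so the sum would belong to
`S`. But it pairs to one with the dual vector of every member of `S`, whereas a member of `S` pairs
to zero with those of the others. -/
theorem IsFanModel.sum_notMem_verts (hT : IsFanModel (normalFan P) T) {t0 S : Finset (Fin n → ℤ)}
    (ht0 : t0 ∈ T) (hS : S ⊆ t0) (h2 : 2 ≤ S.card) : ∑ b ∈ S, b ∉ Tri.verts T := by
  intro hp
  obtain ⟨t, ht, hpt⟩ := Tri.mem_verts.1 hp
  have h1 : coneOver {∑ b ∈ S, b} ⊆ coneOver S := by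
    rintro _ ⟨c, hc, rfl⟩
    refine ⟨fun _ => c (∑ b ∈ S, b), fun a _ => hc _ (Finset.mem_singleton_self _), ?_⟩
    rw [Finset.sum_singleton, ← Finset.smul_sum, latticePt_sum]
  rw [hT.subset_iff ht (Finset.singleton_subset_iff.2 hpt) ht0 hS,
    Finset.singleton_subset_iff] at h1
  obtain ⟨E, hE⟩ := hT.uni t0 ht0
  obtain ⟨a, ha, hap⟩ : ∃ a ∈ S, a ≠ ∑ b ∈ S, b := by
    by_contra hcon
    push Not at hcon
    have : S ⊆ {∑ b ∈ S, b} := fun a ha => Finset.mem_singleton.2 (hcon a ha)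
    have := Finset.card_le_card this
    rw [Finset.card_singleton] at this
    omega
  have h3 := hE.dot_ne (hS ha) (hS h1) (Ne.symm hap)
  rw [sum_dotProduct, Finset.sum_congr rfl fun b hb => hE.dot a (hS ha) b (hS hb),
    Finset.sum_ite_eq', if_pos ha] at h3
  exact one_ne_zero h3

/-- The stellar subdivision of a normal fan in terms of the model of the fan. -/
theorem IsFanModel.stellar (hT : IsFanModel (normalFan P) T) {t0 S : Finset (Fin n → ℤ)}
    (ht0 : t0 ∈ T) (hS : S ⊆ t0) (h2 : 2 ≤ S.card) :
    IsFanModel (stellarSubdivision (normalFan P) (coneOver S) (latticePt (∑ b ∈ S, b)))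
      (Tri.starSub T S (∑ b ∈ S, b)) := by
  have hp := hT.sum_notMem_verts ht0 hS h2
  set p := ∑ b ∈ S, b with hpdef
  have hpt : ∀ t ∈ T, p ∉ t := fun t ht h => hp (Tri.mem_verts.2 ⟨t, ht, h⟩)
  refine ⟨?_, ?_⟩
  · intro s hs
    rcases Tri.mem_starSub.1 hs with ⟨hs, -⟩ | ⟨t, ht, hSt, a, ha, rfl⟩
    · exact hT.uni s hs
    · obtain ⟨E, hE⟩ := hT.uni t ht
      exact ⟨_, hE.starSub hSt ha (hpt t ht)⟩
  · have hstar : ∀ t ∈ T, ∀ A ⊆ t, coneOver A ∈ fanStar (normalFan P) (coneOver S) ↔ S ⊆ A := by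
      intro t ht A hA
      constructor
      · rintro ⟨-, h⟩
        exact (hT.subset_iff ht0 hS ht hA).1 h
      · intro h
        refine ⟨by rw [hT.eq]; exact ⟨t, ht, A, hA, rfl⟩, (hT.subset_iff ht0 hS ht hA).2 h⟩
    have hclosed : ∀ t ∈ T, ∀ A ⊆ t, coneOver A ∈ closedStar (normalFan P) (coneOver S) ↔
        ∃ t' ∈ T, S ⊆ t' ∧ A ⊆ t' := by
      intro t ht A hA
      constructor
      · rintro ⟨-, τ, ⟨hτ, hSτ⟩, hAτ⟩
        rw [hT.eq] at hτ
        obtain ⟨t', ht', A', hA', rfl⟩ := hτ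
        exact ⟨t', ht', ((hT.subset_iff ht0 hS ht' hA').1 hSτ).trans hA',
          ((hT.subset_iff ht hA ht' hA').1 hAτ).trans hA'⟩
      · rintro ⟨t', ht', hSt', hAt'⟩
        refine ⟨by rw [hT.eq]; exact ⟨t, ht, A, hA, rfl⟩, coneOver t',
          (hstar t' ht' t' subset_rfl).2 hSt', (hT.subset_iff ht hA ht' subset_rfl).2 hAt'⟩
    ext σ
    constructor
    · rintro (⟨hσ, hns⟩ | ⟨τ, ⟨hτc, hτs⟩, rfl⟩)
      · rw [hT.eq] at hσ
        obtain ⟨t, ht, A, hA, rfl⟩ := hσ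
        rw [hstar t ht A hA] at hns
        by_cases hSt : S ⊆ t
        · obtain ⟨a, ha, haA⟩ := Finset.not_subset.1 hns
          refine ⟨_, Tri.mem_starSub.2 (Or.inr ⟨t, ht, hSt, a, ha, rfl⟩), A, ?_, rfl⟩
          intro b hb
          refine Finset.mem_insert_of_mem (Finset.mem_erase.2 ⟨?_, hA hb⟩)
          rintro rfl; exact haA hb
        · exact ⟨t, Tri.mem_starSub.2 (Or.inl ⟨ht, hSt⟩), A, hA, rfl⟩
      · have hτ : τ ∈ normalFan P := hτc.1
        rw [hT.eq] at hτ
        obtain ⟨t, ht, A, hA, rfl⟩ := hτ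
        rw [hstar t ht A hA] at hτs
        obtain ⟨t', ht', hSt', hAt'⟩ := (hclosed t ht A hA).1 hτc
        obtain ⟨a, ha, haA⟩ := Finset.not_subset.1 hτs
        refine ⟨_, Tri.mem_starSub.2 (Or.inr ⟨t', ht', hSt', a, ha, rfl⟩), insert p A, ?_,
          joinRay_coneOver fun h => hpt t ht (hA h)⟩
        refine Finset.insert_subset_insert _ fun b hb => Finset.mem_erase.2 ⟨?_, hAt' hb⟩
        rintro rfl; exact haA hb
    · rintro ⟨s, hs, A, hA, rfl⟩
      rcases Tri.mem_starSub.1 hs with ⟨hs, hns⟩ | ⟨t, ht, hSt, a, ha, rfl⟩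
      · left
        refine ⟨by rw [hT.eq]; exact ⟨s, hs, A, hA, rfl⟩, ?_⟩
        rw [hstar s hs A hA]
        exact fun h => hns (h.trans hA)
      · have hpe : A.erase p ⊆ t.erase a := by
          intro b hb
          exact (Finset.mem_insert.1 (hA (Finset.mem_of_mem_erase hb))).resolve_left
            (Finset.ne_of_mem_erase hb)
        have hpet : A.erase p ⊆ t := hpe.trans (Finset.erase_subset _ _)
        have hnS : ¬ S ⊆ A.erase p := fun h => Finset.notMem_erase a t (hpe (h ha))
        by_cases hpA : p ∈ A
        · right
          refine ⟨coneOver (A.erase p), ⟨(hclosed t ht _ hpet).2 ⟨t, ht, hSt, hpet⟩, ?_⟩, ?_⟩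
          · rw [hstar t ht _ hpet]; exact hnS
          · rw [joinRay_coneOver (Finset.notMem_erase _ _), Finset.insert_erase hpA]
        · rw [Finset.erase_eq_of_notMem hpA] at hpet hnS
          left
          refine ⟨by rw [hT.eq]; exact ⟨t, ht, A, hpet, rfl⟩, ?_⟩
          rw [hstar t ht A hpet]; exact hnS

/-- The indecomposable lattice points of the cone are the members of `S`, so each of them occurs
among the `x i`; linear independence excludes further ones. Hence the direction of the blow-up does
not depend on the choice of `x`. -/
theorem isUnimodularBasis_image_eq {t S : Finset (Fin n → ℤ)} {E : (Fin n → ℤ) → Fin n → ℤ}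
    (h : IsDual t E) (hS : S ⊆ t) {r : ℕ} {x : Fin r → Fin n → ℤ}
    (hx : IsUnimodularBasis (coneOver S) x) : S.card = r ∧ ∑ i, x i = ∑ b ∈ S, b := by
  obtain ⟨hli, hσ, hgen⟩ := hx
  have hxS : ∀ i, latticePt (x i) ∈ coneOver S := by
    intro i
    rw [hσ]
    refine ⟨fun j => if j = i then 1 else 0, fun j => by dsimp only; split_ifs <;> norm_num, ?_⟩
    simp [ite_smul]
  have hex : ∀ a ∈ S, ∃ i, x i = a := by
    intro a ha
    obtain ⟨c, hc⟩ := hgen a (latticePt_mem_coneOver ha)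
    obtain ⟨i, -, hi⟩ := h.subset_of_generate hS (s := Finset.univ) (x := x) (fun i _ => hxS i) ha
      (c := fun i => (c i : ℤ)) (fun i _ => Int.natCast_nonneg _) (by
        rw [hc]; exact Finset.sum_congr rfl fun i _ => (natCast_zsmul _ _).symm)
    exact ⟨i, hi⟩
  have hmem : ∀ j, x j ∈ S := by
    intro j
    by_contra hj
    have hnot := hli.notMem_span_image (s := {i | i ≠ j}) (x := j) (by simp)
    apply hnot
    obtain ⟨c, -, hc⟩ := hxS j
    rw [hc]
    refine Submodule.sum_mem _ fun a ha => Submodule.smul_mem _ _ (Submodule.subset_span ?_)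
    obtain ⟨i, hi⟩ := hex a ha
    refine ⟨i, ?_, by dsimp only; rw [hi]⟩
    rintro rfl
    exact hj (hi ▸ ha)
  have hinj : Function.Injective x := fun i j hij => hli.injective (congrArg latticePt hij)
  have himg : Finset.univ.image x = S := by
    ext a
    rw [Finset.mem_image]
    constructor
    · rintro ⟨i, -, rfl⟩; exact hmem i
    · intro ha
      obtain ⟨i, hi⟩ := hex a ha
      exact ⟨i, Finset.mem_univ _, hi⟩
  constructor
  · rw [← himg, Finset.card_image_of_injective _ hinj, Finset.card_univ, Fintype.card_fin]
  · rw [← himg, Finset.sum_image fun i _ j _ hij => hinj hij]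

/-- The cone of the face is spanned by some `S`, and the definition of a blow-up prescribes the new
fan, so the combinatorial subdivision can be read off without looking at the truncated polytope. -/
theorem IsFanModel.blowUp (hT : IsFanModel (normalFan P) T) {F P' : Set (Fin n → ℝ)} {k : ℕ}
    (h : IsBlowUpAt P F k P') : ∃ t0 ∈ T, ∃ S, S ⊆ t0 ∧ 2 ≤ S.card ∧
      IsFanModel (normalFan P') (Tri.starSub T S (∑ b ∈ S, b)) := by
  obtain ⟨hF, -, r, x, hr, hx, -, hfan⟩ := h
  have hΦ : normalCone P F ∈ normalFan P := ⟨F, hF, rfl⟩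
  rw [hT.eq] at hΦ
  obtain ⟨t0, ht0, S, hS, hσ⟩ := hΦ
  obtain ⟨E, hE⟩ := hT.uni t0 ht0
  rw [hσ] at hx hfan
  obtain ⟨hc, hsum⟩ := isUnimodularBasis_image_eq hE hS hx
  refine ⟨t0, ht0, S, hS, hc ▸ hr, ?_⟩
  rw [hfan, hsum]
  exact hT.stellar ht0 hS (hc ▸ hr)

end Stellar

/-! ### The invariant preserved by blow-ups -/

section Chain

variable {α : Type*} [DecidableEq α]

/-- The number of vertices of degree `m`. -/
def Tri.num (T : Finset (Finset α)) (m : ℕ) : ℕ :=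
  ((Tri.verts T).filter fun x => Tri.deg T x = m).card

/-- The properties of the triangulations with at most eight vertices in question that are
preserved by stellar subdivisions. -/
structure IsGood (T : Finset (Finset α)) : Prop where
  isTri : IsTri T
  euler : T.card + 4 = 2 * (Tri.verts T).card
  -- With eight vertices the last condition excludes only the label `3^4 6^4`; from nine on nothing
  -- but Euler's relation is needed.
  small : ((Tri.verts T).card = 6 ∧ ∀ x ∈ Tri.verts T, Tri.deg T x = 4) ∨
    ((Tri.verts T).card = 7 ∧
      ((Tri.num T 3 = 1 ∧ Tri.num T 4 = 3 ∧ Tri.num T 5 = 3) ∨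
        (Tri.num T 3 = 2 ∧ Tri.num T 4 = 3 ∧ Tri.num T 6 = 2) ∨
        (Tri.num T 4 = 5 ∧ Tri.num T 5 = 2))) ∨
    ((Tri.verts T).card = 8 ∧ ∃ x ∈ Tri.verts T, Tri.deg T x ≠ 3 ∧ Tri.deg T x ≠ 6) ∨
    9 ≤ (Tri.verts T).card

/-- Subdividing an octahedron at a triangle gives `3 4^3 5^3`, at an edge `4^5 5^2`. In the step
from seven to eight vertices it is enough to exhibit one vertex whose degree is neither three nor
six. -/
theorem IsGood.starSub {T : Finset (Finset α)} (h : IsGood T) {S t0 : Finset α} {p : α}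
    (hp : p ∉ Tri.verts T) (ht0 : t0 ∈ T) (hS : S ⊆ t0) (h2 : 2 ≤ S.card) :
    IsGood (Tri.starSub T S p) := by
  have hverts := Tri.verts_starSub (p := p) h2 ht0 hS
  have hcard : (Tri.verts (Tri.starSub T S p)).card = (Tri.verts T).card + 1 := by
    rw [hverts, Finset.card_insert_of_notMem hp]
  have hSv : S ⊆ Tri.verts T := fun x hx => Tri.mem_verts.2 ⟨t0, ht0, hS hx⟩
  have hne : ∀ x ∈ Tri.verts T, x ≠ p := fun x hx h => hp (h ▸ hx)
  have hstar := h.isTri.card_star ht0 hS h2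
  have hpdeg := Tri.deg_starSub_new (S := S) hp
  have hmem : ∀ x ∈ S, Tri.deg (Tri.starSub T S p) x + (T.filter fun t => S ⊆ t).card =
      Tri.deg T x + (T.filter fun t => S ⊆ t).card * (S.card - 1) := fun x hx =>
    Tri.deg_starSub_mem hp hx (hne x (hSv hx))
  have hnot : ∀ x ∈ Tri.verts T, x ∉ S →
      Tri.deg (Tri.starSub T S p) x + (T.filter fun t => S ⊆ t ∧ x ∈ t).card =
      Tri.deg T x + (T.filter fun t => S ⊆ t ∧ x ∈ t).card * S.card := fun x hx hxS =>
    Tri.deg_starSub_notMem hp hxS (hne x hx)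
  have hpv : p ∈ Tri.verts (Tri.starSub T S p) := by rw [hverts]; exact Finset.mem_insert_self _ _
  have hzero : S.card = 3 → ∀ x ∉ S, (T.filter fun t => S ⊆ t ∧ x ∈ t).card = 0 := by
    intro hc x hx
    rw [Finset.card_eq_zero, Finset.filter_eq_empty_iff]
    rintro t ht ⟨hSt, hxt⟩
    have : S = t := Finset.eq_of_subset_of_card_le hSt (by rw [hc, h.isTri.card t ht])
    exact hx (this ▸ hxt)
  refine ⟨h.isTri.starSub hp ht0 hS h2, ?_, ?_⟩
  · rw [hcard, h.isTri.card_starSub hp ht0 hS h2]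
    have := h.euler
    omega
  rw [hcard]
  rcases h.small with ⟨h6, hdeg⟩ | ⟨h7, hlab⟩ | ⟨h8, -⟩ | h9
  -- Six vertices, all of degree four. At a triangle its three corners rise to degree five and the
  -- new vertex has degree three; at an edge the two opposite vertices rise to five and the new
  -- vertex has degree four.
  · right; left
    refine ⟨by omega, ?_⟩
    rcases hstar with ⟨e1, e2⟩ | ⟨e1, e2⟩
    · left
      have d1 : Tri.deg (Tri.starSub T S p) p = 3 := by rw [hpdeg, e1, e2]
      have d2 : ∀ x ∈ S, Tri.deg (Tri.starSub T S p) x = 5 := by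
        intro x hx
        have h3 := hmem x hx
        rw [e1, e2, hdeg x (hSv hx)] at h3
        omega
      have d3 : ∀ x ∈ Tri.verts T, x ∉ S → Tri.deg (Tri.starSub T S p) x = 4 := by
        intro x hx hxS
        have h3 := hnot x hx hxS
        rw [hzero e1 x hxS, hdeg x hx] at h3
        omega
      unfold Tri.num
      rw [hverts]
      refine ⟨?_, ?_, ?_⟩
      · rw [Finset.card_eq_one]
        refine ⟨p, ?_⟩
        ext x
        rw [Finset.mem_filter, Finset.mem_insert, Finset.mem_singleton]
        constructor
        · rintro ⟨rfl | hx, hd⟩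
          · rfl
          · by_cases hxS : x ∈ S
            · have := d2 x hxS; omega
            · have := d3 x hx hxS; omega
        · rintro rfl; exact ⟨Or.inl rfl, d1⟩
      · have : (insert p (Tri.verts T)).filter (fun x => Tri.deg (Tri.starSub T S p) x = 4) =
            Tri.verts T \ S := by
          ext x
          rw [Finset.mem_filter, Finset.mem_insert, Finset.mem_sdiff]
          constructor
          · rintro ⟨rfl | hx, hd⟩
            · omega
            · refine ⟨hx, fun hxS => ?_⟩
              have := d2 x hxS; omega
          · rintro ⟨hx, hxS⟩; exact ⟨Or.inr hx, d3 x hx hxS⟩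
        rw [this, Finset.card_sdiff_of_subset hSv, h6, e1]
      · have : (insert p (Tri.verts T)).filter (fun x => Tri.deg (Tri.starSub T S p) x = 5) =
            S := by
          ext x
          rw [Finset.mem_filter, Finset.mem_insert]
          constructor
          · rintro ⟨rfl | hx, hd⟩
            · omega
            · by_contra hxS
              have := d3 x hx hxS; omega
          · intro hx; exact ⟨Or.inr (hSv hx), d2 x hx⟩
        rw [this, e1]
    · right; right
      obtain ⟨t1, t2, ht12, hst⟩ := Finset.card_eq_two.1 e2
      have ht1 : t1 ∈ T.filter fun t => S ⊆ t := by rw [hst]; simp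
      have ht2 : t2 ∈ T.filter fun t => S ⊆ t := by rw [hst]; simp
      rw [Finset.mem_filter] at ht1 ht2
      have hexc : ∀ t ∈ T, S ⊆ t → ∃ c, c ∉ S ∧ t = insert c S := by
        intro t ht hSt
        have h1 : (t \ S).card = 1 := by
          rw [Finset.card_sdiff_of_subset hSt, h.isTri.card t ht, e1]
        obtain ⟨c, hc⟩ := Finset.card_eq_one.1 h1
        have hcm : c ∈ t \ S := hc ▸ Finset.mem_singleton_self c
        refine ⟨c, (Finset.mem_sdiff.1 hcm).2, ?_⟩
        rw [Finset.insert_eq, ← hc, Finset.sdiff_union_of_subset hSt]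
      obtain ⟨c, hcS, hc⟩ := hexc t1 ht1.1 ht1.2
      obtain ⟨d, hdS, hd⟩ := hexc t2 ht2.1 ht2.2
      have hcd : c ≠ d := by rintro rfl; exact ht12 (hc.trans hd.symm)
      have hcount : ∀ x ∉ S, (T.filter fun t => S ⊆ t ∧ x ∈ t).card =
          if x = c ∨ x = d then 1 else 0 := by
        intro x hx
        rw [← Finset.filter_filter, hst, Finset.filter_insert, Finset.filter_singleton]
        have i1 : x ∈ t1 ↔ x = c := by rw [hc, Finset.mem_insert]; simp [hx]
        have i2 : x ∈ t2 ↔ x = d := by rw [hd, Finset.mem_insert]; simp [hx]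
        simp only [i1, i2]
        by_cases x1 : x = c
        · have x2 : x ≠ d := fun h => hcd (x1 ▸ h)
          simp [x1, hcd]
        · by_cases x2 : x = d
          · simp [x2, Ne.symm hcd]
          · simp [x1, x2]
      have hcv : c ∈ Tri.verts T := Tri.mem_verts.2 ⟨t1, ht1.1, by rw [hc]; simp⟩
      have hdv : d ∈ Tri.verts T := Tri.mem_verts.2 ⟨t2, ht2.1, by rw [hd]; simp⟩
      have hdg : ∀ x ∈ Tri.verts T, Tri.deg (Tri.starSub T S p) x =
          if x = c ∨ x = d then 5 else 4 := by
        intro x hx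
        by_cases hxS : x ∈ S
        · have h3 := hmem x hxS
          rw [e1, e2, hdeg x hx] at h3
          rw [if_neg]
          · omega
          · rintro (rfl | rfl)
            · exact hcS hxS
            · exact hdS hxS
        · have h3 := hnot x hx hxS
          rw [hcount x hxS, e1, hdeg x hx] at h3
          split_ifs at h3 ⊢ <;> omega
      have d1 : Tri.deg (Tri.starSub T S p) p = 4 := by rw [hpdeg, e1, e2]
      have hpc : p ≠ c := fun h => hp (h ▸ hcv)
      have hpd : p ≠ d := fun h => hp (h ▸ hdv)
      have hf5 : (insert p (Tri.verts T)).filter (fun x => Tri.deg (Tri.starSub T S p) x = 5) =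
          {c, d} := by
        ext x
        rw [Finset.mem_filter, Finset.mem_insert, Finset.mem_insert, Finset.mem_singleton]
        constructor
        · rintro ⟨rfl | hx, hd⟩
          · omega
          · rw [hdg x hx] at hd
            by_contra hcon
            rw [if_neg hcon] at hd
            omega
        · rintro (rfl | rfl)
          · exact ⟨Or.inr hcv, by rw [hdg _ hcv]; simp⟩
          · exact ⟨Or.inr hdv, by rw [hdg _ hdv]; simp⟩
      have hf4 : (insert p (Tri.verts T)).filter (fun x => Tri.deg (Tri.starSub T S p) x = 4) =
          (insert p (Tri.verts T)) \ {c, d} := by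
        ext x
        rw [Finset.mem_filter, Finset.mem_sdiff, Finset.mem_insert, Finset.mem_insert,
          Finset.mem_singleton]
        constructor
        · rintro ⟨rfl | hx, hd⟩
          · exact ⟨Or.inl rfl, by simp [hpc, hpd]⟩
          · refine ⟨Or.inr hx, fun hcon => ?_⟩
            rw [hdg x hx, if_pos hcon] at hd
            omega
        · rintro ⟨rfl | hx, hcon⟩
          · exact ⟨Or.inl rfl, d1⟩
          · exact ⟨Or.inr hx, by rw [hdg x hx, if_neg hcon]⟩
      unfold Tri.num
      rw [hverts, hf5, hf4, Finset.card_sdiff_of_subset (by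
        intro x hx
        rw [Finset.mem_insert, Finset.mem_singleton] at hx
        rcases hx with rfl | rfl
        · exact Finset.mem_insert_of_mem hcv
        · exact Finset.mem_insert_of_mem hdv), Finset.card_insert_of_notMem hp,
        Finset.card_pair hcd, h6]
      exact ⟨rfl, rfl⟩
  -- Seven vertices. Each of the three labels has a vertex of degree four: a subdivision at a
  -- triangle leaves its degree four or makes it five. A subdivision at an edge creates a vertex of
  -- degree four.
  · right; right; left
    refine ⟨by omega, ?_⟩
    rcases hstar with ⟨e1, e2⟩ | ⟨e1, e2⟩
    · have h4 : 0 < Tri.num T 4 := by omega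
      obtain ⟨x, hx⟩ := Finset.card_pos.1 h4
      obtain ⟨hx, hx4⟩ := Finset.mem_filter.1 hx
      refine ⟨x, by rw [hverts]; exact Finset.mem_insert_of_mem hx, ?_⟩
      by_cases hxS : x ∈ S
      · have h3 := hmem x hxS
        rw [e1, e2, hx4] at h3
        omega
      · have h3 := hnot x hx hxS
        rw [hzero e1 x hxS, hx4] at h3
        omega
    · refine ⟨p, hpv, ?_⟩
      rw [hpdeg, e1, e2]
      omega
  · right; right; right; omega
  · right; right; right; omega

theorem Tri.card_of_deg_le {T : Finset (Finset α)} (h : IsTri T)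
    (hd : ∀ x ∈ Tri.verts T, Tri.deg T x ∈ ({3, 4, 5, 6, 7} : Finset ℕ)) :
    (Tri.verts T).card = Tri.num T 3 + Tri.num T 4 + Tri.num T 5 + Tri.num T 6 + Tri.num T 7 ∧
    3 * T.card = 3 * Tri.num T 3 + 4 * Tri.num T 4 + 5 * Tri.num T 5 + 6 * Tri.num T 6 +
      7 * Tri.num T 7 := by
  constructor
  · rw [Finset.card_eq_sum_card_fiberwise hd]
    simp only [Tri.num]
    rw [Finset.sum_insert (by decide), Finset.sum_insert (by decide),
      Finset.sum_insert (by decide), Finset.sum_insert (by decide), Finset.sum_singleton]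
    ring
  · rw [← Tri.sum_deg h.card, ← Finset.sum_fiberwise_of_maps_to hd]
    have : ∀ m ∈ ({3, 4, 5, 6, 7} : Finset ℕ),
        ∑ x ∈ (Tri.verts T).filter (fun x => Tri.deg T x = m), Tri.deg T x = m * Tri.num T m := by
      intro m _
      rw [Finset.sum_congr rfl (g := fun _ => m) fun x hx => (Finset.mem_filter.1 hx).2,
        Finset.sum_const, smul_eq_mul, mul_comm]; rfl
    rw [Finset.sum_congr rfl this, Finset.sum_insert (by decide), Finset.sum_insert (by decide),
      Finset.sum_insert (by decide), Finset.sum_insert (by decide), Finset.sum_singleton]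
    ring

/-- The degrees add up to three times the number of triangles, so each of the four labels determines
both numbers, and Euler's relation can be checked numerically. -/
theorem isGood_of_label {Q : Set (Fin 3 → ℝ)} {T : Finset (Finset (Fin 3 → ℤ))}
    (hT : IsFanModel (normalFan Q) T) (h3 : IsTri T)
    (hlab : HasLabel Q {3, 4, 4, 4, 5, 5, 5} ∨ HasLabel Q {4, 4, 4, 4, 4, 4} ∨
      HasLabel Q {3, 3, 4, 4, 4, 6, 6} ∨ HasLabel Q {4, 4, 4, 4, 4, 5, 5}) : IsGood T := by
  simp only [hT.hasLabel_iff h3] at hlab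
  have hmem : ∀ L : Multiset ℕ, (∀ m ∈ L, m ∈ ({3, 4, 5, 6, 7} : Finset ℕ)) →
      (∀ m, 0 < m → ((Tri.verts T).filter fun r => Tri.deg T r = m).card = L.count m) →
      ∀ x ∈ Tri.verts T, Tri.deg T x ∈ ({3, 4, 5, 6, 7} : Finset ℕ) := by
    intro L hL hc x hx
    apply hL
    rw [← Multiset.count_pos, ← hc _ (Tri.deg_pos hx)]
    exact Finset.card_pos.2 ⟨x, Finset.mem_filter.2 ⟨hx, rfl⟩⟩
  rcases hlab with h | h | h | h
  all_goals
    obtain ⟨c1, c2⟩ := Tri.card_of_deg_le h3 (hmem _ (by decide) h)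
    have n3 : Tri.num T 3 = _ := h 3 (by norm_num)
    have n4 : Tri.num T 4 = _ := h 4 (by norm_num)
    have n5 : Tri.num T 5 = _ := h 5 (by norm_num)
    have n6 : Tri.num T 6 = _ := h 6 (by norm_num)
    have n7 : Tri.num T 7 = _ := h 7 (by norm_num)
    simp at n3 n4 n5 n6 n7
    refine ⟨h3, by omega, ?_⟩
  · right; left; refine ⟨by omega, ?_⟩; omega
  · left
    refine ⟨by omega, fun x hx => ?_⟩
    have h1 := h _ (Tri.deg_pos hx)
    have h2 : 0 < ((Tri.verts T).filter fun r => Tri.deg T r = Tri.deg T x).card :=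
      Finset.card_pos.2 ⟨x, Finset.mem_filter.2 ⟨hx, rfl⟩⟩
    rw [h1, Multiset.count_pos] at h2
    simpa using h2
  · right; left; refine ⟨by omega, ?_⟩; omega
  · right; left; refine ⟨by omega, ?_⟩; omega

/-- A smooth polytope obtained by blow-ups from one with a good triangulation has a good
triangulation. -/
theorem SmoothModel.isGood_of_blowUps (M : SmoothModel 3) {Q : Set (Fin 3 → ℝ)}
    (hQ : ∃ T, IsFanModel (normalFan Q) T ∧ IsGood T) (h : ObtainedByBlowUps Q M.body) :
    IsGood M.T := by
  have : ∀ P, ObtainedByBlowUps Q P → ∃ T, IsFanModel (normalFan P) T ∧ IsGood T := by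
    intro P hP
    induction hP with
    | refl => exact hQ
    | tail _ hstep ih =>
      obtain ⟨T, hT, hG⟩ := ih
      obtain ⟨F, k, hb⟩ := hstep
      obtain ⟨t0, ht0, S, hS, h2, hT'⟩ := hT.blowUp hb
      exact ⟨_, hT', hG.starSub (hT.sum_notMem_verts ht0 hS h2) ht0 hS h2⟩
  obtain ⟨T, hT, hG⟩ := this _ h
  have := M.isFanModel.unique hT
  unfold SmoothModel.T
  rw [this]; exact hG

end Chain


/-- A smooth lattice polygon with `n` edges. The `i`-th edge (cyclically) is the zero set of the
affine function `F i`, has length `l i`, and joins the vertices `v (i - 1)` and `v i`. -/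
structure SmoothPolygon (n : ℕ) (β : Type*) where
  F : ℤ → β → ℤ
  l : ℤ → ℤ
  a : ℤ → ℤ
  v : ℤ → β
  -- The affine form of the relation between three consecutive normals of a smooth polygon; `a (i +
  -- 1)` is the self-intersection number of the toric divisor of edge `i + 1`.
  recur : ∀ i b, F (i + 2) b = l (i + 1) - F i b - a (i + 1) * F (i + 1) b
  surj : ∀ i X Y, ∃ b, F i b = X ∧ F (i + 1) b = Y
  ext : ∀ i b b', F i b = F i b' → F (i + 1) b = F (i + 1) b' → b = b'
  F_period : ∀ i, F (i + n) = F i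
  l_period : ∀ i, l (i + n) = l i
  a_period : ∀ i, a (i + n) = a i
  nonneg : ∀ j i, 0 ≤ F j (v i)
  zero : ∀ j i, F j (v i) = 0 ↔ (n : ℤ) ∣ j - i ∨ (n : ℤ) ∣ j - i - 1
  l_pos : ∀ i, 0 < l i
  n_pos : 0 < n

/-! ### Interior lattice points of smooth polygons -/

namespace SmoothPolygon

variable {n : ℕ} {β : Type*} (Q : SmoothPolygon n β)

/-- Membership in the interior of the polygon. -/
def Interior (b : β) : Prop := ∀ j, 0 < Q.F j b

theorem F_emod (i j : ℤ) (h : (n : ℤ) ∣ i - j) : Q.F i = Q.F j := by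
  obtain ⟨k, hk⟩ := h
  obtain rfl : i = j + n * k := by linarith
  induction k using Int.induction_on generalizing j with
  | zero => simp
  | succ k ih =>
    rw [show j + n * ((k : ℤ) + 1) = (j + n * k) + n by ring, Q.F_period]
    exact ih j (by ring)
  | pred k ih =>
    rw [← Q.F_period, show j + n * (-(k : ℤ) - 1) + n = (j + n * (-(k : ℤ))) by ring]
    exact ih j (by ring)

theorem F_self (i : ℤ) : Q.F i (Q.v i) = 0 := (Q.zero i i).2 (by simp)

theorem F_succ (i : ℤ) : Q.F (i + 1) (Q.v i) = 0 := (Q.zero (i + 1) i).2 (by simp)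

theorem F_v_succ (i : ℤ) : Q.F i (Q.v (i + 1)) = Q.l (i + 1) := by
  have h := Q.recur i (Q.v (i + 1))
  rw [Q.F_self, show i + 2 = (i + 1) + 1 by ring, Q.F_succ] at h
  linarith

/-- All the functions are affine in any two consecutive ones. -/
theorem affine (i j : ℤ) : ∃ p q c : ℤ, ∀ b, Q.F j b = p * Q.F i b + q * Q.F (i + 1) b + c := by
  have key : ∀ k : ℕ, (∃ p q c : ℤ, ∀ b, Q.F (i + k) b = p * Q.F i b + q * Q.F (i + 1) b + c) ∧
      ∃ p q c : ℤ, ∀ b, Q.F (i + k + 1) b = p * Q.F i b + q * Q.F (i + 1) b + c := by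
    intro k
    induction k with
    | zero => exact ⟨⟨1, 0, 0, by simp⟩, 0, 1, 0, by simp⟩
    | succ k ih =>
      obtain ⟨⟨p, q, c, h1⟩, p', q', c', h2⟩ := ih
      refine ⟨⟨p', q', c', fun b => by rw [← h2]; push_cast; ring_nf⟩,
        -p - Q.a (i + k + 1) * p', -q - Q.a (i + k + 1) * q',
        Q.l (i + k + 1) - c - Q.a (i + k + 1) * c', fun b => ?_⟩
      have := Q.recur (i + k) b
      rw [h1, h2] at this
      push_cast
      rw [show i + (k + 1) + 1 = i + (k : ℤ) + 2 by ring, this]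
      ring
  obtain ⟨k, hk⟩ : ∃ k : ℕ, (n : ℤ) ∣ i + k - j := by
    have hn : (0 : ℤ) < n := by exact_mod_cast Q.n_pos
    refine ⟨((j - i) % n).toNat, ?_⟩
    rw [Int.toNat_of_nonneg (Int.emod_nonneg _ hn.ne')]
    have := Int.emod_add_mul_ediv (j - i) n
    exact ⟨-((j - i) / n), by linarith⟩
  obtain ⟨p, q, c, h⟩ := (key k).1
  exact ⟨p, q, c, fun b => by rw [← h, Q.F_emod _ _ hk]⟩

theorem exists_pos (j : ℤ) : ∃ k, 0 < Q.F j (Q.v k) := by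
  refine ⟨j + 1, ?_⟩
  rw [Q.F_v_succ]
  exact Q.l_pos _

theorem dvd_of_zero_zero {i j : ℤ} (h3 : 2 < n) (h : Q.F i (Q.v j) = 0)
    (h' : Q.F (i + 1) (Q.v j) = 0) : (n : ℤ) ∣ i - j := by
  rw [Q.zero] at h h'
  rcases h with h | h
  · exact h
  · exfalso
    have h3' : (2 : ℤ) < n := by exact_mod_cast h3
    rcases h' with h' | h'
    · have := dvd_sub h' h
      rw [show i + 1 - j - (i - j - 1) = 2 by ring] at this
      have := Int.le_of_dvd (by norm_num) this
      omega
    · have := dvd_sub h' h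
      rw [show i + 1 - j - 1 - (i - j - 1) = 1 by ring] at this
      have := Int.le_of_dvd (by norm_num) this
      omega

/-- No vertex lies between two others. -/
theorem no_between {i : ℤ} (h3 : 2 < n) {x y z : ℤ}
    (hxy : Q.F i (Q.v x) = Q.F i (Q.v y)) (hyz : Q.F i (Q.v y) = Q.F i (Q.v z))
    (h1 : Q.F (i + 1) (Q.v x) < Q.F (i + 1) (Q.v y))
    (h2 : Q.F (i + 1) (Q.v y) < Q.F (i + 1) (Q.v z)) : False := by
  -- An edge function that is nonnegative at `x` and `z` and vanishes at the point `y` between them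
  -- is constant on their line. So both edges through `y` also contain `x`.
  have key : ∀ j, Q.F j (Q.v y) = 0 → Q.F j (Q.v x) = 0 := by
    intro j hj
    obtain ⟨p, q, c, h⟩ := Q.affine i j
    have e1 := h (Q.v x)
    have e2 := h (Q.v y)
    have e3 := h (Q.v z)
    have n1 := Q.nonneg j x
    have n2 := Q.nonneg j z
    rw [hj] at e2
    have f1 : Q.F j (Q.v x) = q * (Q.F (i + 1) (Q.v x) - Q.F (i + 1) (Q.v y)) := by
      rw [e1, hxy]; linarith
    have f2 : Q.F j (Q.v z) = q * (Q.F (i + 1) (Q.v z) - Q.F (i + 1) (Q.v y)) := by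
      rw [e3, ← hyz]; linarith
    rw [f1] at n1
    rw [f2] at n2
    have q1 : 0 ≤ q := nonneg_of_mul_nonneg_left n2 (by linarith)
    have q2 : q ≤ 0 := by nlinarith
    have : q = 0 := le_antisymm q2 q1
    rw [f1, this, zero_mul]
  have := Q.dvd_of_zero_zero h3 (key y (Q.F_self y)) (key (y + 1) (Q.F_succ y))
  obtain ⟨k, hk⟩ := this
  have hyx : ∀ j, Q.F j (Q.v x) = 0 → Q.F j (Q.v y) = 0 := by
    intro j hj
    rw [Q.zero] at hj ⊢
    rcases hj with ⟨m, hm⟩ | ⟨m, hm⟩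
    · left; exact ⟨m - k, by linarith⟩
    · right; exact ⟨m - k, by linarith⟩
  have e : Q.v x = Q.v y :=
    Q.ext x _ _ ((Q.F_self x).trans (hyx _ (Q.F_self x)).symm)
      ((Q.F_succ x).trans (hyx _ (Q.F_succ x)).symm)
  rw [e] at h1
  exact lt_irrefl _ h1

theorem v_inj {i j : ℤ} (h3 : 2 < n) (h : Q.v i = Q.v j) : (n : ℤ) ∣ i - j :=
  Q.dvd_of_zero_zero h3 (h ▸ Q.F_self i) (h ▸ Q.F_succ i)

/-- A polygon that meets few lines of a parallel class has few edges. -/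
theorem card_le {i : ℤ} (K : Finset ℤ) (hK : ∀ j, Q.F i (Q.v j) ∈ K) : n ≤ 2 * K.card := by
  by_contra hcon
  rcases Nat.lt_or_ge 2 n with h3 | h3
  · obtain ⟨c, hc, hlt⟩ := Finset.exists_lt_card_fiber_of_mul_lt_card_of_maps_to
      (s := Finset.range n) (t := K) (f := fun j => Q.F i (Q.v (j : ℤ))) (n := 2)
      (fun j _ => hK j) (by rw [Finset.card_range]; omega)
    set S := (Finset.range n).filter fun j : ℕ => Q.F i (Q.v (j : ℤ)) = c with hS
    have hinj : Set.InjOn (fun j : ℕ => Q.F (i + 1) (Q.v (j : ℤ))) S := by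
      intro x hx y hy hxy
      rw [hS, Finset.mem_coe, Finset.mem_filter, Finset.mem_range] at hx hy
      have := Q.v_inj h3 (Q.ext i _ _ (hx.2.trans hy.2.symm) hxy)
      obtain ⟨k, hk⟩ := this
      have h5 : (x : ℤ) < n := by exact_mod_cast hx.1
      have h6 : (y : ℤ) < n := by exact_mod_cast hy.1
      have : k = 0 := by
        by_contra hk0
        rcases lt_or_gt_of_ne hk0 with h | h <;> nlinarith
      rw [this] at hk
      omega
    have hcard : 2 < (S.image fun j : ℕ => Q.F (i + 1) (Q.v (j : ℤ))).card := by
      rw [Finset.card_image_of_injOn hinj]; exact hlt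
    obtain ⟨a, ha, b, hb, c', hc', hab, hbc⟩ : ∃ a ∈ (S.image fun j : ℕ => Q.F (i + 1) (Q.v (j : ℤ))),
        ∃ b ∈ (S.image fun j : ℕ => Q.F (i + 1) (Q.v (j : ℤ))),
        ∃ c ∈ (S.image fun j : ℕ => Q.F (i + 1) (Q.v (j : ℤ))), a < b ∧ b < c := by
      obtain ⟨a, b, c, ha, hb, hc, hab, hac, hbc⟩ := Finset.two_lt_card_iff.1 hcard
      rcases lt_or_gt_of_ne hab with h1 | h1 <;> rcases lt_or_gt_of_ne hac with h2 | h2 <;>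
        rcases lt_or_gt_of_ne hbc with h3 | h3
      · exact ⟨a, ha, b, hb, c, hc, h1, h3⟩
      · exact ⟨a, ha, c, hc, b, hb, h2, h3⟩
      · omega
      · exact ⟨c, hc, a, ha, b, hb, h2, h1⟩
      · exact ⟨b, hb, a, ha, c, hc, h1, h2⟩
      · omega
      · exact ⟨b, hb, c, hc, a, ha, h3, h2⟩
      · exact ⟨c, hc, b, hb, a, ha, h3, h1⟩
    obtain ⟨x, hx, rfl⟩ := Finset.mem_image.1 ha
    obtain ⟨y, hy, rfl⟩ := Finset.mem_image.1 hb
    obtain ⟨z, hz, rfl⟩ := Finset.mem_image.1 hc'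
    rw [hS, Finset.mem_filter] at hx hy hz
    exact Q.no_between h3 (hx.2.trans hy.2.symm) (hy.2.trans hz.2.symm) hab hbc
  · have h0 := Finset.card_pos.2 ⟨_, hK 0⟩
    omega

/-- The vertices lie on two parallel lines, and a line contains at most two of them. -/
theorem le_four_of_le_one {i : ℤ} (h : ∀ j, Q.F i (Q.v j) ≤ 1) : n ≤ 4 := by
  have := Q.card_le (i := i) (Finset.Icc 0 1) fun j => Finset.mem_Icc.2 ⟨Q.nonneg _ _, h j⟩
  simpa using this

theorem le_six_of_le_two {i : ℤ} (h : ∀ j, Q.F i (Q.v j) ≤ 2) : n ≤ 6 := by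
  have := Q.card_le (i := i) (Finset.Icc 0 2) fun j => Finset.mem_Icc.2 ⟨Q.nonneg _ _, h j⟩
  simpa using this

theorem not_zero_zero {i j : ℤ} (h : 4 < n) (h1 : Q.F i (Q.v j) = 0)
    (h2 : Q.F (i + 2) (Q.v j) = 0) (h3 : Q.F (i + 1) (Q.v j) ≠ 0) : False := by
  rw [Ne, Q.zero] at h3
  rw [Q.zero] at h1 h2
  push Not at h3
  have h' : (4 : ℤ) < n := by exact_mod_cast h
  have hd : ∀ m : ℤ, 0 < m → m ≤ 4 → ¬ (n : ℤ) ∣ m := fun m hm hm4 hdvd => by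
    have := Int.le_of_dvd hm hdvd
    omega
  rcases h1 with h1 | h1
  · apply h3.2; rw [show i + 1 - j - 1 = i - j by ring]; exact h1
  · rcases h2 with h2 | h2
    · exact hd 3 (by norm_num) (by norm_num) (by
        have := dvd_sub h2 h1
        rwa [show i + 2 - j - (i - j - 1) = 3 by ring] at this)
    · apply h3.1; rw [show i + 1 - j = i + 2 - j - 1 by ring]; exact h2

theorem nonneg_line (i j : ℤ) : Q.F i (Q.v j) + Q.a (i + 1) * Q.F (i + 1) (Q.v j) ≤ Q.l (i + 1) := by
  have := Q.nonneg (i + 2) j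
  rw [Q.recur] at this
  linarith

/-- In the row at height one over edge `i`, the two adjacent edges leave a segment of length `l i -
a i`. If it were at most one, either the vertices would lie on two parallel lines, giving at most
four edges, or `l = 2` and `a = 1`. In the latter case a vertex at height two would lie on the edges
before and after edge `i`, which are disjoint in a polygon with at least five edges. -/
theorem two_le_sub (h5 : 4 < n) (i : ℤ) : 2 ≤ Q.l i - Q.a i := by
  obtain ⟨i, rfl⟩ : ∃ j, i = j + 1 := ⟨i - 1, by ring⟩
  by_contra hcon
  have hl := Q.l_pos (i + 1)
  by_cases h1 : Q.l (i + 1) = 1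
  · rcases eq_or_lt_of_le (show 0 ≤ Q.a (i + 1) by omega) with h0 | h0
    · have := Q.le_four_of_le_one (i := i) fun j => by
        have := Q.nonneg_line i j
        rw [← h0] at this
        linarith
      omega
    · have := Q.le_four_of_le_one (i := i + 1) fun j => by
        have h1 := Q.nonneg_line i j
        have h2 := Q.nonneg i j
        have h3 := Q.nonneg (i + 1) j
        nlinarith
      omega
  · have : ∃ j, 2 ≤ Q.F (i + 1) (Q.v j) := by
      by_contra hc
      push Not at hc
      have := Q.le_four_of_le_one (i := i + 1) fun j => by have := hc j; omega
      omega
    obtain ⟨j, hj⟩ := this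
    have h1 := Q.nonneg_line i j
    have h2 := Q.nonneg i j
    have ha : 1 ≤ Q.a (i + 1) := by omega
    have h2a : 2 * Q.a (i + 1) ≤ Q.a (i + 1) * Q.F (i + 1) (Q.v j) := by nlinarith
    have h3 : Q.a (i + 1) = 1 := by omega
    have h4 : Q.l (i + 1) = 2 := by omega
    rw [h3, h4] at h1
    have h5' : Q.F i (Q.v j) = 0 := by omega
    have h6 : Q.F (i + 1) (Q.v j) = 2 := by omega
    refine Q.not_zero_zero h5 h5' ?_ (by omega)
    rw [Q.recur, h3, h4, h5', h6]; norm_num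

/-- The lattice points in the first row over an edge are interior. -/
theorem interior_row (h5 : 4 < n) {i : ℤ} {b : β} (h1 : 1 ≤ Q.F i b)
    (h2 : Q.F i b ≤ Q.l (i + 1) - Q.a (i + 1) - 1) (h3 : Q.F (i + 1) b = 1) : Q.Interior b := by
  intro j
  have hL := Q.two_le_sub h5 (i + 1)
  obtain ⟨p, q, c, h⟩ := Q.affine i j
  have hvi := h (Q.v i)
  rw [Q.F_self, Q.F_succ] at hvi
  have hc : 0 ≤ c := by have := Q.nonneg j i; linarith
  obtain ⟨i', rfl⟩ : ∃ i', i = i' + 1 := ⟨i - 1, by ring⟩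
  have hm := h (Q.v i')
  have hm1 : Q.F (i' + 1) (Q.v i') = 0 := Q.F_succ i'
  have hm2 : 0 < Q.F (i' + 1 + 1) (Q.v i') := by
    refine lt_of_le_of_ne (Q.nonneg _ _) fun h0 => ?_
    obtain ⟨k, hk⟩ := Q.dvd_of_zero_zero (by omega) hm1 h0.symm
    have hk' : (n : ℤ) ∣ 1 := ⟨k, by linarith⟩
    have := Int.le_of_dvd (by norm_num) hk'
    omega
  have hm3 := Q.nonneg j i'
  rw [hm, hm1] at hm3
  have hp := h (Q.v (i' + 1 + 1))
  have hp1 := Q.F_v_succ (i' + 1)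
  have hp2 := Q.F_self (i' + 1 + 1)
  have hp3 := Q.nonneg j (i' + 1 + 1)
  rw [hp, hp1, hp2] at hp3
  have hs := h (Q.v (i' + 1 + 2))
  have hs1 := Q.F_self (i' + 1 + 2)
  rw [Q.recur] at hs1
  have hs2 := Q.F_v_succ (i' + 1 + 1)
  rw [show i' + 1 + 1 + 1 = i' + 1 + 2 by ring] at hs2
  rw [hs2] at hs1
  have hs3 := Q.nonneg j (i' + 1 + 2)
  rw [hs, hs2] at hs3
  have hlp := Q.l_pos (i' + 1 + 2)
  set X := Q.F (i' + 1) b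
  set l := Q.l (i' + 1 + 1)
  set a := Q.a (i' + 1 + 1)
  set m := Q.l (i' + 1 + 2)
  have hX' : Q.F (i' + 1) (Q.v (i' + 1 + 2)) = l - a * m := by linarith
  rw [hX'] at hs3
  -- The values of `F j` at the two ends `(0, 1)` and `(l - a, 1)` of the row. They are nonnegative
  -- because these points lie on the sides of the polygon that leave the ends of the bottom edge, or
  -- at ends of those sides.
  have e1 : 0 ≤ q + c := by nlinarith
  have e2 : 0 ≤ p * (l - a) + q + c := by
    have : 0 ≤ m * (p * (l - a) + q + c) := by nlinarith
    exact nonneg_of_mul_nonneg_right this hlp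
  have e3 := h b
  rw [h3] at e3
  have e4 : 0 ≤ Q.F j b ∧ (Q.F j b = 0 → p = 0 ∧ q = -c) := by
    have hXpos : 0 < X := h1
    have hXL : 0 < l - a - X := by omega
    have e5 : (l - a) * Q.F j b = X * (p * (l - a) + q + c) + (l - a - X) * (q + c) := by
      rw [e3]; ring
    constructor
    · have : 0 ≤ (l - a) * Q.F j b := by rw [e5]; positivity
      exact nonneg_of_mul_nonneg_right this (by omega)
    · intro h0
      rw [h0, mul_zero] at e5
      have t1 : 0 ≤ X * (p * (l - a) + q + c) := by positivity
      have t2 : 0 ≤ (l - a - X) * (q + c) := by positivity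
      have t3 : X * (p * (l - a) + q + c) = 0 := by linarith
      have t4 : (l - a - X) * (q + c) = 0 := by linarith
      have t5 := (mul_eq_zero.1 t3).resolve_left hXpos.ne'
      have t6 := (mul_eq_zero.1 t4).resolve_left hXL.ne'
      have t7 : p * (l - a) = 0 := by linarith
      exact ⟨(mul_eq_zero.1 t7).resolve_right (by omega), by linarith⟩
  -- If `F j` vanished at an inner point of the row, it would vanish on the whole row and be `c`
  -- times one minus the height. All vertices would then have height at most one, which is
  -- impossible with five edges.
  refine lt_of_le_of_ne e4.1 fun h0 => ?_
  obtain ⟨rfl, rfl⟩ := e4.2 h0.symm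
  have hcne : c ≠ 0 := by
    rintro rfl
    obtain ⟨k, hk⟩ := Q.exists_pos j
    rw [h] at hk
    simp at hk
  have := Q.le_four_of_le_one (i := i' + 1 + 1) fun k => by
    have hk := Q.nonneg j k
    rw [h] at hk
    have hcp : 0 < c := by omega
    nlinarith
  omega

theorem exists_interior (h5 : 4 < n) (i : ℤ) :
    ∃ b, Q.F i b = 1 ∧ Q.F (i + 1) b = 1 ∧ Q.Interior b := by
  obtain ⟨b, h1, h2⟩ := Q.surj i 1 1
  have := Q.two_le_sub h5 (i + 1)
  exact ⟨b, h1, h2, Q.interior_row h5 (by omega) (by omega) h2⟩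

/-- If all the edges have defect zero, the interior point in a corner lies in all the corners. -/
theorem F_add_two_of_defect {i : ℤ} (h : ∀ i, Q.l i - Q.a i = 2) (b : β) :
    Q.F (i + 2) b = Q.l (i + 1) - Q.F i b - (Q.l (i + 1) - 2) * Q.F (i + 1) b := by
  rw [Q.recur, show Q.a (i + 1) = Q.l (i + 1) - 2 by linarith [h (i + 1)]]

/-- A row at height one has `l - a - 1` inner lattice points, so one with `l - a ≥ 4` suffices. If
the largest value is three, two points of one row would have to serve as the corner points of all
corners; going around the polygon yields a parallel edge and at most six edges. If all values are
two, either all lengths are one and the edge functions have period six, or a long edge confines the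
polygon to a strip of width two. -/
theorem exists_three_interior (h7 : 6 < n) : ∃ b₁ b₂ b₃, Q.Interior b₁ ∧ Q.Interior b₂ ∧
    Q.Interior b₃ ∧ b₁ ≠ b₂ ∧ b₁ ≠ b₃ ∧ b₂ ≠ b₃ := by
  have h5 : 4 < n := by omega
  by_contra hcon
  by_cases h4 : ∃ i, 4 ≤ Q.l i - Q.a i
  · obtain ⟨i, hi⟩ := h4
    obtain ⟨i, rfl⟩ : ∃ j, i = j + 1 := ⟨i - 1, by ring⟩
    obtain ⟨b₁, x1, y1⟩ := Q.surj i 1 1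
    obtain ⟨b₂, x2, y2⟩ := Q.surj i 2 1
    obtain ⟨b₃, x3, y3⟩ := Q.surj i 3 1
    refine hcon ⟨b₁, b₂, b₃, Q.interior_row h5 (by omega) (by omega) y1,
      Q.interior_row h5 (by omega) (by omega) y2, Q.interior_row h5 (by omega) (by omega) y3,
      ?_, ?_, ?_⟩ <;> rintro rfl <;> omega
  push Not at h4
  by_cases h3 : ∃ i, Q.l i - Q.a i = 3
  · obtain ⟨i, hi⟩ := h3
    obtain ⟨i, rfl⟩ : ∃ j, i = j + 1 := ⟨i - 1, by ring⟩
    obtain ⟨p₁, x1, y1⟩ := Q.surj i 1 1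
    obtain ⟨p₂, x2, y2⟩ := Q.surj i 2 1
    have hi1 := Q.interior_row h5 (by omega) (by omega) y1
    have hi2 := Q.interior_row h5 (by omega) (by omega) y2
    have hne : p₁ ≠ p₂ := by rintro rfl; omega
    have hall : ∀ b, Q.Interior b → b = p₁ ∨ b = p₂ := by
      intro b hb
      by_contra hc
      push Not at hc
      exact hcon ⟨p₁, p₂, b, hi1, hi2, hb, hne, hc.1.symm, hc.2.symm⟩
    choose q hq using fun j => Q.exists_interior h5 j
    have hq0 : q (i + 1) = p₂ := by
      refine Q.ext (i + 1) _ _ ((hq _).1.trans y2.symm) ((hq _).2.1.trans ?_)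
      rw [show i + 1 + 1 = i + 2 by ring, Q.recur, x2, y2]
      linarith
    have hqn : q (i + n) = p₁ := by
      refine Q.ext i _ _ ?_ ?_
      · rw [x1, ← Q.F_period]; exact (hq _).1
      · rw [y1, ← Q.F_period, show i + 1 + (n : ℤ) = i + n + 1 by ring]; exact (hq _).2.1
    -- Around the polygon the corner points start with `p₂` and end with `p₁`. If there are no other
    -- interior points, they change from `p₂` to `p₁` between two consecutive corners, and both
    -- points are then at height one over the edge `j + 1` between these corners.
    obtain ⟨k, hk1, hk2⟩ : ∃ k : ℕ, q (i + 1 + k) = p₂ ∧ q (i + 1 + k + 1) = p₁ := by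
      by_contra hc
      push Not at hc
      have : ∀ k : ℕ, q (i + 1 + k) = p₂ := by
        intro k
        induction k with
        | zero => simpa using hq0
        | succ k ih =>
          have h1 := hc k ih
          push_cast
          rw [← add_assoc]
          exact (hall _ (hq _).2.2).resolve_left h1
      have h1 := this (n - 1)
      rw [Nat.cast_sub (by omega), show i + 1 + ((n : ℤ) - (1 : ℕ)) = i + n by push_cast; ring,
        hqn] at h1
      exact hne h1
    set j := i + 1 + (k : ℤ)
    have f1 : Q.F (j + 1) p₂ = 1 := hk1 ▸ (hq j).2.1
    have f2 : Q.F (j + 1) p₁ = 1 := hk2 ▸ (hq (j + 1)).1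
    have f3 : Q.F j p₂ = 1 := hk1 ▸ (hq j).1
    obtain ⟨p, r, e, h⟩ := Q.affine i (j + 1)
    have g1 := h p₁
    have g2 := h p₂
    rw [x1, y1, f2] at g1
    rw [x2, y2, f1] at g2
    obtain rfl : p = 0 := by linarith
    obtain rfl : r = 1 - e := by linarith
    have he := h (Q.v i)
    rw [Q.F_self, Q.F_succ] at he
    have he0 : 0 ≤ e := by have := Q.nonneg (j + 1) i; linarith
    -- The edge `j + 1` is parallel to the edge `i + 1`, with function `(1 - e) F + e`. For `e = 0`
    -- it is the same edge, which contradicts the position of `p₂`; for `e = 1` the function is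
    -- constant; for `e ≥ 2` the polygon has width at most two.
    rcases (show e = 0 ∨ e = 1 ∨ 2 ≤ e by omega) with rfl | rfl | he2
    · have z2 : Q.F (j + 1) (Q.v (i + 1)) = 0 := by rw [h, Q.F_self]; simp
      have z1 : Q.F (j + 1) (Q.v i) = 0 := by rw [h, Q.F_succ]; simp
      have hd : (n : ℤ) ∣ j - i := by
        rw [Q.zero] at z1 z2
        rcases z1 with z1 | z1
        · rcases z2 with z2 | z2
          · rwa [show j + 1 - (i + 1) = j - i by ring] at z2
          · have h9 := dvd_sub z1 z2
            rw [show j + 1 - i - (j + 1 - (i + 1) - 1) = 2 by ring] at h9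
            have := Int.le_of_dvd (by norm_num) h9
            omega
        · rwa [show j + 1 - i - 1 = j - i by ring] at z1
      rw [Q.F_emod j i hd, x2] at f3
      omega
    · have := h (Q.v (j + 1))
      rw [Q.F_self] at this
      norm_num at this
    · have := Q.le_six_of_le_two (i := i + 1) fun m => by
        have hm := Q.nonneg (j + 1) m
        rw [h] at hm
        nlinarith
      omega
  · push Not at h3
    have h2 : ∀ i, Q.l i - Q.a i = 2 := by
      intro i
      have e1 := Q.two_le_sub h5 i
      have e2 := h4 i
      have e3 := h3 i
      omega
    by_cases hl : ∀ i, Q.l i = 1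
    · have key : ∀ i b, Q.F (i + 3) b = 2 - Q.F i b := by
        intro i b
        have e1 := Q.F_add_two_of_defect h2 (i := i) b
        have e2 := Q.F_add_two_of_defect h2 (i := i + 1) b
        rw [hl] at e1 e2
        rw [show i + 1 + 2 = i + 3 by ring, show i + 1 + 1 = i + 2 by ring] at e2
        linarith
      have z : Q.F 6 (Q.v 0) = 0 := by
        have e1 := key 3 (Q.v 0)
        have e2 := key 0 (Q.v 0)
        rw [Q.F_self] at e2
        norm_num at e1 e2
        linarith
      rw [Q.zero] at z
      rcases z with z | z <;> have := Int.le_of_dvd (by norm_num) z <;> omega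
    · push Not at hl
      obtain ⟨i, hi⟩ := hl
      obtain ⟨i, rfl⟩ : ∃ j, i = j + 1 := ⟨i - 1, by ring⟩
      have hlp := Q.l_pos (i + 1)
      have ha := h2 (i + 1)
      rcases (show Q.l (i + 1) = 2 ∨ Q.l (i + 1) = 3 ∨ 4 ≤ Q.l (i + 1) by omega) with e | e | e
      · have := Q.le_six_of_le_two (i := i) fun j => by
          have := Q.nonneg_line i j
          rw [show Q.a (i + 1) = 0 by omega] at this
          linarith
        omega
      · have ha1 : Q.a (i + 1) = 1 := by omega
        have := Q.le_six_of_le_two (i := i + 1) fun j => by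
          by_contra hc
          have hj := Q.nonneg_line i j
          have hj0 := Q.nonneg i j
          rw [ha1, e] at hj
          refine Q.not_zero_zero h5 (i := i) (j := j) (by omega) ?_ (by omega)
          rw [Q.recur, ha1, e]
          omega
        omega
      · have := Q.le_six_of_le_two (i := i + 1) fun j => by
          have hj := Q.nonneg_line i j
          have hj0 := Q.nonneg i j
          have hj1 := Q.nonneg (i + 1) j
          by_contra hc
          have : 3 * Q.a (i + 1) ≤ Q.a (i + 1) * Q.F (i + 1) (Q.v j) := by nlinarith
          omega
        omega

end SmoothPolygon


namespace SmoothPolygon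

variable {β : Type*}

/-! ### Smooth pentagons -/

section Pentagon

variable (Q : SmoothPolygon 5 β)

/-- The function of edge `i + 3` is reached from edges `i` and `i + 1` by going around in either
direction. Comparing the two expressions at `(0,0)`, `(1,0)` and `(0,1)` gives the relations. -/
theorem pentagon_relations (i : ℤ) : Q.a (i + 2) = -1 + Q.a (i + 4) * Q.a i ∧
    Q.a (i + 2) * Q.a (i + 1) = 1 + Q.a (i + 4) ∧
    Q.l (i + 2) - Q.a (i + 2) * Q.l (i + 1) = Q.l (i + 4) - Q.a (i + 4) * Q.l i := by
  have key : ∀ b, Q.l (i + 2) - Q.F (i + 1) b -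
      Q.a (i + 2) * (Q.l (i + 1) - Q.F i b - Q.a (i + 1) * Q.F (i + 1) b) =
      Q.l (i + 4) - Q.F i b - Q.a (i + 4) * (Q.l i - Q.F (i + 1) b - Q.a i * Q.F i b) := by
    intro b
    have e1 := Q.recur i b
    have e2 := Q.recur (i + 1) b
    have e3 := Q.recur (i + 3) b
    have e4 := Q.recur (i + 4) b
    have p0 := congrFun (Q.F_period i) b
    have p1 := congrFun (Q.F_period (i + 1)) b
    have pl := Q.l_period i
    have pa := Q.a_period i
    push_cast at p0 p1 pl pa
    rw [show i + 1 + 2 = i + 3 by ring, show i + 1 + 1 = i + 2 by ring] at e2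
    rw [show i + 3 + 2 = i + 5 by ring, show i + 3 + 1 = i + 4 by ring, p0] at e3
    rw [show i + 4 + 2 = i + 1 + 5 by ring, show i + 4 + 1 = i + 5 by ring, pl, pa, p0, p1] at e4
    rw [← e1, ← e2]
    have e4' : Q.F (i + 4) b = Q.l i - Q.F (i + 1) b - Q.a i * Q.F i b := by linarith
    rw [← e4']
    linarith
  obtain ⟨b0, x0, y0⟩ := Q.surj i 0 0
  obtain ⟨b1, x1, y1⟩ := Q.surj i 1 0
  obtain ⟨b2, x2, y2⟩ := Q.surj i 0 1
  have k0 := key b0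
  have k1 := key b1
  have k2 := key b2
  rw [x0, y0] at k0
  rw [x1, y1] at k1
  rw [x2, y2] at k2
  refine ⟨?_, ?_, ?_⟩ <;> linarith

/-- A smooth pentagon has at least two edges of length greater than one. -/
theorem pentagon_two_long (i : ℤ) : 2 ≤ Q.l (i + 1) ∨ 2 ≤ Q.l (i + 2) ∨ 2 ≤ Q.l (i + 3) ∨
    2 ≤ Q.l (i + 4) := by
  by_contra hcon
  push Not at hcon
  obtain ⟨c1, c2, c3, c4⟩ := hcon
  obtain ⟨-, h2, h3⟩ := Q.pentagon_relations (i - 1)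
  have q1 := Q.l_pos (i + 1)
  have q3 := Q.l_pos (i + 3)
  have q4 := Q.l_pos (i + 4)
  have pl := Q.l_period (i - 1)
  push_cast at pl
  rw [show i - 1 + 5 = i + 4 by ring] at pl
  have ha := Q.two_le_sub (by norm_num) i
  rw [show i - 1 + 2 = i + 1 by ring, show i - 1 + 1 = i by ring,
    show i - 1 + 4 = i + 3 by ring] at h2 h3
  rw [← pl, show Q.l (i + 1) = 1 by omega, show Q.l (i + 3) = 1 by omega,
    show Q.l (i + 4) = 1 by omega] at h3
  have h4 : Q.a (i + 1) * (Q.a i - Q.l i) = 1 := by linarith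
  rcases Int.mul_eq_one_iff_eq_one_or_neg_one.1 h4 with h5 | h5 <;> omega

/-- The closing relation becomes `a (i + 4) * (a i - 2) = 2`. With `a ≤ l - 2` on every edge this
forces `a (i + 4) = -1` and `a i = 0`, and the other relations then make `a (i + 1)` zero although
it is at most `-1`. -/
theorem pentagon_not_alternating (i : ℤ) (h0 : Q.l i = 2) (h1 : Q.l (i + 1) = 1)
    (h2 : Q.l (i + 2) = 2) (h4 : Q.l (i + 4) = 1) : False := by
  obtain ⟨r1, r2, r3⟩ := Q.pentagon_relations i
  have a0 := Q.two_le_sub (by norm_num) i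
  have a1 := Q.two_le_sub (by norm_num) (i + 1)
  have a4 := Q.two_le_sub (by norm_num) (i + 4)
  rw [h0, h1, h2, h4] at r3
  have e : Q.a (i + 4) * (Q.a i - 2) = 2 := by linarith
  have e4 : -2 ≤ Q.a (i + 4) := by nlinarith
  rcases (show Q.a (i + 4) = -1 ∨ Q.a (i + 4) = -2 by omega) with e5 | e5
  · rw [show Q.a (i + 2) = -1 by linarith, e5] at r2
    omega
  · rw [e5] at e
    omega

/-- The relations and the bounds `a ≤ l - 2` determine all `a`. The pentagon is the square of side
two with one unit corner cut off. -/
theorem pentagon_adjacent (i : ℤ) (h0 : Q.l i = 2) (h1 : Q.l (i + 1) = 2) (h2 : Q.l (i + 2) = 1)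
    (h4 : Q.l (i + 4) = 1) (b : β) : Q.F (i + 2) b = 2 - Q.F i b ∧
    Q.F (i + 4) b = 2 - Q.F (i + 1) b ∧ Q.F (i + 3) b = 3 - Q.F i b - Q.F (i + 1) b := by
  obtain ⟨r1, r2, r3⟩ := Q.pentagon_relations i
  have a0 := Q.two_le_sub (by norm_num) i
  have a1 := Q.two_le_sub (by norm_num) (i + 1)
  have a4 := Q.two_le_sub (by norm_num) (i + 4)
  rw [h0, h1, h2, h4] at r3
  have e : Q.a (i + 2) * (Q.a (i + 1) - 1) = 1 := by linarith
  have e2 : Q.a (i + 2) = -1 := by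
    rcases Int.mul_eq_one_iff_eq_one_or_neg_one.1 e with h5 | h5 <;> omega
  have e1 : Q.a (i + 1) = 0 := by rw [e2] at e; omega
  have e4 : Q.a (i + 4) = -1 := by omega
  have e0 : Q.a i = 0 := by rw [e2, e4] at r1; omega
  have f2 := Q.recur i b
  have f3 := Q.recur (i + 1) b
  have f4 := Q.recur (i + 4) b
  have p0 := congrFun (Q.F_period i) b
  have p1 := congrFun (Q.F_period (i + 1)) b
  have pl := Q.l_period i
  have pa := Q.a_period i
  push_cast at p0 p1 pl pa
  rw [show i + 1 + 2 = i + 3 by ring, show i + 1 + 1 = i + 2 by ring] at f3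
  rw [show i + 4 + 2 = i + 1 + 5 by ring, show i + 4 + 1 = i + 5 by ring, pl, pa, p0, p1, e0,
    h0] at f4
  rw [e1, h1] at f2
  rw [e2, h2] at f3
  refine ⟨?_, ?_, ?_⟩ <;> linarith

end Pentagon

end SmoothPolygon


/-! ### The cyclic order of the neighbours of a vertex -/

section Cycle

variable {α : Type*} [DecidableEq α] {T : Finset (Finset α)}

theorem IsTri.ne_of_mem (h : IsTri T) {x y z : α} (ht : {x, y, z} ∈ T) : x ≠ y ∧ x ≠ z ∧ y ≠ z := by
  have h3 := h.card _ ht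
  refine ⟨?_, ?_, ?_⟩ <;> rintro rfl
  · rw [Finset.insert_eq_of_mem (Finset.mem_insert_self _ _)] at h3
    have := Finset.card_le_two (a := x) (b := z)
    omega
  · rw [Finset.insert_eq_of_mem (by simp)] at h3
    have := Finset.card_le_two (a := y) (b := x)
    omega
  · rw [Finset.insert_eq_of_mem (Finset.mem_singleton_self _)] at h3
    have := Finset.card_le_two (a := x) (b := y)
    omega

theorem insert_insert_inj {x y z z' : α} (hz : z ≠ x) (hz' : z ≠ y)
    (h : ({x, y, z} : Finset α) = {x, y, z'}) : z = z' := by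
  have : z ∈ ({x, y, z'} : Finset α) := h ▸ (by simp)
  simp only [Finset.mem_insert, Finset.mem_singleton] at this
  tauto

/-- An edge lies in two triangles only. -/
theorem IsTri.eq_of_three (h : IsTri T) {r y x z z' : α} (h1 : {r, y, x} ∈ T)
    (h2 : {r, y, z} ∈ T) (h3 : {r, y, z'} ∈ T) (hz : z ≠ x) (hz' : z' ≠ x) : z = z' := by
  by_contra hne
  obtain ⟨d1, d2, d3⟩ := h.ne_of_mem h1
  obtain ⟨e1, e2, e3⟩ := h.ne_of_mem h2
  obtain ⟨f1, f2, f3⟩ := h.ne_of_mem h3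
  have hp := h.pair r y d1 ⟨_, h1, by simp, by simp⟩
  have hsub : ({{r, y, x}, {r, y, z}, {r, y, z'}} : Finset (Finset α)) ⊆
      T.filter fun t => r ∈ t ∧ y ∈ t := by
    intro t ht
    simp only [Finset.mem_insert, Finset.mem_singleton] at ht
    rcases ht with rfl | rfl | rfl <;> simp [h1, h2, h3]
  have := Finset.card_le_card hsub
  rw [hp, Finset.card_insert_of_notMem, Finset.card_pair] at this
  · omega
  · exact fun e => hne (insert_insert_inj e2.symm e3.symm e)
  · simp only [Finset.mem_insert, Finset.mem_singleton]
    rintro (e | e)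
    · exact hz (insert_insert_inj d2.symm d3.symm e).symm
    · exact hz' (insert_insert_inj d2.symm d3.symm e).symm

theorem IsTri.exists_next (h : IsTri T) {r x y : α} (ht : {r, x, y} ∈ T) :
    ∃ z, z ≠ x ∧ {r, y, z} ∈ T := by
  obtain ⟨d1, d2, d3⟩ := h.ne_of_mem ht
  have hp := h.pair r y d2 ⟨_, ht, by simp, by simp⟩
  obtain ⟨t, ht', hne⟩ := Finset.exists_mem_ne
    (show 1 < (T.filter fun t => r ∈ t ∧ y ∈ t).card by rw [hp]; norm_num) ({r, x, y} : Finset α)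
  rw [Finset.mem_filter] at ht'
  obtain ⟨z, hz1, hz2, hz⟩ := exists_third (h.card t ht'.1) ht'.2.1 ht'.2.2 d2
  refine ⟨z, ?_, hz ▸ ht'.1⟩
  rintro rfl
  apply hne
  rw [hz]
  ext w; simp; tauto

/-- The link of `r` in `T` is connected. -/
def Tri.LinkConnected (T : Finset (Finset α)) (r : α) : Prop :=
  ∀ U : Finset α → Prop, (∃ t ∈ T, r ∈ t ∧ U t) →
    (∀ t ∈ T, r ∈ t → U t → ∀ t' ∈ T, r ∈ t' → (t ∩ t').card = 2 → U t') →
    ∀ t ∈ T, r ∈ t → U t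

/-- The neighbours of `r` in cyclic order, starting with `x` and `y`. -/
structure Tri.IsCycle (T : Finset (Finset α)) (r : α) (s : ℤ → α) : Prop where
  mem : ∀ i, {r, s i, s (i + 1)} ∈ T
  eq_iff : ∀ i j, s i = s j ↔ (Tri.deg T r : ℤ) ∣ i - j
  surj : ∀ t ∈ T, r ∈ t → ∃ i, t = {r, s i, s (i + 1)}

/-- Passing from `(x, y)` to `(y, z)`, with `z` the other third vertex at the edge `r y`, is a
permutation of the directed edges of the link. Its integer powers produce a sequence indexed by all
integers. -/
theorem IsTri.exists_seq (h : IsTri T) {r x y : α} (ht : {r, x, y} ∈ T) :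
    ∃ s : ℤ → α, s 0 = x ∧ s 1 = y ∧ (∀ i, {r, s i, s (i + 1)} ∈ T) ∧ ∀ i, s (i + 2) ≠ s i := by
  have hsw : ∀ {x y : α}, {r, x, y} ∈ T → {r, y, x} ∈ T := fun {x y} h => by
    rwa [Finset.pair_comm]
  choose! z hz1 hz2 using fun (x y : α) (h' : {r, x, y} ∈ T) => h.exists_next h'
  let X := {p : α × α // {r, p.1, p.2} ∈ T}
  let f : X → X := fun p => ⟨(p.1.2, z p.1.1 p.1.2), hz2 _ _ p.2⟩
  let g : X → X := fun p => ⟨(z p.1.2 p.1.1, p.1.1), hsw (hz2 _ _ (hsw p.2))⟩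
  have hgf : Function.LeftInverse g f := by
    rintro ⟨⟨x, y⟩, hp⟩
    have h1 := hz2 x y hp
    have h2 := hz1 x y hp
    have h3 := hz2 _ _ (hsw h1)
    have h4 := hz1 _ _ (hsw h1)
    exact Subtype.ext (Prod.ext (h.eq_of_three h1 h3 (hsw hp) h4 h2.symm) rfl)
  have hfg : Function.RightInverse g f := by
    rintro ⟨⟨x, y⟩, hp⟩
    have h1 := hz2 y x (hsw hp)
    have h2 := hz1 y x (hsw hp)
    have h3 := hz2 _ _ (hsw h1)
    have h4 := hz1 _ _ (hsw h1)
    exact Subtype.ext (Prod.ext rfl (h.eq_of_three h1 h3 hp h4 h2.symm))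
  let σ : Equiv.Perm X := ⟨f, g, hgf, hfg⟩
  let p0 : X := ⟨(x, y), ht⟩
  have hs : ∀ i : ℤ, ((σ ^ (i + 1)) p0).1 = (((σ ^ i) p0).1.2, z ((σ ^ i) p0).1.1 ((σ ^ i) p0).1.2) := by
    intro i
    rw [add_comm, zpow_add, zpow_one]; rfl
  refine ⟨fun i => ((σ ^ i) p0).1.1, rfl, ?_, ?_, ?_⟩
  · have := hs 0
    rw [zero_add] at this
    dsimp only; rw [this]; rfl
  · intro i
    dsimp only
    rw [hs]
    exact ((σ ^ i) p0).2
  · intro i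
    dsimp only
    rw [show i + 2 = i + 1 + 1 by ring, hs, hs]
    exact hz1 _ _ ((σ ^ i) p0).2

/-- The walk around `r` cannot return to a vertex in the opposite direction, because halfway a step
would have equal ends or turn back. Hence a term determines its neighbours, and the coincidences are
the congruences modulo one period. Connectedness makes the walk exhaust the link, so the period is
the number of neighbours. -/
theorem IsTri.exists_cycle (h : IsTri T) {r x y : α} (hconn : Tri.LinkConnected T r)
    (ht : {r, x, y} ∈ T) : ∃ s : ℤ → α, s 0 = x ∧ s 1 = y ∧ Tri.IsCycle T r s := by
  obtain ⟨s, s0, s1, hs, hs2⟩ := h.exists_seq ht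
  have hsw : ∀ {x y : α}, {r, x, y} ∈ T → {r, y, x} ∈ T := fun {x y} h => by
    rwa [Finset.pair_comm]
  have hne : ∀ i, s i ≠ s (i + 1) := fun i => (h.ne_of_mem (hs i)).2.2
  have hnext : ∀ i w, {r, s (i + 1), w} ∈ T → w = s i ∨ w = s (i + 2) := by
    intro i w hw
    by_contra hcon
    push Not at hcon
    have h2 := hs (i + 1)
    rw [show i + 1 + 1 = i + 2 by ring] at h2
    exact hcon.2 (h.eq_of_three (hsw (hs i)) hw h2 hcon.1 (hs2 i))
  -- the sequence never runs backwards
  have hrev : ∀ m : ℕ, (∀ i, s (i + m) = s i → s (i + m + 1) = s (i - 1) → False) ∧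
      ∀ i, s (i + (m + 1 : ℕ)) = s i → s (i + (m + 1 : ℕ) + 1) = s (i - 1) → False := by
    intro m
    induction m with
    | zero =>
      refine ⟨fun i _ h2 => ?_, fun i h1 _ => ?_⟩
      · have := hs2 (i - 1)
        rw [show i - 1 + 2 = i + (0 : ℕ) + 1 by push_cast; ring] at this
        exact this h2
      · exact hne i (by simpa using h1.symm)
    | succ m ih =>
      refine ⟨ih.2, fun i h1 h2 => ?_⟩
      have e := hnext (i + m + 1) (s (i + 1)) (by
        have := hs i
        rw [← h1] at this
        rwa [show i + (m : ℤ) + 1 + 1 = i + ((m + 1 + 1 : ℕ) : ℤ) by push_cast; ring])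
      have e' : s (i + 1) = s (i + m + 1) := by
        refine e.resolve_right fun h3 => ?_
        rw [show i + (m : ℤ) + 1 + 2 = i + ((m + 1 + 1 : ℕ) : ℤ) + 1 by push_cast; ring, h2] at h3
        have := hs2 (i - 1)
        rw [show i - 1 + 2 = i + 1 by ring] at this
        exact this h3
      refine ih.1 (i + 1) (by rw [e']; congr 1; ring) ?_
      rw [show i + 1 + (m : ℤ) + 1 = i + ((m + 1 + 1 : ℕ) : ℤ) by push_cast; ring, h1]
      congr 1; ring
  have hfwd : ∀ i j, s i = s j → s (i + 1) = s (j + 1) := by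
    have : ∀ i (m : ℕ), s (i + m) = s i → s (i + m + 1) = s (i + 1) := by
      intro i m hm
      have e := hnext (i - 1) (s (i + m + 1)) (by
        rw [show i - 1 + 1 = i by ring, ← hm]; exact hs _)
      rcases e with e | e
      · exact ((hrev m).1 i hm e).elim
      · rw [e]; congr 1; ring
    intro i j hij
    rcases le_total i j with h1 | h1
    · obtain ⟨m, rfl⟩ := Int.le.dest h1
      exact (this i m hij.symm).symm
    · obtain ⟨m, rfl⟩ := Int.le.dest h1
      exact this j m hij
  have hbwd : ∀ i j, s (i + 1) = s (j + 1) → s i = s j := by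
    intro i j hij
    have e := hfwd _ _ hij
    have h1 := hsw (hs j)
    rw [← hij] at h1
    rcases hnext i _ h1 with h2 | h2
    · exact h2.symm
    · exfalso
      rw [show i + 2 = i + 1 + 1 by ring, e] at h2
      exact hs2 j (by rw [show j + 2 = j + 1 + 1 by ring]; exact h2.symm)
  have hshift : ∀ d i j, s i = s j → s (i + d) = s (j + d) := by
    intro d
    induction d using Int.induction_on with
    | zero => intro i j hij; simpa using hij
    | succ k ih => intro i j hij; rw [← add_assoc, ← add_assoc]; exact hfwd _ _ (ih i j hij)
    | pred k ih =>
      intro i j hij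
      refine hbwd _ _ ?_
      rw [show i + (-(k : ℤ) - 1) + 1 = i + -(k : ℤ) by ring,
        show j + (-(k : ℤ) - 1) + 1 = j + -(k : ℤ) by ring]
      exact ih i j hij
  -- The periods form a subgroup of the integers, hence consist of the multiples of one number.
  let H : AddSubgroup ℤ :=
    { carrier := {d | s d = s 0}
      zero_mem' := rfl
      add_mem' := fun {a b} ha hb => by
        have := hshift b a 0 ha
        rw [zero_add] at this
        exact this.trans hb
      neg_mem' := fun {a} ha => by
        have := hshift (-a) a 0 ha
        rw [zero_add, add_neg_cancel] at this
        exact this.symm }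
  have hH : ∀ d, d ∈ H ↔ s d = s 0 := fun d => Iff.rfl
  obtain ⟨g, hg⟩ := Int.subgroup_cyclic H
  rw [← AddSubgroup.zmultiples_eq_closure] at hg
  have hiff : ∀ i j, s i = s j ↔ (g.natAbs : ℤ) ∣ i - j := by
    intro i j
    have h1 : s i = s j ↔ i - j ∈ H := by
      rw [hH]
      constructor
      · intro hij
        have := hshift (-j) i j hij
        rwa [← sub_eq_add_neg, ← sub_eq_add_neg, sub_self] at this
      · intro hij
        have := hshift j _ _ hij
        simpa using this
    rw [h1, hg, Int.mem_zmultiples_iff, Int.natAbs_dvd]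
  have hsurj : ∀ t ∈ T, r ∈ t → ∃ i, t = {r, s i, s (i + 1)} := by
    refine hconn _ ⟨_, hs 0, by simp, 0, rfl⟩ ?_
    rintro t htT hrt ⟨i, rfl⟩ t' ht' hrt' hcard
    obtain ⟨z, hz⟩ : ∃ z, z ∈ t' ∧ z ∈ ({s i, s (i + 1)} : Finset α) := by
      by_contra hcon
      push Not at hcon
      have : ({r, s i, s (i + 1)} : Finset α) ∩ t' ⊆ {r} := by
        intro w hw
        rw [Finset.mem_inter, Finset.mem_insert] at hw
        rcases hw.1 with h1 | h1
        · exact Finset.mem_singleton.2 h1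
        · exact (hcon w hw.2 h1).elim
      have := Finset.card_le_card this
      rw [Finset.card_singleton] at this
      omega
    obtain ⟨hzt, hz⟩ := hz
    rw [Finset.mem_insert, Finset.mem_singleton] at hz
    have hmain : ∀ k, s (k + 1) ∈ t' → ∃ i, t' = {r, s i, s (i + 1)} := by
      intro k hk
      obtain ⟨w, hw1, hw2, hw⟩ := exists_third (h.card t' ht') hrt' hk (h.ne_of_mem (hs k)).2.1
      rcases hnext k w (hw ▸ ht') with rfl | rfl
      · exact ⟨k, by rw [hw, Finset.pair_comm]⟩
      · exact ⟨k + 1, by rw [hw, show k + 2 = k + 1 + 1 by ring]⟩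
    rcases hz with rfl | rfl
    · exact hmain (i - 1) (by rwa [show i - 1 + 1 = i by ring])
    · exact hmain i hzt
  have hg0 : 0 < g.natAbs := by
    by_contra hcon
    have hg0 : g.natAbs = 0 := by omega
    have hinj : Function.Injective s := by
      intro i j hij
      rw [hiff, hg0] at hij
      simp at hij; omega
    have hmaps : ∀ i, s i ∈ Tri.verts T := fun i => Tri.mem_verts.2 ⟨_, hs i, by simp⟩
    exact not_injective_infinite_finite (fun i : ℤ => (⟨s i, hmaps i⟩ : Tri.verts T))
      fun i j hij => hinj (congrArg Subtype.val hij)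
  have hgdeg : g.natAbs = Tri.deg T r := by
    rw [← h.card_nbrs r]
    have : Tri.nbrs T r = (Finset.range g.natAbs).image fun i : ℕ => s i := by
      ext w
      rw [Tri.mem_nbrs, Finset.mem_image]
      constructor
      · rintro ⟨hw, t, ht, hrt, hwt⟩
        obtain ⟨i, rfl⟩ := hsurj t ht hrt
        have hw' : ∃ i, s i = w := by
          simp only [Finset.mem_insert, Finset.mem_singleton] at hwt
          rcases hwt with h1 | h1 | h1
          · exact absurd h1 hw
          · exact ⟨_, h1.symm⟩
          · exact ⟨_, h1.symm⟩
        obtain ⟨j, rfl⟩ := hw'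
        have hgp : (0 : ℤ) < g.natAbs := by exact_mod_cast hg0
        refine ⟨(j % g.natAbs).toNat, ?_, ?_⟩
        · rw [Finset.mem_range]
          have := Int.emod_lt_of_pos j hgp
          have := Int.emod_nonneg j hgp.ne'
          omega
        · rw [Int.toNat_of_nonneg (Int.emod_nonneg j hgp.ne'), hiff]
          have := Int.emod_add_mul_ediv j g.natAbs
          exact ⟨-(j / g.natAbs), by linarith⟩
      · rintro ⟨i, -, rfl⟩
        exact ⟨(h.ne_of_mem (hs i)).1.symm, _, hs i, by simp, by simp⟩
    rw [this, Finset.card_image_of_injOn, Finset.card_range]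
    intro i hi j hj hij
    rw [Finset.mem_coe, Finset.mem_range] at hi hj
    dsimp only at hij
    rw [hiff] at hij
    obtain ⟨k, hk⟩ := hij
    have h1 : (i : ℤ) < g.natAbs := by exact_mod_cast hi
    have h2 : (j : ℤ) < g.natAbs := by exact_mod_cast hj
    have : k = 0 := by
      by_contra hk0
      rcases lt_or_gt_of_ne hk0 with h | h <;> nlinarith
    rw [this] at hk
    omega
  exact ⟨s, s0, s1, hs, fun i j => by rw [hiff, hgdeg], hsurj⟩

theorem Tri.IsCycle.three_le {r : α} {s : ℤ → α} (h : IsTri T) (hs : Tri.IsCycle T r s)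
    (hr : r ∈ Tri.verts T) : 3 ≤ Tri.deg T r := by
  have h0 := Tri.deg_pos hr
  by_contra hcon
  rcases (show Tri.deg T r = 1 ∨ Tri.deg T r = 2 by omega) with h1 | h1
  · exact (h.ne_of_mem (hs.mem 0)).2.2 ((hs.eq_iff _ _).2 (by rw [h1]; simp))
  · have e : s 2 = s 0 := (hs.eq_iff _ _).2 (by rw [h1]; simp)
    have hsub : (T.filter fun t => r ∈ t) ⊆ {{r, s 0, s 1}} := by
      intro t ht
      rw [Finset.mem_filter] at ht
      obtain ⟨i, rfl⟩ := hs.surj t ht.1 ht.2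
      rw [Finset.mem_singleton]
      rcases Int.even_or_odd' i with ⟨k, rfl | rfl⟩
      · rw [(hs.eq_iff (2 * k) 0).2 (by rw [h1]; simp),
          (hs.eq_iff (2 * k + 1) 1).2 (by rw [h1]; simp)]
      · rw [(hs.eq_iff (2 * k + 1) 1).2 (by rw [h1]; simp),
          (hs.eq_iff (2 * k + 1 + 1) 0).2 (by rw [h1]; exact ⟨k + 1, by push_cast; ring⟩),
          Finset.pair_comm]
    have := Finset.card_le_card hsub
    rw [Finset.card_singleton] at this
    unfold Tri.deg at h1
    omega

end Cycle


namespace SmoothModel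

/-! ### Facet functions and lattice points -/

section General

variable {n : ℕ} (M : SmoothModel n)

/-- The lattice distance of `p` from the supporting hyperplane with normal `a`. -/
def phi (a p : Fin n → ℤ) : ℤ := a ⬝ᵥ p - M.V.inf' M.nonempty fun v => a ⬝ᵥ v

theorem phi_nonneg (a : Fin n → ℤ) {v : Fin n → ℤ} (hv : v ∈ M.V) : 0 ≤ M.phi a v :=
  sub_nonneg.2 (Finset.inf'_le _ hv)

theorem phi_eq {v a : Fin n → ℤ} (hv : v ∈ M.V) (ha : a ∈ M.t v) (p : Fin n → ℤ) :
    M.phi a p = a ⬝ᵥ p - a ⬝ᵥ v := by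
  unfold phi
  congr 1
  exact le_antisymm (Finset.inf'_le _ hv) (Finset.le_inf' _ _ fun w hw => M.le v hv a ha w hw)

theorem phi_self {v a : Fin n → ℤ} (hv : v ∈ M.V) (ha : a ∈ M.t v) : M.phi a v = 0 := by
  rw [M.phi_eq hv ha, sub_self]

theorem mem_verts {a : Fin n → ℤ} : a ∈ Tri.verts M.T ↔ ∃ v ∈ M.V, a ∈ M.t v := by
  rw [Tri.mem_verts]
  constructor
  · rintro ⟨t, ht, hat⟩
    obtain ⟨v, hv, rfl⟩ := M.mem_T.1 ht
    exact ⟨v, hv, hat⟩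
  · rintro ⟨v, hv, ha⟩
    exact ⟨_, M.t_mem_T hv, ha⟩

theorem phi_eq_zero {v a : Fin n → ℤ} (hv : v ∈ M.V) (ha : a ∈ Tri.verts M.T) :
    M.phi a v = 0 ↔ a ∈ M.t v := by
  refine ⟨fun h => ?_, M.phi_self hv⟩
  obtain ⟨w, hw, haw⟩ := M.mem_verts.1 ha
  rw [M.phi_eq hw haw] at h
  exact M.mem_t_of_dot_eq hw haw hv (by linarith)

theorem phi_sub (a p q : Fin n → ℤ) : M.phi a p - M.phi a q = a ⬝ᵥ p - a ⬝ᵥ q := by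
  unfold phi; ring

theorem phi_expand {v : Fin n → ℤ} (hv : v ∈ M.V) (a p : Fin n → ℤ) :
    M.phi a p = M.phi a v + ∑ b ∈ M.t v, (a ⬝ᵥ M.E v b) * M.phi b p := by
  rw [Finset.sum_congr rfl fun b hb => by rw [M.phi_eq hv hb], ← M.dot_sub_int hv]
  have := M.phi_sub a p v
  linarith

/-- The lattice points of the polytope, as solutions of inequalities. -/
def IsPt (p : Fin n → ℤ) : Prop := ∀ a ∈ Tri.verts M.T, 0 ≤ M.phi a p

theorem isPt_iff (p : Fin n → ℤ) : M.IsPt p ↔ latticePt p ∈ M.body := by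
  rw [M.mem_body_iff]
  constructor
  · intro h v hv a ha
    have := h a (M.mem_verts.2 ⟨v, hv, ha⟩)
    rw [M.phi_eq hv ha] at this
    rw [latticePt_dot, latticePt_dot]
    exact_mod_cast (by linarith : a ⬝ᵥ v ≤ a ⬝ᵥ p)
  · intro h a ha
    obtain ⟨v, hv, hav⟩ := M.mem_verts.1 ha
    have := h v hv a hav
    rw [latticePt_dot, latticePt_dot] at this
    have h' : a ⬝ᵥ v ≤ a ⬝ᵥ p := by exact_mod_cast this
    rw [M.phi_eq hv hav]
    linarith

theorem isPt_of_mem {v : Fin n → ℤ} (hv : v ∈ M.V) : M.IsPt v := fun a _ => M.phi_nonneg a hv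

theorem finite_pts : {p | M.IsPt p}.Finite := by
  refine (Set.finite_Icc (fun i => M.V.inf' M.nonempty fun v => v i)
    (fun i => M.V.sup' M.nonempty fun v => v i)).subset ?_
  intro p hp
  have hp' := (M.isPt_iff p).1 hp
  constructor <;> intro i
  · have h1 := M.dot_le_body (u := Pi.single i 1)
      (c := ((M.V.inf' M.nonempty fun v => v i : ℤ) : ℝ)) (fun w hw => by
        rw [single_dotProduct, one_mul, latticePt_apply]
        exact_mod_cast Finset.inf'_le (fun v : Fin n → ℤ => v i) hw) hp'
    rw [single_dotProduct, one_mul, latticePt_apply] at h1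
    exact_mod_cast h1
  · have h1 := M.dot_le_body (u := Pi.single i (-1))
      (c := -((M.V.sup' M.nonempty fun v => v i : ℤ) : ℝ)) (fun w hw => by
        rw [single_dotProduct, neg_one_mul, latticePt_apply, neg_le_neg_iff]
        exact_mod_cast Finset.le_sup' (fun v : Fin n → ℤ => v i) hw) hp'
    rw [single_dotProduct, neg_one_mul, latticePt_apply, neg_le_neg_iff] at h1
    exact_mod_cast h1

/-- The lattice points of the polytope. -/
noncomputable def pts : Finset (Fin n → ℤ) := M.finite_pts.toFinset

theorem mem_pts {p : Fin n → ℤ} : p ∈ M.pts ↔ M.IsPt p := by simp [pts]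

theorem card_pts_le {N : ℕ} (h : {z | latticePt z ∈ M.body}.encard ≤ N) : M.pts.card ≤ N := by
  have : {z | latticePt z ∈ M.body} = (M.pts : Set (Fin n → ℤ)) := by
    ext z
    rw [Finset.mem_coe, mem_pts, isPt_iff]; rfl
  rw [this, Set.encard_coe_eq_coe_finsetCard] at h
  exact_mod_cast h

/-- The facets on which a point lies. -/
def tight (p : Fin n → ℤ) : Finset (Fin n → ℤ) := (Tri.verts M.T).filter fun a => M.phi a p = 0

theorem mem_tight {a p : Fin n → ℤ} : a ∈ M.tight p ↔ a ∈ Tri.verts M.T ∧ M.phi a p = 0 :=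
  Finset.mem_filter

theorem tight_of_mem {v : Fin n → ℤ} (hv : v ∈ M.V) : M.tight v = M.t v := by
  ext a
  rw [mem_tight]
  constructor
  · rintro ⟨ha, h⟩; exact (M.phi_eq_zero hv ha).1 h
  · intro ha; exact ⟨M.mem_verts.2 ⟨v, hv, ha⟩, M.phi_self hv ha⟩

/-- The lattice points in the relative interior of the face cut out by the facets in `S`. -/
noncomputable def cell (S : Finset (Fin n → ℤ)) : Finset (Fin n → ℤ) :=
  M.pts.filter fun p => M.tight p = S

theorem mem_cell {S : Finset (Fin n → ℤ)} {p : Fin n → ℤ} :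
    p ∈ M.cell S ↔ M.IsPt p ∧ M.tight p = S := by
  rw [cell, Finset.mem_filter, mem_pts]

/-- The vertices, the lattice points in the relative interiors of some faces of positive dimension,
and further lattice points. -/
theorem card_add_sum_cell_add_le (A : Finset (Finset (Fin n → ℤ))) (hA : ∀ S ∈ A, S.card < n)
    (X : Finset (Fin n → ℤ)) (hX : ∀ p ∈ X, M.IsPt p ∧ p ∉ M.V ∧ M.tight p ∉ A) :
    M.V.card + ∑ S ∈ A, (M.cell S).card + X.card ≤ M.pts.card := by
  classical
  rw [← Finset.card_biUnion, ← Finset.card_union_of_disjoint, ← Finset.card_union_of_disjoint]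
  · refine Finset.card_le_card ?_
    intro p hp
    rw [Finset.mem_union, Finset.mem_union, Finset.mem_biUnion] at hp
    rw [mem_pts]
    rcases hp with (hp | ⟨S, -, hp⟩) | hp
    · exact M.isPt_of_mem hp
    · exact (M.mem_cell.1 hp).1
    · exact (hX p hp).1
  · rw [Finset.disjoint_left]
    intro p hp hpX
    rcases Finset.mem_union.1 hp with hp | hp
    · exact (hX p hpX).2.1 hp
    · obtain ⟨S, hS, hpS⟩ := Finset.mem_biUnion.1 hp
      exact (hX p hpX).2.2 ((M.mem_cell.1 hpS).2 ▸ hS)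
  · rw [Finset.disjoint_left]
    intro v hv hv'
    obtain ⟨S, hS, hvS⟩ := Finset.mem_biUnion.1 hv'
    have h1 := (M.mem_cell.1 hvS).2
    rw [M.tight_of_mem hv] at h1
    have := hA S hS
    rw [← h1, (M.dual v hv).card] at this
    exact lt_irrefl _ this
  · intro S _ S' _ hne
    rw [Function.onFun, Finset.disjoint_left]
    intro p hp hp'
    exact hne ((M.mem_cell.1 hp).2.symm.trans (M.mem_cell.1 hp').2)

theorem phi_add_smul (a p e : Fin n → ℤ) (k : ℤ) :
    M.phi a (p + k • e) = M.phi a p + k * (a ⬝ᵥ e) := by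
  unfold phi
  rw [dotProduct_add, dotProduct_smul, smul_eq_mul]; ring

/-- The lattice points in the interior of an edge. -/
theorem card_cell_edge {v a : Fin n → ℤ} (hv : v ∈ M.V) (ha : a ∈ M.t v) :
    ((M.cell ((M.t v).erase a)).card : ℤ) = M.len v a - 1 := by
  have hmem : ∀ k, 0 < k → k < M.len v a →
      v + k • M.E v a ∈ M.cell ((M.t v).erase a) := by
    intro k hk hkl
    have hw := M.nb_mem hv ha
    have hcomb : ∀ b, M.len v a * M.phi b (v + k • M.E v a) =
        (M.len v a - k) * M.phi b v + k * M.phi b (M.nb v a) := by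
      intro b
      rw [nb, phi_add_smul, phi_add_smul]; ring
    have hl := M.len_pos hv ha
    rw [mem_cell]
    constructor
    · intro b _
      have h1 := M.phi_nonneg b hv
      have h2 := M.phi_nonneg b hw
      have h3 : 0 < M.len v a - k := by omega
      have : 0 ≤ M.len v a * M.phi b (v + k • M.E v a) := by rw [hcomb]; positivity
      exact nonneg_of_mul_nonneg_right this hl
    · ext b
      rw [mem_tight, Finset.mem_erase]
      constructor
      · rintro ⟨hb, h0⟩
        have h1 := M.phi_nonneg b hv
        have h2 := M.phi_nonneg b hw
        have h3 := hcomb b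
        have h4 : 0 < M.len v a - k := by omega
        rw [h0, mul_zero] at h3
        have t1 : 0 ≤ (M.len v a - k) * M.phi b v := by positivity
        have t2 : 0 ≤ k * M.phi b (M.nb v a) := by positivity
        have t3 : (M.len v a - k) * M.phi b v = 0 := by linarith
        have t4 : k * M.phi b (M.nb v a) = 0 := by linarith
        have t5 := (mul_eq_zero.1 t3).resolve_left h4.ne'
        have t6 := (mul_eq_zero.1 t4).resolve_left hk.ne'
        rw [M.phi_eq_zero hv hb] at t5
        rw [M.phi_eq_zero hw hb] at t6
        refine ⟨?_, t5⟩
        rintro rfl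
        exact M.notMem_t_nb hv ha t6
      · rintro ⟨hba, hb⟩
        refine ⟨M.mem_verts.2 ⟨v, hv, hb⟩, ?_⟩
        rw [phi_add_smul, M.phi_self hv hb, (M.dual v hv).dot_ne ha hb hba]; ring
  have hE : M.E v a ≠ 0 := by
    intro h0
    have := (M.dual v hv).dot_self ha
    rw [h0, dotProduct_zero] at this
    exact zero_ne_one this
  have himg : M.cell ((M.t v).erase a) =
      (Finset.Ioo 0 (M.len v a)).image fun k => v + k • M.E v a := by
    ext p
    rw [Finset.mem_image]
    constructor
    · intro hp
      rw [mem_cell] at hp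
      have hzero : ∀ b ∈ M.t v, b ≠ a → M.phi b p = 0 := by
        intro b hb hba
        have : b ∈ M.tight p := by rw [hp.2]; exact Finset.mem_erase.2 ⟨hba, hb⟩
        exact (M.mem_tight.1 this).2
      have hp1 : v + M.phi a p • M.E v a = p := by
        refine M.eq_of_dot_eq hv fun b hb => ?_
        rw [dotProduct_add, dotProduct_smul, smul_eq_mul]
        by_cases hba : b = a
        · rw [hba, (M.dual v hv).dot_self ha, M.phi_eq hv ha]; ring
        · have := hzero b hb hba
          rw [M.phi_eq hv hb] at this
          rw [(M.dual v hv).dot_ne ha hb hba]; linarith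
      have hav : a ∈ Tri.verts M.T := M.mem_verts.2 ⟨v, hv, ha⟩
      refine ⟨M.phi a p, ?_, hp1⟩
      rw [Finset.mem_Ioo]
      constructor
      · refine lt_of_le_of_ne (hp.1 a hav) fun h0 => ?_
        have : a ∈ M.tight p := M.mem_tight.2 ⟨hav, h0.symm⟩
        rw [hp.2] at this
        exact Finset.notMem_erase _ _ this
      · obtain ⟨a', ha', ht, hE', -⟩ := M.exists_opp hv ha
        have hw := M.nb_mem hv ha
        have hm : a' ∈ M.t (M.nb v a) := by rw [ht]; exact Finset.mem_insert_self _ _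
        have hav' : a' ∈ Tri.verts M.T := M.mem_verts.2 ⟨_, hw, hm⟩
        have h1 := hp.1 a' hav'
        have h2 : M.phi a' p ≠ 0 := by
          intro h0
          have : a' ∈ M.tight p := M.mem_tight.2 ⟨hav', h0⟩
          rw [hp.2] at this
          exact ha' (Finset.mem_of_mem_erase this)
        have h3 := M.phi_self hw hm
        rw [nb, phi_add_smul, hE'] at h3
        rw [← hp1, phi_add_smul, hE'] at h1 h2
        omega
    · rintro ⟨k, hk, rfl⟩
      rw [Finset.mem_Ioo] at hk
      exact hmem k hk.1 hk.2
  rw [himg, Finset.card_image_of_injective, Int.card_Ioo]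
  · have := M.len_pos hv ha
    omega
  · intro k k' hkk
    have h1 := add_left_cancel hkk
    exact smul_left_injective _ hE h1

/-- A set of vertices of the facet `r` that is closed under passing to neighbours in `r` contains
all the vertices of the facet. -/
theorem facet_connected {r : Fin n → ℤ} (U : (Fin n → ℤ) → Prop)
    (hne : ∃ v ∈ M.V, r ∈ M.t v ∧ U v)
    (hcl : ∀ v ∈ M.V, r ∈ M.t v → U v → ∀ a ∈ M.t v, a ≠ r → U (M.nb v a)) :
    ∀ w ∈ M.V, r ∈ M.t w → U w := by
  classical
  intro w hw hrw
  -- The simplex method: on the facet, `u` attains its minimum only at `w`. A minimizer of `u` among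
  -- the vertices in `U` cannot be improved along edges of the facet, so it is minimal on the facet
  -- and is `w`.
  set u := ∑ a ∈ M.t w, a with hu
  obtain ⟨v, hvm, hmin⟩ := Finset.exists_min_image (M.V.filter fun v => r ∈ M.t v ∧ U v)
    (fun v => u ⬝ᵥ v) (by
      obtain ⟨v, hv, h1, h2⟩ := hne
      exact ⟨v, Finset.mem_filter.2 ⟨hv, h1, h2⟩⟩)
  rw [Finset.mem_filter] at hvm
  obtain ⟨hv, hrv, hUv⟩ := hvm
  have hnn : ∀ a ∈ M.t v, a ≠ r → 0 ≤ u ⬝ᵥ M.E v a := by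
    intro a ha har
    have h1 := hmin (M.nb v a) (Finset.mem_filter.2 ⟨M.nb_mem hv ha,
      M.mem_t_nb hv ha hrv har.symm, hcl v hv hrv hUv a ha har⟩)
    rw [dot_nb] at h1
    have hl := M.len_pos hv ha
    exact nonneg_of_mul_nonneg_right (by linarith) hl
  have hle : u ⬝ᵥ v ≤ u ⬝ᵥ w := by
    have h1 := M.dot_sub_int hv u w
    have h2 : 0 ≤ ∑ a ∈ M.t v, (u ⬝ᵥ M.E v a) * (a ⬝ᵥ w - a ⬝ᵥ v) := by
      refine Finset.sum_nonneg fun a ha => ?_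
      by_cases har : a = r
      · rw [har, le_antisymm (M.le w hw r hrw v hv) (M.le v hv r hrv w hw), sub_self, mul_zero]
      · exact mul_nonneg (hnn a ha har) (sub_nonneg.2 (M.le v hv a ha w hw))
    linarith
  have hsum : ∑ a ∈ M.t w, (a ⬝ᵥ v - a ⬝ᵥ w) ≤ 0 := by
    rw [Finset.sum_sub_distrib, ← sum_dotProduct, ← sum_dotProduct]; linarith
  have hz := (Finset.sum_eq_zero_iff_of_nonneg fun a ha =>
    sub_nonneg.2 (M.le w hw a ha v hv)).1 (le_antisymm hsum (Finset.sum_nonneg fun a ha =>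
      sub_nonneg.2 (M.le w hw a ha v hv)))
  have : v = w := M.eq_of_dot_eq hw fun a ha => by have := hz a ha; linarith
  exact this ▸ hUv

/-- On the hyperplane of the facet the adjacent inequalities suffice. At a vertex of the facet where
`b` is smallest, `b` is its value there plus a nonnegative combination of the adjacent facet
functions. -/
theorem nonneg_of_facet {r b p : Fin n → ℤ} (hr : r ∈ Tri.verts M.T)
    (hp : M.phi r p = 0) (h : ∀ v ∈ M.V, r ∈ M.t v → ∀ a ∈ M.t v, 0 ≤ M.phi a p) :
    ∃ v ∈ M.V, r ∈ M.t v ∧ M.phi b v ≤ M.phi b p := by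
  obtain ⟨v, hvm, hmin⟩ := Finset.exists_min_image (M.V.filter fun v => r ∈ M.t v)
    (fun v => M.phi b v) (by
      obtain ⟨v, hv, h1⟩ := M.mem_verts.1 hr
      exact ⟨v, Finset.mem_filter.2 ⟨hv, h1⟩⟩)
  rw [Finset.mem_filter] at hvm
  obtain ⟨hv, hrv⟩ := hvm
  refine ⟨v, hv, hrv, ?_⟩
  rw [M.phi_expand hv b p]
  have : 0 ≤ ∑ a ∈ M.t v, (b ⬝ᵥ M.E v a) * M.phi a p := by
    refine Finset.sum_nonneg fun a ha => ?_
    by_cases har : a = r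
    · rw [har, hp, mul_zero]
    · refine mul_nonneg ?_ (h v hv hrv a ha)
      have h1 := hmin (M.nb v a) (Finset.mem_filter.2 ⟨M.nb_mem hv ha,
        M.mem_t_nb hv ha hrv (Ne.symm har)⟩)
      rw [nb, phi_add_smul] at h1
      exact nonneg_of_mul_nonneg_right (by linarith) (M.len_pos hv ha)
  linarith

end General

/-! ### Facets as smooth polygons -/

variable (M : SmoothModel 3)

theorem linkConnected (r : Fin 3 → ℤ) : Tri.LinkConnected M.T r := by
  intro U hne hcl
  have := M.facet_connected (r := r) (fun v => U (M.t v)) ?_ ?_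
  · intro t ht hrt
    obtain ⟨v, hv, rfl⟩ := M.mem_T.1 ht
    exact this v hv hrt
  · obtain ⟨t, ht, hrt, hU⟩ := hne
    obtain ⟨v, hv, rfl⟩ := M.mem_T.1 ht
    exact ⟨v, hv, hrt, hU⟩
  · intro v hv hrv hU a ha har
    refine hcl _ (M.t_mem_T hv) hrv hU _ (M.t_mem_T (M.nb_mem hv ha))
      (M.mem_t_nb hv ha hrv har.symm) ?_
    obtain ⟨a', ha', ht, -⟩ := M.exists_opp hv ha
    rw [ht, Finset.inter_insert_of_notMem ha', Finset.inter_eq_right.2 (Finset.erase_subset _ _),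
      Finset.card_erase_of_mem ha, (M.dual v hv).card]

theorem exists_cycle {r x y : Fin 3 → ℤ} (ht : {r, x, y} ∈ M.T) :
    ∃ s : ℤ → Fin 3 → ℤ, s 0 = x ∧ s 1 = y ∧ Tri.IsCycle M.T r s :=
  M.isTri.exists_cycle (M.linkConnected r) ht

theorem exists_vertex {t : Finset (Fin 3 → ℤ)} (ht : t ∈ M.T) : ∃ v ∈ M.V, M.t v = t :=
  M.mem_T.1 ht

theorem sum_triple {f : (Fin 3 → ℤ) → ℤ} {x y z : Fin 3 → ℤ} (ht : {x, y, z} ∈ M.T) :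
    ∑ a ∈ ({x, y, z} : Finset (Fin 3 → ℤ)), f a = f x + f y + f z := by
  obtain ⟨h1, h2, h3⟩ := M.isTri.ne_of_mem ht
  rw [Finset.sum_insert (by simp [h1, h2]), Finset.sum_pair h3, add_assoc]

/-- The coordinates at a vertex take arbitrary values. -/
theorem exists_point {x y z : Fin 3 → ℤ} (ht : {x, y, z} ∈ M.T) (X Y Z : ℤ) :
    ∃ p, M.phi x p = X ∧ M.phi y p = Y ∧ M.phi z p = Z := by
  obtain ⟨h1, h2, h3⟩ := M.isTri.ne_of_mem ht
  obtain ⟨v, hv, hvt⟩ := M.exists_vertex ht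
  have hx : x ∈ M.t v := by rw [hvt]; simp
  have hy : y ∈ M.t v := by rw [hvt]; simp
  have hz : z ∈ M.t v := by rw [hvt]; simp
  have d := M.dual v hv
  refine ⟨v + X • M.E v x + Y • M.E v y + Z • M.E v z, ?_, ?_, ?_⟩
  · rw [phi_add_smul, phi_add_smul, phi_add_smul, M.phi_self hv hx, d.dot_self hx,
      d.dot_ne hy hx h1, d.dot_ne hz hx h2]; ring
  · rw [phi_add_smul, phi_add_smul, phi_add_smul, M.phi_self hv hy, d.dot_self hy,
      d.dot_ne hx hy h1.symm, d.dot_ne hz hy h3]; ring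
  · rw [phi_add_smul, phi_add_smul, phi_add_smul, M.phi_self hv hz, d.dot_self hz,
      d.dot_ne hx hz h2.symm, d.dot_ne hy hz h3.symm]; ring

theorem point_ext {x y z : Fin 3 → ℤ} (ht : {x, y, z} ∈ M.T) {p q : Fin 3 → ℤ}
    (hx : M.phi x p = M.phi x q) (hy : M.phi y p = M.phi y q) (hz : M.phi z p = M.phi z q) :
    p = q := by
  obtain ⟨v, hv, hvt⟩ := M.exists_vertex ht
  refine M.eq_of_dot_eq hv fun a ha => ?_
  have : M.phi a p = M.phi a q := by
    rw [hvt] at ha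
    simp only [Finset.mem_insert, Finset.mem_singleton] at ha
    rcases ha with rfl | rfl | rfl <;> assumption
  have h2 := M.phi_sub a p q
  linarith

/-- Any facet function in the coordinates at a vertex. -/
theorem exists_affine {x y z : Fin 3 → ℤ} (ht : {x, y, z} ∈ M.T) (a : Fin 3 → ℤ) :
    ∃ α β γ c : ℤ, (∀ p, M.phi a p = α * M.phi x p + β * M.phi y p + γ * M.phi z p + c) ∧
      ∀ v ∈ M.V, M.t v = {x, y, z} → c = M.phi a v := by
  obtain ⟨v, hv, hvt⟩ := M.exists_vertex ht
  refine ⟨a ⬝ᵥ M.E v x, a ⬝ᵥ M.E v y, a ⬝ᵥ M.E v z, M.phi a v, fun p => ?_, ?_⟩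
  · rw [M.phi_expand hv a p, hvt, M.sum_triple ht]; ring
  · intro w hw hwt
    rw [M.t_inj hv hw (hvt.trans hwt.symm)]

/-- The wall relation between the normals of the facets around an edge. -/
theorem wall {x x' y z v w : Fin 3 → ℤ} (hv : v ∈ M.V) (hw : w ∈ M.V) (hvt : M.t v = {x, y, z})
    (hwt : M.t w = {x', y, z}) (hne : x ≠ x') : ∃ b c : ℤ, (∀ p, M.phi x' p =
      M.phi x w - M.phi x p + b * M.phi y p + c * M.phi z p) ∧ x' = -x + b • y + c • z ∧
      w = M.nb v x ∧ M.phi x w = M.len v x := by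
  have ht : {x, y, z} ∈ M.T := hvt ▸ M.t_mem_T hv
  have ht' : {x', y, z} ∈ M.T := hwt ▸ M.t_mem_T hw
  obtain ⟨h1, h2, h3⟩ := M.isTri.ne_of_mem ht
  obtain ⟨h1', h2', -⟩ := M.isTri.ne_of_mem ht'
  have hx : x ∈ M.t v := by rw [hvt]; simp
  have hers : (M.t v).erase x = {y, z} := by
    rw [hvt, Finset.erase_insert]; simp [h1, h2]
  have hxw : x ∉ M.t w := by rw [hwt]; simp [h1, h2, hne]
  have hwnb : w = M.nb v x := by
    rcases M.eq_or_eq_nb hv hx hw (by rw [hers, hwt]; exact Finset.subset_insert _ _) with h | h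
    · exact absurd (h ▸ hx) hxw
    · exact h
  obtain ⟨a', ha', htn, hE, -⟩ := M.exists_opp hv hx
  have hax : a' = x' := by
    have : x' ∈ M.t (M.nb v x) := by rw [← hwnb, hwt]; simp
    rw [htn, hers] at this
    simp only [Finset.mem_insert, Finset.mem_singleton] at this
    rcases this with h | h | h
    · exact h.symm
    · exact absurd h h1'
    · exact absurd h h2'
  rw [hax] at hE
  refine ⟨x' ⬝ᵥ M.E v y, x' ⬝ᵥ M.E v z, ?_, ?_, hwnb, ?_⟩
  · have key : ∀ p, M.phi x' p = M.phi x' v - M.phi x p + (x' ⬝ᵥ M.E v y) * M.phi y p +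
        (x' ⬝ᵥ M.E v z) * M.phi z p := by
      intro p
      rw [M.phi_expand hv x' p, hvt, M.sum_triple ht, hE]; ring
    intro p
    rw [key p]
    have h4 := key w
    rw [M.phi_self hw (by rw [hwt]; simp), M.phi_self hw (a := y) (by rw [hwt]; simp),
      M.phi_self hw (a := z) (by rw [hwt]; simp)] at h4
    linarith
  · conv_lhs => rw [(M.dual v hv).expand_dual x', hvt]
    rw [Finset.sum_insert (by simp [h1, h2]), Finset.sum_pair h3, hE, neg_one_smul, add_assoc]
  · rw [hwnb, nb, phi_add_smul, M.phi_self hv hx, (M.dual v hv).dot_self hx]; ring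

/-- The facet `r` as a polygon. -/
theorem exists_polygon {r : Fin 3 → ℤ} {s : ℤ → Fin 3 → ℤ} (hr : r ∈ Tri.verts M.T)
    (hs : Tri.IsCycle M.T r s) : ∃ Q : SmoothPolygon (Tri.deg M.T r) {p // M.phi r p = 0},
      (∀ i p, Q.F i p = M.phi (s i) p) ∧
      (∀ i, (Q.v i : Fin 3 → ℤ) ∈ M.V ∧ M.t (Q.v i) = {r, s i, s (i + 1)}) ∧
      (∀ i, Q.l i = (M.cell {r, s i}).card + 1) ∧
      (∀ p, Q.Interior p ↔ (p : Fin 3 → ℤ) ∈ M.cell {r}) := by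
  have h3 := hs.three_le M.isTri hr
  choose v hv hvt using fun i => M.exists_vertex (hs.mem i)
  have hrv : ∀ i, r ∈ M.t (v i) := fun i => by rw [hvt]; simp
  have hsv : ∀ i, s i ∈ M.t (v i) := fun i => by rw [hvt]; simp
  have hsv' : ∀ i, s (i + 1) ∈ M.t (v i) := fun i => by rw [hvt]; simp
  have hsverts : ∀ i, s i ∈ Tri.verts M.T := fun i => M.mem_verts.2 ⟨_, hv i, hsv i⟩
  have hv1 : ∀ i, M.t (v i) = {s i, s (i + 1), r} := fun i => by
    rw [hvt, Finset.insert_comm, Finset.pair_comm r]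
  have hv2 : ∀ i, M.t (v (i + 1)) = {s (i + 2), s (i + 1), r} := fun i => by
    rw [hvt, Finset.insert_comm, show i + 1 + 1 = i + 2 by ring, Finset.pair_comm r,
      Finset.insert_comm]
  have hT1 : ∀ i, {s i, s (i + 1), r} ∈ M.T := fun i => hv1 i ▸ M.t_mem_T (hv i)
  have hne2 : ∀ i, s i ≠ s (i + 2) := by
    intro i h
    rw [hs.eq_iff] at h
    have := Int.le_of_dvd (by norm_num) ((dvd_neg.2 h))
    omega
  choose b c hw hnorm hnb hlen using fun i => M.wall (hv i) (hv (i + 1)) (hv1 i) (hv2 i) (hne2 i)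
  have hb : ∀ i j, (Tri.deg M.T r : ℤ) ∣ i - j → v i = v j := by
    intro i j hij
    refine M.t_inj (hv i) (hv j) ?_
    rw [hvt, hvt, (hs.eq_iff i j).2 hij,
      (hs.eq_iff (i + 1) (j + 1)).2 (by rwa [add_sub_add_right_eq_sub])]
  let Q : SmoothPolygon (Tri.deg M.T r) {p // M.phi r p = 0} :=
    { F := fun i p => M.phi (s i) p
      -- The length of edge `i` is the value of the preceding edge function at its far end; `a` is
      -- minus a coefficient of the wall relation across that edge.
      l := fun i => M.phi (s (i - 1)) (v i)
      a := fun i => - (s (i + 1) ⬝ᵥ M.E (v (i - 1)) (s i))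
      v := fun i => ⟨v i, M.phi_self (hv i) (hrv i)⟩
      recur := by
        rintro i ⟨p, hp⟩
        dsimp only
        have h1 := M.phi_expand (hv i) (s (i + 2)) p
        rw [hv1, M.sum_triple (hT1 i), hp] at h1
        have h2 := hw i p
        rw [hp] at h2
        rw [show i + 1 - 1 = i by ring, show i + 1 + 1 = i + 2 by ring]
        have h4 := congrArg (fun u => u ⬝ᵥ M.E (v i) (s (i + 1))) (hnorm i)
        have d := M.dual _ (hv i)
        obtain ⟨n1, n2, n3⟩ := M.isTri.ne_of_mem (hT1 i)
        simp only [add_dotProduct, neg_dotProduct, smul_dotProduct, smul_eq_mul,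
          d.dot_self (hsv' i), d.dot_ne (hsv' i) (hsv i) n1, d.dot_ne (hsv' i) (hrv i) n3.symm]
          at h4
        rw [h4, h2]; ring
      surj := by
        intro i X Y
        obtain ⟨p, h1, h2, h3⟩ := M.exists_point (hs.mem i) 0 X Y
        exact ⟨⟨p, h1⟩, h2, h3⟩
      ext := by
        rintro i ⟨p, hp⟩ ⟨q, hq⟩ h1 h2
        exact Subtype.ext (M.point_ext (hs.mem i) (hp.trans hq.symm) h1 h2)
      F_period := by
        intro i
        funext p
        rw [(hs.eq_iff (i + (Tri.deg M.T r : ℤ)) i).2 (by simp)]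
      l_period := by
        intro i
        rw [hb (i + (Tri.deg M.T r : ℤ)) i (by simp),
          (hs.eq_iff (i + (Tri.deg M.T r : ℤ) - 1) (i - 1)).2 (by ring_nf; simp)]
      a_period := by
        intro i
        rw [(hs.eq_iff (i + (Tri.deg M.T r : ℤ)) i).2 (by simp),
          (hs.eq_iff (i + (Tri.deg M.T r : ℤ) + 1) (i + 1)).2 (by ring_nf; simp),
          hb (i + (Tri.deg M.T r : ℤ) - 1) (i - 1) (by ring_nf; simp)]
      nonneg := fun j i => M.phi_nonneg _ (hv i)
      zero := by
        intro j i
        dsimp only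
        rw [M.phi_eq_zero (hv i) (hsverts j), hvt]
        simp only [Finset.mem_insert, Finset.mem_singleton]
        rw [hs.eq_iff, hs.eq_iff, show j - i - 1 = j - (i + 1) by ring]
        refine or_iff_right fun h => ?_
        exact (M.isTri.ne_of_mem (hs.mem j)).1 h.symm
      l_pos := by
        intro i
        have h1 := hlen (i - 1)
        rw [show i - 1 + 1 = i by ring] at h1
        rw [h1]
        exact M.len_pos (hv _) (hsv _)
      n_pos := by omega }
  refine ⟨Q, fun i p => rfl, fun i => ⟨hv i, hvt i⟩, ?_, ?_⟩
  · intro i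
    have h1 := hlen (i - 1)
    rw [show i - 1 + 1 = i by ring] at h1
    have h2 := M.card_cell_edge (hv (i - 1)) (hsv (i - 1))
    have h3 : (M.t (v (i - 1))).erase (s (i - 1)) = {r, s i} := by
      have h4 := hT1 (i - 1)
      obtain ⟨n1, n2, n3⟩ := M.isTri.ne_of_mem h4
      rw [show i - 1 + 1 = i by ring] at n1
      rw [hv1, show i - 1 + 1 = i by ring, Finset.erase_insert (by simp [n1, n2]),
        Finset.pair_comm]
    rw [h3] at h2
    change M.phi (s (i - 1)) (v i) = _
    rw [h1, h2]; ring
  · rintro ⟨p, hp⟩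
    rw [mem_cell]
    constructor
    · intro hint
      -- Every vertex of the facet is one of the `v i`, so positivity of the polygon's edge
      -- functions supplies the hypothesis of `nonneg_of_facet`.
      have hfacet : ∀ w ∈ M.V, r ∈ M.t w → ∀ a ∈ M.t w, 0 ≤ M.phi a p := by
        intro w hw hrw a ha
        obtain ⟨i, hi⟩ := hs.surj _ (M.t_mem_T hw) hrw
        rw [hi] at ha
        simp only [Finset.mem_insert, Finset.mem_singleton] at ha
        rcases ha with rfl | rfl | rfl
        · rw [hp]
        · exact (hint i).le
        · exact (hint (i + 1)).le
      constructor
      · intro a ha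
        obtain ⟨w, hw, -, hle⟩ := M.nonneg_of_facet (b := a) hr hp hfacet
        exact (M.phi_nonneg a hw).trans hle
      · ext a
        rw [mem_tight, Finset.mem_singleton]
        constructor
        · rintro ⟨ha, h0⟩
          obtain ⟨w, hw, hrw, hle⟩ := M.nonneg_of_facet (b := a) hr hp hfacet
          have h1 : a ∈ M.t w := (M.phi_eq_zero hw ha).1
            (le_antisymm (h0 ▸ hle) (M.phi_nonneg a hw))
          obtain ⟨i, hi⟩ := hs.surj _ (M.t_mem_T hw) hrw
          rw [hi] at h1
          simp only [Finset.mem_insert, Finset.mem_singleton] at h1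
          rcases h1 with rfl | rfl | rfl
          · rfl
          · exact absurd h0 (hint i).ne'
          · exact absurd h0 (hint (i + 1)).ne'
        · rintro rfl; exact ⟨hr, hp⟩
    · rintro ⟨h1, h2⟩ j
      refine lt_of_le_of_ne (h1 _ (hsverts j)) fun h0 => ?_
      have : s j ∈ M.tight p := M.mem_tight.2 ⟨hsverts j, h0.symm⟩
      rw [h2, Finset.mem_singleton] at this
      exact (M.isTri.ne_of_mem (hs.mem j)).1 this.symm

end SmoothModel


/-! ### Counting lattice points and the possible labels -/

namespace SmoothModel

variable (M : SmoothModel 3)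

theorem exists_cycle_of_mem {r : Fin 3 → ℤ} (hr : r ∈ Tri.verts M.T) :
    ∃ s, Tri.IsCycle M.T r s := by
  obtain ⟨t, ht, hrt⟩ := Tri.mem_verts.1 hr
  obtain ⟨y, z, -, -, -, rfl⟩ := exists_others (M.isTri.card t ht) hrt
  obtain ⟨s, -, -, hs⟩ := M.exists_cycle ht
  exact ⟨s, hs⟩

theorem three_le_deg {r : Fin 3 → ℤ} (hr : r ∈ Tri.verts M.T) : 3 ≤ Tri.deg M.T r := by
  obtain ⟨s, hs⟩ := M.exists_cycle_of_mem hr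
  exact hs.three_le M.isTri hr

theorem exists_polygon_of_deg {r : Fin 3 → ℤ} {s : ℤ → Fin 3 → ℤ} {n : ℕ}
    (hr : r ∈ Tri.verts M.T) (hs : Tri.IsCycle M.T r s) (hn : Tri.deg M.T r = n) :
    ∃ Q : SmoothPolygon n {p // M.phi r p = 0},
      (∀ i p, Q.F i p = M.phi (s i) p) ∧
      (∀ i, (Q.v i : Fin 3 → ℤ) ∈ M.V ∧ M.t (Q.v i) = {r, s i, s (i + 1)}) ∧
      (∀ i, Q.l i = (M.cell {r, s i}).card + 1) ∧
      (∀ p, Q.Interior p ↔ (p : Fin 3 → ℤ) ∈ M.cell {r}) := by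
  subst hn
  exact M.exists_polygon hr hs

theorem one_le_card_cell {r : Fin 3 → ℤ} (hr : r ∈ Tri.verts M.T) (h : 5 ≤ Tri.deg M.T r) :
    1 ≤ (M.cell {r}).card := by
  obtain ⟨s, hs⟩ := M.exists_cycle_of_mem hr
  obtain ⟨Q, -, -, -, hQ⟩ := M.exists_polygon hr hs
  obtain ⟨b, -, -, hb⟩ := Q.exists_interior h 0
  exact Finset.card_pos.2 ⟨b, (hQ b).1 hb⟩

theorem three_le_card_cell {r : Fin 3 → ℤ} (hr : r ∈ Tri.verts M.T) (h : 7 ≤ Tri.deg M.T r) :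
    3 ≤ (M.cell {r}).card := by
  obtain ⟨s, hs⟩ := M.exists_cycle_of_mem hr
  obtain ⟨Q, -, -, -, hQ⟩ := M.exists_polygon hr hs
  obtain ⟨b₁, b₂, b₃, h1, h2, h3, h12, h13, h23⟩ := Q.exists_three_interior h
  have : 2 < (M.cell {r}).card := Finset.two_lt_card_iff.2 ⟨b₁, b₂, b₃, (hQ _).1 h1, (hQ _).1 h2,
    (hQ _).1 h3, fun h => h12 (Subtype.ext h), fun h => h13 (Subtype.ext h),
    fun h => h23 (Subtype.ext h)⟩
  omega

/-- The edges of the facet `r` that contain lattice points besides their ends. -/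
noncomputable def longEdges (r : Fin 3 → ℤ) : Finset (Finset (Fin 3 → ℤ)) :=
  ((Tri.nbrs M.T r).image fun y => {r, y}).filter fun S => 1 ≤ (M.cell S).card

theorem mem_longEdges {r : Fin 3 → ℤ} {S : Finset (Fin 3 → ℤ)} :
    S ∈ M.longEdges r ↔ (∃ y ∈ Tri.nbrs M.T r, {r, y} = S) ∧ 1 ≤ (M.cell S).card := by
  rw [longEdges, Finset.mem_filter, Finset.mem_image]

theorem mem_nbrs_of_mem {r x y : Fin 3 → ℤ} (h : {r, x, y} ∈ M.T) :
    x ∈ Tri.nbrs M.T r ∧ y ∈ Tri.nbrs M.T r := by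
  obtain ⟨h1, h2, -⟩ := M.isTri.ne_of_mem h
  exact ⟨Tri.mem_nbrs.2 ⟨h1.symm, _, h, by simp, by simp⟩,
    Tri.mem_nbrs.2 ⟨h2.symm, _, h, by simp, by simp⟩⟩

/-- `pentagon_two_long` finds a long edge among any four of the five edges. A second application,
leaving out the edge already found, gives another one. -/
theorem two_le_longEdges {r : Fin 3 → ℤ} (hr : r ∈ Tri.verts M.T) (h : Tri.deg M.T r = 5) :
    2 ≤ (M.longEdges r).card := by
  obtain ⟨s, hs⟩ := M.exists_cycle_of_mem hr
  obtain ⟨Q, -, -, hl, -⟩ := M.exists_polygon_of_deg hr hs h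
  have hmem : ∀ i, 2 ≤ Q.l i → {r, s i} ∈ M.longEdges r := by
    intro i hi
    rw [mem_longEdges]
    refine ⟨⟨s i, (M.mem_nbrs_of_mem (hs.mem i)).1, rfl⟩, ?_⟩
    rw [hl] at hi
    omega
  have hne : ∀ i j : ℤ, 0 < j → j < 5 → s i ≠ s (i + j) := by
    intro i j h0 h5 he
    rw [hs.eq_iff, h] at he
    have := Int.le_of_dvd (by omega) (dvd_neg.2 he)
    push_cast at this
    omega
  have hpair : ∀ i j, s i ≠ s j → ({r, s i} : Finset (Fin 3 → ℤ)) ≠ {r, s j} := by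
    intro i j hij he
    have h1 : s i ∈ ({r, s j} : Finset (Fin 3 → ℤ)) := he ▸ (by simp)
    rw [Finset.mem_insert, Finset.mem_singleton] at h1
    exact h1.elim (fun h => (M.isTri.ne_of_mem (hs.mem i)).1 h.symm) hij
  have two : ∀ i j, s i ≠ s j → 2 ≤ Q.l i → 2 ≤ Q.l j → 2 ≤ (M.longEdges r).card := by
    intro i j hij hi hj
    have hsub : ({{r, s i}, {r, s j}} : Finset (Finset (Fin 3 → ℤ))) ⊆ M.longEdges r := by
      intro S hS
      rw [Finset.mem_insert, Finset.mem_singleton] at hS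
      rcases hS with rfl | rfl
      · exact hmem i hi
      · exact hmem j hj
    have := Finset.card_le_card hsub
    rwa [Finset.card_pair (hpair i j hij)] at this
  obtain ⟨i, hi⟩ : ∃ i, 2 ≤ Q.l i := by
    rcases Q.pentagon_two_long 0 with h | h | h | h <;> exact ⟨_, h⟩
  rcases Q.pentagon_two_long i with h | h | h | h
  · exact two _ _ (hne i 1 (by norm_num) (by norm_num)) hi h
  · exact two _ _ (hne i 2 (by norm_num) (by norm_num)) hi h
  · exact two _ _ (hne i 3 (by norm_num) (by norm_num)) hi h
  · exact two _ _ (hne i 4 (by norm_num) (by norm_num)) hi h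

theorem card_of_mem_longEdges {r : Fin 3 → ℤ} {S : Finset (Fin 3 → ℤ)} (h : S ∈ M.longEdges r) :
    S.card = 2 := by
  obtain ⟨⟨y, hy, rfl⟩, -⟩ := M.mem_longEdges.1 h
  exact Finset.card_pair (Tri.mem_nbrs.1 hy).1.symm

theorem card_inter_longEdges {a b : Fin 3 → ℤ} (h : a ≠ b) :
    (M.longEdges a ∩ M.longEdges b).card ≤ 1 := by
  rw [Finset.card_le_one]
  have : ∀ S ∈ M.longEdges a ∩ M.longEdges b, S = {a, b} := by
    intro S hS
    rw [Finset.mem_inter, mem_longEdges, mem_longEdges] at hS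
    obtain ⟨⟨⟨y, -, rfl⟩, -⟩, ⟨⟨z, -, hz⟩, -⟩⟩ := hS
    have h1 : b ∈ ({a, y} : Finset (Fin 3 → ℤ)) := hz ▸ (by simp)
    rw [Finset.mem_insert, Finset.mem_singleton] at h1
    rw [h1.resolve_left h.symm]
  intro S hS S' hS'
  rw [this S hS, this S' hS']

/-- Counting lattice points: vertices, points in facets, points in edges, further points. -/
theorem card_count_add (R : Finset (Fin 3 → ℤ)) (A : Finset (Finset (Fin 3 → ℤ)))
    (hA : ∀ S ∈ A, S.card = 2) (X : Finset (Fin 3 → ℤ)) (hX : ∀ p ∈ X, M.IsPt p ∧ p ∉ M.V ∧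
      (∀ r ∈ R, M.tight p ≠ {r}) ∧ M.tight p ∉ A) :
    M.V.card + ∑ r ∈ R, (M.cell {r}).card + ∑ S ∈ A, (M.cell S).card + X.card ≤ M.pts.card := by
  have h := M.card_add_sum_cell_add_le (R.image (fun r => {r}) ∪ A) (by
    intro S hS
    rw [Finset.mem_union, Finset.mem_image] at hS
    rcases hS with ⟨r, -, rfl⟩ | hS
    · simp
    · rw [hA S hS]; norm_num) X (by
    intro p hp
    obtain ⟨h1, h2, h3, h4⟩ := hX p hp
    refine ⟨h1, h2, ?_⟩
    rw [Finset.mem_union, Finset.mem_image, not_or]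
    exact ⟨fun ⟨r, hr, hrp⟩ => h3 r hr hrp.symm, h4⟩)
  rw [Finset.sum_union, Finset.sum_image fun _ _ _ _ h => Finset.singleton_injective h] at h
  · linarith
  · rw [Finset.disjoint_left]
    intro S hS hS'
    obtain ⟨r, -, rfl⟩ := Finset.mem_image.1 hS
    have := hA _ hS'
    simp at this

theorem card_count (R : Finset (Fin 3 → ℤ)) (A : Finset (Finset (Fin 3 → ℤ)))
    (hA : ∀ S ∈ A, S.card = 2) :
    M.V.card + ∑ r ∈ R, (M.cell {r}).card + ∑ S ∈ A, (M.cell S).card ≤ M.pts.card := by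
  simpa using M.card_count_add R A hA ∅ (by simp)

theorem card_longEdges_le {r : Fin 3 → ℤ} {A : Finset (Finset (Fin 3 → ℤ))}
    (h : A ⊆ M.longEdges r) : A.card ≤ ∑ S ∈ A, (M.cell S).card := by
  rw [Finset.card_eq_sum_ones]
  exact Finset.sum_le_sum fun S hS => (M.mem_longEdges.1 (h hS)).2

theorem card_V_eq (h : M.T.card + 4 = 2 * (Tri.verts M.T).card) :
    M.V.card + 4 = 2 * (Tri.verts M.T).card := by rw [← M.card_T]; exact h

theorem deg_lt_card (r : Fin 3 → ℤ) (hr : r ∈ Tri.verts M.T) :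
    Tri.deg M.T r < (Tri.verts M.T).card := by
  rw [← M.isTri.card_nbrs]
  have h1 : r ∉ Tri.nbrs M.T r := fun h => (Tri.mem_nbrs.1 h).1 rfl
  exact Finset.card_lt_card ⟨Finset.filter_subset _ _, fun h => h1 (h hr)⟩

/-- The vertices of degree `m`. -/
def ofDeg (m : ℕ) : Finset (Fin 3 → ℤ) := (Tri.verts M.T).filter fun r => Tri.deg M.T r = m

theorem mem_ofDeg {m : ℕ} {r : Fin 3 → ℤ} :
    r ∈ M.ofDeg m ↔ r ∈ Tri.verts M.T ∧ Tri.deg M.T r = m := Finset.mem_filter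

theorem card_ofDeg (m : ℕ) : (M.ofDeg m).card = Tri.num M.T m := rfl

theorem num_mul_le {m k : ℕ} (h : ∀ r ∈ M.ofDeg m, k ≤ (M.cell {r}).card) :
    Tri.num M.T m * k ≤ ∑ r ∈ M.ofDeg m, (M.cell {r}).card := by
  have := Finset.card_nsmul_le_sum (M.ofDeg m) (fun r => (M.cell {r}).card) k h
  rwa [smul_eq_mul] at this

theorem disjoint_ofDeg {m k : ℕ} (h : m ≠ k) : Disjoint (M.ofDeg m) (M.ofDeg k) := by
  rw [Finset.disjoint_left]
  intro r h1 h2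
  exact h ((M.mem_ofDeg.1 h1).2.symm.trans (M.mem_ofDeg.1 h2).2)

theorem sum_cell_big : Tri.num M.T 5 + Tri.num M.T 6 + 3 * Tri.num M.T 7 ≤
    ∑ r ∈ M.ofDeg 5 ∪ (M.ofDeg 6 ∪ M.ofDeg 7), (M.cell {r}).card := by
  have d1 : Disjoint (M.ofDeg 5) (M.ofDeg 6 ∪ M.ofDeg 7) :=
    Finset.disjoint_union_right.2 ⟨M.disjoint_ofDeg (by norm_num), M.disjoint_ofDeg (by norm_num)⟩
  rw [Finset.sum_union d1, Finset.sum_union (M.disjoint_ofDeg (by norm_num))]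
  have h5 := M.num_mul_le (m := 5) (k := 1) fun r hr =>
    M.one_le_card_cell (M.mem_ofDeg.1 hr).1 (M.mem_ofDeg.1 hr).2.ge
  have h6 := M.num_mul_le (m := 6) (k := 1) fun r hr =>
    M.one_le_card_cell (M.mem_ofDeg.1 hr).1 (by rw [(M.mem_ofDeg.1 hr).2]; norm_num)
  have h7 := M.num_mul_le (m := 7) (k := 3) fun r hr =>
    M.three_le_card_cell (M.mem_ofDeg.1 hr).1 (M.mem_ofDeg.1 hr).2.ge
  omega

/-- If all degrees were at most four, the degree sum `6f - 12` would be at most `4f`, so that `f ≤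
6`. -/
theorem exists_five_le (heul : M.T.card + 4 = 2 * (Tri.verts M.T).card)
    (h : 7 ≤ (Tri.verts M.T).card) : ∃ r ∈ Tri.verts M.T, 5 ≤ Tri.deg M.T r := by
  by_contra hcon
  push Not at hcon
  have h1 := Tri.sum_deg M.isTri.card
  have h2 : ∑ x ∈ Tri.verts M.T, Tri.deg M.T x ≤ ∑ _x ∈ Tri.verts M.T, 4 :=
    Finset.sum_le_sum fun x hx => by have := hcon x hx; omega
  rw [Finset.sum_const, smul_eq_mul] at h2
  omega

/-- Ten facets give sixteen vertices and one interior point of a facet. Nine facets give fourteen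
vertices, so only two further points are allowed: this excludes heptagons and larger facets (three
points) and pentagons (one point and two long edges) and permits at most two hexagons, too few for
the degree sum. -/
theorem card_verts_le (heul : M.T.card + 4 = 2 * (Tri.verts M.T).card) (h16 : M.pts.card ≤ 16) :
    (Tri.verts M.T).card ≤ 8 := by
  by_contra hcon
  have hV := M.card_V_eq heul
  obtain ⟨r, hr, hr5⟩ := M.exists_five_le heul (by omega)
  have hr1 := M.one_le_card_cell hr hr5
  have hc := M.card_count {r} ∅ (by simp)
  rw [Finset.sum_singleton, Finset.sum_empty] at hc
  have h9 : (Tri.verts M.T).card = 9 := by omega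
  have hdeg : ∀ x ∈ Tri.verts M.T, Tri.deg M.T x ≤ 6 ∧ Tri.deg M.T x ≠ 5 := by
    intro x hx
    constructor
    · by_contra h7
      have h1 := M.three_le_card_cell hx (by omega)
      have hc := M.card_count {x} ∅ (by simp)
      rw [Finset.sum_singleton, Finset.sum_empty] at hc
      omega
    · intro h5
      have h1 := M.one_le_card_cell hx h5.ge
      have h2 := M.two_le_longEdges hx h5
      have h3 := M.card_longEdges_le (subset_refl (M.longEdges x))
      have hc := M.card_count {x} _ fun S hS => M.card_of_mem_longEdges (r := x) hS
      rw [Finset.sum_singleton] at hc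
      omega
  have hsum := M.sum_cell_big
  have hc2 := M.card_count (M.ofDeg 5 ∪ (M.ofDeg 6 ∪ M.ofDeg 7)) ∅ (by simp)
  rw [Finset.sum_empty] at hc2
  obtain ⟨c1, c2⟩ := Tri.card_of_deg_le M.isTri fun x hx => by
    have := M.three_le_deg hx
    have := (hdeg x hx).1
    simp only [Finset.mem_insert, Finset.mem_singleton]
    omega
  have h5 : Tri.num M.T 5 = 0 := by
    rw [← M.card_ofDeg, Finset.card_eq_zero, Finset.eq_empty_iff_forall_notMem]
    intro x hx
    exact (hdeg x (M.mem_ofDeg.1 hx).1).2 (M.mem_ofDeg.1 hx).2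
  have h7 : Tri.num M.T 7 = 0 := by
    rw [← M.card_ofDeg, Finset.card_eq_zero, Finset.eq_empty_iff_forall_notMem]
    intro x hx
    have := (hdeg x (M.mem_ofDeg.1 hx).1).1
    rw [(M.mem_ofDeg.1 hx).2] at this
    omega
  omega

/-- The degrees that may occur when there are at most sixteen lattice points. -/
theorem classification (hG : IsGood M.T) (h16 : M.pts.card ≤ 16) :
    ((Tri.verts M.T).card = 6 ∧ ∀ x ∈ Tri.verts M.T, Tri.deg M.T x = 4) ∨
    ((Tri.verts M.T).card = 7 ∧
      ((Tri.num M.T 3 = 1 ∧ Tri.num M.T 4 = 3 ∧ Tri.num M.T 5 = 3) ∨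
        (Tri.num M.T 3 = 2 ∧ Tri.num M.T 4 = 3 ∧ Tri.num M.T 6 = 2) ∨
        (Tri.num M.T 4 = 5 ∧ Tri.num M.T 5 = 2))) ∨
    ((Tri.verts M.T).card = 8 ∧
      ((Tri.num M.T 4 = 6 ∧ Tri.num M.T 6 = 2) ∨
        (Tri.num M.T 3 = 2 ∧ Tri.num M.T 4 = 3 ∧ Tri.num M.T 6 = 3) ∨
        (Tri.num M.T 3 = 1 ∧ Tri.num M.T 4 = 5 ∧ Tri.num M.T 6 = 1 ∧ Tri.num M.T 7 = 1))) := by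
  have h8 := M.card_verts_le hG.euler h16
  rcases hG.small with h | h | ⟨h, x, hx, hx3, hx6⟩ | h
  · exact Or.inl h
  · exact Or.inr (Or.inl h)
  · right; right
    refine ⟨h, ?_⟩
    have hV := M.card_V_eq hG.euler
    obtain ⟨c1, c2⟩ := Tri.card_of_deg_le M.isTri fun x hx => by
      have := M.three_le_deg hx
      have := M.deg_lt_card x hx
      simp only [Finset.mem_insert, Finset.mem_singleton]
      omega
    have heul := hG.euler
    have hsum := M.sum_cell_big
    have hc := M.card_count (M.ofDeg 5 ∪ (M.ofDeg 6 ∪ M.ofDeg 7)) ∅ (by simp)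
    rw [Finset.sum_empty] at hc
    -- With twelve vertices there is room for four more points, and a pentagon spends two of them on
    -- its long edges.
    have h5a : 1 ≤ Tri.num M.T 5 → Tri.num M.T 5 + Tri.num M.T 6 + 3 * Tri.num M.T 7 ≤ 2 := by
      intro h5
      rw [← M.card_ofDeg] at h5
      obtain ⟨r, hr⟩ := Finset.card_pos.1 h5
      obtain ⟨hr, hr5⟩ := M.mem_ofDeg.1 hr
      have h2 := M.two_le_longEdges hr hr5
      have h3 := M.card_longEdges_le (subset_refl (M.longEdges r))
      have hc := M.card_count (M.ofDeg 5 ∪ (M.ofDeg 6 ∪ M.ofDeg 7)) _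
        fun S hS => M.card_of_mem_longEdges (r := r) hS
      omega
    -- Two pentagons have at least three long edges in all, since they share at most one; with their
    -- two interior points this makes seventeen.
    have h5b : Tri.num M.T 5 ≤ 1 := by
      by_contra h5
      push Not at h5
      rw [← M.card_ofDeg, Finset.one_lt_card_iff] at h5
      obtain ⟨a, b, ha, hb, hab⟩ := h5
      rw [mem_ofDeg] at ha hb
      have a2 := M.two_le_longEdges ha.1 ha.2
      have b2 := M.two_le_longEdges hb.1 hb.2
      have i1 := M.card_inter_longEdges hab
      have u1 := Finset.card_union_add_card_inter (M.longEdges a) (M.longEdges b)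
      have hc := M.card_count {a, b} (M.longEdges a ∪ M.longEdges b) fun S hS => by
        rcases Finset.mem_union.1 hS with h | h <;> exact M.card_of_mem_longEdges h
      have h3 : (M.longEdges a ∪ M.longEdges b).card ≤
          ∑ S ∈ M.longEdges a ∪ M.longEdges b, (M.cell S).card := by
        rw [Finset.card_eq_sum_ones]
        refine Finset.sum_le_sum fun S hS => ?_
        rcases Finset.mem_union.1 hS with h | h <;> exact (M.mem_longEdges.1 h).2
      rw [Finset.sum_pair hab] at hc
      have p1 := M.one_le_card_cell ha.1 ha.2.ge
      have p2 := M.one_le_card_cell hb.1 hb.2.ge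
      omega
    -- The label `3^4 6^4` passes the count, with twelve vertices and four interior points. It is
    -- excluded by the vertex `x` that the invariant provides.
    have hbad : ¬ (Tri.num M.T 4 = 0 ∧ Tri.num M.T 5 = 0 ∧ Tri.num M.T 7 = 0) := by
      rintro ⟨n4, n5, n7⟩
      have e3 := M.three_le_deg hx
      have e8 := M.deg_lt_card x hx
      have key : ∀ m, Tri.deg M.T x = m → Tri.num M.T m ≠ 0 := by
        intro m hm h0
        rw [← M.card_ofDeg, Finset.card_eq_zero] at h0
        have : x ∈ M.ofDeg m := M.mem_ofDeg.2 ⟨hx, hm⟩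
        rw [h0] at this
        exact Finset.notMem_empty _ this
      rcases (show Tri.deg M.T x = 4 ∨ Tri.deg M.T x = 5 ∨ Tri.deg M.T x = 7 by omega) with e | e | e
      · exact key _ e n4
      · exact key _ e n5
      · exact key _ e n7
    rcases (show Tri.num M.T 7 = 0 ∨ Tri.num M.T 7 = 1 by omega) with e7 | e7
    · rcases (show Tri.num M.T 6 = 0 ∨ Tri.num M.T 6 = 1 ∨ Tri.num M.T 6 = 2 ∨ Tri.num M.T 6 = 3 ∨
        Tri.num M.T 6 = 4 by omega) with e6 | e6 | e6 | e6 | e6 <;> omega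
    · omega
  · omega

end SmoothModel


/-! ### Recognizing Cayley polytopes -/

section Cayley

theorem append_add_smul_mem {n k : ℕ} (c : Fin k → ℝ) : ∃ f : (Fin n → ℝ) →ᵃ[ℝ] (Fin (n + k) → ℝ),
    ∀ p, f p = Fin.append p c := by
  refine ⟨{ toFun := fun p => Fin.append p c
            linear :=
              { toFun := fun p => Fin.append p 0
                map_add' := ?_
                map_smul' := ?_ }
            map_vadd' := ?_ }, fun p => rfl⟩
  · intro p q
    funext i
    refine Fin.addCases (fun j => ?_) (fun j => ?_) i <;> simp
  · intro a p
    funext i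
    refine Fin.addCases (fun j => ?_) (fun j => ?_) i <;> simp
  · intro p q
    funext i
    refine Fin.addCases (fun j => ?_) (fun j => ?_) i <;> simp

theorem cayley_convexHull {n k : ℕ} (s : ℕ) (P S : Fin (k + 1) → Set (Fin n → ℝ))
    (h : ∀ i, P i = convexHull ℝ (S i)) :
    cayley s P = convexHull ℝ (⋃ i, (fun p => Fin.append p ((s : ℝ) • cayleyVertex i)) '' S i) := by
  unfold cayley
  have himg : ∀ i, (fun p => Fin.append p ((s : ℝ) • cayleyVertex i)) '' P i =
      convexHull ℝ ((fun p => Fin.append p ((s : ℝ) • cayleyVertex i)) '' S i) := by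
    intro i
    obtain ⟨f, hf⟩ := append_add_smul_mem (n := n) ((s : ℝ) • cayleyVertex (k := k) i)
    have h1 : (fun p => Fin.append p ((s : ℝ) • cayleyVertex i)) = f := funext fun p => (hf p).symm
    rw [h1, h i, AffineMap.image_convexHull]
  refine Set.Subset.antisymm (convexHull_min (Set.iUnion_subset fun i => ?_)
    (convex_convexHull ℝ _)) (convexHull_mono (Set.iUnion_mono fun i => ?_))
  · rw [himg]
    exact convexHull_mono (Set.subset_iUnion
      (fun i => (fun p => Fin.append p ((s : ℝ) • cayleyVertex i)) '' S i) i)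
  · rw [himg]; exact subset_convexHull ℝ _

/-- A unimodular change of coordinates. -/
theorem exists_affineEquiv {n : ℕ} (a e : Fin n → Fin n → ℤ) (c : Fin n → ℤ)
    (h : ∀ i j, a i ⬝ᵥ e j = if i = j then 1 else 0) :
    ∃ φ : (Fin n → ℝ) ≃ᵃ[ℝ] (Fin n → ℝ),
      (∀ x i, φ x i = latticePt (a i) ⬝ᵥ x - c i) ∧
      φ '' Set.range (latticePt (n := n)) = Set.range (latticePt (n := n)) := by
  let A : Matrix (Fin n) (Fin n) ℝ := fun i j => a i j
  let B : Matrix (Fin n) (Fin n) ℝ := fun i j => e j i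
  have hAB : A * B = 1 := by
    ext i j
    rw [Matrix.mul_apply, Matrix.one_apply]
    have := h i j
    simp only [dotProduct] at this
    change ∑ k, (a i k : ℝ) * (e j k : ℝ) = _
    exact_mod_cast this
  have hBA : B * A = 1 := mul_eq_one_comm.1 hAB
  let φ := (LinearEquiv.toAffineEquiv (Matrix.toLin'OfInv hBA hAB)).trans
    (AffineEquiv.constVAdd ℝ (Fin n → ℝ) (-(latticePt c)))
  have hφ : ∀ x i, φ x i = latticePt (a i) ⬝ᵥ x - c i := by
    intro x i
    change -(latticePt c) i + (Matrix.toLin' A x) i = _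
    rw [Matrix.toLin'_apply, latticePt_apply]
    change -(c i : ℝ) + latticePt (a i) ⬝ᵥ x = _
    ring
  refine ⟨φ, hφ, ?_⟩
  have hint : ∀ z, φ (latticePt z) = latticePt fun i => a i ⬝ᵥ z - c i := by
    intro z
    funext i
    rw [hφ, latticePt_dot, latticePt_apply]
    push_cast; rfl
  ext x
  constructor
  · rintro ⟨_, ⟨z, rfl⟩, rfl⟩
    exact ⟨_, (hint z).symm⟩
  · rintro ⟨z, rfl⟩
    refine ⟨_, ⟨∑ j, (z j + c j) • e j, rfl⟩, ?_⟩
    rw [hint]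
    congr 1
    funext i
    rw [dotProduct_sum, Finset.sum_congr rfl fun j _ => by
      rw [dotProduct_smul, h i j, smul_eq_mul, mul_ite, mul_one, mul_zero],
      Finset.sum_ite_eq, if_pos (Finset.mem_univ _)]
    ring

/-- Polytopes with corresponding vertices at which the same functionals are minimal. -/
theorem normalFan_eq_of_forall {n : ℕ} {ι : Type*} [Finite ι] [Nonempty ι] (y z : ι → Fin n → ℝ)
    (h : ∀ u i, (∀ j, u ⬝ᵥ y i ≤ u ⬝ᵥ y j) ↔ ∀ j, u ⬝ᵥ z i ≤ u ⬝ᵥ z j) :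
    normalFan (convexHull ℝ (Set.range y)) = normalFan (convexHull ℝ (Set.range z)) := by
  have key : ∀ y : ι → Fin n → ℝ, normalFan (convexHull ℝ (Set.range y)) =
      {σ | ∃ u, σ = {u' | ∀ i, (∀ j, u ⬝ᵥ y i ≤ u ⬝ᵥ y j) → ∀ j, u' ⬝ᵥ y i ≤ u' ⬝ᵥ y j}} := by
    intro y
    have hle : ∀ (u : Fin n → ℝ) c, (∀ j, c ≤ u ⬝ᵥ y j) → ∀ x ∈ convexHull ℝ (Set.range y),
        c ≤ u ⬝ᵥ x := by
      intro u c hc x hx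
      refine dot_le_of_mem_convexHull ?_ hx
      rintro _ ⟨j, rfl⟩
      exact hc j
    have hmem : ∀ i, y i ∈ convexHull ℝ (Set.range y) := fun i =>
      subset_convexHull ℝ _ ⟨i, rfl⟩
    have hcone : ∀ u : Fin n → ℝ, normalCone (convexHull ℝ (Set.range y))
        {x ∈ convexHull ℝ (Set.range y) | ∀ y' ∈ convexHull ℝ (Set.range y), u ⬝ᵥ x ≤ u ⬝ᵥ y'} =
        {u' | ∀ i, (∀ j, u ⬝ᵥ y i ≤ u ⬝ᵥ y j) → ∀ j, u' ⬝ᵥ y i ≤ u' ⬝ᵥ y j} := by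
      intro u
      ext u'
      constructor
      · intro hu' i hi j
        exact hu' (y i) ⟨hmem i, hle u _ hi⟩ (y j) (hmem j)
      · rintro hu' x ⟨hx, hxmin⟩ x' hx'
        obtain ⟨i0, hi0⟩ := Finite.exists_min fun i => u ⬝ᵥ y i
        refine (?_ : u' ⬝ᵥ x ≤ u' ⬝ᵥ y i0).trans (hle u' _ (hu' i0 hi0) x' hx')
        cases nonempty_fintype ι
        rw [convexHull_range_eq_exists_affineCombination] at hx
        obtain ⟨s, w, hw, hw1, rfl⟩ := hx
        rw [Finset.affineCombination_eq_linear_combination _ _ _ hw1] at hxmin ⊢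
        have hsum : ∀ u : Fin n → ℝ, u ⬝ᵥ ∑ i ∈ s, w i • y i = ∑ i ∈ s, w i * (u ⬝ᵥ y i) := by
          intro u
          rw [dotProduct_sum]
          exact Finset.sum_congr rfl fun i _ => by rw [dotProduct_smul, smul_eq_mul]
        have h0 := hxmin (y i0) (hmem i0)
        rw [hsum] at h0
        have h1 : ∑ i ∈ s, w i * (u ⬝ᵥ y i - u ⬝ᵥ y i0) ≤ 0 := by
          simp only [mul_sub]
          rw [Finset.sum_sub_distrib, ← Finset.sum_mul, hw1]
          linarith
        have hnn : ∀ i ∈ s, 0 ≤ w i * (u ⬝ᵥ y i - u ⬝ᵥ y i0) := fun i hi =>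
          mul_nonneg (hw i hi) (sub_nonneg.2 (hi0 i))
        have h2 := (Finset.sum_eq_zero_iff_of_nonneg hnn).1
          (le_antisymm h1 (Finset.sum_nonneg hnn))
        rw [hsum]
        have h3 : ∀ i ∈ s, w i * (u' ⬝ᵥ y i) ≤ w i * (u' ⬝ᵥ y i0) := by
          intro i hi
          rcases mul_eq_zero.1 (h2 i hi) with h4 | h4
          · rw [h4, zero_mul, zero_mul]
          · refine mul_le_mul_of_nonneg_left (hu' i (fun j => ?_) i0) (hw i hi)
            have := hi0 j
            linarith
        calc ∑ i ∈ s, w i * (u' ⬝ᵥ y i) ≤ ∑ i ∈ s, w i * (u' ⬝ᵥ y i0) := Finset.sum_le_sum h3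
          _ = _ := by rw [← Finset.sum_mul, hw1, one_mul]
    ext σ
    constructor
    · rintro ⟨F, ⟨-, u, rfl⟩, rfl⟩
      exact ⟨u, hcone u⟩
    · rintro ⟨u, rfl⟩
      refine ⟨_, ⟨?_, u, rfl⟩, (hcone u).symm⟩
      obtain ⟨i0, hi0⟩ := Finite.exists_min fun i => u ⬝ᵥ y i
      exact ⟨y i0, hmem i0, hle u _ hi0⟩
  rw [key, key]
  simp only [h]

end Cayley

theorem affineSpan_eq_top_of_mem {n : ℕ} {S : Set (Fin n → ℝ)} {y : Fin n → ℝ} (hy : y ∈ S)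
    (h : ∀ i, ∃ k : ℝ, k ≠ 0 ∧ y + Pi.single i k ∈ S) : affineSpan ℝ S = ⊤ := by
  rw [AffineSubspace.affineSpan_eq_top_iff_vectorSpan_eq_top_of_nonempty ℝ _ _ ⟨y, hy⟩,
    eq_top_iff]
  intro x _
  rw [← Finset.univ_sum_single x]
  refine Submodule.sum_mem _ fun i _ => ?_
  obtain ⟨k, hk, hS⟩ := h i
  have h1 := vsub_mem_vectorSpan ℝ hS hy
  rw [vsub_eq_sub, add_sub_cancel_left] at h1
  have h2 := Submodule.smul_mem _ (x i / k) h1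
  rwa [← Pi.single_smul, smul_eq_mul, div_mul_cancel₀ _ hk] at h2

namespace SmoothModel

/-- In the expansion of `u` at `v` the term of `r` drops out on the facet `r`. Minimality on the
facet is thus decided by the edge directions inside it, which makes the normal fans of parallel
facets comparable. -/
theorem facet_min_iff {n : ℕ} (M : SmoothModel n) {r v : Fin n → ℤ} (hv : v ∈ M.V)
    (hr : r ∈ M.t v) (u : Fin n → ℝ) :
    (∀ w ∈ M.V, r ∈ M.t w → u ⬝ᵥ latticePt v ≤ u ⬝ᵥ latticePt w) ↔
      ∀ b ∈ M.t v, b ≠ r → 0 ≤ u ⬝ᵥ latticePt (M.E v b) := by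
  constructor
  · intro h b hb hbr
    have h1 := h _ (M.nb_mem hv hb) (M.mem_t_nb hv hb hr hbr.symm)
    unfold nb at h1
    rw [latticePt_add, latticePt_smul, dotProduct_add, dotProduct_smul, smul_eq_mul] at h1
    have hk : (0 : ℝ) < M.len v b := by exact_mod_cast M.len_pos hv hb
    exact nonneg_of_mul_nonneg_right (by linarith) hk
  · intro h w hw hrw
    have h1 := M.dot_sub_eq hv u (latticePt w)
    have h2 : 0 ≤ ∑ a ∈ M.t v, (u ⬝ᵥ latticePt (M.E v a)) *
        (latticePt a ⬝ᵥ latticePt w - latticePt a ⬝ᵥ latticePt v) := by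
      refine Finset.sum_nonneg fun a ha => ?_
      by_cases har : a = r
      · rw [har, le_antisymm (M.le_body hv hr (M.mem_body hw)) (M.le_body hw hrw (M.mem_body hv)),
          sub_self, mul_zero]
      · exact mul_nonneg (h a ha har) (sub_nonneg.2 (M.le_body hv ha (M.mem_body hw)))
    linarith

variable (M : SmoothModel 3)

/-- A smooth polytope whose vertices lie in two opposite parallel facets is a Cayley polytope. -/
theorem isCayleyOfPolygons {A : Fin 3 → ℤ} (hA : A ∈ Tri.verts M.T)
    (hcov : ∀ v ∈ M.V, A ∈ M.t v ∨ -A ∈ M.t v) : IsCayleyOfPolygons M.body := by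
  obtain ⟨v0, hv0, hAv0⟩ := M.mem_verts.1 hA
  obtain ⟨p, q, hpA, hqA, hpq, ht0⟩ := exists_others (M.dual v0 hv0).card hAv0
  have hp : p ∈ M.t v0 := by rw [ht0]; simp
  have hq : q ∈ M.t v0 := by rw [ht0]; simp
  have d0 := M.dual v0 hv0
  have hnot : ∀ v ∈ M.V, A ∈ M.t v → -A ∉ M.t v := by
    intro v hv h1 h2
    have hne : -A ≠ A := by
      intro h
      have e1 := (M.dual v hv).dot_self h1
      have e2 : (-A) ⬝ᵥ M.E v A = A ⬝ᵥ M.E v A := by rw [h]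
      rw [neg_dotProduct] at e2
      omega
    have := (M.dual v hv).dot_ne h1 h2 hne
    rw [neg_dotProduct, (M.dual v hv).dot_self h1] at this
    omega
  have hnbA : ∀ v ∈ M.V, A ∈ M.t v → -A ∈ M.t (M.nb v A) := fun v hv h =>
    (hcov _ (M.nb_mem hv h)).resolve_left (M.notMem_t_nb hv h)
  have hnbB : ∀ v ∈ M.V, -A ∈ M.t v → A ∈ M.t (M.nb v (-A)) := fun v hv h =>
    (hcov _ (M.nb_mem hv h)).resolve_right (M.notMem_t_nb hv h)
  -- The edge that leaves the facet `A` ends in the facet `-A` and keeps the other two normals, so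
  -- vertices of the two facets are matched.
  have hers : ∀ v (hv : v ∈ M.V) (h : A ∈ M.t v),
      M.t (M.nb v A) = insert (-A) ((M.t v).erase A) := by
    intro v hv h
    obtain ⟨a', ha', ht, -⟩ := M.exists_opp hv h
    have h1 := hnbA v hv h
    rw [ht, Finset.mem_insert] at h1
    rw [ht, h1.resolve_right fun h2 => hnot v hv h (Finset.mem_of_mem_erase h2)]
  have hdE : ∀ v ∈ M.V, A ∈ M.t v → ∀ b ∈ M.t v, b ≠ A → M.E (M.nb v A) b = M.E v b := by
    intro v hv h b hb hbA
    have hw := M.nb_mem hv h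
    have hbw := M.mem_t_nb hv h hb hbA
    refine M.eq_of_dot_eq hw fun c hc => ?_
    have hc' := hc
    rw [hers v hv h, Finset.mem_insert, Finset.mem_erase] at hc'
    rw [(M.dual _ hw).dot b hbw c hc]
    rcases hc' with rfl | ⟨hcA, hcv⟩
    · rw [neg_dotProduct, (M.dual v hv).dot_ne hb h hbA.symm, if_neg, neg_zero]
      rintro rfl
      exact hnot v hv h hb
    · rw [(M.dual v hv).dot b hb c hcv]
  have hconst : ∀ w ∈ M.V, -A ∈ M.t w → A ⬝ᵥ w = A ⬝ᵥ v0 + M.len v0 A := by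
    intro w hw h
    have hw0 := M.nb_mem hv0 hAv0
    have h1 := M.le w hw _ h _ hw0
    have h2 := M.le _ hw0 _ (hnbA v0 hv0 hAv0) w hw
    rw [neg_dotProduct, neg_dotProduct] at h1 h2
    rw [← M.dot_nb_self hv0 hAv0]
    omega
  have hconst0 : ∀ v ∈ M.V, A ∈ M.t v → A ⬝ᵥ v = A ⬝ᵥ v0 := fun v hv h =>
    le_antisymm (M.le v hv A h v0 hv0) (M.le v0 hv0 A hAv0 v hv)
  have hl := M.len_pos hv0 hAv0
  obtain ⟨s, hs⟩ : ∃ s : ℕ, M.len v0 A = s := ⟨_, (Int.toNat_of_nonneg hl.le).symm⟩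
  -- The coordinates `p` and `q` at `v0`, which parametrize both parallel facets; `A` becomes the
  -- Cayley coordinate.
  let π : (Fin 3 → ℤ) → Fin 2 → ℤ := fun x => ![p ⬝ᵥ x, q ⬝ᵥ x]
  let ι := {v // v ∈ M.V.filter fun v => A ∈ M.t v}
  have hι : ∀ v : ι, (v : Fin 3 → ℤ) ∈ M.V ∧ A ∈ M.t v := fun v => Finset.mem_filter.1 v.2
  let i0 : ι := ⟨v0, Finset.mem_filter.2 ⟨hv0, hAv0⟩⟩
  have : Nonempty ι := ⟨i0⟩
  let y : ι → Fin 2 → ℝ := fun v => latticePt (π v)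
  let z : ι → Fin 2 → ℝ := fun v => latticePt (π (M.nb v A))
  have hπ : ∀ (u : Fin 2 → ℝ) x, u ⬝ᵥ latticePt (π x) =
      (u 0 • latticePt p + u 1 • latticePt q) ⬝ᵥ latticePt x := by
    intro u x
    rw [add_dotProduct, smul_dotProduct, smul_dotProduct, latticePt_dot, latticePt_dot]
    simp [dotProduct, π, latticePt_apply, Fin.sum_univ_two]
  have hfin : ∀ (f : ι → Fin 2 → ℤ), ∃ S : Finset (Fin 2 → ℤ),
      convexHull ℝ (Set.range fun i => latticePt (f i)) =
        convexHull ℝ (latticePt '' (S : Set (Fin 2 → ℤ))) := by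
    intro f
    refine ⟨Finset.univ.image f, ?_⟩
    congr 1
    ext x
    simp only [Set.mem_range, Finset.coe_image, Finset.coe_univ, Set.image_univ]
    rw [← Set.range_comp]; rfl
  have hsingle : ∀ (b : Fin 3 → ℤ) (v : Fin 3 → ℤ), M.E v b = M.E v0 b → b = p ∨ b = q →
      π (M.nb v b) = π v + (if b = p then Pi.single 0 (M.len v b) else Pi.single 1 (M.len v b)) := by
    intro b v hE hb
    have e1 : p ⬝ᵥ M.nb v b = p ⬝ᵥ v + M.len v b * (if b = p then 1 else 0) := by
      rw [dot_nb, hE]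
      rcases hb with rfl | rfl
      · rw [d0.dot_self hp, if_pos rfl]
      · rw [d0.dot_ne hq hp hpq, if_neg hpq.symm]
    have e2 : q ⬝ᵥ M.nb v b = q ⬝ᵥ v + M.len v b * (if b = p then 0 else 1) := by
      rw [dot_nb, hE]
      rcases hb with rfl | rfl
      · rw [d0.dot_ne hp hq hpq.symm, if_pos rfl]
      · rw [d0.dot_self hq, if_neg hpq.symm]
    funext j
    fin_cases j
    · change p ⬝ᵥ M.nb v b = p ⬝ᵥ v + _
      rw [e1]; split_ifs <;> simp
    · change q ⬝ᵥ M.nb v b = q ⬝ᵥ v + _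
      rw [e2]; split_ifs <;> simp
  have hspan : ∀ (S : Set (Fin 2 → ℝ)) (v : Fin 3 → ℤ), v ∈ M.V → p ∈ M.t v → q ∈ M.t v →
      M.E v p = M.E v0 p → M.E v q = M.E v0 q →
      latticePt (π v) ∈ S → latticePt (π (M.nb v p)) ∈ S → latticePt (π (M.nb v q)) ∈ S →
      affineSpan ℝ S = ⊤ := by
    intro S v hv hpv hqv hEp hEq h1 h2 h3
    refine affineSpan_eq_top_of_mem h1 fun i => ?_
    have cast : ∀ (i : Fin 2) (k : ℤ), latticePt (Pi.single i k : Fin 2 → ℤ) =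
        (Pi.single i (k : ℝ) : Fin 2 → ℝ) := by
      intro i k
      funext j
      rw [latticePt_apply]
      by_cases h : j = i
      · subst h; simp
      · simp [h]
    fin_cases i
    · refine ⟨M.len v p, by exact_mod_cast (M.len_pos hv hpv).ne', ?_⟩
      rw [hsingle p v hEp (Or.inl rfl), if_pos rfl, latticePt_add, cast] at h2
      exact h2
    · refine ⟨M.len v q, by exact_mod_cast (M.len_pos hv hqv).ne', ?_⟩
      rw [hsingle q v hEq (Or.inr rfl), if_neg hpq.symm, latticePt_add, cast] at h3
      exact h3
  have hy : ∀ v ∈ M.V, A ∈ M.t v → latticePt (π v) ∈ convexHull ℝ (Set.range y) := fun v hv h =>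
    subset_convexHull ℝ _ ⟨⟨v, Finset.mem_filter.2 ⟨hv, h⟩⟩, rfl⟩
  have hback : ∀ w ∈ M.V, -A ∈ M.t w → M.nb (M.nb w (-A)) A = w := by
    intro w hw h
    have h1 := M.nb_mem hw h
    have h2 := hnbB w hw h
    rcases M.eq_or_eq_nb h1 h2 hw (by
      intro b hb
      obtain ⟨a', ha', ht, -⟩ := M.exists_opp hw h
      rw [ht] at hb h2
      rw [Finset.mem_erase, Finset.mem_insert] at hb
      rw [Finset.mem_insert] at h2
      have : A = a' := h2.resolve_right fun h3 => hnot w hw (Finset.mem_of_mem_erase h3) h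
      rcases hb with ⟨hbA, hb | hb⟩
      · exact absurd (hb.trans this.symm) hbA
      · exact Finset.mem_of_mem_erase hb) with h3 | h3
    · rw [← h3] at h2
      exact absurd h (hnot w hw h2)
    · exact h3.symm
  have hz : ∀ w ∈ M.V, -A ∈ M.t w → latticePt (π w) ∈ convexHull ℝ (Set.range z) := by
    intro w hw h
    refine subset_convexHull ℝ _ ⟨⟨M.nb w (-A), Finset.mem_filter.2 ⟨M.nb_mem hw h,
      hnbB w hw h⟩⟩, ?_⟩
    change latticePt (π (M.nb (M.nb w (-A)) A)) = _
    rw [hback w hw h]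
  refine ⟨s, convexHull ℝ (Set.range y), convexHull ℝ (Set.range z), by omega,
    ⟨hfin _, ?_⟩, ⟨hfin _, ?_⟩, ?_, ?_⟩
  · exact hspan _ v0 hv0 hp hq rfl rfl (hy _ hv0 hAv0)
      (hy _ (M.nb_mem hv0 hp) (M.mem_t_nb hv0 hp hAv0 hpA.symm))
      (hy _ (M.nb_mem hv0 hq) (M.mem_t_nb hv0 hq hAv0 hqA.symm))
  · have hw := M.nb_mem hv0 hAv0
    have hB := hnbA v0 hv0 hAv0
    have hpw := M.mem_t_nb hv0 hAv0 hp hpA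
    have hqw := M.mem_t_nb hv0 hAv0 hq hqA
    have hpB : -A ≠ p := fun h => hnot v0 hv0 hAv0 (h ▸ hp)
    have hqB : -A ≠ q := fun h => hnot v0 hv0 hAv0 (h ▸ hq)
    exact hspan _ _ hw hpw hqw (hdE v0 hv0 hAv0 p hp hpA) (hdE v0 hv0 hAv0 q hq hqA)
      (hz _ hw hB) (hz _ (M.nb_mem hw hpw) (M.mem_t_nb hw hpw hB hpB))
      (hz _ (M.nb_mem hw hqw) (M.mem_t_nb hw hqw hB hqB))
  · refine normalFan_eq_of_forall y z fun u i => ?_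
    obtain ⟨hv, hAv⟩ := hι i
    have hw := M.nb_mem hv hAv
    have hB := hnbA _ hv hAv
    set û := u 0 • latticePt p + u 1 • latticePt q with hû
    have h1 : (∀ j, u ⬝ᵥ y i ≤ u ⬝ᵥ y j) ↔
        ∀ w ∈ M.V, A ∈ M.t w → û ⬝ᵥ latticePt i.1 ≤ û ⬝ᵥ latticePt w := by
      constructor
      · intro h w hw hAw
        have := h ⟨w, Finset.mem_filter.2 ⟨hw, hAw⟩⟩
        simp only [y, hπ] at this
        exact this
      · intro h j
        simp only [y, hπ]
        exact h j (hι j).1 (hι j).2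
    have h2 : (∀ j, u ⬝ᵥ z i ≤ u ⬝ᵥ z j) ↔
        ∀ w ∈ M.V, -A ∈ M.t w → û ⬝ᵥ latticePt (M.nb i.1 A) ≤ û ⬝ᵥ latticePt w := by
      constructor
      · intro h w hw hBw
        have := h ⟨M.nb w (-A), Finset.mem_filter.2 ⟨M.nb_mem hw hBw, hnbB w hw hBw⟩⟩
        simp only [z, hπ] at this
        rwa [hback w hw hBw] at this
      · intro h j
        simp only [z, hπ]
        exact h _ (M.nb_mem (hι j).1 (hι j).2) (hnbA _ (hι j).1 (hι j).2)
    -- Matched vertices have the same edge directions within their facets, so the same functionals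
    -- are minimal at both.
    rw [h1, h2, M.facet_min_iff hv hAv, M.facet_min_iff hw hB, hers _ hv hAv]
    constructor
    · intro h b hb hbB
      obtain ⟨hbA, hb⟩ := Finset.mem_erase.1 ((Finset.mem_insert.1 hb).resolve_left hbB)
      rw [hdE _ hv hAv b hb hbA]
      exact h b hb hbA
    · intro h b hb hbA
      have := h b (Finset.mem_insert_of_mem (Finset.mem_erase.2 ⟨hbA, hb⟩)) (fun h' =>
        hnot _ hv hAv (h' ▸ hb))
      rwa [hdE _ hv hAv b hb hbA] at this
  · have hdual : ∀ i j : Fin 3, (![p, q, A] : Fin 3 → Fin 3 → ℤ) i ⬝ᵥ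
        (![M.E v0 p, M.E v0 q, M.E v0 A] : Fin 3 → Fin 3 → ℤ) j = if i = j then 1 else 0 := by
      intro i j
      fin_cases i <;> fin_cases j <;>
        simp [d0.dot_self hp, d0.dot_self hq, d0.dot_self hAv0, d0.dot_ne hp hq hpq.symm,
          d0.dot_ne hq hp hpq, d0.dot_ne hp hAv0 hpA.symm, d0.dot_ne hAv0 hp hpA,
          d0.dot_ne hq hAv0 hqA.symm, d0.dot_ne hAv0 hq hqA]
    obtain ⟨φ, hφ, hlat⟩ := exists_affineEquiv _ _ ![0, 0, A ⬝ᵥ v0] hdual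
    refine ⟨φ, hlat, ?_⟩
    rw [cayley_convexHull s _ ![Set.range y, Set.range z] (by
      intro i; fin_cases i <;> rfl)]
    unfold body
    have hcoe : (φ : (Fin 3 → ℝ) → Fin 3 → ℝ) = (φ.toAffineMap : (Fin 3 → ℝ) → Fin 3 → ℝ) := rfl
    rw [hcoe, AffineMap.image_convexHull]
    refine congrArg (convexHull ℝ) ?_
    have hval0 : ∀ v ∈ M.V, A ∈ M.t v → φ (latticePt v) =
        Fin.append (latticePt (π v)) ((s : ℝ) • cayleyVertex (k := 1) 0) := by
      intro v hv h
      funext j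
      rw [hφ]
      fin_cases j
      · simp [Fin.append, Fin.addCases, π, latticePt_apply, latticePt_dot]
      · simp [Fin.append, Fin.addCases, π, latticePt_apply, latticePt_dot]
      · simp [Fin.append, Fin.addCases, latticePt_dot, cayleyVertex, hconst0 v hv h]
    have hval1 : ∀ v ∈ M.V, -A ∈ M.t v → φ (latticePt v) =
        Fin.append (latticePt (π v)) ((s : ℝ) • cayleyVertex (k := 1) 1) := by
      intro v hv h
      funext j
      rw [hφ]
      fin_cases j
      · simp [Fin.append, Fin.addCases, π, latticePt_apply, latticePt_dot]
      · simp [Fin.append, Fin.addCases, π, latticePt_apply, latticePt_dot]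
      · simp [Fin.append, Fin.addCases, latticePt_dot, cayleyVertex, hconst v hv h, hs]
    ext x
    simp only [Set.mem_iUnion, Set.mem_image]
    constructor
    · rintro ⟨_, ⟨v, hv, rfl⟩, rfl⟩
      rcases hcov v hv with h | h
      · exact ⟨0, _, ⟨⟨v, Finset.mem_filter.2 ⟨hv, h⟩⟩, rfl⟩, (hval0 v hv h).symm⟩
      · refine ⟨1, _, ⟨⟨M.nb v (-A), Finset.mem_filter.2 ⟨M.nb_mem hv h, hnbB v hv h⟩⟩, rfl⟩, ?_⟩
        change Fin.append (latticePt (π (M.nb (M.nb v (-A)) A))) _ = _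
        rw [hback v hv h]
        exact (hval1 v hv h).symm
    · rintro ⟨k, x', hx', rfl⟩
      rcases (show k = 0 ∨ k = 1 by fin_cases k <;> simp) with rfl | rfl
      · obtain ⟨i, rfl⟩ : ∃ j, y j = x' := hx'
        exact ⟨_, ⟨_, (hι i).1, rfl⟩, hval0 _ (hι i).1 (hι i).2⟩
      · obtain ⟨i, rfl⟩ : ∃ j, z j = x' := hx'
        have hw := M.nb_mem (hι i).1 (hι i).2
        exact ⟨_, ⟨_, hw, rfl⟩, hval1 _ hw (hnbA _ (hι i).1 (hι i).2)⟩

end SmoothModel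


/-! ### Small triangulations -/

section Perm

variable {α : Type*} [DecidableEq α] {T : Finset (Finset α)}

theorem Tri.rot {a b c : α} (h : {a, b, c} ∈ T) : {b, c, a} ∈ T := by
  rwa [Finset.pair_comm c a, Finset.insert_comm b a]

theorem Tri.swap {a b c : α} (h : {a, b, c} ∈ T) : {a, c, b} ∈ T := by rwa [Finset.pair_comm]

theorem Tri.flip {a b c : α} (h : {a, b, c} ∈ T) : {b, a, c} ∈ T := by rwa [Finset.insert_comm]

/-- When the vertices with degrees in `K` already number all the vertices, no other degree occurs.
-/
theorem Tri.deg_mem {K : Finset ℕ} (h : ∑ m ∈ K, Tri.num T m = (Tri.verts T).card) {x : α}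
    (hx : x ∈ Tri.verts T) : Tri.deg T x ∈ K := by
  have h1 : ((Tri.verts T).filter fun x => Tri.deg T x ∈ K).card = (Tri.verts T).card := by
    rw [Finset.card_eq_sum_card_fiberwise (s := (Tri.verts T).filter fun x => Tri.deg T x ∈ K)
      (f := Tri.deg T) (t := K) (fun x hx => (Finset.mem_filter.1 hx).2), ← h]
    refine Finset.sum_congr rfl fun m hm => ?_
    unfold Tri.num
    congr 1
    ext x
    simp only [Finset.mem_filter]
    constructor
    · rintro ⟨⟨h1, -⟩, h2⟩; exact ⟨h1, h2⟩
    · rintro ⟨h1, h2⟩; exact ⟨⟨h1, h2 ▸ hm⟩, h2⟩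
  have h2 := Finset.eq_of_subset_of_card_le (Finset.filter_subset _ _) h1.ge
  rw [← h2] at hx
  exact (Finset.mem_filter.1 hx).2

theorem Tri.exists_two_of_num {m : ℕ} (h : Tri.num T m = 2) : ∃ a b, a ≠ b ∧ a ∈ Tri.verts T ∧
    b ∈ Tri.verts T ∧ ∀ x ∈ Tri.verts T, Tri.deg T x = m ↔ x = a ∨ x = b := by
  obtain ⟨a, b, hab, he⟩ := Finset.card_eq_two.1 h
  have hiff : ∀ x, (x ∈ Tri.verts T ∧ Tri.deg T x = m) ↔ x = a ∨ x = b := by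
    intro x
    rw [← Finset.mem_filter (p := fun x => Tri.deg T x = m), he, Finset.mem_insert,
      Finset.mem_singleton]
  exact ⟨a, b, hab, ((hiff a).2 (Or.inl rfl)).1, ((hiff b).2 (Or.inr rfl)).1, fun x hx =>
    ⟨fun h => (hiff x).1 ⟨hx, h⟩, fun h => ((hiff x).2 h).2⟩⟩

theorem Tri.exists_one_of_num {m : ℕ} (h : Tri.num T m = 1) : ∃ a, a ∈ Tri.verts T ∧
    ∀ x ∈ Tri.verts T, Tri.deg T x = m ↔ x = a := by
  obtain ⟨a, he⟩ := Finset.card_eq_one.1 h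
  have hiff : ∀ x, (x ∈ Tri.verts T ∧ Tri.deg T x = m) ↔ x = a := by
    intro x
    rw [← Finset.mem_filter (p := fun x => Tri.deg T x = m), he, Finset.mem_singleton]
  exact ⟨a, ((hiff a).2 rfl).1, fun x hx =>
    ⟨fun h => (hiff x).1 ⟨hx, h⟩, fun h => ((hiff x).2 h).2⟩⟩

theorem Tri.mem_verts_of_mem {a b c : α} (h : {a, b, c} ∈ T) :
    a ∈ Tri.verts T ∧ b ∈ Tri.verts T ∧ c ∈ Tri.verts T :=
  ⟨Tri.mem_verts.2 ⟨_, h, by simp⟩, Tri.mem_verts.2 ⟨_, h, by simp⟩,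
    Tri.mem_verts.2 ⟨_, h, by simp⟩⟩

/-- Triangles at two vertices that are not adjacent. -/
theorem Tri.cover {a b : α} (hab : ∀ t ∈ T, a ∈ t → b ∉ t)
    (h : T.card ≤ Tri.deg T a + Tri.deg T b) {t : Finset α} (ht : t ∈ T) : a ∈ t ∨ b ∈ t := by
  have hd : Disjoint (T.filter fun t => a ∈ t) (T.filter fun t => b ∈ t) := by
    rw [Finset.disjoint_left]
    intro t h1 h2
    rw [Finset.mem_filter] at h1 h2
    exact hab t h1.1 h1.2 h2.2
  have h1 := Finset.card_union_of_disjoint hd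
  have hsub : (T.filter fun t => a ∈ t) ∪ (T.filter fun t => b ∈ t) ⊆ T :=
    Finset.union_subset (Finset.filter_subset _ _) (Finset.filter_subset _ _)
  have h2 := Finset.eq_of_subset_of_card_le hsub (by rw [h1]; exact h)
  rw [← h2, Finset.mem_union, Finset.mem_filter, Finset.mem_filter] at ht
  exact ht.imp And.right And.right

/-- Inclusion and exclusion: exactly two triangles contain both ends of an edge. -/
theorem IsTri.card_avoid (h : IsTri T) {a b c : α} (ht : {a, b, c} ∈ T) :
    (T.filter fun t => a ∉ t ∧ b ∉ t).card + Tri.deg T a + Tri.deg T b = T.card + 2 := by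
  have h1 := h.pair a b (h.ne_of_mem ht).1 ⟨_, ht, by simp, by simp⟩
  have h2 := Finset.card_union_add_card_inter (T.filter fun t => a ∈ t) (T.filter fun t => b ∈ t)
  rw [← Finset.filter_or, ← Finset.filter_and, h1] at h2
  have h3 := Finset.card_filter_add_card_filter_not (s := T) fun t => a ∈ t ∨ b ∈ t
  simp only [not_or] at h3
  unfold Tri.deg
  omega

end Perm

namespace SmoothModel

variable (M : SmoothModel 3)

section Combinatorics

variable {A B C D X Y : Fin 3 → ℤ}

theorem ne_of_mem (h : {A, B, C} ∈ M.T) : A ≠ B ∧ A ≠ C ∧ B ≠ C := M.isTri.ne_of_mem h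

/-- The link of `C` is a four-cycle `A, B, X, Y`. -/
theorem quad_step (hC : Tri.deg M.T C = 4) (h : {C, A, B} ∈ M.T) :
    ∃ X Y, {C, B, X} ∈ M.T ∧ {C, X, Y} ∈ M.T ∧ {C, Y, A} ∈ M.T ∧ A ≠ X ∧ B ≠ Y := by
  obtain ⟨s, rfl, rfl, hs⟩ := M.exists_cycle h
  have h3 := hs.mem 3
  rw [(hs.eq_iff (3 + 1) 0).2 (by rw [hC]; norm_num)] at h3
  refine ⟨s 2, s 3, hs.mem 1, hs.mem 2, h3, fun e => ?_, fun e => ?_⟩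
  · rw [hs.eq_iff, hC] at e; norm_num at e
  · rw [hs.eq_iff, hC] at e; norm_num at e

theorem next_unique {x z z' : Fin 3 → ℤ} (h1 : {A, B, x} ∈ M.T) (h2 : {A, B, z} ∈ M.T)
    (h3 : {A, B, z'} ∈ M.T) (hz : z ≠ x) (hz' : z' ≠ x) : z = z' :=
  M.isTri.eq_of_three h1 h2 h3 hz hz'

/-- The walk around `A` closes after three steps, so the degree divides three. -/
theorem deg_dvd_three (h1 : {A, B, C} ∈ M.T) (h2 : {A, C, D} ∈ M.T) (h3 : {A, D, B} ∈ M.T) :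
    Tri.deg M.T A ≤ 3 := by
  obtain ⟨s, rfl, rfl, hs⟩ := M.exists_cycle h1
  have hA := (Tri.mem_verts_of_mem h1).1
  have h4 := M.three_le_deg hA
  have hne : s 2 ≠ s 0 := by
    rw [Ne, hs.eq_iff]
    intro h
    have := Int.le_of_dvd (by norm_num) h
    omega
  have hne' : s 3 ≠ s 1 := by
    rw [Ne, hs.eq_iff]
    intro h
    have := Int.le_of_dvd (by norm_num) h
    omega
  have e2 : s 2 = D := M.next_unique (Tri.swap (hs.mem 0)) (hs.mem 1) h2 hne
    (M.ne_of_mem h3).2.2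
  have e3 : s 3 = s 0 := M.next_unique (Tri.swap h2) (e2 ▸ hs.mem 2) h3 hne'
    (M.ne_of_mem h1).2.2
  rw [hs.eq_iff] at e3
  have := Int.le_of_dvd (by norm_num) e3
  omega

theorem deg_le_four {E : Fin 3 → ℤ} (h1 : {A, B, C} ∈ M.T) (h2 : {A, C, D} ∈ M.T)
    (h3 : {A, D, E} ∈ M.T) (h4 : {A, E, B} ∈ M.T) (hD : D ≠ B) (hE : E ≠ C) :
    Tri.deg M.T A ≤ 4 := by
  obtain ⟨s, rfl, rfl, hs⟩ := M.exists_cycle h1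
  have hA := (Tri.mem_verts_of_mem h1).1
  have h5 := M.three_le_deg hA
  have hne : ∀ i, s (i + 2) ≠ s i := by
    intro i
    rw [Ne, hs.eq_iff]
    intro h
    have := Int.le_of_dvd (by norm_num) h
    omega
  have e2 : s 2 = D := M.next_unique (Tri.swap (hs.mem 0)) (hs.mem 1) h2 (hne 0) hD
  have e3 : s 3 = E := M.next_unique (Tri.swap h2) (e2 ▸ hs.mem 2) h3 (hne 1) hE
  have e4 : s 4 = s 0 := M.next_unique (Tri.swap h3) (e3 ▸ hs.mem 3) h4 (e2 ▸ hne 2) hD.symm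
  rw [hs.eq_iff] at e4
  have := Int.le_of_dvd (by norm_num) e4
  omega

/-- Two steps away from an edge `AB` along facets with four edges. -/
theorem quad_ladder (hX : Tri.deg M.T X = 4) (hY : Tri.deg M.T Y = 4)
    (h1 : {C, B, X} ∈ M.T) (h2 : {C, X, Y} ∈ M.T) (h3 : {C, Y, A} ∈ M.T) (hAX : A ≠ X)
    (hBY : B ≠ Y) : ∃ Z, {X, Y, Z} ∈ M.T ∧ Z ≠ C ∧ Z ≠ A ∧ Z ≠ B ∧ {A, Y, Z} ∈ M.T := by
  have k1 : {X, B, C} ∈ M.T := Tri.swap (Tri.rot (Tri.rot h1))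
  have k2 : {X, C, Y} ∈ M.T := Tri.flip h2
  have k3 : {Y, C, X} ∈ M.T := Tri.rot (Tri.rot h2)
  have k4 : {Y, C, A} ∈ M.T := Tri.flip h3
  obtain ⟨Y', Z, a1, a2, a3, a4, a5⟩ := M.quad_step hX k1
  obtain ⟨A', Z', b1, b2, b3, b4, b5⟩ := M.quad_step hY (Tri.swap k3)
  obtain rfl : Y' = Y := M.next_unique (Tri.swap k1) a1 k2 a4.symm hBY.symm
  obtain rfl : A' = A := M.next_unique k3 b1 k4 b4.symm hAX
  obtain rfl : Z' = Z := M.next_unique (Tri.swap k2) (Tri.rot (Tri.rot b3)) a2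
    b5.symm a5.symm
  exact ⟨Z', a2, a5.symm, (M.ne_of_mem b2).2.2.symm, (M.ne_of_mem a3).2.2, Tri.flip b2⟩

/-- Two adjacent facets such that all the others have four edges and just two vertices lie on
neither of them. -/
theorem not_adjacent (hA : 5 ≤ Tri.deg M.T A) (hq : ∀ x ∈ Tri.verts M.T, x ≠ A → x ≠ B →
    Tri.deg M.T x = 4) (hcard : M.T.card ≤ Tri.deg M.T A + Tri.deg M.T B)
    (t : Finset (Fin 3 → ℤ)) (ht : t ∈ M.T) (hAB : A ≠ B) (hAt : A ∈ t) (hBt : B ∈ t) : False := by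
  obtain ⟨C, hCA, hCB, rfl⟩ := exists_third (M.isTri.card t ht) hAt hBt hAB
  obtain ⟨D, hDC, hD⟩ := M.isTri.exists_next (Tri.swap ht)
  obtain ⟨-, hDA, hDB⟩ := M.ne_of_mem hD
  have hstep : ∀ C, C ≠ A → C ≠ B → {A, B, C} ∈ M.T → ∃ X Y Z, {C, X, Y} ∈ M.T ∧ {X, Y, Z} ∈ M.T ∧
      Z ≠ C ∧ A ∉ ({C, X, Y} : Finset (Fin 3 → ℤ)) ∧ B ∉ ({C, X, Y} : Finset (Fin 3 → ℤ)) ∧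
      A ∉ ({X, Y, Z} : Finset (Fin 3 → ℤ)) ∧ B ∉ ({X, Y, Z} : Finset (Fin 3 → ℤ)) ∧
      {A, C, Y} ∈ M.T ∧ {A, Y, Z} ∈ M.T := by
    intro C hCA hCB ht
    obtain ⟨-, -, vC⟩ := Tri.mem_verts_of_mem ht
    obtain ⟨X, Y, h1, h2, h3, hAX, hBY⟩ := M.quad_step (hq C vC hCA hCB) (Tri.rot (Tri.rot ht))
    obtain ⟨-, vX, vY⟩ := Tri.mem_verts_of_mem h2
    obtain ⟨-, -, hBX⟩ := M.ne_of_mem h1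
    obtain ⟨-, -, hYA⟩ := M.ne_of_mem h3
    obtain ⟨Z, h4, h5, h6, h7, h8⟩ := M.quad_ladder (hq X vX hAX.symm hBX.symm)
      (hq Y vY hYA hBY.symm) h1 h2 h3 hAX hBY
    refine ⟨X, Y, Z, h2, h4, h5, ?_, ?_, ?_, ?_, Tri.rot (Tri.rot (Tri.swap (Tri.swap h3))), h8⟩ <;>
      simp [hCA.symm, hCB.symm, hAX, hBX, hYA.symm, hBY, h6.symm, h7.symm]
  -- At most two triangles avoid both `A` and `B`. The ladder that starts at `C` produces two of
  -- them, and so does the one that starts at `D`; hence the pairs agree.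
  have hF := M.isTri.card_avoid ht
  set F := M.T.filter fun t => A ∉ t ∧ B ∉ t with hFdef
  obtain ⟨X, Y, Z, c1, c2, c3, c4, c5, c6, c7, c8, c9⟩ := hstep C hCA hCB ht
  obtain ⟨X', Y', Z', d1, d2, d3, d4, d5, d6, d7, d8, d9⟩ := hstep D hDA.symm hDB.symm hD
  obtain ⟨nCX, nCY, nXY⟩ := M.ne_of_mem c1
  obtain ⟨-, nXZ, nYZ⟩ := M.ne_of_mem c2
  obtain ⟨nDX, nDY, -⟩ := M.ne_of_mem d1
  have hne : ({C, X, Y} : Finset (Fin 3 → ℤ)) ≠ {X, Y, Z} := by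
    intro h
    have : C ∈ ({X, Y, Z} : Finset (Fin 3 → ℤ)) := h ▸ (by simp)
    simp [nCX, nCY, c3.symm] at this
  have hne' : ({D, X', Y'} : Finset (Fin 3 → ℤ)) ≠ {X', Y', Z'} := by
    intro h
    have : D ∈ ({X', Y', Z'} : Finset (Fin 3 → ℤ)) := h ▸ (by simp)
    simp [nDX, nDY, d3.symm] at this
  have hF2 : F = {{C, X, Y}, {X, Y, Z}} := by
    symm
    apply Finset.eq_of_subset_of_card_le
    · intro s hs
      rw [Finset.mem_insert, Finset.mem_singleton] at hs
      rw [hFdef, Finset.mem_filter]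
      rcases hs with rfl | rfl
      · exact ⟨c1, c4, c5⟩
      · exact ⟨c2, c6, c7⟩
    · rw [Finset.card_pair hne]; omega
  have m1 : ({D, X', Y'} : Finset (Fin 3 → ℤ)) ∈ F := Finset.mem_filter.2 ⟨d1, d4, d5⟩
  have m2 : ({X', Y', Z'} : Finset (Fin 3 → ℤ)) ∈ F := Finset.mem_filter.2 ⟨d2, d6, d7⟩
  rw [hF2, Finset.mem_insert, Finset.mem_singleton] at m1 m2
  have hDnot : D ∉ ({X', Y', Z'} : Finset (Fin 3 → ℤ)) := by simp [nDX, nDY, d3.symm]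
  have hDXY : D ≠ X ∧ D ≠ Y := by
    constructor
    · rintro rfl
      rcases m2 with h | h <;> exact hDnot (h ▸ (by simp))
    · rintro rfl
      rcases m2 with h | h <;> exact hDnot (h ▸ (by simp))
  -- `D` lies in just one of the two triangles and is not `C`, so it is the far end of the ladder of
  -- `C`. Then `B, C, Y, Z` close up around `A`, whose degree would be at most four.
  have hDZ : D = Z := by
    have h0 : D ∈ ({D, X', Y'} : Finset (Fin 3 → ℤ)) := by simp
    rcases m1 with h | h <;> rw [h] at h0
    · simp [hDC, hDXY.1, hDXY.2] at h0
    · simpa [hDXY.1, hDXY.2] using h0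
  have := M.deg_le_four ht c8 c9 (hDZ ▸ Tri.swap hD) (by rintro rfl; simp at c5) c3
  omega

/-- The same with a heptagon, a hexagon, a triangle, and quadrangles. -/
theorem not_heptagon_hexagon {W : Fin 3 → ℤ} (hA : 4 ≤ Tri.deg M.T A) (hB : 4 ≤ Tri.deg M.T B)
    (hq : ∀ x ∈ Tri.verts M.T, x ≠ A → x ≠ B → x ≠ W → Tri.deg M.T x = 4)
    (hcard : M.T.card + 1 ≤ Tri.deg M.T A + Tri.deg M.T B)
    (t : Finset (Fin 3 → ℤ)) (ht : t ∈ M.T) (hAB : A ≠ B) (hAt : A ∈ t) (hBt : B ∈ t) : False := by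
  obtain ⟨C, hCA, hCB, rfl⟩ := exists_third (M.isTri.card t ht) hAt hBt hAB
  obtain ⟨D, hDC, hD⟩ := M.isTri.exists_next (Tri.swap ht)
  obtain ⟨-, hDA, hDB⟩ := M.ne_of_mem hD
  have hF := M.isTri.card_avoid ht
  set F := M.T.filter fun t => A ∉ t ∧ B ∉ t with hFdef
  have hF1 : F.card ≤ 1 := by omega
  rw [Finset.card_le_one] at hF1
  -- Only one triangle may avoid `A` and `B`. From `C` one obtains `C X Y`. If `D` is the
  -- exceptional vertex, the ladder goes one step further and gives a second such triangle;
  -- otherwise `D` gives one too, different because `D = X` or `D = Y` would make `B` or `A` have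
  -- degree three.
  have main : ∀ C D, C ≠ A → C ≠ B → D ≠ A → D ≠ B → D ≠ C → {A, B, C} ∈ M.T → {A, B, D} ∈ M.T →
      C ≠ W → False := by
    intro C D hCA hCB hDA hDB hDC ht hD hCW
    obtain ⟨-, -, vC⟩ := Tri.mem_verts_of_mem ht
    obtain ⟨-, -, vD⟩ := Tri.mem_verts_of_mem hD
    obtain ⟨X, Y, h1, h2, h3, hAX, hBY⟩ := M.quad_step (hq C vC hCA hCB hCW)
      (Tri.rot (Tri.rot ht))
    obtain ⟨-, vX, vY⟩ := Tri.mem_verts_of_mem h2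
    obtain ⟨-, -, hBX⟩ := M.ne_of_mem h1
    obtain ⟨-, -, hYA⟩ := M.ne_of_mem h3
    obtain ⟨nCX, nCY, nXY⟩ := M.ne_of_mem h2
    have hXD : X ≠ D := by
      rintro rfl
      have := M.deg_dvd_three (Tri.flip ht : {B, A, C} ∈ M.T) (Tri.flip h1) (Tri.rot hD)
      omega
    have hYD : Y ≠ D := by
      rintro rfl
      have := M.deg_dvd_three ht (Tri.rot (Tri.rot h3)) (Tri.swap hD)
      omega
    have m1 : ({C, X, Y} : Finset (Fin 3 → ℤ)) ∈ F := Finset.mem_filter.2 ⟨h2, by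
      simp [hCA.symm, hAX, hYA.symm], by simp [hCB.symm, hBX, hBY]⟩
    by_cases hDW : D = W
    · obtain ⟨Z, h4, h5, h6, h7, h8⟩ := M.quad_ladder (hq X vX hAX.symm hBX.symm (hDW ▸ hXD))
        (hq Y vY hYA hBY.symm (hDW ▸ hYD)) h1 h2 h3 hAX hBY
      have m2 : ({X, Y, Z} : Finset (Fin 3 → ℤ)) ∈ F := Finset.mem_filter.2 ⟨h4, by
        simp [hYA.symm, hAX, h6.symm], by simp [hBX, hBY, h7.symm]⟩
      have h0 : C ∈ ({C, X, Y} : Finset (Fin 3 → ℤ)) := by simp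
      rw [hF1 _ m1 _ m2] at h0
      simp [nCX, nCY, h5.symm] at h0
    · obtain ⟨X', Y', k1, k2, k3, kAX, kBY⟩ := M.quad_step (hq D vD hDA hDB hDW)
        (Tri.rot (Tri.rot hD))
      obtain ⟨-, -, kBX⟩ := M.ne_of_mem k1
      obtain ⟨-, -, kYA⟩ := M.ne_of_mem k3
      have m2 : ({D, X', Y'} : Finset (Fin 3 → ℤ)) ∈ F := Finset.mem_filter.2 ⟨k2, by
        simp [hDA.symm, kAX, kYA.symm], by simp [hDB.symm, kBX, kBY]⟩
      have h0 : D ∈ ({D, X', Y'} : Finset (Fin 3 → ℤ)) := by simp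
      rw [← hF1 _ m1 _ m2] at h0
      simp [hDC, hXD.symm, hYD.symm] at h0
  by_cases hCW : C = W
  · exact main D C hDA.symm hDB.symm hCA hCB hDC.symm hD ht (hCW ▸ hDC)
  · exact main C D hCA hCB hDA.symm hDB.symm hDC ht hD hCW

end Combinatorics

end SmoothModel


/-! ### Prisms -/

namespace SmoothModel

variable (M : SmoothModel 3)

theorem card_facet (r : Fin 3 → ℤ) : (M.V.filter fun v => r ∈ M.t v).card = Tri.deg M.T r := by
  unfold Tri.deg
  rw [← Finset.card_image_of_injOn (s := M.V.filter fun v => r ∈ M.t v) (f := M.t)]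
  · congr 1
    ext t
    simp only [Finset.mem_image, Finset.mem_filter, mem_T]
    constructor
    · rintro ⟨v, ⟨hv, hr⟩, rfl⟩; exact ⟨⟨v, hv, rfl⟩, hr⟩
    · rintro ⟨⟨_, hv, rfl⟩, hr⟩; exact ⟨_, ⟨hv, hr⟩, rfl⟩
  · intro v hv w hw h
    rw [Finset.mem_coe, Finset.mem_filter] at hv hw
    exact M.t_inj hv.1 hw.1 h

variable {A B : Fin 3 → ℤ}

theorem isCayley_of_eq_neg (hA : A ∈ Tri.verts M.T) (hdisj : ∀ t ∈ M.T, A ∈ t → B ∉ t)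
    (hcard : M.T.card ≤ Tri.deg M.T A + Tri.deg M.T B) (h : B = -A) :
    IsCayleyOfPolygons M.body :=
  M.isCayleyOfPolygons hA fun _ hv => h ▸ Tri.cover hdisj hcard (M.t_mem_T hv)

/-- A polytope with the combinatorial type of a prism, having three edges of length one between
top and bottom, is a Cayley polytope. -/
theorem isCayley_of_prism (hA : A ∈ Tri.verts M.T) (hB : B ∈ Tri.verts M.T)
    (hdisj : ∀ t ∈ M.T, A ∈ t → B ∉ t)
    (hcard : M.T.card ≤ Tri.deg M.T A + Tri.deg M.T B)
    (hL : (M.V.filter fun v => A ∈ M.t v ∧ M.len v A ≠ 1).card + 3 ≤ Tri.deg M.T A) :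
    IsCayleyOfPolygons M.body := by
  refine M.isCayley_of_eq_neg hA hdisj hcard ?_
  have hcov : ∀ v ∈ M.V, A ∈ M.t v ∨ B ∈ M.t v := fun v hv =>
    Tri.cover hdisj hcard (M.t_mem_T hv)
  have h3 : 2 < (M.V.filter fun v => A ∈ M.t v ∧ M.len v A = 1).card := by
    have h1 := Finset.card_filter_add_card_filter_not (s := M.V.filter fun v => A ∈ M.t v)
      fun v => M.len v A = 1
    rw [Finset.filter_filter, Finset.filter_filter, M.card_facet] at h1
    simp only [ne_eq] at hL
    omega
  obtain ⟨v₁, v₂, v₃, h1, h2, h3, h12, h13, h23⟩ := Finset.two_lt_card_iff.1 h3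
  rw [Finset.mem_filter] at h1 h2 h3
  have hB' : ∀ v ∈ M.V, A ∈ M.t v → B ⬝ᵥ M.E v A = -1 := by
    intro v hv hAv
    obtain ⟨a', ha', ht, hE, -⟩ := M.exists_opp hv hAv
    have h4 := (hcov _ (M.nb_mem hv hAv)).resolve_left (M.notMem_t_nb hv hAv)
    rw [ht, Finset.mem_insert] at h4
    rw [h4.resolve_right fun h5 => hdisj _ (M.t_mem_T hv) hAv (Finset.mem_of_mem_erase h5)]
    exact hE
  -- The facets are disjoint, so the two distances do not both vanish. Their sum is one at the foot
  -- of every connecting edge of length one, and this is its minimum.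
  have hmin : ∀ w ∈ M.V, 1 ≤ M.phi A w + M.phi B w := by
    intro w hw
    have hnA := M.phi_nonneg A hw
    have hnB := M.phi_nonneg B hw
    by_contra hlt
    exact hdisj _ (M.t_mem_T hw) ((M.phi_eq_zero hw hA).1 (by omega))
      ((M.phi_eq_zero hw hB).1 (by omega))
  have hone : ∀ v ∈ M.V, A ∈ M.t v → M.len v A = 1 → M.phi A v + M.phi B v = 1 := by
    intro v hv hAv hl
    have hw := M.nb_mem hv hAv
    have h4 := (hcov _ hw).resolve_left (M.notMem_t_nb hv hAv)
    have h5 := M.phi_self hw h4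
    rw [nb, phi_add_smul, hB' v hv hAv, hl] at h5
    rw [M.phi_self hv hAv]
    linarith
  have hphi : ∀ p q, M.phi A p + M.phi B p - (M.phi A q + M.phi B q) =
      (A + B) ⬝ᵥ p - (A + B) ⬝ᵥ q := by
    intro p q
    rw [add_dotProduct, add_dotProduct]
    have := M.phi_sub A p q
    have := M.phi_sub B p q
    linarith
  have hmin1 : ∀ w ∈ M.V, (A + B) ⬝ᵥ v₁ ≤ (A + B) ⬝ᵥ w := by
    intro w hw
    have := hphi w v₁
    have := hmin w hw
    have := hone v₁ h1.1 h1.2.1 h1.2.2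
    linarith
  -- If `A + B` were not constant along this edge, the three feet `v₁`, `v₂`, `v₃` would all lie on
  -- the facet `a` as well as on `A`, although these facets meet in an edge with only two vertices.
  have hzero : ∀ a ∈ M.t v₁, a ≠ A → (A + B) ⬝ᵥ M.E v₁ a = 0 := by
    intro a ha haA
    by_contra hne
    have hmem : ∀ w ∈ M.V, A ∈ M.t w → M.len w A = 1 → a ∈ M.t w := by
      intro w hw hAw hl
      have e := M.dot_sub_int h1.1 (A + B) w
      have e0 : (A + B) ⬝ᵥ w - (A + B) ⬝ᵥ v₁ = 0 := by
        rw [← hphi, hone w hw hAw hl, hone v₁ h1.1 h1.2.1 h1.2.2, sub_self]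
      rw [e0] at e
      have := (Finset.sum_eq_zero_iff_of_nonneg fun b hb => mul_nonneg
        (M.E_nonneg h1.1 hmin1 hb) (sub_nonneg.2 (M.le v₁ h1.1 b hb w hw))).1 e.symm a ha
      have h6 := (mul_eq_zero.1 this).resolve_left hne
      exact M.mem_t_of_dot_eq h1.1 ha hw (by linarith)
    have hp := M.isTri.pair A a haA.symm ⟨_, M.t_mem_T h1.1, h1.2.1, ha⟩
    have hsub : ({M.t v₁, M.t v₂, M.t v₃} : Finset (Finset (Fin 3 → ℤ))) ⊆
        M.T.filter fun t => A ∈ t ∧ a ∈ t := by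
      intro t ht
      simp only [Finset.mem_insert, Finset.mem_singleton] at ht
      rw [Finset.mem_filter]
      rcases ht with rfl | rfl | rfl
      · exact ⟨M.t_mem_T h1.1, h1.2.1, ha⟩
      · exact ⟨M.t_mem_T h2.1, h2.2.1, hmem _ h2.1 h2.2.1 h2.2.2⟩
      · exact ⟨M.t_mem_T h3.1, h3.2.1, hmem _ h3.1 h3.2.1 h3.2.2⟩
    have := Finset.card_le_card hsub
    rw [hp, Finset.card_eq_three.2 ⟨_, _, _, fun h => h12 (M.t_inj h1.1 h2.1 h),
      fun h => h13 (M.t_inj h1.1 h3.1 h), fun h => h23 (M.t_inj h2.1 h3.1 h), rfl⟩] at this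
    omega
  have h0 : A + B = 0 := by
    refine M.eq_of_dual_eq h1.1 fun a ha => ?_
    rw [zero_dotProduct]
    by_cases haA : a = A
    · rw [haA, add_dotProduct, (M.dual _ h1.1).dot_self h1.2.1, hB' _ h1.1 h1.2.1]; norm_num
    · exact hzero a ha haA
  exact eq_neg_of_add_eq_zero_right h0

/-- The long edges that connect two disjoint facets. -/
theorem exists_connecting (hdisj : ∀ t ∈ M.T, A ∈ t → B ∉ t) :
    ∃ S : Finset (Finset (Fin 3 → ℤ)), (∀ s ∈ S, s.card = 2 ∧ A ∉ s ∧ B ∉ s ∧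
      1 ≤ (M.cell s).card) ∧
      S.card = (M.V.filter fun v => A ∈ M.t v ∧ M.len v A ≠ 1).card := by
  refine ⟨(M.V.filter fun v => A ∈ M.t v ∧ M.len v A ≠ 1).image fun v => (M.t v).erase A, ?_,
    Finset.card_image_of_injOn ?_⟩
  · intro s hs
    obtain ⟨v, hv, rfl⟩ := Finset.mem_image.1 hs
    obtain ⟨hv, hAv, hl⟩ := Finset.mem_filter.1 hv
    refine ⟨by rw [Finset.card_erase_of_mem hAv, (M.dual v hv).card], Finset.notMem_erase _ _,
      fun h => hdisj _ (M.t_mem_T hv) hAv (Finset.mem_of_mem_erase h), ?_⟩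
    have h1 := M.card_cell_edge hv hAv
    have h2 := M.len_pos hv hAv
    omega
  · intro v hv w hw h
    rw [Finset.mem_coe, Finset.mem_filter] at hv hw
    refine M.t_inj hv.1 hw.1 ?_
    rw [← Finset.insert_erase hv.2.1, ← Finset.insert_erase hw.2.1]
    exact congrArg _ h

theorem card_le_sum_cell {S : Finset (Finset (Fin 3 → ℤ))} (h : ∀ s ∈ S, 1 ≤ (M.cell s).card) :
    S.card ≤ ∑ s ∈ S, (M.cell s).card := by
  rw [Finset.card_eq_sum_ones]
  exact Finset.sum_le_sum h

/-- Ten vertices, two interior points and four long edges of the disjoint pentagons already make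
sixteen, so all five connecting edges have length one. -/
theorem num_five_two (heul : M.T.card + 4 = 2 * (Tri.verts M.T).card) (h16 : M.pts.card ≤ 16)
    (h7 : (Tri.verts M.T).card = 7) (h4 : Tri.num M.T 4 = 5) (h5 : Tri.num M.T 5 = 2) :
    IsCayleyOfPolygons M.body := by
  obtain ⟨A, B, hAB, hA, hB, hiff⟩ := Tri.exists_two_of_num h5
  have dA := (hiff A hA).2 (Or.inl rfl)
  have dB := (hiff B hB).2 (Or.inr rfl)
  have hq : ∀ x ∈ Tri.verts M.T, x ≠ A → x ≠ B → Tri.deg M.T x = 4 := by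
    intro x hx h1 h2
    have := Tri.deg_mem (K := {4, 5}) (by rw [Finset.sum_pair (by norm_num), h4, h5, h7]) hx
    simp only [Finset.mem_insert, Finset.mem_singleton, hiff x hx, h1, h2, or_self, or_false] at this
    exact this
  have hdisj : ∀ t ∈ M.T, A ∈ t → B ∉ t := fun t ht h1 h2 =>
    M.not_adjacent dA.ge hq (by omega) t ht hAB h1 h2
  have hV := M.card_V_eq heul
  refine M.isCayley_of_prism hA hB hdisj (by omega) ?_
  obtain ⟨S, hS, hSc⟩ := M.exists_connecting hdisj
  have hdAB : Disjoint (M.longEdges A) (M.longEdges B) := by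
    rw [Finset.disjoint_left]
    intro s h1 h2
    obtain ⟨⟨y, hy, rfl⟩, -⟩ := M.mem_longEdges.1 h1
    obtain ⟨⟨z, -, hz⟩, -⟩ := M.mem_longEdges.1 h2
    have : B ∈ ({A, y} : Finset (Fin 3 → ℤ)) := hz ▸ (by simp)
    rw [Finset.mem_insert, Finset.mem_singleton] at this
    obtain ⟨-, t, ht, hAt, hyt⟩ := Tri.mem_nbrs.1 hy
    exact hdisj t ht hAt (this.resolve_left hAB.symm ▸ hyt)
  have hdS : Disjoint (M.longEdges A ∪ M.longEdges B) S := by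
    rw [Finset.disjoint_left]
    intro s h1 h2
    rcases Finset.mem_union.1 h1 with h1 | h1
    · obtain ⟨⟨y, hy, rfl⟩, -⟩ := M.mem_longEdges.1 h1
      exact (hS _ h2).2.1 (by simp)
    · obtain ⟨⟨y, hy, rfl⟩, -⟩ := M.mem_longEdges.1 h1
      exact (hS _ h2).2.2.1 (by simp)
  have hc := M.card_count {A, B} (M.longEdges A ∪ M.longEdges B ∪ S) fun s hs => by
    rcases Finset.mem_union.1 hs with h | h
    · rcases Finset.mem_union.1 h with h | h <;> exact M.card_of_mem_longEdges h
    · exact (hS s h).1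
  have h1 := M.card_le_sum_cell (S := M.longEdges A ∪ M.longEdges B ∪ S) fun s hs => by
    rcases Finset.mem_union.1 hs with h | h
    · rcases Finset.mem_union.1 h with h | h <;> exact (M.mem_longEdges.1 h).2
    · exact (hS s h).2.2.2
  rw [Finset.card_union_of_disjoint hdS, Finset.card_union_of_disjoint hdAB] at h1
  rw [Finset.sum_pair hAB] at hc
  have := M.two_le_longEdges hA dA
  have := M.two_le_longEdges hB dB
  have := M.one_le_card_cell hA dA.ge
  have := M.one_le_card_cell hB dB.ge
  omega

/-- Twelve vertices and two interior points leave room for at most two long edges among the six that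
connect the hexagons. -/
theorem num_six_two (heul : M.T.card + 4 = 2 * (Tri.verts M.T).card) (h16 : M.pts.card ≤ 16)
    (h8 : (Tri.verts M.T).card = 8) (h4 : Tri.num M.T 4 = 6) (h6 : Tri.num M.T 6 = 2) :
    IsCayleyOfPolygons M.body := by
  obtain ⟨A, B, hAB, hA, hB, hiff⟩ := Tri.exists_two_of_num h6
  have dA := (hiff A hA).2 (Or.inl rfl)
  have dB := (hiff B hB).2 (Or.inr rfl)
  have hq : ∀ x ∈ Tri.verts M.T, x ≠ A → x ≠ B → Tri.deg M.T x = 4 := by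
    intro x hx h1 h2
    have := Tri.deg_mem (K := {4, 6}) (by rw [Finset.sum_pair (by norm_num), h4, h6, h8]) hx
    simp only [Finset.mem_insert, Finset.mem_singleton, hiff x hx, h1, h2, or_self, or_false] at this
    exact this
  have hdisj : ∀ t ∈ M.T, A ∈ t → B ∉ t := fun t ht h1 h2 =>
    M.not_adjacent (by omega) hq (by omega) t ht hAB h1 h2
  have hV := M.card_V_eq heul
  refine M.isCayley_of_prism hA hB hdisj (by omega) ?_
  obtain ⟨S, hS, hSc⟩ := M.exists_connecting hdisj
  have hc := M.card_count {A, B} S fun s hs => (hS s hs).1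
  have h1 := M.card_le_sum_cell (S := S) fun s hs => (hS s hs).2.2.2
  rw [Finset.sum_pair hAB] at hc
  have := M.one_le_card_cell hA (by omega)
  have := M.one_le_card_cell hB (by omega)
  omega

/-- A heptagon among eight facets is adjacent to all the others, in particular to the hexagon, and
`not_heptagon_hexagon` excludes this. -/
theorem not_num_heptagon (heul : M.T.card + 4 = 2 * (Tri.verts M.T).card)
    (h8 : (Tri.verts M.T).card = 8) (h3 : Tri.num M.T 3 = 1) (h4 : Tri.num M.T 4 = 5)
    (h6 : Tri.num M.T 6 = 1) (h7 : Tri.num M.T 7 = 1) : False := by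
  obtain ⟨A, hA, hAiff⟩ := Tri.exists_one_of_num h7
  obtain ⟨B, hB, hBiff⟩ := Tri.exists_one_of_num h6
  obtain ⟨W, hW, hWiff⟩ := Tri.exists_one_of_num h3
  have dA := (hAiff A hA).2 rfl
  have dB := (hBiff B hB).2 rfl
  have hAB : A ≠ B := by rintro rfl; omega
  have hq : ∀ x ∈ Tri.verts M.T, x ≠ A → x ≠ B → x ≠ W → Tri.deg M.T x = 4 := by
    intro x hx h1 h2 h3'
    have := Tri.deg_mem (K := {3, 4, 6, 7}) (by
      rw [Finset.sum_insert (by decide), Finset.sum_insert (by decide), Finset.sum_pair (by decide),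
        h3, h4, h6, h7, h8]
      norm_num) hx
    simp only [Finset.mem_insert, Finset.mem_singleton, hAiff x hx, hBiff x hx, hWiff x hx, h1, h2,
      h3', or_false, false_or] at this
    exact this
  have hnb : B ∈ Tri.nbrs M.T A := by
    have h1 : (Tri.nbrs M.T A) = (Tri.verts M.T).erase A := by
      apply Finset.eq_of_subset_of_card_le
      · intro y hy
        exact Finset.mem_erase.2 ⟨(Tri.mem_nbrs.1 hy).1, (Finset.mem_filter.1 hy).1⟩
      · rw [M.isTri.card_nbrs, Finset.card_erase_of_mem hA, dA, h8]
    rw [h1]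
    exact Finset.mem_erase.2 ⟨hAB.symm, hB⟩
  obtain ⟨-, t, ht, hAt, hBt⟩ := Tri.mem_nbrs.1 hnb
  exact M.not_heptagon_hexagon (by omega) (by omega) hq (by omega) t ht hAB hAt hBt

/-! ### Polytopes with six quadrangles -/

section Octahedron

theorem exists_dual_vec {x y z : Fin 3 → ℤ} (h : {x, y, z} ∈ M.T) :
    ∃ e, x ⬝ᵥ e = 1 ∧ y ⬝ᵥ e = 0 ∧ z ⬝ᵥ e = 0 := by
  obtain ⟨v, hv, hvt⟩ := M.exists_vertex h
  obtain ⟨h1, h2, h3⟩ := M.ne_of_mem h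
  have d := M.dual v hv
  have hx : x ∈ M.t v := by rw [hvt]; simp
  exact ⟨M.E v x, d.dot_self hx, d.dot_ne hx (by rw [hvt]; simp) h1.symm,
    d.dot_ne hx (by rw [hvt]; simp) h2.symm⟩

theorem wall_vec {x x' y z : Fin 3 → ℤ} (h : {x, y, z} ∈ M.T) (h' : {x', y, z} ∈ M.T)
    (hne : x ≠ x') : ∃ b c : ℤ, x' = -x + b • y + c • z := by
  obtain ⟨v, hv, hvt⟩ := M.exists_vertex h
  obtain ⟨w, hw, hwt⟩ := M.exists_vertex h'
  obtain ⟨b, c, -, hbc, -⟩ := M.wall hv hw hvt hwt hne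
  exact ⟨b, c, hbc⟩

theorem wall_dot {x x' y z e : Fin 3 → ℤ} (h : {x, y, z} ∈ M.T) (h' : {x', y, z} ∈ M.T)
    (hne : x ≠ x') (hx : x ⬝ᵥ e = 1) (hy : y ⬝ᵥ e = 0) (hz : z ⬝ᵥ e = 0) : x' ⬝ᵥ e = -1 := by
  obtain ⟨b, c, hbc⟩ := M.wall_vec h h' hne
  rw [hbc]
  simp only [add_dotProduct, neg_dotProduct, smul_dotProduct, smul_eq_mul, hx, hy, hz]
  ring

/-- The triangulation is an octahedron with the given pairs of opposite vertices. -/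
theorem octahedron_opposite {x y z x' y' z' : Fin 3 → ℤ} (hx : x ≠ x') (hy : y ≠ y') (hz : z ≠ z')
    (h1 : {x, y, z} ∈ M.T) (h2 : {x', y, z} ∈ M.T) (h3 : {x, y', z} ∈ M.T)
    (h4 : {x, y, z'} ∈ M.T) (h5 : {x, y', z'} ∈ M.T) (h6 : {x', y, z'} ∈ M.T)
    (h7 : {x', y', z} ∈ M.T) (h8 : {x', y', z'} ∈ M.T) :
    x' = -x ∨ y' = -y ∨ z' = -z := by
  obtain ⟨a, b, hab⟩ := M.wall_vec h1 h2 hx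
  obtain ⟨c, d, hcd⟩ := M.wall_vec (Tri.flip h1) (Tri.flip h3) hy
  obtain ⟨e, f, hef⟩ := M.wall_vec (Tri.rot (Tri.rot h1)) (Tri.rot (Tri.rot h4)) hz
  have dx : ∀ u, x' ⬝ᵥ u = -(x ⬝ᵥ u) + a * (y ⬝ᵥ u) + b * (z ⬝ᵥ u) := fun u => by
    rw [hab]; simp only [add_dotProduct, neg_dotProduct, smul_dotProduct, smul_eq_mul]
  have dy : ∀ u, y' ⬝ᵥ u = -(y ⬝ᵥ u) + c * (x ⬝ᵥ u) + d * (z ⬝ᵥ u) := fun u => by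
    rw [hcd]; simp only [add_dotProduct, neg_dotProduct, smul_dotProduct, smul_eq_mul]
  have dz : ∀ u, z' ⬝ᵥ u = -(z ⬝ᵥ u) + e * (x ⬝ᵥ u) + f * (y ⬝ᵥ u) := fun u => by
    rw [hef]; simp only [add_dotProduct, neg_dotProduct, smul_dotProduct, smul_eq_mul]
  -- Each of the following relations says that across an edge of a further triangle the opposite
  -- normals also have coefficient `-1`. One reflection away from `x, y, z` this kills the products
  -- `b e`, `a c` and `d f`.
  have hbe : b * e = 0 := by
    obtain ⟨u, u1, u2, u3⟩ := M.exists_dual_vec h4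
    have e1 := M.wall_dot h4 h6 hx u1 u2 u3
    have e2 := dx u
    have e3 := dz u
    rw [u1, u2, e1] at e2
    rw [u1, u2, u3] at e3
    have : z ⬝ᵥ u = e := by linarith
    rw [this] at e2
    linarith
  have hac : a * c = 0 := by
    obtain ⟨u, u1, u2, u3⟩ := M.exists_dual_vec h3
    have e1 := M.wall_dot h3 h7 hx u1 u2 u3
    have e2 := dx u
    have e3 := dy u
    rw [u1, u3, e1] at e2
    rw [u1, u2, u3] at e3
    have : y ⬝ᵥ u = c := by linarith
    rw [this] at e2
    linarith
  have hdf : d * f = 0 := by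
    obtain ⟨u, u1, u2, u3⟩ := M.exists_dual_vec (Tri.flip h4)
    have e1 := M.wall_dot (Tri.flip h4) (Tri.flip h5) hy u1 u2 u3
    have e2 := dy u
    have e3 := dz u
    rw [u1, u2, e1] at e2
    rw [u1, u2, u3] at e3
    have : z ⬝ᵥ u = f := by linarith
    rw [this] at e2
    linarith
  -- Two reflections away from `x, y, z`, when the obvious terms vanish, the cyclic product of the
  -- remaining coefficients is killed.
  have hfbc : a = 0 → e = 0 → b * (f * c) = 0 := by
    rintro rfl rfl
    obtain ⟨u, u1, u2, u3⟩ := M.exists_dual_vec h5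
    have e1 := M.wall_dot h5 h8 hx u1 u2 u3
    have e2 := dx u
    have e3 := dy u
    have e4 := dz u
    rw [u1, e1] at e2
    rw [u1, u2] at e3
    rw [u1, u3] at e4
    have k1 : b * (z ⬝ᵥ u) = 0 := by linarith
    rcases mul_eq_zero.1 k1 with k | k
    · rw [k, zero_mul]
    · rw [k] at e3 e4
      have : y ⬝ᵥ u = c := by linarith
      rw [this] at e4
      rw [show f * c = 0 by linarith, mul_zero]
  have hdea : c = 0 → f = 0 → d * (e * a) = 0 := by
    rintro rfl rfl
    obtain ⟨u, u1, u2, u3⟩ := M.exists_dual_vec (Tri.flip h6)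
    have e1 := M.wall_dot (Tri.flip h6) (Tri.flip h8) hy u1 u2 u3
    have e2 := dx u
    have e3 := dy u
    have e4 := dz u
    rw [u1, u2] at e2
    rw [u1, e1] at e3
    rw [u1, u3] at e4
    have k1 : d * (z ⬝ᵥ u) = 0 := by linarith
    rcases mul_eq_zero.1 k1 with k | k
    · rw [k, zero_mul]
    · rw [k] at e2 e4
      have : x ⬝ᵥ u = a := by linarith
      rw [this] at e4
      rw [show e * a = 0 by linarith, mul_zero]
  by_contra hcon
  push Not at hcon
  obtain ⟨c1, c2, c3⟩ := hcon
  have n1 : ¬ (a = 0 ∧ b = 0) := by rintro ⟨rfl, rfl⟩; exact c1 (by rw [hab]; simp)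
  have n2 : ¬ (c = 0 ∧ d = 0) := by rintro ⟨rfl, rfl⟩; exact c2 (by rw [hcd]; simp)
  have n3 : ¬ (e = 0 ∧ f = 0) := by rintro ⟨rfl, rfl⟩; exact c3 (by rw [hef]; simp)
  -- If no two opposite normals were antiparallel, each of the pairs `(a, b)`, `(c, d)`, `(e, f)`
  -- would have a nonzero member. The three vanishing products then leave one of the cyclic triples
  -- `b, f, c` and `d, e, a` free of zeros, and its product is zero.
  rcases mul_eq_zero.1 hac with ha | hc
  · have hb : b ≠ 0 := fun h => n1 ⟨ha, h⟩
    have he := (mul_eq_zero.1 hbe).resolve_left hb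
    have hf : f ≠ 0 := fun h => n3 ⟨he, h⟩
    have hd := (mul_eq_zero.1 hdf).resolve_right hf
    have hc : c ≠ 0 := fun h => n2 ⟨h, hd⟩
    exact mul_ne_zero hb (mul_ne_zero hf hc) (hfbc ha he)
  · have hd : d ≠ 0 := fun h => n2 ⟨hc, h⟩
    have hf := (mul_eq_zero.1 hdf).resolve_left hd
    have he : e ≠ 0 := fun h => n3 ⟨h, hf⟩
    have hb := (mul_eq_zero.1 hbe).resolve_right he
    have ha : a ≠ 0 := fun h => n1 ⟨h, hb⟩
    exact mul_ne_zero hd (mul_ne_zero he ha) (hdea hc hf)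

theorem notMem_nbrs_of_four {x a b c d e : Fin 3 → ℤ} (hx : Tri.deg M.T x = 4)
    (ha : a ∈ Tri.nbrs M.T x) (hb : b ∈ Tri.nbrs M.T x) (hc : c ∈ Tri.nbrs M.T x)
    (hd : d ∈ Tri.nbrs M.T x) (hab : a ≠ b) (hac : a ≠ c) (had : a ≠ d) (hbc : b ≠ c) (hbd : b ≠ d)
    (hcd : c ≠ d) (hea : e ≠ a) (heb : e ≠ b) (hec : e ≠ c) (hed : e ≠ d) (t : Finset (Fin 3 → ℤ))
    (ht : t ∈ M.T) (hxt : x ∈ t) (hxe : x ≠ e) : e ∉ t := by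
  intro het
  have he : e ∈ Tri.nbrs M.T x := Tri.mem_nbrs.2 ⟨hxe.symm, t, ht, hxt, het⟩
  have hsub : ({a, b, c, d, e} : Finset (Fin 3 → ℤ)) ⊆ Tri.nbrs M.T x := by
    intro w hw
    simp only [Finset.mem_insert, Finset.mem_singleton] at hw
    rcases hw with rfl | rfl | rfl | rfl | rfl <;> assumption
  have := Finset.card_le_card hsub
  rw [M.isTri.card_nbrs, hx, Finset.card_insert_of_notMem, Finset.card_insert_of_notMem,
    Finset.card_insert_of_notMem, Finset.card_pair hed.symm] at this
  · omega
  · simp [hcd, hec.symm]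
  · simp [hbc, hbd, heb.symm]
  · simp [hab, hac, had, hea.symm]

/-- Going around three mutually adjacent quadrangles, the uniqueness of the second triangle at an
edge identifies the vertices found, and an octahedron appears. Two opposite vertices of it are not
adjacent, so their stars, with four triangles each, cover all eight. -/
theorem num_four (heul : M.T.card + 4 = 2 * (Tri.verts M.T).card)
    (h6 : (Tri.verts M.T).card = 6) (h4 : ∀ x ∈ Tri.verts M.T, Tri.deg M.T x = 4) :
    IsCayleyOfPolygons M.body := by
  obtain ⟨v, hv⟩ := M.nonempty
  obtain ⟨x, y, z, -, -, -, hvt⟩ := Finset.card_eq_three.1 (M.dual v hv).card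
  have h1 : {x, y, z} ∈ M.T := hvt ▸ M.t_mem_T hv
  obtain ⟨vx, vy, vz⟩ := Tri.mem_verts_of_mem h1
  obtain ⟨y', z', a1, a2, a3, nyy, nzz⟩ := M.quad_step (h4 x vx) h1
  obtain ⟨-, vy', vz'⟩ := Tri.mem_verts_of_mem a2
  obtain ⟨x', u, b1, b2, b3, nxx, nzu⟩ := M.quad_step (h4 y vy) (Tri.flip h1)
  obtain ⟨-, vx', -⟩ := Tri.mem_verts_of_mem b2
  obtain rfl : u = z' := M.next_unique h1 (Tri.rot (Tri.rot b3)) (Tri.swap a3) nzu.symm nzz.symm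
  obtain ⟨w, w', c1, c2, c3, nxw, nyw⟩ := M.quad_step (h4 z vz) (Tri.rot (Tri.rot h1))
  obtain rfl : w = x' := M.next_unique (Tri.rot h1) (Tri.flip c1) b1 nxw.symm nxx.symm
  obtain rfl : w' = y' := M.next_unique (Tri.swap h1) (Tri.rot (Tri.rot c3)) a1 nyw.symm nyy.symm
  have h2 : {w, y, z} ∈ M.T := Tri.rot (Tri.rot b1)
  have h6' : {w, y, u} ∈ M.T := Tri.flip b2
  have h7 : {w, w', z} ∈ M.T := Tri.rot c2
  obtain ⟨p, q, d1, d2, d3, nzp, nyq⟩ := M.quad_step (h4 w vx') (Tri.swap h2)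
  obtain rfl : p = u := M.next_unique h2 d1 h6' nzp.symm nzz.symm
  obtain rfl : q = w' := M.next_unique (Tri.swap h2) (Tri.swap d3) (Tri.swap h7) nyq.symm nyy.symm
  have h3 : {x, q, z} ∈ M.T := Tri.swap a1
  have h4' : {x, y, p} ∈ M.T := Tri.swap a3
  have h8 : {w, q, p} ∈ M.T := Tri.swap d2
  obtain ⟨e1, e2, e3⟩ := M.ne_of_mem h1
  obtain ⟨e4, e5, e6⟩ := M.ne_of_mem h8
  obtain ⟨e7, e8, e9⟩ := M.ne_of_mem h3
  obtain ⟨e10, e11, e12⟩ := M.ne_of_mem h4'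
  obtain ⟨e13, e14, e15⟩ := M.ne_of_mem h2
  have nb := fun {a b c} (h : {a, b, c} ∈ M.T) => M.mem_nbrs_of_mem h
  rcases M.octahedron_opposite nxx nyy nzz h1 h2 h3 h4' a2 h6' h7 h8 with h | h | h
  · refine M.isCayley_of_eq_neg vx (fun t ht hxt => ?_) (by rw [h4 x vx, h4 w vx']; omega) h
    exact M.notMem_nbrs_of_four (h4 x vx) (nb h1).1 (nb h1).2 (nb a2).1 (nb a2).2 e3 nyy e12
      e9.symm nzz e6 e13 e14 e4 e5 t ht hxt nxx
  · refine M.isCayley_of_eq_neg vy (fun t ht hyt => ?_) (by rw [h4 y vy, h4 q vy']; omega) h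
    exact M.notMem_nbrs_of_four (h4 y vy) (nb (Tri.flip h1)).1 (nb (Tri.flip h1)).2 (nb b2).1
      (nb b2).2 e2 nxx e11 e14.symm nzz e5 e7.symm e9 e4.symm e6 t ht hyt nyy
  · refine M.isCayley_of_eq_neg vz (fun t ht hzt => ?_) (by rw [h4 z vz, h4 p vz']; omega) h
    exact M.notMem_nbrs_of_four (h4 z vz) (nb (Tri.rot (Tri.rot h1))).1 (nb (Tri.rot (Tri.rot h1))).2
      (nb c2).1 (nb c2).2 e1 nxx e7 e13.symm nyy e4 e11.symm e12.symm e5.symm e6.symm t ht hzt nzz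

end Octahedron

end SmoothModel


theorem Tri.exists_three_of_num {α : Type*} [DecidableEq α] {T : Finset (Finset α)} {m : ℕ}
    (h : Tri.num T m = 3) : ∃ a b c, a ≠ b ∧ a ≠ c ∧ b ≠ c ∧ a ∈ Tri.verts T ∧
    b ∈ Tri.verts T ∧ c ∈ Tri.verts T ∧
    ∀ x ∈ Tri.verts T, Tri.deg T x = m ↔ x = a ∨ x = b ∨ x = c := by
  obtain ⟨a, b, c, hab, hac, hbc, he⟩ := Finset.card_eq_three.1 h
  have hiff : ∀ x, (x ∈ Tri.verts T ∧ Tri.deg T x = m) ↔ x = a ∨ x = b ∨ x = c := by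
    intro x
    rw [← Finset.mem_filter (p := fun x => Tri.deg T x = m), he, Finset.mem_insert,
      Finset.mem_insert, Finset.mem_singleton]
  exact ⟨a, b, c, hab, hac, hbc, ((hiff a).2 (by simp)).1, ((hiff b).2 (by simp)).1,
    ((hiff c).2 (by simp)).1, fun x hx => ⟨fun h => (hiff x).1 ⟨hx, h⟩, fun h => ((hiff x).2 h).2⟩⟩

/-! ### Three pentagons -/

namespace SmoothModel

variable (M : SmoothModel 3) {A B C : Fin 3 → ℤ}

theorem eq_of_mem_inter_longEdges (h : A ≠ B) {S : Finset (Fin 3 → ℤ)}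
    (hS : S ∈ M.longEdges A ∩ M.longEdges B) : S = {A, B} := by
  rw [Finset.mem_inter, mem_longEdges, mem_longEdges] at hS
  obtain ⟨⟨⟨y, -, rfl⟩, -⟩, ⟨⟨z, -, hz⟩, -⟩⟩ := hS
  have h1 : B ∈ ({A, y} : Finset (Fin 3 → ℤ)) := hz ▸ (by simp)
  rw [Finset.mem_insert, Finset.mem_singleton] at h1
  rw [h1.resolve_left h.symm]

/-- The distribution of the lattice points if there are three pentagons and few points. -/
theorem three_pentagons (h16 : M.pts.card ≤ 16) (hV : 10 ≤ M.V.card) (hAB : A ≠ B) (hAC : A ≠ C)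
    (hBC : B ≠ C) (hA : A ∈ Tri.verts M.T) (hB : B ∈ Tri.verts M.T) (hC : C ∈ Tri.verts M.T)
    (dA : Tri.deg M.T A = 5) (dB : Tri.deg M.T B = 5) (dC : Tri.deg M.T C = 5) :
    (B ∈ Tri.nbrs M.T A) ∧ (M.cell {A, B}).card = 1 ∧
    (∀ y ∈ Tri.nbrs M.T A, y ≠ B → y ≠ C → (M.cell {A, y}).card = 0) ∧
    ∀ p, M.IsPt p → p ∉ M.V → 0 < M.phi A p → 0 < M.phi B p → 0 < M.phi C p → False := by
  have a2 := M.two_le_longEdges hA dA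
  have b2 := M.two_le_longEdges hB dB
  have c2 := M.two_le_longEdges hC dC
  have iAB := M.card_inter_longEdges hAB
  have iAC := M.card_inter_longEdges hAC
  have iBC := M.card_inter_longEdges hBC
  have uAB := Finset.card_union_add_card_inter (M.longEdges A) (M.longEdges B)
  have uC := Finset.card_union_add_card_inter (M.longEdges A ∪ M.longEdges B) (M.longEdges C)
  have iC : ((M.longEdges A ∪ M.longEdges B) ∩ M.longEdges C).card ≤
      (M.longEdges A ∩ M.longEdges C).card + (M.longEdges B ∩ M.longEdges C).card := by
    rw [Finset.union_inter_distrib_right]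
    exact Finset.card_union_le _ _
  have pA := M.one_le_card_cell hA dA.ge
  have pB := M.one_le_card_cell hB dB.ge
  have pC := M.one_le_card_cell hC dC.ge
  set L := M.longEdges A ∪ M.longEdges B ∪ M.longEdges C with hL
  have hL2 : ∀ S ∈ L, S.card = 2 ∧ 1 ≤ (M.cell S).card ∧ (A ∈ S ∨ B ∈ S ∨ C ∈ S) := by
    intro S hS
    have key : ∀ r, S ∈ M.longEdges r → S.card = 2 ∧ 1 ≤ (M.cell S).card ∧ r ∈ S := by
      intro r hr
      refine ⟨M.card_of_mem_longEdges hr, (M.mem_longEdges.1 hr).2, ?_⟩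
      obtain ⟨⟨y, -, rfl⟩, -⟩ := M.mem_longEdges.1 hr
      simp
    rcases Finset.mem_union.1 hS with hS | hS
    · rcases Finset.mem_union.1 hS with hS | hS
      · obtain ⟨h1, h2, h3⟩ := key _ hS; exact ⟨h1, h2, Or.inl h3⟩
      · obtain ⟨h1, h2, h3⟩ := key _ hS; exact ⟨h1, h2, Or.inr (Or.inl h3)⟩
    · obtain ⟨h1, h2, h3⟩ := key _ hS; exact ⟨h1, h2, Or.inr (Or.inr h3)⟩
  have hle := M.card_le_sum_cell (S := L) fun S hS => (hL2 S hS).2.1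
  have hsum3 : ∑ r ∈ {A, B, C}, (M.cell {r}).card =
      (M.cell {A}).card + (M.cell {B}).card + (M.cell {C}).card := by
    rw [Finset.sum_insert (by simp [hAB, hAC]), Finset.sum_pair hBC, add_assoc]
  -- Ten vertices and three interior points leave three. Three pentagons with two long edges each,
  -- where two of them share at most one, have at least three long edges; so equality holds in every
  -- estimate.
  have hc := M.card_count {A, B, C} L fun S hS => (hL2 S hS).1
  rw [hsum3] at hc
  have hone : ∀ S ∈ L, (M.cell S).card = 1 := by
    have h1 : ∑ S ∈ L, 1 = ∑ S ∈ L, (M.cell S).card := by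
      rw [← Finset.card_eq_sum_ones]; omega
    have := (Finset.sum_eq_sum_iff_of_le fun S hS => (hL2 S hS).2.1).1 h1
    exact fun S hS => (this S hS).symm
  have hmem : ∀ X Y, X ≠ Y → (M.longEdges X ∩ M.longEdges Y).card = 1 →
      {X, Y} ∈ M.longEdges X := by
    intro X Y hXY h
    obtain ⟨S, hS⟩ := Finset.card_pos.1 (by rw [h]; norm_num : 0 < (M.longEdges X ∩ M.longEdges Y).card)
    rw [← M.eq_of_mem_inter_longEdges hXY hS]
    exact (Finset.mem_inter.1 hS).1
  have mAB := hmem A B hAB (by omega)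
  have mAC := hmem A C hAC (by omega)
  have hsubL : M.longEdges A ⊆ L := fun S hS =>
    Finset.mem_union_left _ (Finset.mem_union_left _ hS)
  have hpair : ∀ {x y : Fin 3 → ℤ}, x ≠ A → ({A, x} : Finset (Fin 3 → ℤ)) = {A, y} → x = y := by
    intro x y hxA h
    have h1 : x ∈ ({A, y} : Finset (Fin 3 → ℤ)) := h ▸ (by simp)
    rw [Finset.mem_insert, Finset.mem_singleton] at h1
    exact h1.resolve_left hxA
  refine ⟨?_, hone _ (hsubL mAB), ?_, ?_⟩
  · obtain ⟨⟨y, hy, hyB⟩, -⟩ := M.mem_longEdges.1 mAB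
    rwa [hpair (Tri.mem_nbrs.1 hy).1 hyB] at hy
  · intro y hy hyB hyC
    by_contra hne
    have hyA := (Tri.mem_nbrs.1 hy).1
    have h1 : {A, y} ∈ M.longEdges A := M.mem_longEdges.2 ⟨⟨y, hy, rfl⟩, by omega⟩
    have h2 : 2 < (M.longEdges A).card := Finset.two_lt_card.2
      ⟨_, mAB, _, mAC, _, h1, fun h => hBC (hpair hAB.symm h), fun h => hyB (hpair hAB.symm h).symm,
        fun h => hyC (hpair hAC.symm h).symm⟩
    omega
  · intro p hp hpV h1 h2 h3
    have hn : ∀ S, M.tight p = S → ¬ (A ∈ S ∨ B ∈ S ∨ C ∈ S) := by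
      rintro S rfl (h | h | h) <;> have := (M.mem_tight.1 h).2 <;> omega
    have hc := M.card_count_add {A, B, C} L (fun S hS => (hL2 S hS).1) {p} (by
      intro q hq
      rw [Finset.mem_singleton] at hq
      subst hq
      refine ⟨hp, hpV, fun r hr he => hn _ he ?_, fun hq => hn _ rfl (hL2 _ hq).2.2⟩
      simp only [Finset.mem_insert, Finset.mem_singleton] at hr
      rcases hr with rfl | rfl | rfl <;> simp)
    rw [hsum3, Finset.card_singleton] at hc
    omega

/-- A pentagon with two long edges: these meet, and the vertices are known. -/
theorem pentagon_vertex (hA : A ∈ Tri.verts M.T) (dA : Tri.deg M.T A = 5) (hBC : B ≠ C)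
    (hB : B ∈ Tri.nbrs M.T A) (hC : C ∈ Tri.nbrs M.T A)
    (cB : (M.cell {A, B}).card = 1) (cC : (M.cell {A, C}).card = 1)
    (h0 : ∀ y ∈ Tri.nbrs M.T A, y ≠ B → y ≠ C → (M.cell {A, y}).card = 0) :
    {A, B, C} ∈ M.T ∧ ∃ w ∈ M.V, M.phi A w = 0 ∧ M.phi B w = 2 ∧ M.phi C w = 1 := by
  have setup : ∀ s, Tri.IsCycle M.T A s → s 0 = B → ∃ Q : SmoothPolygon 5 {p // M.phi A p = 0},
      (∀ i p, Q.F i p = M.phi (s i) p) ∧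
      (∀ i, (Q.v i : Fin 3 → ℤ) ∈ M.V ∧ M.t (Q.v i) = {A, s i, s (i + 1)}) ∧
      (∀ i, s i = B → Q.l i = 2) ∧ (∀ i, s i = C → Q.l i = 2) ∧
      (∀ i, s i ≠ B → s i ≠ C → Q.l i = 1) := by
    intro s hs h0s
    obtain ⟨Q, hF, hv, hl, -⟩ := M.exists_polygon_of_deg hA hs dA
    refine ⟨Q, hF, hv, fun i hi => by rw [hl, hi, cB]; norm_num,
      fun i hi => by rw [hl, hi, cC]; norm_num, fun i h1 h2 => ?_⟩
    rw [hl, h0 _ (M.mem_nbrs_of_mem (hs.mem i)).1 h1 h2]; norm_num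
  have hne5 : ∀ s, Tri.IsCycle M.T A s → ∀ i j, ¬ (5 : ℤ) ∣ i - j → s i ≠ s j := by
    intro s hs i j hij he
    rw [hs.eq_iff, dA] at he
    exact hij he
  -- In the cyclic order of the pentagon's edges, positions two and three for `C` relative to `B`
  -- are excluded by `pentagon_not_alternating`, so the long edges are adjacent.
  have htri : {A, B, C} ∈ M.T := by
    obtain ⟨hBA, t, ht, hAt, hBt⟩ := Tri.mem_nbrs.1 hB
    obtain ⟨u, -, -, rfl⟩ := exists_third (M.isTri.card t ht) hAt hBt hBA.symm
    obtain ⟨s, s0, -, hs⟩ := M.exists_cycle ht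
    obtain ⟨Q, -, -, hlB, hlC, hl1⟩ := setup s hs s0
    obtain ⟨hCA, t', ht', hAt', hCt'⟩ := Tri.mem_nbrs.1 hC
    obtain ⟨j, hj⟩ : ∃ j, s j = C := by
      obtain ⟨i, hi⟩ := hs.surj _ ht' hAt'
      rw [hi] at hCt'
      simp only [Finset.mem_insert, Finset.mem_singleton] at hCt'
      rcases hCt' with h | h | h
      · exact absurd h hCA
      · exact ⟨i, h.symm⟩
      · exact ⟨_, h.symm⟩
    have hs5 : ∀ i k : ℤ, s (i + 5 * k) = s i := fun i k => by
      rw [hs.eq_iff, dA]; exact ⟨k, by push_cast; ring⟩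
    have hmod : s (j % 5) = C := by
      rw [← hj, hs.eq_iff, dA]; push_cast; omega
    have hone : ∀ i, ¬ (5 : ℤ) ∣ i → ¬ (5 : ℤ) ∣ i - j → Q.l i = 1 := fun i h1 h2 =>
      hl1 i (s0 ▸ hne5 s hs i 0 (by simpa using h1)) (hj ▸ hne5 s hs i j h2)
    rcases (show j % 5 = 0 ∨ j % 5 = 1 ∨ j % 5 = 2 ∨ j % 5 = 3 ∨ j % 5 = 4 by omega) with
      h | h | h | h | h
    · rw [h, s0] at hmod; exact absurd hmod hBC
    · have := hs.mem 0
      rw [h] at hmod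
      rwa [s0, zero_add, hmod] at this
    · exact (Q.pentagon_not_alternating 0 (hlB 0 s0) (hone _ (by norm_num) (by omega))
        (hlC _ (by rw [zero_add, ← h]; exact hmod)) (hone _ (by norm_num) (by omega))).elim
    · exact (Q.pentagon_not_alternating 3 (hlC _ (by rw [← h]; exact hmod))
        (hone _ (by norm_num) (by omega)) (hlB _ (by rw [← s0]; exact hs5 0 1))
        (hone _ (by norm_num) (by omega))).elim
    · have := hs.mem 4
      rw [h] at hmod
      rw [hmod, show (4 : ℤ) + 1 = 0 + 5 * 1 by norm_num, hs5, s0] at this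
      exact Tri.swap this
  refine ⟨htri, ?_⟩
  obtain ⟨s, s0, s1, hs⟩ := M.exists_cycle htri
  obtain ⟨Q, hF, hv, hlB, hlC, hl1⟩ := setup s hs s0
  have hone : ∀ i, ¬ (5 : ℤ) ∣ i → ¬ (5 : ℤ) ∣ i - 1 → Q.l i = 1 := fun i h1 h2 =>
    hl1 i (s0 ▸ hne5 s hs i 0 (by simpa using h1)) (s1 ▸ hne5 s hs i 1 h2)
  -- In the coordinates `B`, `C` the pentagon is given by `x ≤ 2`, `y ≤ 2`, `x + y ≤ 3`, and its
  -- vertex number two is `(2, 1)`.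
  obtain ⟨e1, -, e3⟩ := Q.pentagon_adjacent 0 (hlB _ s0) (hlC _ s1) (hone _ (by norm_num)
    (by norm_num)) (hone _ (by norm_num) (by norm_num)) (Q.v 2)
  refine ⟨Q.v 2, (hv 2).1, (Q.v 2).2, ?_⟩
  have f2 := Q.F_self 2
  have f3 := Q.F_succ 2
  rw [← s0, ← s1, ← hF, ← hF]
  norm_num at e1 e3 f3 ⊢
  omega

/-- The midpoint of two vertices. -/
theorem midpoint_isPt {x y z p v w : Fin 3 → ℤ} (ht : {x, y, z} ∈ M.T) (hv : v ∈ M.V) (hw : w ∈ M.V)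
    (hx : 2 * M.phi x p = M.phi x v + M.phi x w) (hy : 2 * M.phi y p = M.phi y v + M.phi y w)
    (hz : 2 * M.phi z p = M.phi z v + M.phi z w) (hne : v ≠ w) :
    M.IsPt p ∧ p ∉ M.V ∧ ∀ a, 2 * M.phi a p = M.phi a v + M.phi a w := by
  have key : ∀ a, 2 * M.phi a p = M.phi a v + M.phi a w := by
    intro a
    obtain ⟨α, β, γ, c, h, -⟩ := M.exists_affine ht a
    rw [h p, h v, h w]
    linear_combination α * hx + β * hy + γ * hz
  refine ⟨fun a _ => ?_, fun hp => hne ?_, key⟩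
  · have := key a
    have := M.phi_nonneg a hv
    have := M.phi_nonneg a hw
    omega
  · have hsub : ∀ u ∈ M.V, (∀ a ∈ M.t p, M.phi a u = 0) → u = p := by
      intro u hu h
      refine M.t_inj hu hp (Finset.eq_of_subset_of_card_le (fun a ha => ?_) ?_).symm
      · exact (M.phi_eq_zero hu (M.mem_verts.2 ⟨p, hp, ha⟩)).1 (h a ha)
      · rw [(M.dual u hu).card, (M.dual p hp).card]
    have h2 : ∀ a ∈ M.t p, M.phi a v = 0 ∧ M.phi a w = 0 := by
      intro a ha
      have h1 := key a
      rw [M.phi_self hp ha] at h1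
      have := M.phi_nonneg a hv
      have := M.phi_nonneg a hw
      constructor <;> omega
    rw [hsub v hv fun a ha => (h2 a ha).1, hsub w hw fun a ha => (h2 a ha).2]

/-- In the coordinates `(A, C, B)` the polytope has the vertices `(0, 2, 1)` and `(2, 0, 1)`. Their
midpoint `(1, 1, 1)` is a lattice point on none of the pentagons and is no vertex, while the count
has no room for it. -/
theorem not_num_five_three (heul : M.T.card + 4 = 2 * (Tri.verts M.T).card) (h16 : M.pts.card ≤ 16)
    (h7 : (Tri.verts M.T).card = 7) (h5 : Tri.num M.T 5 = 3) : False := by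
  obtain ⟨A, B, C, hAB, hAC, hBC, hA, hB, hC, hiff⟩ := Tri.exists_three_of_num h5
  have dA := (hiff A hA).2 (by simp)
  have dB := (hiff B hB).2 (by simp)
  have dC := (hiff C hC).2 (by simp)
  have hV : 10 ≤ M.V.card := by have := M.card_V_eq heul; omega
  obtain ⟨nAB, cAB, zA, hfin⟩ := M.three_pentagons h16 hV hAB hAC hBC hA hB hC dA dB dC
  obtain ⟨nAC, cAC, -, -⟩ := M.three_pentagons h16 hV hAC hAB hBC.symm hA hC hB dA dC dB
  obtain ⟨nCA, cCA, zC, -⟩ := M.three_pentagons h16 hV hAC.symm hBC.symm hAB hC hA hB dC dA dB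
  obtain ⟨nCB, cCB, -, -⟩ := M.three_pentagons h16 hV hBC.symm hAC.symm hAB.symm hC hB hA dC dB dA
  obtain ⟨ht, w, hw, wA, wC, wB⟩ := M.pentagon_vertex hA dA hBC.symm nAC nAB cAC cAB
    fun y hy h1 h2 => zA y hy h2 h1
  obtain ⟨-, w', hw', wC', wA', wB'⟩ := M.pentagon_vertex hC dC hAB nCA nCB cCA cCB zC
  obtain ⟨p, pA, pC, pB⟩ := M.exists_point ht 1 1 1
  obtain ⟨h1, h2, -⟩ := M.midpoint_isPt (p := p) ht hw hw' (by omega) (by omega) (by omega)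
    (by rintro rfl; omega)
  exact hfin p h1 h2 (by omega) (by omega) (by omega)

end SmoothModel


/-! ### Three hexagons among eight facets -/

section

variable {α : Type*} [DecidableEq α] {T : Finset (Finset α)} {A B C : α}

theorem Tri.nbrs_symm {x y : α} (h : y ∈ Tri.nbrs T x) :
    x ∈ Tri.nbrs T y := by
  obtain ⟨hne, t, ht, hxt, hyt⟩ := Tri.mem_nbrs.1 h
  exact Tri.mem_nbrs.2 ⟨hne.symm, t, ht, hyt, hxt⟩

/-- The two triangles at an edge. -/
theorem IsTri.exists_two (h : IsTri T) {x y : α} (hy : y ∈ Tri.nbrs T x) :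
    ∃ p q, p ≠ q ∧ {x, y, p} ∈ T ∧ {x, y, q} ∈ T := by
  obtain ⟨hne, t, ht, hxt, hyt⟩ := Tri.mem_nbrs.1 hy
  obtain ⟨p, -, -, rfl⟩ := exists_third (h.card t ht) hxt hyt hne.symm
  have h1 : {y, x, p} ∈ T := by rwa [Finset.insert_comm]
  obtain ⟨q, hq, h2⟩ := h.exists_next (r := x) (x := p) (y := y) (by rwa [Finset.pair_comm])
  exact ⟨p, q, hq.symm, ht, h2⟩

/-- The two triangles at an edge with both ends outside `{A, B, C}` need a third vertex inside. -/
theorem IsTri.exists_two_of_cover (h : IsTri T) (hcov : ∀ t ∈ T, A ∈ t ∨ B ∈ t ∨ C ∈ t) {x y : α}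
    (hx : x ∉ ({A, B, C} : Finset α)) (hy : y ∉ ({A, B, C} : Finset α)) (hxy : y ∈ Tri.nbrs T x) :
    ∃ p ∈ ({A, B, C} : Finset α), ∃ q ∈ ({A, B, C} : Finset α), p ≠ q ∧ p ∈ Tri.nbrs T x ∧
      p ∈ Tri.nbrs T y ∧ q ∈ Tri.nbrs T x ∧ q ∈ Tri.nbrs T y := by
  obtain ⟨p, q, hpq, h1, h2⟩ := h.exists_two hxy
  have key : ∀ p, {x, y, p} ∈ T → p ∈ ({A, B, C} : Finset α) ∧ p ∈ Tri.nbrs T x ∧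
      p ∈ Tri.nbrs T y := by
    intro p hp
    obtain ⟨-, d2, d3⟩ := h.ne_of_mem hp
    refine ⟨?_, Tri.mem_nbrs.2 ⟨d2.symm, _, hp, by simp, by simp⟩,
      Tri.mem_nbrs.2 ⟨d3.symm, _, hp, by simp, by simp⟩⟩
    have := hcov _ hp
    simp only [Finset.mem_insert, Finset.mem_singleton] at this hx hy ⊢
    grind
  obtain ⟨a1, a2, a3⟩ := key p h1
  obtain ⟨b1, b2, b3⟩ := key q h2
  exact ⟨p, a1, q, b1, hpq, a2, a3, b2, b3⟩

/-- `X`, `Y`, `E` are the outer vertices missed by `A`, `B`, `C`. The four neighbours of `E` are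
`A`, `B` and two outer vertices `D`, `F`, each of which has exactly the neighbours `A, B, C, E`. For
`X` only `B`, `C`, `Y` remain as neighbours, so `X Y` is an edge; but `C` alone can complete it to a
triangle. -/
theorem IsTri.three_cover_aux (h : IsTri T) (hcov : ∀ t ∈ T, A ∈ t ∨ B ∈ t ∨ C ∈ t)
    (h3 : ∀ x ∈ Tri.verts T, 3 ≤ Tri.deg T x)
    (h4 : ∀ x ∈ Tri.verts T, x ∉ ({A, B, C} : Finset α) → Tri.deg T x ≤ 4)
    (h8 : (Tri.verts T).card = 8) (hAB : A ≠ B) (hAC : A ≠ C) (hBC : B ≠ C)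
    (hA : A ∈ Tri.verts T) (hB : B ∈ Tri.verts T) (hC : C ∈ Tri.verts T) {X Y E : α}
    (hX : X ∈ Tri.verts T) (hY : Y ∈ Tri.verts T) (hE : E ∈ Tri.verts T)
    (oX : X ∉ ({A, B, C} : Finset α)) (oY : Y ∉ ({A, B, C} : Finset α))
    (oE : E ∉ ({A, B, C} : Finset α)) (hXY : X ≠ Y) (hXE : X ≠ E) (hYE : Y ≠ E)
    (nX : ∀ z ∈ Tri.verts T, z ∉ ({A, B, C} : Finset α) → (A ∈ Tri.nbrs T z ↔ z ≠ X))
    (nY : ∀ z ∈ Tri.verts T, z ∉ ({A, B, C} : Finset α) → (B ∈ Tri.nbrs T z ↔ z ≠ Y))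
    (nE : ∀ z ∈ Tri.verts T, z ∉ ({A, B, C} : Finset α) → (C ∈ Tri.nbrs T z ↔ z ≠ E))
    (dE : Tri.deg T E = 4) : False := by
  have hsub : ∀ {x y : α}, y ∈ Tri.nbrs T x → y ∈ Tri.verts T := fun h => (Finset.mem_filter.1 h).1
  have eA := (nX E hE oE).2 hXE.symm
  have eB := (nY E hE oE).2 hYE.symm
  have eC : C ∉ Tri.nbrs T E := fun hc => (nE E hE oE).1 hc rfl
  have hcard : (((Tri.nbrs T E).erase A).erase B).card = 2 := by
    rw [Finset.card_erase_of_mem (Finset.mem_erase.2 ⟨hAB.symm, eB⟩), Finset.card_erase_of_mem eA,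
      h.card_nbrs, dE]
  -- The outer neighbours of `E`, which is not adjacent to `C`. The two triangles at such an edge
  -- have `A` and `B` as their third vertices.
  obtain ⟨D, F, hDF, he⟩ := Finset.card_eq_two.1 hcard
  have key : ∀ Z, Z ∈ ((Tri.nbrs T E).erase A).erase B → Z ∈ Tri.nbrs T E ∧
      Z ∉ ({A, B, C} : Finset α) ∧ Z ≠ X ∧ Z ≠ Y ∧ Z ≠ E ∧ Tri.nbrs T Z = {A, B, C, E} := by
    intro Z hZ
    rw [Finset.mem_erase, Finset.mem_erase] at hZ
    obtain ⟨zB, zA, hZ⟩ := hZ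
    have zC : Z ≠ C := fun h => eC (h ▸ hZ)
    have oZ : Z ∉ ({A, B, C} : Finset α) := by simp [zA, zB, zC]
    have zE : Z ≠ E := (Tri.mem_nbrs.1 hZ).1
    obtain ⟨p, hp, q, hq, hpq, p1, p2, q1, q2⟩ := h.exists_two_of_cover hcov oE oZ hZ
    have hAB' : A ∈ Tri.nbrs T Z ∧ B ∈ Tri.nbrs T Z := by
      simp only [Finset.mem_insert, Finset.mem_singleton] at hp hq
      grind
    have zX := (nX Z (hsub hZ) oZ).1 hAB'.1
    have zY := (nY Z (hsub hZ) oZ).1 hAB'.2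
    refine ⟨hZ, oZ, zX, zY, zE, ?_⟩
    symm
    apply Finset.eq_of_subset_of_card_le
    · intro w hw
      simp only [Finset.mem_insert, Finset.mem_singleton] at hw
      rcases hw with rfl | rfl | rfl | rfl
      · exact hAB'.1
      · exact hAB'.2
      · exact (nE Z (hsub hZ) oZ).2 zE
      · exact Tri.nbrs_symm hZ
    · simp only [Finset.mem_insert, Finset.mem_singleton, not_or] at oE
      rw [h.card_nbrs, Finset.card_insert_of_notMem (by simp [hAB, hAC, Ne.symm oE.1]),
        Finset.card_insert_of_notMem (by simp [hBC, Ne.symm oE.2.1]),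
        Finset.card_pair (Ne.symm oE.2.2)]
      exact h4 Z (hsub hZ) oZ
  obtain ⟨D1, D2, D3, D4, D5, D6⟩ := key D (by rw [he]; simp)
  obtain ⟨F1, F2, F3, F4, F5, F6⟩ := key F (by rw [he]; simp)
  have hverts : ({A, B, C, E, D, F, X, Y} : Finset α) = Tri.verts T := by
    apply Finset.eq_of_subset_of_card_le
    · intro w hw
      simp only [Finset.mem_insert, Finset.mem_singleton] at hw
      rcases hw with rfl | rfl | rfl | rfl | rfl | rfl | rfl | rfl <;>
        first | assumption | exact hsub D1 | exact hsub F1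
    · simp only [Finset.mem_insert, Finset.mem_singleton, not_or] at oE oX oY D2 F2
      rw [h8]
      repeat rw [Finset.card_insert_of_notMem]
      · simp
      all_goals simp only [Finset.mem_insert, Finset.mem_singleton]; grind
  have xsub : Tri.nbrs T X ⊆ {B, C, Y} := by
    intro w hw
    have hwX := Tri.nbrs_symm hw
    have h1 := hsub hw
    rw [← hverts] at h1
    simp only [Finset.mem_insert, Finset.mem_singleton] at h1 ⊢
    simp only [Finset.mem_insert, Finset.mem_singleton, not_or] at oX
    rcases h1 with rfl | rfl | rfl | rfl | rfl | rfl | rfl | rfl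
    · exact absurd rfl ((nX X hX (by simp [oX])).1 hw)
    · simp
    · simp
    · have : X ∈ ((Tri.nbrs T w).erase A).erase B := by simp [oX, hwX]
      rw [he] at this
      simp only [Finset.mem_insert, Finset.mem_singleton] at this
      grind
    · rw [D6] at hwX
      simp only [Finset.mem_insert, Finset.mem_singleton] at hwX
      grind
    · rw [F6] at hwX
      simp only [Finset.mem_insert, Finset.mem_singleton] at hwX
      grind
    · exact absurd rfl (Tri.mem_nbrs.1 hw).1
    · simp
  have hYX : Y ∈ Tri.nbrs T X := by
    rw [Finset.eq_of_subset_of_card_le xsub (by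
      rw [h.card_nbrs]; exact Finset.card_le_three.trans (h3 X hX))]
    simp
  obtain ⟨p, hp, q, hq, hpq, p1, p2, q1, q2⟩ := h.exists_two_of_cover hcov oX oY hYX
  have nA : A ∉ Tri.nbrs T X := fun hc => (nX X hX oX).1 hc rfl
  have nB : B ∉ Tri.nbrs T Y := fun hc => (nY Y hY oY).1 hc rfl
  simp only [Finset.mem_insert, Finset.mem_singleton] at hp hq
  grind

/-- The number of triangles that meet three vertices. -/
theorem IsTri.three_cover (h : IsTri T) (h12 : T.card = 12) (hAB : A ≠ B) (hAC : A ≠ C)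
    (hBC : B ≠ C) (dA : Tri.deg T A = 6) (dB : Tri.deg T B = 6) (dC : Tri.deg T C = 6) :
    (∀ t ∈ T, A ∈ t ∨ B ∈ t ∨ C ∈ t) ∧ (∃ t ∈ T, A ∈ t ∧ B ∈ t) ∧ (∃ t ∈ T, A ∈ t ∧ C ∈ t) ∧
      ∃ t ∈ T, B ∈ t ∧ C ∈ t := by
  have hpair : ∀ a b : α, a ≠ b → (T.filter fun t => a ∈ t ∧ b ∈ t).card = 0 ∨
      ((T.filter fun t => a ∈ t ∧ b ∈ t).card = 2 ∧ ∃ t ∈ T, a ∈ t ∧ b ∈ t) := by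
    intro a b hab
    by_cases hex : ∃ t ∈ T, a ∈ t ∧ b ∈ t
    · exact Or.inr ⟨h.pair a b hab hex, hex⟩
    · left
      rw [Finset.card_eq_zero, Finset.filter_eq_empty_iff]
      exact fun t ht hc => hex ⟨t, ht, hc⟩
  -- Three stars of six triangles lie in a set of twelve. At most two triangles are shared by each
  -- pair, so the union has at least `18 - 6` members. It is therefore everything, and each pair
  -- shares two.
  have e1 := Finset.card_union_add_card_inter (T.filter fun t => A ∈ t) (T.filter fun t => B ∈ t)
  rw [← Finset.filter_or, ← Finset.filter_and] at e1
  have e2 := Finset.card_union_add_card_inter (T.filter fun t => A ∈ t ∨ B ∈ t)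
    (T.filter fun t => C ∈ t)
  rw [← Finset.filter_or, ← Finset.filter_and] at e2
  have e3 := Finset.card_union_le (T.filter fun t => A ∈ t ∧ C ∈ t)
    (T.filter fun t => B ∈ t ∧ C ∈ t)
  rw [← Finset.filter_or] at e3
  simp only [or_and_right] at e2
  have e4 := Finset.card_filter_le T fun t => (A ∈ t ∨ B ∈ t) ∨ C ∈ t
  change (T.filter fun t => A ∈ t).card = 6 at dA
  change (T.filter fun t => B ∈ t).card = 6 at dB
  change (T.filter fun t => C ∈ t).card = 6 at dC
  refine ⟨?_, ?_⟩
  · have h1 : (T.filter fun t => (A ∈ t ∨ B ∈ t) ∨ C ∈ t) = T := by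
      apply Finset.eq_of_subset_of_card_le (Finset.filter_subset _ _)
      rcases hpair A B hAB with h1 | ⟨h1, -⟩ <;> rcases hpair A C hAC with h2 | ⟨h2, -⟩ <;>
        rcases hpair B C hBC with h3 | ⟨h3, -⟩ <;> omega
    intro t ht
    rw [← h1, Finset.mem_filter, or_assoc] at ht
    exact ht.2
  · rcases hpair A B hAB with h1 | ⟨h1, k1⟩
    · rcases hpair A C hAC with h2 | ⟨h2, -⟩ <;> rcases hpair B C hBC with h3 | ⟨h3, -⟩ <;> omega
    rcases hpair A C hAC with h2 | ⟨h2, k2⟩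
    · rcases hpair B C hBC with h3 | ⟨h3, -⟩ <;> omega
    rcases hpair B C hBC with h3 | ⟨h3, k3⟩
    · omega
    exact ⟨k1, k2, k3⟩

/-- The three hexagons are pairwise adjacent and each misses exactly one other facet. The missed
facets are distinct, and only two facets have degree three, so one of the missed facets has degree
four and plays the role of `E` in `three_cover_aux`. -/
theorem IsTri.not_num_six_three (h : IsTri T) (h3 : ∀ x ∈ Tri.verts T, 3 ≤ Tri.deg T x)
    (heul : T.card + 4 = 2 * (Tri.verts T).card)
    (h8 : (Tri.verts T).card = 8) (n3 : Tri.num T 3 = 2) (n4 : Tri.num T 4 = 3)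
    (n6 : Tri.num T 6 = 3) : False := by
  obtain ⟨A, B, C, hAB, hAC, hBC, hA, hB, hC, hiff⟩ := Tri.exists_three_of_num n6
  have dA := (hiff A hA).2 (by simp)
  have dB := (hiff B hB).2 (by simp)
  have dC := (hiff C hC).2 (by simp)
  obtain ⟨hcov, kAB, kAC, kBC⟩ := h.three_cover (by omega) hAB hAC hBC dA dB dC
  have h34 : ∀ x ∈ Tri.verts T, x ∉ ({A, B, C} : Finset α) → Tri.deg T x = 3 ∨ Tri.deg T x = 4 := by
    intro x hx ho
    have := Tri.deg_mem (K := {3, 4, 6}) (by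
      rw [Finset.sum_insert (by decide), Finset.sum_pair (by decide), n3, n4, n6, h8]; norm_num) hx
    simp only [Finset.mem_insert, Finset.mem_singleton, hiff x hx] at this ho
    tauto
  have h4 : ∀ x ∈ Tri.verts T, x ∉ ({A, B, C} : Finset α) → Tri.deg T x ≤ 4 := by
    intro x hx ho
    rcases h34 x hx ho with h | h <;> omega
  have hmiss : ∀ P Q R, P ≠ Q → P ≠ R → Q ≠ R → Q ∈ Tri.nbrs T P → R ∈ Tri.nbrs T P →
      ({P, Q, R} : Finset α) = {A, B, C} → P ∈ Tri.verts T → Tri.deg T P = 6 →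
      ∃ X ∈ Tri.verts T, X ∉ ({A, B, C} : Finset α) ∧ ∀ z ∈ Tri.verts T,
        z ∉ ({A, B, C} : Finset α) → (P ∈ Tri.nbrs T z ↔ z ≠ X) := by
    intro P Q R hPQ hPR hQR hQ hR hset hP dP
    have hsub : Tri.nbrs T P ⊆ (Tri.verts T).erase P := fun y hy =>
      Finset.mem_erase.2 ⟨(Tri.mem_nbrs.1 hy).1, (Finset.mem_filter.1 hy).1⟩
    have hc : (((Tri.verts T).erase P) \ Tri.nbrs T P).card = 1 := by
      rw [Finset.card_sdiff_of_subset hsub, Finset.card_erase_of_mem hP, h.card_nbrs, h8, dP]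
    obtain ⟨X, hX⟩ := Finset.card_eq_one.1 hc
    have hX' : ∀ z, (z ∈ Tri.verts T ∧ z ≠ P ∧ z ∉ Tri.nbrs T P) ↔ z = X := by
      intro z
      rw [← Finset.mem_singleton, ← hX, Finset.mem_sdiff, Finset.mem_erase]
      tauto
    obtain ⟨x1, x2, x3⟩ := (hX' X).2 rfl
    refine ⟨X, x1, ?_, ?_⟩
    · rw [← hset]
      simp only [Finset.mem_insert, Finset.mem_singleton]
      rintro (rfl | rfl | rfl)
      · exact x2 rfl
      · exact x3 hQ
      · exact x3 hR
    · intro z hz ho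
      have hzP : z ≠ P := by
        rintro rfl
        exact ho (hset ▸ by simp)
      have := hX' z
      constructor
      · rintro hn rfl
        exact x3 (Tri.nbrs_symm hn)
      · intro hne
        by_contra hn
        exact hne (this.1 ⟨hz, hzP, fun hc => hn (Tri.nbrs_symm hc)⟩)
  have adj : ∀ {P Q : α}, P ≠ Q → (∃ t ∈ T, P ∈ t ∧ Q ∈ t) → Q ∈ Tri.nbrs T P ∧ P ∈ Tri.nbrs T Q :=
    fun hne ⟨t, ht, h1, h2⟩ => ⟨Tri.mem_nbrs.2 ⟨hne.symm, t, ht, h1, h2⟩,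
      Tri.mem_nbrs.2 ⟨hne, t, ht, h2, h1⟩⟩
  obtain ⟨aAB, aBA⟩ := adj hAB kAB
  obtain ⟨aAC, aCA⟩ := adj hAC kAC
  obtain ⟨aBC, aCB⟩ := adj hBC kBC
  have s1 : ({B, A, C} : Finset α) = {A, B, C} := Finset.insert_comm _ _ _
  have s2 : ({C, A, B} : Finset α) = {A, B, C} := by
    rw [Finset.insert_comm C A, Finset.pair_comm C B]
  obtain ⟨X, hX, oX, nX⟩ := hmiss A B C hAB hAC hBC aAB aAC rfl hA dA
  obtain ⟨Y, hY, oY, nY⟩ := hmiss B A C hAB.symm hBC hAC aBA aBC s1 hB dB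
  obtain ⟨E, hE, oE, nE⟩ := hmiss C A B hAC.symm hBC.symm hAB aCA aCB s2 hC dC
  -- An outer vertex adjacent to at most one of `A, B, C` still has an outer neighbour, because its
  -- degree is at least three; the edge between them requires two of `A, B, C`.
  have hdist : ∀ Z ∈ Tri.verts T, Z ∉ ({A, B, C} : Finset α) → ∀ P,
      (∀ Q ∈ ({A, B, C} : Finset α), Q ∈ Tri.nbrs T Z → Q = P) → False := by
    intro Z hZ oZ P hP
    have hc := h3 Z hZ
    rw [← h.card_nbrs] at hc
    obtain ⟨D, hD, hDP⟩ := Finset.exists_mem_ne (show 1 < (Tri.nbrs T Z).card by omega) P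
    have oD : D ∉ ({A, B, C} : Finset α) := fun ho => hDP (hP D ho hD)
    obtain ⟨p, hp, q, hq, hpq, p1, -, q1, -⟩ := h.exists_two_of_cover hcov oZ oD hD
    exact hpq ((hP p hp p1).trans (hP q hq q1).symm)
  have hXY : X ≠ Y := by
    rintro rfl
    refine hdist X hX oX C fun Q hQ hQX => ?_
    simp only [Finset.mem_insert, Finset.mem_singleton] at hQ
    rcases hQ with rfl | rfl | rfl
    · exact absurd rfl ((nX X hX oX).1 hQX)
    · exact absurd rfl ((nY X hX oX).1 hQX)
    · rfl
  have hXE : X ≠ E := by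
    rintro rfl
    refine hdist X hX oX B fun Q hQ hQX => ?_
    simp only [Finset.mem_insert, Finset.mem_singleton] at hQ
    rcases hQ with rfl | rfl | rfl
    · exact absurd rfl ((nX X hX oX).1 hQX)
    · rfl
    · exact absurd rfl ((nE X hX oX).1 hQX)
  have hYE : Y ≠ E := by
    rintro rfl
    refine hdist Y hY oY A fun Q hQ hQX => ?_
    simp only [Finset.mem_insert, Finset.mem_singleton] at hQ
    rcases hQ with rfl | rfl | rfl
    · rfl
    · exact absurd rfl ((nY Y hY oY).1 hQX)
    · exact absurd rfl ((nE Y hY oY).1 hQX)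
  rcases h34 X hX oX with dX | dX
  · rcases h34 Y hY oY with dY | dY
    · rcases h34 E hE oE with dE | dE
      · have h2 : 2 < Tri.num T 3 := Finset.two_lt_card.2 ⟨X, Finset.mem_filter.2 ⟨hX, dX⟩, Y,
          Finset.mem_filter.2 ⟨hY, dY⟩, E, Finset.mem_filter.2 ⟨hE, dE⟩, hXY, hXE, hYE⟩
        omega
      · exact h.three_cover_aux hcov h3 h4 h8 hAB hAC hBC hA hB hC hX hY hE oX oY oE hXY hXE hYE
          nX nY nE dE
    · have s3 : ({A, C, B} : Finset α) = {A, B, C} := by rw [Finset.pair_comm]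
      rw [← s3] at oX oY oE nX nY nE h4
      exact h.three_cover_aux (A := A) (B := C) (C := B) (fun t ht => by have := hcov t ht; tauto)
        h3 h4 h8 hAC hAB hBC.symm hA hC hB hX hE hY oX oE oY hXE hXY hYE.symm nX nE nY dY
  · have s3 : ({C, B, A} : Finset α) = {A, B, C} := by
      rw [Finset.pair_comm B A, s2]
    rw [← s3] at oX oY oE nX nY nE h4
    exact h.three_cover_aux (A := C) (B := B) (C := A) (fun t ht => by have := hcov t ht; tauto)
      h3 h4 h8 hBC.symm hAC.symm hAB.symm hC hB hA hE hY hX oE oY oX hYE.symm hXE.symm hXY.symm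
      nE nY nX dX

end


/-! ### Two adjacent hexagons -/

namespace SmoothModel

variable (M : SmoothModel 3)

/-- Two adjacent hexagons that together meet all other facets. -/
structure HexagonPair (A B C D E₁ E₂ E₃ : Fin 3 → ℤ) : Prop where
  abc : {A, B, C} ∈ M.T
  abd : {A, B, D} ∈ M.T
  ac3 : {A, C, E₃} ∈ M.T
  a32 : {A, E₃, E₂} ∈ M.T
  a21 : {A, E₂, E₁} ∈ M.T
  a1d : {A, E₁, D} ∈ M.T
  bc3 : {B, C, E₃} ∈ M.T
  b32 : {B, E₃, E₂} ∈ M.T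
  b21 : {B, E₂, E₁} ∈ M.T
  b1d : {B, E₁, D} ∈ M.T
  all : ∀ t ∈ M.T, ∃ P ∈ ({A, B} : Finset (Fin 3 → ℤ)), t = {A, B, C} ∨ t = {A, B, D} ∨
    t = {P, C, E₃} ∨ t = {P, E₃, E₂} ∨ t = {P, E₂, E₁} ∨ t = {P, E₁, D}
  nodup : [A, B, C, D, E₁, E₂, E₃].Nodup
  deg : Tri.deg M.T A = 6

-- The configuration has two ends, at the triangular facets `C` and `D`. This symmetry transfers the
-- analysis of one end to the other.
variable {M} in
theorem HexagonPair.symm {A B C D E₁ E₂ E₃ : Fin 3 → ℤ} (h : M.HexagonPair A B C D E₁ E₂ E₃) :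
    M.HexagonPair A B D C E₃ E₂ E₁ where
  abc := h.abd
  abd := h.abc
  ac3 := Tri.swap h.a1d
  a32 := Tri.swap h.a21
  a21 := Tri.swap h.a32
  a1d := Tri.swap h.ac3
  bc3 := Tri.swap h.b1d
  b32 := Tri.swap h.b21
  b21 := Tri.swap h.b32
  b1d := Tri.swap h.bc3
  all := by
    intro t ht
    obtain ⟨P, hP, hc⟩ := h.all t ht
    refine ⟨P, hP, ?_⟩
    rw [Finset.pair_comm D E₁, Finset.pair_comm E₁ E₂, Finset.pair_comm E₂ E₃, Finset.pair_comm E₃ C]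
    tauto
  nodup := by
    have := h.nodup
    simp only [List.nodup_cons, List.mem_cons, List.not_mem_nil, or_false, not_or] at this ⊢
    grind
  deg := h.deg

/-- A hexagon among seven facets is adjacent to all the others. By `card_avoid` every triangle
contains `A` or `B`, so the triangles at `A` that avoid `B` are mirrored by triangles at `B`. -/
theorem exists_hexagonPair (heul : M.T.card + 4 = 2 * (Tri.verts M.T).card)
    (h7 : (Tri.verts M.T).card = 7) (n6 : Tri.num M.T 6 = 2) :
    ∃ A B C D E₁ E₂ E₃, M.HexagonPair A B C D E₁ E₂ E₃ := by
  obtain ⟨A, B, hAB, hA, hB, hiff⟩ := Tri.exists_two_of_num n6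
  have dA := (hiff A hA).2 (Or.inl rfl)
  have dB := (hiff B hB).2 (Or.inr rfl)
  have hnA : Tri.nbrs M.T A = (Tri.verts M.T).erase A := by
    apply Finset.eq_of_subset_of_card_le
    · intro y hy
      exact Finset.mem_erase.2 ⟨(Tri.mem_nbrs.1 hy).1, (Finset.mem_filter.1 hy).1⟩
    · rw [M.isTri.card_nbrs, Finset.card_erase_of_mem hA, dA, h7]
  have hBA : B ∈ Tri.nbrs M.T A := by rw [hnA]; exact Finset.mem_erase.2 ⟨hAB.symm, hB⟩
  obtain ⟨-, t, ht, hAt, hBt⟩ := Tri.mem_nbrs.1 hBA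
  obtain ⟨C, -, -, rfl⟩ := exists_third (M.isTri.card t ht) hAt hBt hAB
  obtain ⟨s, s0, s1, hs⟩ := M.exists_cycle ht
  have hcov : ∀ t ∈ M.T, A ∈ t ∨ B ∈ t := by
    have := M.isTri.card_avoid ht
    have h0 : (M.T.filter fun t => A ∉ t ∧ B ∉ t).card = 0 := by omega
    rw [Finset.card_eq_zero, Finset.filter_eq_empty_iff] at h0
    intro t ht
    have := h0 ht
    tauto
  have heq : ∀ i j : ℤ, s i = s j ↔ (6 : ℤ) ∣ i - j := fun i j => by
    rw [hs.eq_iff, dA]; rfl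
  have hBs : ∀ i : ℤ, ¬ (6 : ℤ) ∣ i → s i ≠ B := fun i hi he => by
    rw [← s0, heq] at he; exact hi (by simpa using he)
  have hAs : ∀ i, s i ≠ A := fun i => (M.ne_of_mem (hs.mem i)).1.symm
  -- The second triangle at an edge of the link of `A` away from `B` cannot contain `A`, so its
  -- third vertex is `B`.
  have hBT : ∀ i : ℤ, ¬ (6 : ℤ) ∣ i → ¬ (6 : ℤ) ∣ i + 1 → {B, s i, s (i + 1)} ∈ M.T := by
    intro i h1 h2
    obtain ⟨z, hz, hzT⟩ := M.isTri.exists_next (Tri.flip (hs.mem i))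
    have := hcov _ hzT
    simp only [Finset.mem_insert, Finset.mem_singleton] at this
    obtain rfl : z = B := by
      have := hAs i
      have := hAs (i + 1)
      have := hBs i h1
      have := hBs _ h2
      grind
    exact Tri.rot (Tri.rot hzT)
  have hs6 : s 6 = B := by rw [← s0, heq]; norm_num
  have hcycle : ∀ i : ℤ, ({A, s i, s (i + 1)} : Finset (Fin 3 → ℤ)) =
      {A, s (i % 6), s (i % 6 + 1)} := fun i => by
    rw [(heq i (i % 6)).2 (by omega), (heq (i + 1) (i % 6 + 1)).2 (by omega)]
  have hall : ∀ t ∈ M.T, A ∈ t → t = {A, B, C} ∨ t = {A, B, s 5} ∨ t = {A, C, s 2} ∨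
      t = {A, s 2, s 3} ∨ t = {A, s 3, s 4} ∨ t = {A, s 4, s 5} := by
    intro t ht hAt
    obtain ⟨i, rfl⟩ := hs.surj t ht hAt
    rw [hcycle]
    rcases (show i % 6 = 0 ∨ i % 6 = 1 ∨ i % 6 = 2 ∨ i % 6 = 3 ∨ i % 6 = 4 ∨ i % 6 = 5 by omega)
      with h | h | h | h | h | h <;> rw [h]
    · left; rw [s0, zero_add, s1]
    · right; right; left; rw [s1]; rfl
    · right; right; right; left; rfl
    · right; right; right; right; left; rfl
    · right; right; right; right; right; rfl
    · right; left
      rw [show (5 : ℤ) + 1 = 6 by norm_num, hs6, Finset.pair_comm]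
  refine ⟨A, B, C, s 5, s 4, s 3, s 2, ht, ?_, ?_, hs.mem 2, hs.mem 3, hs.mem 4, ?_, ?_, ?_, ?_, ?_,
    ?_, dA⟩
  · have := hs.mem 5
    rw [show (5 : ℤ) + 1 = 6 by norm_num, hs6] at this
    exact Tri.swap this
  · have := hs.mem 1; rwa [s1] at this
  · have := hBT 1 (by norm_num) (by norm_num); rwa [s1] at this
  · exact hBT 2 (by norm_num) (by norm_num)
  · exact hBT 3 (by norm_num) (by norm_num)
  · exact hBT 4 (by norm_num) (by norm_num)
  · intro t ht
    by_cases hAt : A ∈ t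
    · exact ⟨A, by simp, hall t ht hAt⟩
    · have hBt := (hcov t ht).resolve_left hAt
      obtain ⟨p, q, -, -, -, rfl⟩ := exists_others (M.isTri.card t ht) hBt
      obtain ⟨z, hz, hzT⟩ := M.isTri.exists_next (Tri.flip ht)
      obtain ⟨d1, d2, d3⟩ := M.ne_of_mem ht
      have h1 := hcov _ hzT
      simp only [Finset.mem_insert, Finset.mem_singleton, not_or] at h1 hAt
      obtain rfl : z = A := by grind
      have h2 := hall _ (Tri.rot (Tri.rot hzT)) (by simp)
      have hsd : ∀ {x y : Fin 3 → ℤ}, x ≠ z → y ≠ z → ({z, p, q} : Finset (Fin 3 → ℤ)) = {z, x, y} →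
          ({p, q} : Finset (Fin 3 → ℤ)) = {x, y} := by
        intro x y hx hy he
        have := congrArg (fun S => Finset.erase S z) he
        simpa [Finset.erase_insert, Ne.symm hx, Ne.symm hy, hAt.2.1, hAt.2.2] using this
      have hno : ∀ {y : Fin 3 → ℤ}, y ≠ z → ({z, p, q} : Finset (Fin 3 → ℤ)) ≠ {z, B, y} := by
        intro y hy he
        have h3 := hsd hAB.symm hy he
        have : B ∈ ({p, q} : Finset (Fin 3 → ℤ)) := h3 ▸ (by simp)
        simp only [Finset.mem_insert, Finset.mem_singleton] at this
        grind
      have hCz := (M.ne_of_mem ‹_›).2.1.symm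
      refine ⟨B, by simp, ?_⟩
      rcases h2 with h2 | h2 | h2 | h2 | h2 | h2
      · exact absurd h2 (hno (by rw [← s1]; exact hAs 1))
      · exact absurd h2 (hno (hAs 5))
      · rw [hsd (by rw [← s1]; exact hAs 1) (hAs 2) h2]; simp
      · rw [hsd (hAs 2) (hAs 3) h2]; simp
      · rw [hsd (hAs 3) (hAs 4) h2]; simp
      · rw [hsd (hAs 4) (hAs 5) h2]; simp
  · rw [← s0, ← s1]
    simp only [List.nodup_cons, List.mem_cons, List.not_mem_nil, or_false, not_or, heq]
    refine ⟨⟨(hAs 0).symm, (hAs 1).symm, (hAs 5).symm, (hAs 4).symm, (hAs 3).symm, (hAs 2).symm⟩, ?_⟩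
    norm_num

section Coordinates

variable {X Y Z : Fin 3 → ℤ}

/-- The polytope contains the lattice point with the given coordinates. -/
def Has (X Y Z : Fin 3 → ℤ) (x y z : ℤ) : Prop :=
  ∃ p, M.phi X p = x ∧ M.phi Y p = y ∧ M.phi Z p = z ∧ M.IsPt p

/-- The lattice point with the given coordinates lies in the polytope, and is not a vertex. -/
def Extra (X Y Z : Fin 3 → ℤ) (x y z : ℤ) : Prop :=
  ∃ p, M.phi X p = x ∧ M.phi Y p = y ∧ M.phi Z p = z ∧ M.IsPt p ∧ p ∉ M.V

variable {M}

theorem Extra.has {x y z : ℤ} (h : M.Extra X Y Z x y z) : M.Has X Y Z x y z := by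
  obtain ⟨p, h1, h2, h3, h4, -⟩ := h
  exact ⟨p, h1, h2, h3, h4⟩

theorem has_of_mem {v : Fin 3 → ℤ} (hv : v ∈ M.V) {x y z : ℤ} (hx : M.phi X v = x)
    (hy : M.phi Y v = y) (hz : M.phi Z v = z) : M.Has X Y Z x y z :=
  ⟨v, hx, hy, hz, M.isPt_of_mem hv⟩

/-- Facet functions are affine in the three coordinates, so a relation of total weight `i + j`
between the coordinates holds for all of them. -/
theorem combo_aux (ht : {X, Y, Z} ∈ M.T) {p q r : Fin 3 → ℤ} {i j : ℤ}
    (hx : (i + j) * M.phi X p = i * M.phi X q + j * M.phi X r)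
    (hy : (i + j) * M.phi Y p = i * M.phi Y q + j * M.phi Y r)
    (hz : (i + j) * M.phi Z p = i * M.phi Z q + j * M.phi Z r) (a : Fin 3 → ℤ) :
    (i + j) * M.phi a p = i * M.phi a q + j * M.phi a r := by
  obtain ⟨α, β, γ, c, h, -⟩ := M.exists_affine ht a
  rw [h p, h q, h r]
  linear_combination α * hx + β * hy + γ * hz

theorem Has.combo (ht : {X, Y, Z} ∈ M.T) {x₁ y₁ z₁ x₂ y₂ z₂ x y z : ℤ}
    (h₁ : M.Has X Y Z x₁ y₁ z₁) (h₂ : M.Has X Y Z x₂ y₂ z₂) (i j : ℤ) (hi : 0 ≤ i) (hj : 0 ≤ j)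
    (hij : 0 < i + j) (hx : (i + j) * x = i * x₁ + j * x₂) (hy : (i + j) * y = i * y₁ + j * y₂)
    (hz : (i + j) * z = i * z₁ + j * z₂) : M.Has X Y Z x y z := by
  obtain ⟨q, rfl, rfl, rfl, hq⟩ := h₁
  obtain ⟨r, rfl, rfl, rfl, hr⟩ := h₂
  obtain ⟨p, rfl, rfl, rfl⟩ := M.exists_point ht x y z
  refine ⟨p, rfl, rfl, rfl, fun a ha => ?_⟩
  have h1 := combo_aux ht hx hy hz a
  have h2 := mul_nonneg hi (hq a ha)
  have h3 := mul_nonneg hj (hr a ha)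
  exact nonneg_of_mul_nonneg_right (by linarith) hij

theorem Has.extra (ht : {X, Y, Z} ∈ M.T) {x₁ y₁ z₁ x₂ y₂ z₂ x y z : ℤ}
    (h₁ : M.Has X Y Z x₁ y₁ z₁) (h₂ : M.Has X Y Z x₂ y₂ z₂) (i j : ℤ) (hi : 0 < i) (hj : 0 < j)
    (hx : (i + j) * x = i * x₁ + j * x₂) (hy : (i + j) * y = i * y₁ + j * y₂)
    (hz : (i + j) * z = i * z₁ + j * z₂) (hne : x₁ ≠ x ∨ y₁ ≠ y ∨ z₁ ≠ z) :
    M.Extra X Y Z x y z := by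
  obtain ⟨p, hpx, hpy, hpz, hp⟩ := h₁.combo ht h₂ i j hi.le hj.le (by omega) hx hy hz
  obtain ⟨q, rfl, rfl, rfl, hq⟩ := h₁
  obtain ⟨r, rfl, rfl, rfl, hr⟩ := h₂
  refine ⟨p, hpx, hpy, hpz, hp, fun hpV => ?_⟩
  subst hpx hpy hpz
  have key : q = p := by
    refine M.eq_of_dot_eq hpV fun a ha => ?_
    have hav := M.mem_verts.2 ⟨p, hpV, ha⟩
    have h1 := combo_aux ht hx hy hz a
    rw [M.phi_self hpV ha, mul_zero] at h1
    have h2 := mul_nonneg hi.le (hq a hav)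
    have h3 := mul_nonneg hj.le (hr a hav)
    have h4 := (mul_eq_zero.1 (by linarith : i * M.phi a q = 0)).resolve_left hi.ne'
    have := M.phi_eq hpV ha q
    linarith
  subst key
  simp at hne

theorem Has.midpoint (ht : {X, Y, Z} ∈ M.T) {x₁ y₁ z₁ x₂ y₂ z₂ : ℤ} {x y z : ℤ}
    (h₁ : M.Has X Y Z x₁ y₁ z₁) (h₂ : M.Has X Y Z x₂ y₂ z₂) (hx : 2 * x = x₁ + x₂)
    (hy : 2 * y = y₁ + y₂) (hz : 2 * z = z₁ + z₂) (hne : x₁ ≠ x ∨ y₁ ≠ y ∨ z₁ ≠ z) :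
    M.Extra X Y Z x y z :=
  h₁.extra ht h₂ 1 1 one_pos one_pos (by linarith) (by linarith) (by linarith) hne

theorem card_extra (K : Finset (ℤ × ℤ × ℤ)) (hK : ∀ k ∈ K, M.Extra X Y Z k.1 k.2.1 k.2.2) :
    M.V.card + K.card ≤ M.pts.card := by
  choose! f h1 h2 h3 h4 h5 using hK
  have hinj : Set.InjOn f K := by
    intro k hk k' hk' he
    refine Prod.ext ?_ (Prod.ext ?_ ?_)
    · rw [← h1 k hk, ← h1 k' hk', he]
    · rw [← h2 k hk, ← h2 k' hk', he]
    · rw [← h3 k hk, ← h3 k' hk', he]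
  have := M.card_add_sum_cell_add_le ∅ (by simp) (K.image f) (by
    intro p hp
    obtain ⟨k, hk, rfl⟩ := Finset.mem_image.1 hp
    exact ⟨h4 k hk, h5 k hk, by simp⟩)
  rwa [Finset.sum_empty, add_zero, Finset.card_image_of_injOn hinj] at this

theorem card_has (K : Finset (ℤ × ℤ × ℤ)) (hK : ∀ k ∈ K, M.Has X Y Z k.1 k.2.1 k.2.2) :
    K.card ≤ M.pts.card := by
  choose! f h1 h2 h3 h4 using hK
  refine Finset.card_le_card_of_injOn f (fun k hk => M.mem_pts.2 (h4 k hk)) ?_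
  intro k hk k' hk' he
  refine Prod.ext ?_ (Prod.ext ?_ ?_)
  · rw [← h1 k hk, ← h1 k' hk', he]
  · rw [← h2 k hk, ← h2 k' hk', he]
  · rw [← h3 k hk, ← h3 k' hk', he]

/-- A triangle of side three contains seven lattice points besides its vertices. -/
theorem card_of_triangle (ht : {X, Y, Z} ∈ M.T) {x : ℤ} (h₀ : M.Has X Y Z x 0 0)
    (h₁ : M.Has X Y Z x 3 0) (h₂ : M.Has X Y Z x 0 3) : M.V.card + 7 ≤ M.pts.card := by
  have e1 : M.Extra X Y Z x 1 0 := h₀.extra ht h₁ 2 1 (by norm_num) (by norm_num) (by ring)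
    (by ring) (by ring) (by norm_num)
  have e2 : M.Extra X Y Z x 2 0 := h₀.extra ht h₁ 1 2 (by norm_num) (by norm_num) (by ring)
    (by ring) (by ring) (by norm_num)
  have e3 : M.Extra X Y Z x 0 1 := h₀.extra ht h₂ 2 1 (by norm_num) (by norm_num) (by ring)
    (by ring) (by ring) (by norm_num)
  have e4 : M.Extra X Y Z x 0 2 := h₀.extra ht h₂ 1 2 (by norm_num) (by norm_num) (by ring)
    (by ring) (by ring) (by norm_num)
  have e5 : M.Extra X Y Z x 2 1 := h₁.extra ht h₂ 2 1 (by norm_num) (by norm_num) (by ring)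
    (by ring) (by ring) (by norm_num)
  have e6 : M.Extra X Y Z x 1 2 := h₁.extra ht h₂ 1 2 (by norm_num) (by norm_num) (by ring)
    (by ring) (by ring) (by norm_num)
  have e7 : M.Extra X Y Z x 1 1 := e1.has.midpoint ht e6.has (by ring) (by ring) (by ring)
    (by norm_num)
  have := card_extra (M := M) (X := X) (Y := Y) (Z := Z)
    {(x, 1, 0), (x, 2, 0), (x, 0, 1), (x, 0, 2), (x, 2, 1), (x, 1, 2), (x, 1, 1)} (by
      intro k hk
      simp only [Finset.mem_insert, Finset.mem_singleton] at hk
      rcases hk with rfl | rfl | rfl | rfl | rfl | rfl | rfl <;> assumption)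
  simpa using this

end Coordinates

end SmoothModel


namespace SmoothModel

variable {M : SmoothModel 3}

theorem triple_rot {α : Type*} [DecidableEq α] (a b c : α) : ({a, b, c} : Finset α) = {c, a, b} := by
  rw [Finset.pair_comm b c, Finset.insert_comm]

theorem triple_rev {α : Type*} [DecidableEq α] (a b c : α) : ({a, b, c} : Finset α) = {c, b, a} := by
  rw [triple_rot, Finset.pair_comm]

theorem phi_pos {v a : Fin 3 → ℤ} (hv : v ∈ M.V) (ha : a ∈ Tri.verts M.T) (h : a ∉ M.t v) :
    0 < M.phi a v :=
  lt_of_le_of_ne (M.phi_nonneg a hv) fun he => h ((M.phi_eq_zero hv ha).1 he.symm)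

theorem exists_vertex_phi {x y z : Fin 3 → ℤ} (h : {x, y, z} ∈ M.T) :
    ∃ v ∈ M.V, M.t v = {x, y, z} ∧ M.phi x v = 0 ∧ M.phi y v = 0 ∧ M.phi z v = 0 ∧
      ∀ a ∈ Tri.verts M.T, a ≠ x → a ≠ y → a ≠ z → 0 < M.phi a v := by
  obtain ⟨v, hv, ht⟩ := M.exists_vertex h
  refine ⟨v, hv, ht, M.phi_self hv (by simp [ht]), M.phi_self hv (by simp [ht]),
    M.phi_self hv (by simp [ht]), fun a ha h1 h2 h3 => phi_pos hv ha ?_⟩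
  rw [ht]
  simp [h1, h2, h3]

/-- The defect of an edge of a facet with at least five edges. -/
theorem two_le_defect {A B C E : Fin 3 → ℤ} (h : {A, B, C} ∈ M.T) (h' : {A, C, E} ∈ M.T)
    (hBE : B ≠ E) (hd : 5 ≤ Tri.deg M.T A) {b c k : ℤ}
    (hE : ∀ p, M.phi E p = c - M.phi B p + k * M.phi C p + b * M.phi A p) : 2 ≤ c + k := by
  obtain ⟨s, rfl, rfl, hs⟩ := M.exists_cycle h
  have hA := (Tri.mem_verts_of_mem h).1
  obtain ⟨Q, hF, hv, -, -⟩ := M.exists_polygon_of_deg hA hs rfl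
  have hs2 : s 2 = E := by
    refine M.next_unique (Tri.swap h) (hs.mem 1) h' ?_ hBE.symm
    intro he
    have he' : s 2 = s 0 := he
    rw [hs.eq_iff] at he'
    have := Int.le_of_dvd (by norm_num) he'
    omega
  have hr : ∀ p : {p // M.phi A p = 0}, c - Q.F 0 p + k * Q.F 1 p =
      Q.l 1 - Q.F 0 p - Q.a 1 * Q.F 1 p := by
    intro p
    have h1 := Q.recur 0 p
    rw [zero_add, zero_add, hF 2, hs2, hE, p.2, ← hF, ← hF, mul_zero, add_zero] at h1
    exact h1
  obtain ⟨p, p0, p1⟩ := Q.surj 0 0 0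
  obtain ⟨q, q0, q1⟩ := Q.surj 0 0 1
  have hp := hr p
  have hq := hr q
  rw [zero_add] at p1 q1
  rw [p0, p1] at hp
  rw [q0, q1] at hq
  have := Q.two_le_sub (by omega) 1
  linarith

/-- One end of a polytope with two adjacent hexagons. -/
theorem HexagonPair.end_eq {A B C D E₁ E₂ E₃ : Fin 3 → ℤ} (h : M.HexagonPair A B C D E₁ E₂ E₃)
    (h10 : 10 ≤ M.V.card) (h16 : M.pts.card ≤ 16) :
    ∃ q : ℤ, (∀ p, M.phi E₃ p = 1 + M.phi C p - M.phi B p - M.phi A p) ∧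
      ∀ p, M.phi E₂ p = 1 - M.phi C p + q * M.phi E₃ p := by
  have hnd := h.nodup
  simp only [List.nodup_cons, List.mem_cons, List.not_mem_nil, or_false, not_or] at hnd
  obtain ⟨⟨nAB, nAC, nAD, nA1, nA2, nA3⟩, ⟨nBC, nBD, nB1, nB2, nB3⟩, ⟨nCD, nC1, nC2, nC3⟩,
    ⟨nD1, nD2, nD3⟩, ⟨n12, n13⟩, n23, -⟩ := hnd
  have ht : {C, B, A} ∈ M.T := by rw [Finset.pair_comm]; exact Tri.rot (Tri.rot h.abc)
  obtain ⟨vA, vB, vC⟩ := Tri.mem_verts_of_mem h.abc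
  obtain ⟨-, v1, vD⟩ := Tri.mem_verts_of_mem h.a1d
  obtain ⟨-, v3, v2⟩ := Tri.mem_verts_of_mem h.a32
  obtain ⟨o, ho, hot, oA, oB, oC, opos⟩ := exists_vertex_phi h.abc
  obtain ⟨a, ha, hat, aA, aC, a3, apos⟩ := exists_vertex_phi h.ac3
  obtain ⟨b, hb, hbt, bB, bC, b3, bpos⟩ := exists_vertex_phi h.bc3
  obtain ⟨a', ha', hat', a'A, a'3, a'2, a'pos⟩ := exists_vertex_phi h.a32
  obtain ⟨b', hb', hbt', b'B, b'3, b'2, b'pos⟩ := exists_vertex_phi h.b32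
  obtain ⟨m, hm, hmt, mA, m2, m1, mpos⟩ := exists_vertex_phi h.a21
  obtain ⟨n, hn, hnt, nA', n1, nD, npos⟩ := exists_vertex_phi h.a1d
  obtain ⟨w, hw, hwt, wA, wB, wD, wpos⟩ := exists_vertex_phi h.abd
  obtain ⟨p0, p0C, p0B, p0A⟩ := M.exists_point ht 0 0 0
  obtain ⟨pC, pCC, pCB, pCA⟩ := M.exists_point ht 1 0 0
  obtain ⟨pB, pBC, pBB, pBA⟩ := M.exists_point ht 0 1 0
  obtain ⟨pA, pAC, pAB, pAA⟩ := M.exists_point ht 0 0 1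
  obtain ⟨β, k, hE, -, -, -⟩ := M.wall ho ha (hot.trans (Finset.insert_comm _ _ _))
    (hat.trans (triple_rot _ _ _)) nB3
  obtain ⟨β', k', hE', -, -, -⟩ := M.wall ho hb hot (hbt.trans (triple_rot _ _ _)) nA3
  set c := M.phi B a with hc
  have e0 := (hE p0).symm.trans (hE' p0)
  have eC := (hE pC).symm.trans (hE' pC)
  have eB := (hE pB).symm.trans (hE' pB)
  have eA := (hE pA).symm.trans (hE' pA)
  simp only [p0C, p0B, p0A, pCC, pCB, pCA, pBC, pBB, pBA, pAC, pAB, pAA] at e0 eC eB eA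
  have hcA : M.phi A b = c := by linarith
  -- The relations across the edges `A C` and `B C` describe the same function; comparing them makes
  -- the coefficients of `A` and `B` both `-1`.
  have hE3 : ∀ p, M.phi E₃ p = c - M.phi B p + k * M.phi C p + -1 * M.phi A p := by
    intro p
    rw [hE, show β = -1 by linarith]; ring
  have hM := two_le_defect h.abc h.ac3 nB3 (by rw [h.deg]; norm_num) hE3
  have hc1 : 0 < c := apos B vB (Ne.symm nAB) nBC nB3
  set g := M.phi C a' with hg
  set g' := M.phi C b' with hg'
  have hgpos : 0 < g := a'pos C vC (Ne.symm nAC) nC3 nC2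
  have hgpos' : 0 < g' := b'pos C vC (Ne.symm nBC) nC3 nC2
  have a'B : M.phi B a' = c + k * g := by have := hE3 a'; rw [a'3, a'A] at this; linarith
  have b'A : M.phi A b' = c + k * g' := by have := hE3 b'; rw [b'3, b'B] at this; linarith
  have Ho : M.Has C B A 0 0 0 := has_of_mem ho oC oB oA
  have Ha : M.Has C B A 0 c 0 := has_of_mem ha aC rfl aA
  have Hb : M.Has C B A 0 0 c := has_of_mem hb bC bB hcA
  have Ha' : M.Has C B A g (c + k * g) 0 := has_of_mem ha' rfl a'B a'A
  have Hb' : M.Has C B A g' 0 (c + k * g') := has_of_mem hb' rfl b'B b'A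
  have Hw : M.Has C B A (M.phi C w) 0 0 := has_of_mem hw rfl wB wA
  have hwC : 0 < M.phi C w := wpos C vC (Ne.symm nAC) (Ne.symm nBC) nCD
  have H1 : M.Has C B A 1 0 0 := Ho.combo ht Hw (M.phi C w - 1) 1 (by omega) (by omega) (by omega)
    (by ring) (by ring) (by ring)
  have H1a : M.Has C B A 1 (c + k) 0 := Ha.combo ht Ha' (g - 1) 1 (by omega) (by omega) (by omega)
    (by ring) (by ring) (by ring)
  have H1b : M.Has C B A 1 0 (c + k) := Hb.combo ht Hb' (g' - 1) 1 (by omega) (by omega) (by omega)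
    (by ring) (by ring) (by ring)
  have shrink : ∀ {x d : ℤ}, 3 ≤ d → M.Has C B A x 0 0 → M.Has C B A x d 0 → M.Has C B A x 0 d →
      False := by
    intro x d hd h0 h1 h2
    have k1 : M.Has C B A x 3 0 := h0.combo ht h1 (d - 3) 3 (by omega) (by omega) (by omega)
      (by ring) (by ring) (by ring)
    have k2 : M.Has C B A x 0 3 := h0.combo ht h2 (d - 3) 3 (by omega) (by omega) (by omega)
      (by ring) (by ring) (by ring)
    have := card_of_triangle ht h0 k1 k2
    omega
  -- The sections `C = 0` and `C = 1` contain triangles of sides `c` and `c + k`. A side of at least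
  -- three would give seven points besides the ten vertices. The lower bound for `c + k` comes from
  -- the hexagon `A`.
  have hM2 : c + k = 2 := by
    by_contra hne
    exact shrink (by omega) H1 H1a H1b
  have hc2 : c ≤ 2 := by
    by_contra hlt
    exact shrink (by omega) Ho Ha Hb
  -- Otherwise `E₃ = 2 - B - A`, and the vertices `m` and `n` of the edge `A ∩ E₁` both have `B =
  -- 1`. So `E₁` does not depend on `C`; it vanishes at `B = 1`, is positive at `B = 0`, and would
  -- be negative at `a`, where `B = 2`.
  have hc' : c = 1 := by
    by_contra hne
    have hceq : c = 2 := by omega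
    have hk : k = 0 := by omega
    rw [hceq, hk] at hE3
    have mB : M.phi B m = 1 := by
      have h1 := hE3 m
      have h2 := mpos B vB (Ne.symm nAB) nB2 nB1
      have h3 := mpos E₃ v3 (Ne.symm nA3) (Ne.symm n23) (Ne.symm n13)
      rw [mA] at h1
      omega
    have nB : M.phi B n = 1 := by
      have h1 := hE3 n
      have h2 := npos B vB (Ne.symm nAB) nB1 nBD
      have h3 := npos E₃ v3 (Ne.symm nA3) (Ne.symm n13) (Ne.symm nD3)
      rw [nA'] at h1
      omega
    have hmn : M.phi C m ≠ M.phi C n := by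
      intro he
      have := M.point_ext ht he (mB.trans nB.symm) (mA.trans nA'.symm)
      have h2 := mpos D vD (Ne.symm nAD) nD2 nD1
      rw [this, nD] at h2
      exact lt_irrefl _ h2
    obtain ⟨α, β, γ, d, hE1, -⟩ := M.exists_affine ht E₁
    have k1 := hE1 m
    have k2 := hE1 n
    rw [m1, mB, mA] at k1
    rw [n1, nB, nA'] at k2
    have hα : α = 0 := by
      have : α * (M.phi C m - M.phi C n) = 0 := by linarith
      exact (mul_eq_zero.1 this).resolve_right (sub_ne_zero.2 hmn)
    rw [hα] at k1 hE1
    have k3 := hE1 o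
    have k4 := hE1 a
    rw [oC, oB, oA] at k3
    rw [← hc, aC, aA, hceq] at k4
    have h1 := opos E₁ v1 (Ne.symm nA1) (Ne.symm nB1) (Ne.symm nC1)
    have h2 := M.phi_nonneg E₁ ha
    omega
  have hk : k = 1 := by omega
  rw [hc', hk] at hE3 H1a H1b Ha' Hb'
  rw [hc'] at Ha Hb
  -- `E₂` is computed across the two edges of `E₃` that carry `C`-values up to `g` and `g'`.
  -- Comparison gives `g = g'` and removes the coefficient of `A`.
  obtain ⟨r, q, hE2, -, -, -⟩ := M.wall (x := C) (y := A) (z := E₃) ha ha'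
    (hat.trans (Finset.insert_comm _ _ _))
    (hat'.trans (triple_rot _ _ _)) nC2
  obtain ⟨r', q', hE2', -, -, -⟩ := M.wall (x := C) (y := B) (z := E₃) hb hb'
    (hbt.trans (Finset.insert_comm _ _ _))
    (hbt'.trans (triple_rot _ _ _)) nC2
  have f0 := (hE2 p0).symm.trans (hE2' p0)
  have fC := (hE2 pC).symm.trans (hE2' pC)
  have fA := (hE2 pA).symm.trans (hE2' pA)
  simp only [hE3, p0C, p0B, p0A, pCC, pCB, pCA, pAC, pAB, pAA] at f0 fC fA
  have hgg : g = g' := by linarith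
  have hr : r = 0 := by linarith
  -- For `g ≥ 2` the points `(2, 3, 0)` and `(2, 0, 3)` belong to the polytope, and with the
  -- triangle below they produce seven lattice points that are not vertices.
  have hg1 : g = 1 := by
    by_contra hne
    rw [← hgg] at Hb'
    have H2a : M.Has C B A 2 3 0 := Ha.combo ht Ha' (g - 2) 2 (by omega) (by omega) (by omega)
      (by ring) (by ring) (by ring)
    have H2b : M.Has C B A 2 0 3 := Hb.combo ht Hb' (g - 2) 2 (by omega) (by omega) (by omega)
      (by ring) (by ring) (by ring)
    have e1 := Ha.midpoint ht H2a (x := 1) (y := 2) (z := 0) (by norm_num) (by norm_num)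
      (by norm_num) (by norm_num)
    have e2 := Hb.midpoint ht H2b (x := 1) (y := 0) (z := 2) (by norm_num) (by norm_num)
      (by norm_num) (by norm_num)
    have e3 := e1.has.midpoint ht e2.has (x := 1) (y := 1) (z := 1) (by norm_num) (by norm_num)
      (by norm_num) (by norm_num)
    have e4 := e1.has.midpoint ht H1 (x := 1) (y := 1) (z := 0) (by norm_num) (by norm_num)
      (by norm_num) (by norm_num)
    have e5 := e2.has.midpoint ht H1 (x := 1) (y := 0) (z := 1) (by norm_num) (by norm_num)
      (by norm_num) (by norm_num)
    have e6 := H2a.extra ht H2b 2 1 (x := 2) (y := 2) (z := 1) (by norm_num) (by norm_num)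
      (by norm_num) (by norm_num) (by norm_num) (by norm_num)
    have e7 := H2a.extra ht H2b 1 2 (x := 2) (y := 1) (z := 2) (by norm_num) (by norm_num)
      (by norm_num) (by norm_num) (by norm_num) (by norm_num)
    have := card_extra (M := M) (X := C) (Y := B) (Z := A)
      {(1, 2, 0), (1, 0, 2), (1, 1, 1), (1, 1, 0), (1, 0, 1), (2, 2, 1), (2, 1, 2)} (by
        intro k hk
        simp only [Finset.mem_insert, Finset.mem_singleton] at hk
        rcases hk with rfl | rfl | rfl | rfl | rfl | rfl | rfl <;> assumption)
    simp at this
    omega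
  refine ⟨q, fun p => by rw [hE3]; ring, fun p => ?_⟩
  rw [hE2, hr, ← hg, hg1]
  ring

/-- The equations of a polytope with two adjacent hexagons and few lattice points. -/
theorem HexagonPair.equations {A B C D E₁ E₂ E₃ : Fin 3 → ℤ} (h : M.HexagonPair A B C D E₁ E₂ E₃)
    (h10 : 10 ≤ M.V.card) (h16 : M.pts.card ≤ 16) :
    (∀ p, M.phi E₃ p = 1 + M.phi C p - M.phi B p - M.phi A p) ∧
    (∀ p, M.phi E₂ p = 2 - M.phi B p - M.phi A p) ∧
    (∀ p, M.phi E₁ p = 2 - M.phi C p) ∧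
    (∀ p, M.phi D p = 1 - M.phi C p + M.phi B p + M.phi A p) := by
  obtain ⟨q, h3, h2⟩ := h.end_eq h10 h16
  obtain ⟨q', h1, h2'⟩ := h.symm.end_eq h10 h16
  have hnd := h.nodup
  simp only [List.nodup_cons, List.mem_cons, List.not_mem_nil, or_false, not_or] at hnd
  obtain ⟨⟨nAB, nAC, nAD, nA1, nA2, nA3⟩, ⟨nBC, nBD, nB1, nB2, nB3⟩, ⟨nCD, nC1, nC2, nC3⟩,
    ⟨nD1, nD2, nD3⟩, ⟨n12, n13⟩, n23, -⟩ := hnd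
  have ht : {C, B, A} ∈ M.T := by rw [Finset.pair_comm]; exact Tri.rot (Tri.rot h.abc)
  obtain ⟨vA, vB, vC⟩ := Tri.mem_verts_of_mem h.abc
  obtain ⟨-, v1, vD⟩ := Tri.mem_verts_of_mem h.a1d
  obtain ⟨-, v3, v2⟩ := Tri.mem_verts_of_mem h.a32
  obtain ⟨o, ho, hot, oA, oB, oC, opos⟩ := exists_vertex_phi h.abc
  obtain ⟨w, hw, hwt, wA, wB, wD, wpos⟩ := exists_vertex_phi h.abd
  obtain ⟨β, α, hD, -, -, -⟩ := M.wall (x := C) (x' := D) (y := B) (z := A) ho hw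
    (hot.trans (triple_rev _ _ _))
    (hwt.trans (triple_rev _ _ _)) nCD
  set l := M.phi C w with hl
  have hl0 : 0 < l := wpos C vC (Ne.symm nAC) (Ne.symm nBC) nCD
  obtain ⟨p0, p0C, p0B, p0A⟩ := M.exists_point ht 0 0 0
  obtain ⟨pC, pCC, pCB, pCA⟩ := M.exists_point ht 1 0 0
  have e0 := (h2 p0).symm.trans (h2' p0)
  have eC := (h2 pC).symm.trans (h2' pC)
  simp only [h3, h1, hD, p0C, p0B, p0A, pCC, pCB, pCA] at e0 eC
  -- `E₂` has been expressed from both ends. Eliminating `q` between the two expressions at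
  -- `(0,0,0)` and `(1,0,0)` leaves `(l + 2) (q' - 1) = 0`.
  have hq : q' = 1 := by
    have : (l + 2) * (q' - 1) = 0 := by linarith
    rcases mul_eq_zero.1 this with h | h <;> omega
  have hq1 : q = 1 := by rw [hq] at eC; linarith
  have h1' : ∀ p, M.phi E₁ p = 1 + (l - M.phi C p + β * M.phi B p + α * M.phi A p) - M.phi B p -
      M.phi A p := fun p => by rw [h1, hD]
  have h2'' : ∀ p, M.phi E₂ p = 2 - M.phi B p - M.phi A p := fun p => by
    rw [h2, h3, hq1]; ring
  obtain ⟨a, ha, -, aA, aC, a3, apos⟩ := exists_vertex_phi h.ac3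
  obtain ⟨b, hb, -, bB, bC, b3, bpos⟩ := exists_vertex_phi h.bc3
  obtain ⟨a', ha', -, a'A, a'3, a'2, a'pos⟩ := exists_vertex_phi h.a32
  obtain ⟨b', hb', -, b'B, b'3, b'2, b'pos⟩ := exists_vertex_phi h.b32
  have hβ : 3 ≤ l + 2 * β := by
    have k1 := h3 a'
    have k2 := h2'' a'
    have k3 := h1' a'
    have k4 := a'pos E₁ v1 (Ne.symm nA1) n13 n12
    rw [a'3, a'A] at k1
    rw [a'2, a'A] at k2
    rw [a'A, show M.phi C a' = 1 by linarith, show M.phi B a' = 2 by linarith] at k3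
    linarith
  have hα : 3 ≤ l + 2 * α := by
    have k1 := h3 b'
    have k2 := h2'' b'
    have k3 := h1' b'
    have k4 := b'pos E₁ v1 (Ne.symm nB1) n13 n12
    rw [b'3, b'B] at k1
    rw [b'2, b'B] at k2
    rw [b'B, show M.phi C b' = 1 by linarith, show M.phi A b' = 2 by linarith] at k3
    linarith
  have hverts : ∀ r ∈ Tri.verts M.T, r = A ∨ r = B ∨ r = C ∨ r = D ∨ r = E₁ ∨ r = E₂ ∨ r = E₃ := by
    intro r hr
    obtain ⟨t, htT, hrt⟩ := Tri.mem_verts.1 hr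
    obtain ⟨P, hP, hc⟩ := h.all t htT
    simp only [Finset.mem_insert, Finset.mem_singleton] at hP
    rcases hc with rfl | rfl | rfl | rfl | rfl | rfl <;>
      simp only [Finset.mem_insert, Finset.mem_singleton] at hrt <;> grind
  have hHas : ∀ x y z : ℤ, 0 ≤ x → 0 ≤ y → 0 ≤ z → 0 ≤ 1 + x - y - z → 0 ≤ 2 - y - z →
      0 ≤ l - x + β * y + α * z → 0 ≤ 1 + (l - x + β * y + α * z) - y - z → M.Has C B A x y z := by
    intro x y z hx hy hz k3 k2 kD k1
    obtain ⟨p, rfl, rfl, rfl⟩ := M.exists_point ht x y z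
    refine ⟨p, rfl, rfl, rfl, fun r hr => ?_⟩
    rcases hverts r hr with rfl | rfl | rfl | rfl | rfl | rfl | rfl
    · exact hz
    · exact hy
    · exact hx
    · rw [hD]; exact kD
    · rw [h1']; exact k1
    · rw [h2'']; exact k2
    · rw [h3]; exact k3
  -- The lattice points are counted in six columns parallel to the `C`-axis, over the points of the
  -- triangle `y + z ≤ 2`. The constant terms of the column sizes cancel.
  have hcount : 6 * l + 4 * α + 4 * β ≤ 16 := by
    have col : ∀ (y z a b : ℤ), (∀ x, a ≤ x → x ≤ b → M.Has C B A x y z) →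
        ∀ k ∈ (Finset.Icc a b).image fun x => (x, y, z), M.Has C B A k.1 k.2.1 k.2.2 := by
      intro y z a b hx k hk
      obtain ⟨x, hxm, rfl⟩ := Finset.mem_image.1 hk
      rw [Finset.mem_Icc] at hxm
      exact hx x hxm.1 hxm.2
    have colcard : ∀ (y z a b : ℤ), b + 1 - a ≤
        (((Finset.Icc a b).image fun x => (x, y, z)).card : ℤ) := by
      intro y z a b
      rw [Finset.card_image_of_injective _ fun x x' h => congrArg Prod.fst h, Int.card_Icc]
      exact Int.self_le_toNat _
    have disj : ∀ {y z a b y' z' a' b' : ℤ}, (y ≠ y' ∨ z ≠ z') →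
        Disjoint ((Finset.Icc a b).image fun x => (x, y, z))
          ((Finset.Icc a' b').image fun x => (x, y', z')) := by
      intro y z a b y' z' a' b' hne
      rw [Finset.disjoint_left]
      intro k hk hk'
      obtain ⟨x, -, rfl⟩ := Finset.mem_image.1 hk
      obtain ⟨x', -, he⟩ := Finset.mem_image.1 hk'
      simp only [Prod.mk.injEq] at he
      omega
    have c1 := col 0 0 0 l fun x ha hb => hHas x 0 0 (by omega) (by omega) (by omega) (by omega)
      (by omega) (by omega) (by omega)
    have c2 := col 1 0 0 (l + β) fun x ha hb => hHas x 1 0 (by omega) (by omega) (by omega)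
      (by omega) (by omega) (by omega) (by omega)
    have c3 := col 0 1 0 (l + α) fun x ha hb => hHas x 0 1 (by omega) (by omega) (by omega)
      (by omega) (by omega) (by omega) (by omega)
    have c4 := col 2 0 1 (l + 2 * β - 1) fun x ha hb => hHas x 2 0 (by omega) (by omega) (by omega)
      (by omega) (by omega) (by omega) (by omega)
    have c5 := col 0 2 1 (l + 2 * α - 1) fun x ha hb => hHas x 0 2 (by omega) (by omega) (by omega)
      (by omega) (by omega) (by omega) (by omega)
    have c6 := col 1 1 1 (l + α + β - 1) fun x ha hb => hHas x 1 1 (by omega) (by omega)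
      (by omega) (by omega) (by omega) (by omega) (by omega)
    have d1 := colcard 0 0 0 l
    have d2 := colcard 1 0 0 (l + β)
    have d3 := colcard 0 1 0 (l + α)
    have d4 := colcard 2 0 1 (l + 2 * β - 1)
    have d5 := colcard 0 2 1 (l + 2 * α - 1)
    have d6 := colcard 1 1 1 (l + α + β - 1)
    have hK := card_has (M := M) (X := C) (Y := B) (Z := A) _ (Finset.forall_mem_union.2 ⟨c1,
      Finset.forall_mem_union.2 ⟨c2, Finset.forall_mem_union.2 ⟨c3,
      Finset.forall_mem_union.2 ⟨c4, Finset.forall_mem_union.2 ⟨c5, c6⟩⟩⟩⟩⟩)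
    rw [Finset.card_union_of_disjoint, Finset.card_union_of_disjoint, Finset.card_union_of_disjoint,
      Finset.card_union_of_disjoint, Finset.card_union_of_disjoint] at hK
    · omega
    all_goals
      try simp only [Finset.disjoint_union_right]
      repeat' apply And.intro
      all_goals exact disj (by norm_num)
  -- The count gives `l ≤ 2` by means of `l + 2α ≥ 3` and `l + 2β ≥ 3`. For `l = 2` integrality
  -- makes `α, β ≥ 1` and the count twenty; for `l = 1` it leaves `α = β = 1`.
  have hl1 : l = 1 := by omega
  refine ⟨h3, h2'', fun p => ?_, fun p => ?_⟩
  · rw [h1', hl1, show β = 1 by omega, show α = 1 by omega]; ring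
  · rw [hD, hl1, show β = 1 by omega, show α = 1 by omega]; ring

end SmoothModel


/-! ### Polytopes given by explicit inequalities -/

section Inequalities

/-- The vectors of `N` at which the bound `c` is attained. -/
def activeAt {n : ℕ} (N : Finset (Fin n → ℤ)) (c : (Fin n → ℤ) → ℤ) (v : Fin n → ℤ) :
    Finset (Fin n → ℤ) := N.filter fun a => a ⬝ᵥ v = c a

/-- All conditions are finite checks, which lets explicit examples be decided by computation: the
edge directions are searched in `box` and the edge lengths among `1, 2, 3`. -/
theorem SmoothModel.exists_of_inequalities {n : ℕ} (N V : Finset (Fin n → ℤ))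
    (c : (Fin n → ℤ) → ℤ) (box : Finset (Fin n → ℤ)) (hne : V.Nonempty)
    (h1 : ∀ v ∈ V, ∀ a ∈ N, c a ≤ a ⬝ᵥ v) (h2 : ∀ v ∈ V, (activeAt N c v).card = n)
    (h3 : ∀ v ∈ V, ∀ a ∈ activeAt N c v, ∃ e ∈ box, a ⬝ᵥ e = 1 ∧
      (∀ b ∈ activeAt N c v, b ≠ a → b ⬝ᵥ e = 0) ∧ ∃ k ∈ Finset.Icc (1 : ℤ) 3, v + k • e ∈ V) :
    ∃ M : SmoothModel n, M.V = V ∧ M.t = activeAt N c := by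
  choose! E hE using h3
  refine ⟨⟨V, activeAt N c, E, hne, fun v hv => ⟨h2 v hv, fun a ha b hb => ?_⟩, ?_, ?_⟩, rfl, rfl⟩
  · split_ifs with hba
    · rw [hba]; exact (hE v hv a ha).2.1
    · exact (hE v hv a ha).2.2.1 b hb hba
  · intro v hv a ha w hw
    obtain ⟨ha, hav⟩ := Finset.mem_filter.1 ha
    rw [hav]
    exact h1 w hw a ha
  · intro v hv a ha
    obtain ⟨k, hk, hw⟩ := (hE v hv a ha).2.2.2
    exact ⟨k, by linarith [(Finset.mem_Icc.1 hk).1], hw⟩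

theorem SmoothModel.mem_body_iff_active {n : ℕ} (M : SmoothModel n) {N : Finset (Fin n → ℤ)}
    {c : (Fin n → ℤ) → ℤ} (ht : M.t = activeAt N c) (hN : ∀ a ∈ N, ∃ v ∈ M.V, a ⬝ᵥ v = c a)
    (x : Fin n → ℝ) : x ∈ M.body ↔ ∀ a ∈ N, (c a : ℝ) ≤ latticePt a ⬝ᵥ x := by
  rw [M.mem_body_iff]
  constructor
  · intro h a ha
    obtain ⟨v, hv, hav⟩ := hN a ha
    have := h v hv a (by rw [ht]; exact Finset.mem_filter.2 ⟨ha, hav⟩)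
    rwa [latticePt_dot, hav] at this
  · intro h v hv a ha
    rw [ht] at ha
    obtain ⟨ha, hav⟩ := Finset.mem_filter.1 ha
    rw [latticePt_dot, hav]
    exact h a ha

end Inequalities

section Examples

/-- The bounds for the facet normals of the polytopes below. -/
def facetBound (a : Fin 3 → ℤ) : ℤ := if a 0 = 0 then a 1 * a 2 * (-2) else a 1 + (a 0 - 1)

/-- Edge directions. -/
def unitBox : Finset (Fin 3 → ℤ) :=
  {![1, 0, 0], ![0, 1, 0], ![0, 0, 1], ![-1, 0, 0], ![0, -1, 0], ![0, 0, -1], ![-1, 1, 0],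
    ![-1, 0, 1], ![1, -1, 0], ![1, 0, -1], ![0, 1, -1], ![0, -1, 1], ![1, 1, 0], ![1, 0, 1],
    ![-1, -1, 0], ![-1, 0, -1]}

/-- With `facetBound` these normals describe `x, y, z ≥ 0`, `y + z ≤ 2`, `x + y + z ≤ 3`, a copy of
`Cay²(3Δ₁, Δ₁, Δ₁)`. -/
def prismNormals : Finset (Fin 3 → ℤ) :=
  {![1, 0, 0], ![0, 1, 0], ![0, 0, 1], ![0, -1, -1], ![-1, -1, -1]}

def prismVertices : Finset (Fin 3 → ℤ) :=
  {![0, 0, 0], ![3, 0, 0], ![0, 2, 0], ![1, 2, 0], ![0, 0, 2], ![1, 0, 2]}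

/-- The corner at the origin is cut off by `x + y + z ≥ 1`. -/
def blowUpVertices : Finset (Fin 3 → ℤ) :=
  {![1, 0, 0], ![0, 1, 0], ![0, 0, 1], ![3, 0, 0], ![0, 2, 0], ![1, 2, 0], ![0, 0, 2], ![1, 0, 2]}

/-- The corner `(3, 0, 0)` is cut off as well, by `x ≤ 2`; the normal `(-1, 0, 0)` is the sum of the
three normals there. -/
def doubleBlowUpVertices : Finset (Fin 3 → ℤ) :=
  {![1, 0, 0], ![0, 1, 0], ![0, 0, 1], ![2, 0, 0], ![2, 1, 0], ![2, 0, 1], ![0, 2, 0], ![1, 2, 0],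
    ![0, 0, 2], ![1, 0, 2]}

theorem exists_prism : ∃ M : SmoothModel 3, M.V = prismVertices ∧
    M.t = activeAt prismNormals facetBound := by
  apply SmoothModel.exists_of_inequalities prismNormals prismVertices facetBound unitBox
  · exact ⟨_, Finset.mem_insert_self _ _⟩
  · decide +kernel
  · decide +kernel
  · decide +kernel

theorem exists_blowUp : ∃ M : SmoothModel 3, M.V = blowUpVertices ∧
    M.t = activeAt (insert ![1, 1, 1] prismNormals) facetBound := by
  apply SmoothModel.exists_of_inequalities (insert ![1, 1, 1] prismNormals) blowUpVertices facetBound unitBox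
  · exact ⟨_, Finset.mem_insert_self _ _⟩
  · decide +kernel
  · decide +kernel
  · decide +kernel

theorem exists_doubleBlowUp : ∃ M : SmoothModel 3, M.V = doubleBlowUpVertices ∧
    M.t = activeAt (insert ![-1, 0, 0] (insert ![1, 1, 1] prismNormals)) facetBound := by
  apply SmoothModel.exists_of_inequalities
    (insert ![-1, 0, 0] (insert ![1, 1, 1] prismNormals)) doubleBlowUpVertices facetBound unitBox
  · exact ⟨_, Finset.mem_insert_self _ _⟩
  · decide +kernel
  · decide +kernel
  · decide +kernel

end Examples


/-! ### Blow-ups at vertices -/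

section VertexBlowUp

variable {n : ℕ}

theorem IsDual.exists_isUnimodularBasis {t : Finset (Fin n → ℤ)} {E : (Fin n → ℤ) → Fin n → ℤ}
    (h : IsDual t E) : ∃ x : Fin n → Fin n → ℤ, IsUnimodularBasis (coneOver t) x ∧
      ∑ i, x i = ∑ b ∈ t, b := by
  let e : Fin n ≃ t := (Finset.equivFinOfCardEq h.card).symm
  have hsum : ∀ {β : Type} [AddCommMonoid β] (f : (Fin n → ℤ) → β),
      ∑ i, f (e i) = ∑ b ∈ t, f b := fun f => by
    rw [← Finset.sum_coe_sort t f]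
    exact Equiv.sum_comp e fun a : t => f a
  have key : ∀ (c : Fin n → ℝ) j, (∑ i, c i • latticePt (e i : Fin n → ℤ)) ⬝ᵥ
      latticePt (E (e j)) = c j := by
    intro c j
    rw [sum_dotProduct, Finset.sum_eq_single j]
    · rw [smul_dotProduct, latticePt_dot, h.dot_self (e j).2]; simp
    · intro i _ hij
      rw [smul_dotProduct, latticePt_dot, h.dot_ne (e j).2 (e i).2
        fun he => hij (e.injective (Subtype.ext he))]
      simp
    · simp
  refine ⟨fun i => e i, ⟨?_, ?_, ?_⟩, hsum fun b => b⟩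
  · rw [Fintype.linearIndependent_iff]
    intro c hc j
    rw [← key c j, hc, zero_dotProduct]
  · ext u
    rw [h.mem_coneOver_iff (subset_refl t)]
    constructor
    · rintro ⟨h1, -⟩
      refine ⟨fun i => u ⬝ᵥ latticePt (E (e i)), fun i => h1 _ (e i).2, ?_⟩
      rw [hsum fun a => (u ⬝ᵥ latticePt (E a)) • latticePt a]
      exact h.expand_dual_real u
    · rintro ⟨c, hc, rfl⟩
      refine ⟨fun a ha => ?_, fun a ha hna => absurd ha hna⟩
      have := key c (e.symm ⟨a, ha⟩)
      rw [Equiv.apply_symm_apply] at this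
      rw [this]
      exact hc _
  · intro z hz
    have h1 := ((h.mem_coneOver_iff (subset_refl t) _).1 hz).1
    refine ⟨fun i => (z ⬝ᵥ E (e i)).toNat, ?_⟩
    have h2 : ∀ i, ((z ⬝ᵥ E (e i)).toNat : ℤ) = z ⬝ᵥ E (e i) := fun i => by
      have := h1 _ (e i).2
      rw [latticePt_dot] at this
      exact Int.toNat_of_nonneg (by exact_mod_cast this)
    rw [Finset.sum_congr rfl fun i _ => (by rw [← natCast_zsmul, h2] :
      (z ⬝ᵥ E (e i)).toNat • (e i : Fin n → ℤ) = (z ⬝ᵥ E (e i)) • (e i : Fin n → ℤ)),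
      hsum fun a => (z ⬝ᵥ E a) • a]
    exact h.expand_dual z

namespace SmoothModel

variable (M : SmoothModel n)

/-- The sum of the normals at `v` is smallest only where each of them is, and together they
determine the point. -/
theorem eq_of_sum_dot_le {v : Fin n → ℤ} (hv : v ∈ M.V) {x : Fin n → ℝ} (hx : x ∈ M.body)
    (h : latticePt (∑ b ∈ M.t v, b) ⬝ᵥ x ≤ latticePt (∑ b ∈ M.t v, b) ⬝ᵥ latticePt v) :
    x = latticePt v := by
  have hle : ∀ a ∈ M.t v, latticePt a ⬝ᵥ latticePt v ≤ latticePt a ⬝ᵥ x :=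
    fun a ha => M.le_body hv ha hx
  rw [latticePt_sum, sum_dotProduct, sum_dotProduct] at h
  have h1 := (Finset.sum_eq_sum_iff_of_le hle).1 (le_antisymm (Finset.sum_le_sum hle) h)
  funext i
  have h2 := M.dot_sub_eq hv (Pi.single i 1) x
  rw [Finset.sum_eq_zero fun a ha => by rw [h1 a ha, sub_self, mul_zero], single_one_dotProduct,
    single_one_dotProduct] at h2
  linarith

theorem singleton_eq_face {v : Fin n → ℤ} (hv : v ∈ M.V) : {latticePt v} = {x ∈ M.body |
    ∀ y ∈ M.body, latticePt (∑ b ∈ M.t v, b) ⬝ᵥ x ≤ latticePt (∑ b ∈ M.t v, b) ⬝ᵥ y} := by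
  ext x
  rw [Set.mem_singleton_iff]
  constructor
  · rintro rfl
    refine ⟨M.mem_body hv, fun y hy => ?_⟩
    rw [latticePt_sum, sum_dotProduct, sum_dotProduct]
    exact Finset.sum_le_sum fun a ha => M.le_body hv ha hy
  · rintro ⟨hx, h⟩
    exact M.eq_of_sum_dot_le hv hx (h _ (M.mem_body hv))

theorem mem_extremePoints {v : Fin n → ℤ} (hv : v ∈ M.V) :
    latticePt v ∈ M.body.extremePoints ℝ := by
  rw [_root_.mem_extremePoints]
  have key : ∀ x ∈ M.body, ∀ y ∈ M.body, latticePt v ∈ openSegment ℝ x y → x = latticePt v := by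
    rintro x hx y hy ⟨a, b, ha, hb, hab, he⟩
    set u := latticePt (∑ b ∈ M.t v, b) with hu
    have hmin : ∀ z ∈ M.body, u ⬝ᵥ latticePt v ≤ u ⬝ᵥ z := by
      have : latticePt v ∈ ({latticePt v} : Set (Fin n → ℝ)) := rfl
      rw [M.singleton_eq_face hv] at this
      exact this.2
    refine M.eq_of_sum_dot_le hv hx ?_
    have h1 := hmin y hy
    have h2 : u ⬝ᵥ latticePt v = a * (u ⬝ᵥ x) + b * (u ⬝ᵥ y) := by
      rw [← he, dotProduct_add, dotProduct_smul, dotProduct_smul, smul_eq_mul, smul_eq_mul]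
    obtain rfl : b = 1 - a := by linarith
    have h3 := mul_le_mul_of_nonneg_left h1 hb.le
    exact le_of_mul_le_mul_left (by linarith) ha
  refine ⟨M.mem_body hv, fun x hx y hy h => ?_⟩
  exact ⟨key x hx y hy h, key y hy x hx (by rwa [openSegment_symm])⟩

/-- The blow-up at a vertex. -/
theorem isBlowUpAt_vertex (M' : SmoothModel n) {v : Fin n → ℤ} (hv : v ∈ M.V) (hn : 2 ≤ n) {k : ℕ}
    (hk : 1 ≤ k) (hT : M'.T = Tri.starSub M.T (M.t v) (∑ b ∈ M.t v, b))
    (hbody : ∀ x, x ∈ M'.body ↔ x ∈ M.body ∧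
      latticePt (∑ b ∈ M.t v, b) ⬝ᵥ latticePt v + k ≤ latticePt (∑ b ∈ M.t v, b) ⬝ᵥ x) :
    IsBlowUpAt M.body {latticePt v} k M'.body := by
  have hcone : normalCone M.body {latticePt v} = coneOver (M.t v) := by
    rw [M.singleton_eq_face hv]
    refine (M.normalCone_face hv (subset_refl _) (fun a ha => ?_) fun a ha hna =>
      absurd ha hna).2
    rw [latticePt_dot, sum_dotProduct, Finset.sum_congr rfl fun b hb =>
      (M.dual v hv).dot a ha b hb, Finset.sum_ite_eq', if_pos ha]
    norm_num
  obtain ⟨x, hx, hsum⟩ := (M.dual v hv).exists_isUnimodularBasis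
  refine ⟨⟨⟨_, rfl⟩, _, M.singleton_eq_face hv⟩, hk, n, x, hn, by rwa [hcone], ?_, ?_⟩
  · ext y
    rw [hsum, hbody]
    simp
  · rw [hcone, hsum]
    have h1 := M.isFanModel.stellar (M.t_mem_T hv) (subset_refl _)
      (by rw [(M.dual v hv).card]; exact hn)
    have h2 := M'.isFanModel
    rw [h1.eq, h2.eq]
    have : M'.V.image M'.t = Tri.starSub (M.V.image M.t) (M.t v) (∑ b ∈ M.t v, b) := hT
    rw [this]

end SmoothModel

end VertexBlowUp


/-! ### The exceptional polytope -/

section TwoVertexBlowUp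

theorem dilatedSimplex_one (m : ℕ) :
    dilatedSimplex 1 m = convexHull ℝ {fun _ => (0 : ℝ), fun _ => (m : ℝ)} := by
  unfold dilatedSimplex
  congr 1
  ext x
  simp only [Set.mem_insert_iff, Set.mem_range, Set.mem_singleton_iff]
  constructor
  · rintro (rfl | ⟨i, rfl⟩)
    · exact Or.inl rfl
    · right; funext j; rw [Subsingleton.elim j i, Pi.single_eq_same]
  · rintro (rfl | rfl)
    · exact Or.inl rfl
    · right; exact ⟨0, by funext j; rw [Subsingleton.elim j 0, Pi.single_eq_same]⟩

theorem append_cayleyVertex (i : Fin 3) (c : ℝ) :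
    (Fin.append (fun _ : Fin 1 => c) (((2 : ℕ) : ℝ) • cayleyVertex (k := 2) i) : Fin 3 → ℝ) =
      ![c, if i = 1 then 2 else 0, if i = 2 then 2 else 0] := by
  funext j
  fin_cases i <;> fin_cases j <;> simp [Fin.append, Fin.addCases, cayleyVertex]
  · exact Pi.single_eq_of_ne (M := fun _ : Fin 2 => ℝ) (show (0 : Fin 2) ≠ 1 by decide) 1
  · exact Pi.single_eq_same (M := fun _ : Fin 2 => ℝ) 1 (1 : ℝ)

theorem SmoothModel.body_eq_cayley {M : SmoothModel 3} (hV : M.V = prismVertices) :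
    M.body = cayley (n := 1) (k := 2) 2
      ![dilatedSimplex 1 3, dilatedSimplex 1 1, dilatedSimplex 1 1] := by
  rw [cayley_convexHull 2 _ (fun i => {fun _ => (0 : ℝ), fun _ => ((![3, 1, 1] i : ℕ) : ℝ)})
    (fun i => by fin_cases i <;> exact dilatedSimplex_one _), SmoothModel.body, hV]
  congr 1
  have hlat : ∀ a b c : ℤ, latticePt ![a, b, c] = ![(a : ℝ), b, c] := by
    intro a b c
    funext j
    fin_cases j <;> simp [latticePt]
  simp only [Set.image_insert_eq, Set.image_singleton]
  ext x
  rw [Set.mem_iUnion]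
  simp only [prismVertices, Finset.coe_insert, Finset.coe_singleton, Set.image_insert_eq,
    Set.image_singleton, Set.mem_insert_iff, Set.mem_singleton_iff, hlat]
  rw [Fin.exists_fin_succ, Fin.exists_fin_two]
  erw [append_cayleyVertex, append_cayleyVertex, append_cayleyVertex, append_cayleyVertex,
    append_cayleyVertex, append_cayleyVertex]
  simp
  tauto

/-- Cutting off a vertex of a polytope given by inequalities. -/
theorem SmoothModel.isBlowUpAt_insert {M M' : SmoothModel 3} {N : Finset (Fin 3 → ℤ)}
    {c : (Fin 3 → ℤ) → ℤ} {p v : Fin 3 → ℤ} (ht : M.t = activeAt N c)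
    (ht' : M'.t = activeAt (insert p N) c) (hN : ∀ a ∈ N, ∃ v ∈ M.V, a ⬝ᵥ v = c a)
    (hN' : ∀ a ∈ insert p N, ∃ v ∈ M'.V, a ⬝ᵥ v = c a) (hv : v ∈ M.V)
    (hp : ∑ b ∈ activeAt N c v, b = p) (hc : p ⬝ᵥ v + 1 = c p)
    (hT : M'.V.image (activeAt (insert p N) c) =
      Tri.starSub (M.V.image (activeAt N c)) (activeAt N c v) p) :
    IsBlowUpAt M.body {latticePt v} 1 M'.body := by
  have hp' : ∑ b ∈ M.t v, b = p := by rw [ht, hp]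
  refine M.isBlowUpAt_vertex M' hv (by norm_num) le_rfl ?_ fun x => ?_
  · rw [hp', SmoothModel.T, SmoothModel.T, ht, ht', hT]
  · rw [M.mem_body_iff_active ht hN, M'.mem_body_iff_active ht' hN', hp', latticePt_dot]
    simp only [Finset.mem_insert, forall_eq_or_imp]
    rw [and_comm, ← hc]
    push_cast
    rfl

theorem exists_twoVertexBlowUp : ∃ M : SmoothModel 3, M.V = doubleBlowUpVertices ∧
    ∃ C : Set (Fin 3 → ℝ), C = cayley (n := 1) (k := 2) 2
      ![dilatedSimplex 1 3, dilatedSimplex 1 1, dilatedSimplex 1 1] ∧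
    ∃ v ∈ C.extremePoints ℝ, ∃ w ∈ C.extremePoints ℝ, v ≠ w ∧
    ∃ (k l : ℕ) (B : Set (Fin 3 → ℝ)), IsBlowUpAt C {v} k B ∧ IsBlowUpAt B {w} l M.body := by
  obtain ⟨M, hV, ht⟩ := exists_prism
  obtain ⟨M', hV', ht'⟩ := exists_blowUp
  obtain ⟨M'', hV'', ht''⟩ := exists_doubleBlowUp
  have h0 : ![0, 0, 0] ∈ M.V := by rw [hV]; decide
  have h3 : ![3, 0, 0] ∈ M.V := by rw [hV]; decide
  refine ⟨M'', hV'', M.body, M.body_eq_cayley hV, _, M.mem_extremePoints h0, _,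
    M.mem_extremePoints h3, fun h => ?_, 1, 1, M'.body, ?_, ?_⟩
  · exact absurd (latticePt_injective h) (by decide)
  · refine SmoothModel.isBlowUpAt_insert ht ht' ?_ ?_ h0 ?_ ?_ ?_
    · rw [hV]; decide +kernel
    · rw [hV']; decide +kernel
    · decide +kernel
    · decide +kernel
    · rw [hV, hV']; decide +kernel
  · refine SmoothModel.isBlowUpAt_insert ht' ht'' ?_ ?_ ?_ ?_ ?_ ?_
    · rw [hV']; decide +kernel
    · rw [hV'']; decide +kernel
    · rw [hV']; decide +kernel
    · decide +kernel
    · decide +kernel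
    · rw [hV', hV'']; decide +kernel

namespace SmoothModel

variable {M : SmoothModel 3}

/-- In the coordinates `x = E₃`, `y = B`, `z = A` the other facets become `x + y + z ≥ 1`, `x ≤ 2`,
`y + z ≤ 2` and `x + y + z ≤ 3`, which are the inequalities of the explicit double blow-up. -/
theorem HexagonPair.isomorphic {A B C D E₁ E₂ E₃ : Fin 3 → ℤ}
    (h : M.HexagonPair A B C D E₁ E₂ E₃) (hV : M.V.card = 10) (h16 : M.pts.card ≤ 16)
    {M' : SmoothModel 3} (hV' : M'.V = doubleBlowUpVertices) : Isomorphic M.body M'.body := by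
  obtain ⟨h3, h2, h1, hD⟩ := h.equations hV.ge h16
  have ht : {C, B, A} ∈ M.T := by rw [Finset.pair_comm]; exact Tri.rot (Tri.rot h.abc)
  -- Since `E₃ = 1 + C - B - A`, the differences of the other three points with `p0` form the basis
  -- dual to `E₃, B, A`.
  obtain ⟨p0, p0C, p0B, p0A⟩ := M.exists_point ht 0 0 0
  obtain ⟨pC, pCC, pCB, pCA⟩ := M.exists_point ht 1 0 0
  obtain ⟨pB, pBC, pBB, pBA⟩ := M.exists_point ht 1 1 0
  obtain ⟨pA, pAC, pAB, pAA⟩ := M.exists_point ht 1 0 1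
  obtain ⟨φ, hφ, hφl⟩ := exists_affineEquiv ![E₃, B, A] ![pC - p0, pB - p0, pA - p0]
    (fun i => -M.phi (![E₃, B, A] i) 0) (by
      intro i j
      fin_cases i <;> fin_cases j <;>
        simp [dotProduct_sub, ← M.phi_sub, h3, p0C, p0B, p0A, pCC, pCB, pCA, pBC, pBB, pBA, pAC,
          pAB, pAA])
  refine ⟨φ, hφl, ?_⟩
  let g : (Fin 3 → ℤ) → Fin 3 → ℤ := fun p => ![M.phi E₃ p, M.phi B p, M.phi A p]
  have hφg : ∀ p, φ (latticePt p) = latticePt (g p) := by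
    intro p
    have key : ∀ a : Fin 3 → ℤ, latticePt a ⬝ᵥ latticePt p - ((-M.phi a 0 : ℤ) : ℝ) =
        (M.phi a p : ℝ) := by
      intro a
      have := M.phi_sub a p 0
      rw [dotProduct_zero] at this
      rw [latticePt_dot]
      push_cast
      have h' : (M.phi a p : ℝ) - M.phi a 0 = ((a ⬝ᵥ p : ℤ) : ℝ) - 0 := by exact_mod_cast this
      linarith
    funext i
    rw [hφ, key]
    fin_cases i <;> rfl
  have hinj : Set.InjOn g M.V := by
    intro p _ q _ hpq
    have e0 := congrFun hpq 0
    have e1 := congrFun hpq 1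
    have e2 := congrFun hpq 2
    change M.phi E₃ p = M.phi E₃ q at e0
    change M.phi B p = M.phi B q at e1
    change M.phi A p = M.phi A q at e2
    refine M.point_ext ht ?_ e1 e2
    rw [h3, h3] at e0
    linarith
  have himg : M.V.image g = doubleBlowUpVertices := by
    apply Finset.eq_of_subset_of_card_le
    · intro w hw
      obtain ⟨v, hv, rfl⟩ := Finset.mem_image.1 hw
      have key : ∀ x y z : ℤ, M.phi E₃ v = x → M.phi B v = y → M.phi A v = z →
          ![x, y, z] ∈ doubleBlowUpVertices → g v ∈ doubleBlowUpVertices := by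
        rintro x y z rfl rfl rfl h; exact h
      have hz : ∀ {x y z}, M.t v = {x, y, z} → M.phi x v = 0 ∧ M.phi y v = 0 ∧ M.phi z v = 0 :=
        fun h => ⟨M.phi_self hv (by simp [h]), M.phi_self hv (by simp [h]),
          M.phi_self hv (by simp [h])⟩
      have k3 := h3 v
      have k2 := h2 v
      have k1 := h1 v
      have kD := hD v
      obtain ⟨P, hP, hc⟩ := h.all _ (M.t_mem_T hv)
      simp only [Finset.mem_insert, Finset.mem_singleton] at hP
      rcases hP with rfl | rfl <;> rcases hc with hc | hc | hc | hc | hc | hc <;>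
        obtain ⟨z1, z2, z3⟩ := hz hc
      · exact key 1 0 0 (by omega) (by omega) (by omega) (by decide)
      · exact key 2 0 0 (by omega) (by omega) (by omega) (by decide)
      · exact key 0 1 0 (by omega) (by omega) (by omega) (by decide)
      · exact key 0 2 0 (by omega) (by omega) (by omega) (by decide)
      · exact key 1 2 0 (by omega) (by omega) (by omega) (by decide)
      · exact key 2 1 0 (by omega) (by omega) (by omega) (by decide)
      · exact key 1 0 0 (by omega) (by omega) (by omega) (by decide)
      · exact key 2 0 0 (by omega) (by omega) (by omega) (by decide)
      · exact key 0 0 1 (by omega) (by omega) (by omega) (by decide)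
      · exact key 0 0 2 (by omega) (by omega) (by omega) (by decide)
      · exact key 1 0 2 (by omega) (by omega) (by omega) (by decide)
      · exact key 2 0 1 (by omega) (by omega) (by omega) (by decide)
    · rw [Finset.card_image_of_injOn hinj, hV]
      decide
  unfold body
  rw [hV', ← himg, Finset.coe_image]
  have : (φ : (Fin 3 → ℝ) → Fin 3 → ℝ) = φ.toAffineMap := rfl
  rw [this, AffineMap.image_convexHull]
  congr 1
  rw [Set.image_image, Set.image_image]
  exact Set.image_congr fun p _ => hφg p

theorem isTwoVertexBlowUp (heul : M.T.card + 4 = 2 * (Tri.verts M.T).card)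
    (h16 : M.pts.card ≤ 16) (h7 : (Tri.verts M.T).card = 7) (n3 : Tri.num M.T 3 = 2)
    (n4 : Tri.num M.T 4 = 3) (n6 : Tri.num M.T 6 = 2) : IsTwoVertexBlowUp M.body := by
  constructor
  · rw [M.isFanModel.hasLabel_iff M.isTri]
    intro m _
    by_cases hm : m ∈ ({3, 4, 6} : Finset ℕ)
    · simp only [Finset.mem_insert, Finset.mem_singleton] at hm
      rcases hm with rfl | rfl | rfl
      · exact n3
      · exact n4
      · exact n6
    · rw [Multiset.count_eq_zero_of_notMem (by
        simp only [Finset.mem_insert, Finset.mem_singleton] at hm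
        simp
        omega), Finset.card_eq_zero, Finset.filter_eq_empty_iff]
      intro r hr he
      refine hm (he ▸ Tri.deg_mem ?_ hr)
      rw [Finset.sum_insert (by decide), Finset.sum_pair (by decide)]
      change Tri.num M.T 3 + (Tri.num M.T 4 + Tri.num M.T 6) = (Tri.verts M.T).card
      omega
  · have hV := M.card_V_eq heul
    obtain ⟨A, B, C, D, E₁, E₂, E₃, h⟩ := M.exists_hexagonPair heul h7 n6
    obtain ⟨M', hV', K, hK, v, hv, w, hw, hne, k, l, B', h1, h2⟩ := exists_twoVertexBlowUp
    exact ⟨K, hK, v, hv, w, hw, hne, k, l, B', M'.body, h1, h2,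
      h.isomorphic (by omega) h16 hV'⟩

end SmoothModel

end TwoVertexBlowUp

/-! ### Conclusion: the seven labels -/

theorem lemma6p2 :
    ¬ ∃ P : Set (Fin 3 → ℝ), IsSmooth P ∧
      {z : Fin 3 → ℤ | latticePt z ∈ P}.encard ≤ 16 ∧
      (∃ Q : Set (Fin 3 → ℝ), IsSmooth Q ∧
        (HasLabel Q {3, 4, 4, 4, 5, 5, 5} ∨ HasLabel Q {4, 4, 4, 4, 4, 4} ∨
          HasLabel Q {3, 3, 4, 4, 4, 6, 6} ∨ HasLabel Q {4, 4, 4, 4, 4, 5, 5}) ∧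
        ObtainedByBlowUps Q P) ∧
      ¬ (IsTwoVertexBlowUp P ∨ IsSmallSimplex P ∨ IsCayleyOfSegments P ∨
        IsCayleyOfPolygons P) := by
  rintro ⟨P, hP, hcard, ⟨Q, hQ, hlab, hblow⟩, hnot⟩
  obtain ⟨N, rfl⟩ := IsSmooth.exists_model hQ
  obtain ⟨M, rfl⟩ := IsSmooth.exists_model hP
  have hG : IsGood M.T :=
    M.isGood_of_blowUps ⟨_, N.isFanModel, isGood_of_label N.isFanModel N.isTri hlab⟩ hblow
  have h16 : M.pts.card ≤ 16 := M.card_pts_le hcard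
  rcases M.classification hG h16 with ⟨h6, h4⟩ | ⟨h7, h⟩ | ⟨h8, h⟩
  · exact hnot (Or.inr (Or.inr (Or.inr (M.num_four hG.euler h6 h4))))
  · rcases h with ⟨-, -, n5⟩ | ⟨n3, n4, n6⟩ | ⟨n4, n5⟩
    · exact M.not_num_five_three hG.euler h16 h7 n5
    · exact hnot (Or.inl (SmoothModel.isTwoVertexBlowUp hG.euler h16 h7 n3 n4 n6))
    · exact hnot (Or.inr (Or.inr (Or.inr (M.num_five_two hG.euler h16 h7 n4 n5))))
  · rcases h with ⟨n4, n6⟩ | ⟨n3, n4, n6⟩ | ⟨n3, n4, n6, n7⟩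
    · exact hnot (Or.inr (Or.inr (Or.inr (M.num_six_two hG.euler h16 h8 n4 n6))))
    · exact M.isTri.not_num_six_three (fun x hx => M.three_le_deg hx) hG.euler h8 n3 n4 n6
    · exact M.not_num_heptagon hG.euler h8 n3 n4 n6 n7
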